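/- The model is the word-RAM with \(w\)-bit words, where \(w = \Omega(\log n)\), i.e. \(w \ge K(\lfloor \log_2 n\rfloor + 1)\) for a large enough constant \(K\) and otherwise arbitrary; space is measured in words. Let \(c\) be a constant, and let \(G\) be a graph on \(n \ge 1\) nodes, each of which has one of \(c\) colours. A query is a nonempty multiset \(M\) of colours, of size \(|M| \ge 1\), given as its Parikh vector, i.e. the vector \((M_1,\dots,M_c)\) of the frequencies of the colours in \(M\) (each fitting in a word). A match of \(M\) is the node set of a connected subgraph of \(G\) in which each colour \(i\) occurs exactly \(M_i\) times. For \(\epsilon > 0\), an approximate match of \(M\) is the node set of a connected subgraph of \(G\) in which the frequency \(f_i\) of each colour \(i\) satisfies \(f_i \le (1+\epsilon) M_i\) and \(M_i \le (1+\epsilon) f_i\). An index is a sequence of words stored in memory, together with a fixed query program (the same for all the graphs under consideration), which does not change the index. An exact index is one whose query program, given \(M\), lists the nodes of a match of \(M\) if there is one, and reports that there is none otherwise. A \((1+\epsilon)\)-approximate index is one whose query program, given \(M\), either lists the nodes of an approximate match of \(M\), or reports nothing, the latter only if \(M\) has no match. The space of an index is the number of words stored; workspace used during a query is not counted. 1.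 There is an exact index with \(O(n^{c+1})\) space and \(O(|M|)\) query time, the constants depending only on \(c\). 2. For every constant \(\epsilon > 0\) there is a \((1+\epsilon)\)-approximate index with, for \(n \ge 2\), \(O(n \log^c n)\) space and \(O(|M|)\) query time, the constants depending only on \(c\) and \(\epsilon\). 3. For every constant \(t\) there are programs which, given any such \(G\) of treewidth at most \(t\), build indexes as in 1 and 2 (for the same query programs and with the same bounds on space and query time) in time \(n^{O(1)}\) (\(O(n^{d})\) for a constant \(d\)), the constants depending only on \(c\), \(t\) and, for 2, \(\epsilon\). 4. For every constant \(t\) there is, for the graphs \(G\) of treewidth at most \(t\), an exact index with \(O(n)\) space and query time \(|M|^{O(1)}\) (\(O(|M|^{k})\) for a constant \(k\)), which can be built from \(G\) in time \(n^{O(1)}\), the constants depending only on \(c\) and \(t\). -/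

import Mathlib

/-! ## The word-RAM

A word-RAM with `w`-bit words: registers and memory cells hold numbers below `2 ^ w`, addresses are
words, arithmetic is modulo `2 ^ w`, and every elementary operation takes one step.  Programs are
finite and are written in structured form.  Results are written, word by word, to an output tape. -/

/-- Unit-cost binary operations on words. -/
inductive BinOp where
  | add | sub | mul | div | mod | and | or | xor | shl | shr | lt | eq

/-- The value of an operation on `w`-bit words (subtraction wraps around, division by `0` is `0`). -/
def BinOp.eval (w : ℕ) : BinOp → ℕ → ℕ → ℕ
  | .add, a, b => (a + b) % 2 ^ w
  | .sub, a, b => (a + 2 ^ w - b) % 2 ^ w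
  | .mul, a, b => (a * b) % 2 ^ w
  | .div, a, b => (a / b) % 2 ^ w
  | .mod, a, b => (a % b) % 2 ^ w
  | .and, a, b => (a &&& b) % 2 ^ w
  | .or, a, b => (a ||| b) % 2 ^ w
  | .xor, a, b => (a ^^^ b) % 2 ^ w
  | .shl, a, b => (a <<< b) % 2 ^ w
  | .shr, a, b => (a >>> b) % 2 ^ w
  | .lt, a, b => (if a < b then 1 else 0) % 2 ^ w
  | .eq, a, b => (if a = b then 1 else 0) % 2 ^ w

/-- A machine state: registers, memory, and the output written so far. -/
structure RamState where
  regs : ℕ → ℕ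
  mem : ℕ → ℕ
  out : List ℕ

/-- Expressions: constants, registers, (indirect) memory reads and operations. -/
inductive RamExpr where
  | const (k : ℕ)
  | reg (r : ℕ)
  | load (a : RamExpr)
  | op (o : BinOp) (a b : RamExpr)

/-- The value of an expression in a state. -/
def RamExpr.eval (w : ℕ) (s : RamState) : RamExpr → ℕ
  | .const k => k % 2 ^ w
  | .reg r => s.regs r
  | .load a => s.mem (a.eval w s)
  | .op o a b => o.eval w (a.eval w s) (b.eval w s)

/-- The number of steps needed to evaluate an expression: one for each of its nodes. -/
def RamExpr.cost : RamExpr → ℕ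
  | .const _ => 1
  | .reg _ => 1
  | .load a => a.cost + 1
  | .op _ a b => a.cost + b.cost + 1

/-- Programs. -/
inductive RamProg where
  | skip
  | assign (r : ℕ) (e : RamExpr)
  | store (a e : RamExpr)
  | emit (e : RamExpr)
  | seq (p q : RamProg)
  | ite (e : RamExpr) (p q : RamProg)
  | loop (e : RamExpr) (p : RamProg)

/-- `RamExec w p s t s'`: on a machine with `w`-bit words, the program `p`, started in state `s`,
halts after exactly `t` steps in state `s'`.  (`ite e p q` runs `p` if `e ≠ 0` and `q` otherwise;
`loop e p` runs `p` as long as `e ≠ 0`.) -/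
inductive RamExec (w : ℕ) : RamProg → RamState → ℕ → RamState → Prop where
  | skip (s : RamState) : RamExec w .skip s 1 s
  | assign (r : ℕ) (e : RamExpr) (s : RamState) :
      RamExec w (.assign r e) s (e.cost + 1)
        ⟨Function.update s.regs r (e.eval w s), s.mem, s.out⟩
  | store (a e : RamExpr) (s : RamState) :
      RamExec w (.store a e) s (a.cost + e.cost + 1)
        ⟨s.regs, Function.update s.mem (a.eval w s) (e.eval w s), s.out⟩
  | emit (e : RamExpr) (s : RamState) :
      RamExec w (.emit e) s (e.cost + 1) ⟨s.regs, s.mem, s.out ++ [e.eval w s]⟩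
  | seq {p q : RamProg} {s s' s'' : RamState} {t t' : ℕ} :
      RamExec w p s t s' → RamExec w q s' t' s'' → RamExec w (.seq p q) s (t + t') s''
  | ite_true {e : RamExpr} {p q : RamProg} {s s' : RamState} {t : ℕ} :
      e.eval w s ≠ 0 → RamExec w p s t s' → RamExec w (.ite e p q) s (e.cost + 1 + t) s'
  | ite_false {e : RamExpr} {p q : RamProg} {s s' : RamState} {t : ℕ} :
      e.eval w s = 0 → RamExec w q s t s' → RamExec w (.ite e p q) s (e.cost + 1 + t) s'
  | loop_false {e : RamExpr} {p : RamProg} {s : RamState} :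
      e.eval w s = 0 → RamExec w (.loop e p) s (e.cost + 1) s
  | loop_true {e : RamExpr} {p : RamProg} {s s' s'' : RamState} {t t' : ℕ} :
      e.eval w s ≠ 0 → RamExec w p s t s' → RamExec w (.loop e p) s' t' s'' →
        RamExec w (.loop e p) s (e.cost + 1 + t + t') s''

/-! ## Coloured graphs and matches -/

/-- The Parikh vector of a set `S` of coloured nodes: the frequency of each colour in `S`. -/
def parikh {n c : ℕ} (col : Fin n → Fin c) (S : Finset (Fin n)) (i : Fin c) : ℕ :=
  (S.filter fun v => col v = i).card

/-- `S` is the node set of a connected subgraph of `G`. -/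
def IsConnectedNodeSet {n : ℕ} (G : SimpleGraph (Fin n)) (S : Finset (Fin n)) : Prop :=
  ∃ H : G.Subgraph, H.Connected ∧ H.verts = (S : Set (Fin n))

/-- `S` is a match of the multiset of colours with Parikh vector `M`. -/
def IsMatch {n c : ℕ} (G : SimpleGraph (Fin n)) (col : Fin n → Fin c) (M : Fin c → ℕ)
    (S : Finset (Fin n)) : Prop :=
  IsConnectedNodeSet G S ∧ ∀ i, parikh col S i = M i

/-- `S` is an approximate match: the frequency of each colour is within a factor of `1 + ε` of its
frequency in `M`. -/
def IsApproxMatch {n c : ℕ} (ε : ℝ) (G : SimpleGraph (Fin n)) (col : Fin n → Fin c)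
    (M : Fin c → ℕ) (S : Finset (Fin n)) : Prop :=
  IsConnectedNodeSet G S ∧ ∀ i,
    (parikh col S i : ℝ) ≤ (1 + ε) * M i ∧ (M i : ℝ) ≤ (1 + ε) * parikh col S i

/-- `out` lists the nodes of `S`, each exactly once. -/
def ListsNodes {n : ℕ} (out : List ℕ) (S : Finset (Fin n)) : Prop :=
  ∃ L : List (Fin n), L.Nodup ∧ L.toFinset = S ∧ out = L.map Fin.val

/-- Correct output of an exact query: the nodes of a match, or nothing if there is no match.
(A match is never empty.) -/
def ExactAnswer {n c : ℕ} (G : SimpleGraph (Fin n)) (col : Fin n → Fin c) (M : Fin c → ℕ)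
    (out : List ℕ) : Prop :=
  (∃ S, IsMatch G col M S ∧ ListsNodes out S) ∨ (out = [] ∧ ¬ ∃ S, IsMatch G col M S)

/-- Correct output of an approximate query: the nodes of an approximate match, or nothing, the
latter only if there is no exact match. -/
def ApproxAnswer {n c : ℕ} (ε : ℝ) (G : SimpleGraph (Fin n)) (col : Fin n → Fin c)
    (M : Fin c → ℕ) (out : List ℕ) : Prop :=
  (∃ S, IsApproxMatch ε G col M S ∧ ListsNodes out S) ∨ (out = [] ∧ ¬ ∃ S, IsMatch G col M S)

/-! ## Treewidth -/

/-- `G` has treewidth at most `t`: it has a tree decomposition into bags of at most `t + 1` nodes. -/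
def TreewidthLE {n : ℕ} (G : SimpleGraph (Fin n)) (t : ℕ) : Prop :=
  ∃ (m : ℕ) (T : SimpleGraph (Fin m)) (bag : Fin m → Finset (Fin n)),
    T.IsTree ∧
    (∀ u v, G.Adj u v → ∃ x, u ∈ bag x ∧ v ∈ bag x) ∧
    (∀ v, (T.induce {x | v ∈ bag x}).Connected) ∧
    ∀ x, (bag x).card ≤ t + 1

/-! ## Indexes -/

/-- The list `I` of words is stored at the addresses `0, 1, …, I.length - 1`. -/
def StoredIn (I : List ℕ) (mem : ℕ → ℕ) : Prop :=
  ∀ (i : ℕ) (h : i < I.length), mem i = I[i]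

/-- Registers at the start of a query: `M` in registers `0, …, c - 1`, and `0` elsewhere. -/
def queryRegs {c : ℕ} (M : Fin c → ℕ) (r : ℕ) : ℕ :=
  if h : r < c then M ⟨r, h⟩ else 0

/-- The list `I` of `w`-bit words is an index which the query program `Q` can use: for every
nonempty multiset `M` of colours, given as its Parikh vector, `Q` halts within `time |M|` steps,
its output is a `Good` answer for `M`, and it leaves the index intact.  The contents of the memory
outside the index are arbitrary, so that the index can be queried again and again.
The space of the index is `I.length` words. -/
structure IsIndex {c : ℕ} (w : ℕ) (Q : RamProg) (Good : (Fin c → ℕ) → List ℕ → Prop)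
    (time : ℕ → ℕ) (I : List ℕ) : Prop where
  words : ∀ x ∈ I, x < 2 ^ w
  answers : ∀ M : Fin c → ℕ, (∀ i, M i < 2 ^ w) → 1 ≤ ∑ i, M i →
    ∀ mem : ℕ → ℕ, (∀ a, mem a < 2 ^ w) → StoredIn I mem →
      ∃ (t : ℕ) (s' : RamState), RamExec w Q ⟨queryRegs M, mem, []⟩ t s' ∧
        t ≤ time (∑ i, M i) ∧ Good M s'.out ∧ StoredIn I s'.mem

open Classical in
/-- The memory holding a coloured graph as input: the number `n` of nodes at address `0`, the colour
of node `v` at address `1 + v`, the entry `(u, v)` of the adjacency matrix at address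
`1 + n + u * n + v`, and `0` elsewhere. -/
noncomputable def graphMem {n c : ℕ} (G : SimpleGraph (Fin n)) (col : Fin n → Fin c) (a : ℕ) : ℕ :=
  if a = 0 then n
  else if h : a - 1 < n then (col ⟨a - 1, h⟩ : ℕ)
  else if ∃ u v : Fin n, G.Adj u v ∧ a = 1 + n + u * n + v then 1
  else 0

/-- Given the coloured graph as input, the program `B` outputs the list `I` of words within `T`
steps. -/
def Builds {n c : ℕ} (w : ℕ) (B : RamProg) (G : SimpleGraph (Fin n)) (col : Fin n → Fin c)
    (T : ℕ) (I : List ℕ) : Prop :=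
  ∃ (t : ℕ) (s' : RamState),
    RamExec w B ⟨fun _ => 0, graphMem G col, []⟩ t s' ∧ t ≤ T ∧ s'.out = I

/-- The word length `w` is at least `K` times the length of the binary representation of `n`. -/
def WordsFit (K n w : ℕ) : Prop := K * (Nat.log 2 n + 1) ≤ w

/-! All three indexes rest on one data structure: a table with a cell for every vector of frequency
buckets, one bucket per colour. A cell holds the node list of one connected set whose frequencies
lie in these buckets, and is empty only if no frequency vector in them has a match. To look up `M`,
its address is computed from `c` bucket numbers in constant time and the list is printed; its length
is at most a constant times `|M|`, because frequencies of one bucket differ by a bounded factor.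
With one frequency per bucket (`q = 0`) there are `n + 1` buckets, and the answers are exact. With
buckets `s, …, s + ⌊s / q⌋`, where `q ≥ 1 / ε`, frequencies of a bucket agree up to the factor `1 +
ε` (`bucket_ratio`) and the bucket starts grow geometrically, so that there are `O(log n)` buckets
(`bucket_le_log`).

For linear space, an exact table is kept only for frequencies up to `N = ⌊n ^ (1 / (c + 1))⌋`, which
takes `O(n)` words. It is followed by the graph, which has `O(n)` edges since all its subgraphs have
nodes of degree at most `t` (`card_edges_le`). A query with a frequency above `N` satisfies `n < |M|
^ (c + 1)`, so time polynomial in `n` is polynomial in `|M|`, and the stored graph can be searched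
from scratch (`isIndex_linear`).

What remains is to find a match in polynomial time when the treewidth is bounded. No tree
decomposition is computed. It serves only to show that every component of the graph can be
dismantled (`Good`): if the neighbours of a connected set `C` lie in one bag, this bag can be moved
through the tree until it also meets `C`, say in `v`; then `C` has at most `t` neighbours, and the
components of `C \ {v}` have all their neighbours in the same bag (`good_of_decomposition`). The
program derives facts for all boundaries `Z` of `t + 1` entries at once. Position `0` is meant for
`v`, the others for the neighbours of `C`. A fact records which boundary nodes are selected, how
they are connected so far, and the Parikh vector of the selected nodes off the boundary. The region
of `Z` is processed component by component, in the order of their least nodes. Such a component has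
at most `t` neighbours, so one position of `Z` can be dropped to make room for the component's own
first node. Derived facts are true in every graph (`part_join`); that all necessary facts are
derived uses the dismantling (`elim_step`, `complete_of_good`).

The facts form a fixed point of finitely many rules over relations on `{0, …, n}`; there are
polynomially many tuples, hence polynomially many sweeps suffice (`stratum_spec`). The resulting
yes/no test yields a match by self-reduction: nodes are deleted as long as a solution remains, and
the survivors are a solution (`solves_of_minimal`).

The algorithms are written in a small language whose loops run `d ^ a` times with `d = n + 1`.
Programs then denote total functions, their running time is polynomial by construction (`exec`,
`bound_le`), and overflow is excluded by one inequality between a power of `n + 1` and `2 ^ w`. The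
tables for arbitrary graphs need no separate construction: the same program is run with `t = n` and
an enormous word length, merely to prove that a table exists (`exists_isTable`). -/

/-! ## Bounded-loop programs -/

/-- The state `s` with register `r` set to `v`. -/
def RamState.setReg (s : RamState) (r v : ℕ) : RamState :=
  ⟨Function.update s.regs r v, s.mem, s.out⟩

/-- The state `s` with memory cell `a` set to `v`. -/
def RamState.setMem (s : RamState) (a v : ℕ) : RamState :=
  ⟨s.regs, Function.update s.mem a v, s.out⟩

@[simp] theorem RamState.setReg_mem (s : RamState) (r v : ℕ) : (s.setReg r v).mem = s.mem := rfl
@[simp] theorem RamState.setReg_out (s : RamState) (r v : ℕ) : (s.setReg r v).out = s.out := rfl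
@[simp] theorem RamState.setMem_regs (s : RamState) (a v : ℕ) : (s.setMem a v).regs = s.regs := rfl
@[simp] theorem RamState.setMem_out (s : RamState) (a v : ℕ) : (s.setMem a v).out = s.out := rfl
@[simp] theorem RamState.setReg_regs (s : RamState) (r v x : ℕ) :
    (s.setReg r v).regs x = if x = r then v else s.regs x := by
  simp [RamState.setReg, Function.update_apply]
@[simp] theorem RamState.setMem_mem (s : RamState) (a v x : ℕ) :
    (s.setMem a v).mem x = if x = a then v else s.mem x := by
  simp [RamState.setMem, Function.update_apply]

/-- Programs whose loops run for a number of rounds which is a power of a fixed number `d`: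
`rep a x p` runs `p` for `x = 0, …, d ^ a - 1`. -/
inductive Prog where
  | skip
  | assign (r : ℕ) (e : RamExpr)
  | store (a e : RamExpr)
  | emit (e : RamExpr)
  | seq (p q : Prog)
  | ite (e : RamExpr) (p q : Prog)
  | rep (a x : ℕ) (p : Prog)

/-- The power `d ^ a` of the contents `d` of register `D`. -/
def powE (D : ℕ) : ℕ → RamExpr
  | 0 => .const 1
  | a + 1 => .op .mul (powE D a) (.reg D)

namespace Prog

/-- The word-RAM program of a bounded-loop program; register `D` holds `d`. -/
def toRam (D : ℕ) : Prog → RamProg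
  | skip => .skip
  | assign r e => .assign r e
  | store a e => .store a e
  | emit e => .emit e
  | seq p q => .seq (p.toRam D) (q.toRam D)
  | ite e p q => .ite e (p.toRam D) (q.toRam D)
  | rep a x p => .seq (.assign x (.const 0))
      (.loop (.op .lt (.reg x) (powE D a)) (.seq (p.toRam D)
        (.assign x (.op .add (.reg x) (.const 1)))))

/-- The final state of a bounded-loop program. -/
def run (w D : ℕ) : Prog → RamState → RamState
  | skip, s => s
  | assign r e, s => s.setReg r (e.eval w s)
  | store a e, s => s.setMem (a.eval w s) (e.eval w s)
  | emit e, s => ⟨s.regs, s.mem, s.out ++ [e.eval w s]⟩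
  | seq p q, s => q.run w D (p.run w D s)
  | ite e p q, s => if e.eval w s ≠ 0 then p.run w D s else q.run w D s
  | rep a x p, s =>
      (fun u => (p.run w D u).setReg x (((p.run w D u).regs x + 1) % 2 ^ w))^[s.regs D ^ a]
        (s.setReg x 0)

/-- The program does not write to register `r`. -/
def Keeps (r : ℕ) : Prog → Prop
  | skip => True
  | assign x _ => r ≠ x
  | store _ _ => True
  | emit _ => True
  | seq p q => p.Keeps r ∧ q.Keeps r
  | ite _ p q => p.Keeps r ∧ q.Keeps r
  | rep _ x p => r ≠ x ∧ p.Keeps r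

/-- Loop counters and the register `D` are not written to in loops. -/
def Wf (D : ℕ) : Prog → Prop
  | seq p q => p.Keeps D ∧ p.Wf D ∧ q.Wf D
  | ite _ p q => p.Wf D ∧ q.Wf D
  | rep _ x p => D ≠ x ∧ p.Keeps x ∧ p.Keeps D ∧ p.Wf D
  | _ => True

/-- The largest exponent of a loop. -/
def maxExp : Prog → ℕ
  | seq p q => max p.maxExp q.maxExp
  | ite _ p q => max p.maxExp q.maxExp
  | rep a _ p => max a p.maxExp
  | _ => 0

/-- A bound on the number of steps. -/
def bound (d D : ℕ) : Prog → ℕ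
  | skip => 1
  | assign _ e => e.cost + 1
  | store a e => a.cost + e.cost + 1
  | emit e => e.cost + 1
  | seq p q => p.bound d D + q.bound d D
  | ite e p q => e.cost + 1 + (p.bound d D + q.bound d D)
  | rep a _ p => 2 + ((powE D a).cost + 3 + (d ^ a * ((powE D a).cost + 3 + (p.bound d D + 4))))

theorem run_keeps (w D r : ℕ) (p : Prog) (h : p.Keeps r) (s : RamState) :
    (p.run w D s).regs r = s.regs r := by
  induction p generalizing s with
  | skip => rfl
  | assign x e => simp only [Keeps] at h; simp [run, h]
  | store a e => rfl
  | emit e => rfl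
  | seq p q ihp ihq => simp only [run]; rw [ihq h.2, ihp h.1]
  | ite e p q ihp ihq =>
    simp only [run]; split_ifs
    · exact ihp h.1 s
    · exact ihq h.2 s
  | rep a x p ih =>
    simp only [run]
    have : ∀ (k : ℕ) (u : RamState),
        ((fun u => (p.run w D u).setReg x (((p.run w D u).regs x + 1) % 2 ^ w))^[k] u).regs r
          = u.regs r := by
      intro k
      induction k with
      | zero => intro u; rfl
      | succ k ihk =>
        intro u
        rw [Function.iterate_succ_apply, ihk]
        simp [h.1, ih h.2]
    rw [this]; simp [h.1]

end Prog

theorem powE_eval {w D d : ℕ} (s : RamState) (hd : s.regs D = d) (a : ℕ) (h : d ^ a < 2 ^ w)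
    (h1 : 1 ≤ d) : (powE D a).eval w s = d ^ a := by
  induction a with
  | zero => exact Nat.mod_eq_of_lt (by rwa [pow_zero] at h)
  | succ a ih =>
    have : d ^ a < 2 ^ w := lt_of_le_of_lt (Nat.pow_le_pow_right h1 (by omega)) h
    simp only [powE, RamExpr.eval, BinOp.eval, ih this, hd]
    rw [← pow_succ]; exact Nat.mod_eq_of_lt h

namespace Prog

/-- One round of a loop with counter `x`. -/
def round (w D x : ℕ) (p : Prog) (u : RamState) : RamState :=
  (p.run w D u).setReg x (((p.run w D u).regs x + 1) % 2 ^ w)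

theorem run_rep (w D a x : ℕ) (p : Prog) (s : RamState) :
    (rep a x p).run w D s = (p.round w D x)^[s.regs D ^ a] (s.setReg x 0) := rfl

/-- The body never writes to the counter, so the counter holds the number of the round; the
increment does not wrap around because `i + 1 ≤ d ^ a < 2 ^ w`. -/
theorem round_iterate_regs {w D d a x : ℕ} {p : Prog} (hx : p.Keeps x) (hD : p.Keeps D)
    (hne : D ≠ x) (hw : d ^ a < 2 ^ w) (s : RamState) (hd : s.regs D = d) (i : ℕ)
    (hi : i ≤ d ^ a) :
    ((p.round w D x)^[i] (s.setReg x 0)).regs x = i ∧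
      ((p.round w D x)^[i] (s.setReg x 0)).regs D = d := by
  induction i with
  | zero => simp [hne, hd]
  | succ i ih =>
    rw [Function.iterate_succ_apply']
    obtain ⟨h1, h2⟩ := ih (by omega)
    constructor
    · simp only [round, RamState.setReg_regs, if_true]
      rw [run_keeps _ _ _ _ hx, h1, Nat.mod_eq_of_lt (by omega)]
    · simp only [round, RamState.setReg_regs, if_neg hne]
      rw [run_keeps _ _ _ _ hD, h2]

/-- Transfers the total semantics `run` to the step-counting relation. Loop limits are powers `d ^
a` with `a ≤ maxExp`, so `hw` makes them words and the loop tests, computed modulo `2 ^ w`, correct.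
-/
theorem exec (w D d : ℕ) (h1 : 1 ≤ d) (p : Prog) (hwf : p.Wf D) (hw : d ^ p.maxExp < 2 ^ w)
    (hw1 : 1 < 2 ^ w)
    (s : RamState) (hd : s.regs D = d) :
    ∃ t ≤ p.bound d D, RamExec w (p.toRam D) s t (p.run w D s) := by
  induction p generalizing s with
  | skip => exact ⟨_, le_rfl, .skip s⟩
  | assign r e => exact ⟨_, le_rfl, .assign r e s⟩
  | store a e => exact ⟨_, le_rfl, .store a e s⟩
  | emit e => exact ⟨_, le_rfl, .emit e s⟩
  | seq p q ihp ihq =>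
    have hp : d ^ p.maxExp < 2 ^ w :=
      lt_of_le_of_lt (Nat.pow_le_pow_right h1 (le_max_left _ _)) hw
    have hq : d ^ q.maxExp < 2 ^ w :=
      lt_of_le_of_lt (Nat.pow_le_pow_right h1 (le_max_right _ _)) hw
    obtain ⟨t, ht, ht'⟩ := ihp hwf.2.1 hp s hd
    obtain ⟨u, hu, hu'⟩ := ihq hwf.2.2 hq (p.run w D s) (by rw [run_keeps _ _ _ _ hwf.1, hd])
    exact ⟨t + u, by simp only [bound]; omega, .seq ht' hu'⟩
  | ite e p q ihp ihq =>
    have hp : d ^ p.maxExp < 2 ^ w :=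
      lt_of_le_of_lt (Nat.pow_le_pow_right h1 (le_max_left _ _)) hw
    have hq : d ^ q.maxExp < 2 ^ w :=
      lt_of_le_of_lt (Nat.pow_le_pow_right h1 (le_max_right _ _)) hw
    simp only [run]
    by_cases he : e.eval w s = 0
    · obtain ⟨u, hu, hu'⟩ := ihq hwf.2 hq s hd
      rw [if_neg (by simpa using he)]
      exact ⟨_, by simp only [bound]; omega, .ite_false he hu'⟩
    · obtain ⟨t, ht, ht'⟩ := ihp hwf.1 hp s hd
      rw [if_pos he]
      exact ⟨_, by simp only [bound]; omega, .ite_true he ht'⟩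
  | rep a x p ih =>
    obtain ⟨hne, hx, hD, hpwf⟩ := hwf
    have ha : d ^ a < 2 ^ w :=
      lt_of_le_of_lt (Nat.pow_le_pow_right h1 (le_max_left _ _)) hw
    have hp : d ^ p.maxExp < 2 ^ w :=
      lt_of_le_of_lt (Nat.pow_le_pow_right h1 (le_max_right _ _)) hw
    have reg := fun i hi => round_iterate_regs hx hD hne ha s hd i hi
    rw [run_rep, hd]
    set C := (powE D a).cost + 3 with hC
    have test : ∀ u : RamState, u.regs D = d → (RamExpr.op .lt (.reg x) (powE D a)).eval w u
        = if u.regs x < d ^ a then 1 else 0 := by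
      intro u hu
      simp only [RamExpr.eval, BinOp.eval, powE_eval u hu a ha h1]
      split_ifs <;> simp [Nat.mod_eq_of_lt hw1]
    -- Induction on the number `k` of remaining rounds, from an arbitrary round `i`, as `loop_true`
    -- splits off the first round. `C` pays for one test, the `4` for the increment.
    have key : ∀ k i : ℕ, i + k = d ^ a → ∃ t ≤ C + k * (C + (p.bound d D + 4)),
        RamExec w (.loop (.op .lt (.reg x) (powE D a)) (.seq (p.toRam D)
          (.assign x (.op .add (.reg x) (.const 1))))) ((p.round w D x)^[i] (s.setReg x 0)) t
          ((p.round w D x)^[d ^ a] (s.setReg x 0)) := by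
      intro k
      induction k with
      | zero =>
        intro i hi
        obtain rfl : i = d ^ a := by omega
        obtain ⟨r1, r2⟩ := reg _ le_rfl
        refine ⟨_, ?_, .loop_false ?_⟩
        · simp [RamExpr.cost, hC]; omega
        · rw [test _ r2, r1]; simp
      | succ k ihk =>
        intro i hi
        obtain ⟨r1, r2⟩ := reg i (by omega)
        obtain ⟨t, ht, ht'⟩ := ihk (i + 1) (by omega)
        obtain ⟨t0, ht0, ht0'⟩ := ih hpwf hp _ r2
        rw [Function.iterate_succ_apply'] at ht'
        have e1 : RamExec w (.assign x (.op .add (.reg x) (.const 1)))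
            (p.run w D ((p.round w D x)^[i] (s.setReg x 0))) 4
            (p.round w D x ((p.round w D x)^[i] (s.setReg x 0))) := by
          have := RamExec.assign (w := w) x (.op .add (.reg x) (.const 1))
            (p.run w D ((p.round w D x)^[i] (s.setReg x 0)))
          simp only [RamExpr.eval, BinOp.eval, Nat.mod_eq_of_lt hw1] at this
          exact this
        refine ⟨_, ?_, .loop_true ?_ (.seq ht0' e1) ht'⟩
        · simp only [RamExpr.cost]
          have : (k + 1) * (C + (p.bound d D + 4))
            = k * (C + (p.bound d D + 4)) + (C + (p.bound d D + 4)) := by ring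
          omega
        · rw [test _ r2, r1, if_pos (by omega)]; simp
    obtain ⟨t, ht, ht'⟩ := key (d ^ a) 0 (by omega)
    rw [hC] at ht
    refine ⟨2 + t, by simp only [bound]; omega, .seq (t := 2) ?_ ht'⟩
    have := RamExec.assign (w := w) x (.const 0) s
    simp only [RamExpr.eval, Nat.zero_mod, RamExpr.cost] at this
    exact this

/-- The bound on the number of steps is polynomial. -/
theorem bound_le (D : ℕ) (p : Prog) : ∃ K e : ℕ, ∀ d, 1 ≤ d → p.bound d D ≤ K * d ^ e := by
  have const : ∀ k : ℕ, ∃ K e : ℕ, ∀ d : ℕ, 1 ≤ d → k ≤ K * d ^ e := fun k => ⟨k, 0, by simp⟩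
  have add : ∀ f g : ℕ → ℕ, (∃ K e : ℕ, ∀ d, 1 ≤ d → f d ≤ K * d ^ e) →
      (∃ K e : ℕ, ∀ d, 1 ≤ d → g d ≤ K * d ^ e) →
      ∃ K e : ℕ, ∀ d, 1 ≤ d → f d + g d ≤ K * d ^ e := by
    rintro f g ⟨K, e, h⟩ ⟨K', e', h'⟩
    refine ⟨K + K', max e e', fun d hd => ?_⟩
    have a1 := h d hd
    have a2 := h' d hd
    have b1 : K * d ^ e ≤ K * d ^ max e e' :=
      Nat.mul_le_mul_left _ (Nat.pow_le_pow_right hd (le_max_left _ _))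
    have b2 : K' * d ^ e' ≤ K' * d ^ max e e' :=
      Nat.mul_le_mul_left _ (Nat.pow_le_pow_right hd (le_max_right _ _))
    rw [add_mul]; omega
  induction p with
  | skip => exact const 1
  | assign r e => exact const _
  | store a e => exact const _
  | emit e => exact const _
  | seq p q ihp ihq => exact add _ _ ihp ihq
  | ite e p q ihp ihq => exact add _ _ (const _) (add _ _ ihp ihq)
  | rep a x p ih =>
    refine add _ _ (const 2) (add _ _ (const _) ?_)
    obtain ⟨K, e, h⟩ := add _ _ (const ((powE D a).cost + 3)) (add _ _ ih (const 4))
    refine ⟨K, a + e, fun d hd => ?_⟩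
    calc _ ≤ d ^ a * (K * d ^ e) := Nat.mul_le_mul_left _ (h d hd)
      _ = _ := by ring

/-- The invariant rule for loops. -/
theorem rep_inv {w D d a x : ℕ} {p : Prog} (hx : p.Keeps x) (hD : p.Keeps D)
    (hne : D ≠ x) (hw : d ^ a < 2 ^ w) (s : RamState) (hd : s.regs D = d)
    (Inv : ℕ → RamState → Prop) (h0 : Inv 0 (s.setReg x 0))
    (step : ∀ i < d ^ a, ∀ u, Inv i u → u.regs x = i → u.regs D = d →
      Inv (i + 1) ((p.run w D u).setReg x (i + 1))) :
    Inv (d ^ a) ((rep a x p).run w D s) := by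
  rw [run_rep, hd]
  have key : ∀ i ≤ d ^ a, Inv i ((p.round w D x)^[i] (s.setReg x 0)) := by
    intro i
    induction i with
    | zero => intro _; exact h0
    | succ i ih =>
      intro hi
      obtain ⟨r1, r2⟩ := round_iterate_regs hx hD hne hw s hd i (by omega)
      have := step i (by omega) _ (ih (by omega)) r1 r2
      rw [Function.iterate_succ_apply']
      generalize (p.round w D x)^[i] (s.setReg x 0) = u at r1 r2 this
      have e : p.round w D x u = (p.run w D u).setReg x (i + 1) := by
        unfold round
        rw [run_keeps _ _ _ _ hx, r1, Nat.mod_eq_of_lt (by omega)]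
      rwa [e]
  exact key _ le_rfl

end Prog

/-! ## Evaluation of expressions without overflow -/

section Eval

variable {w : ℕ} {s : RamState} {a b : RamExpr} {x y : ℕ}

theorem eval_const {k : ℕ} (h : k < 2 ^ w) : (RamExpr.const k).eval w s = k := Nat.mod_eq_of_lt h

@[simp] theorem eval_reg {r : ℕ} : (RamExpr.reg r).eval w s = s.regs r := rfl

theorem eval_load (ha : a.eval w s = x) : (RamExpr.load a).eval w s = s.mem x := by
  rw [RamExpr.eval, ha]

theorem eval_add (ha : a.eval w s = x) (hb : b.eval w s = y) (h : x + y < 2 ^ w) :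
    (RamExpr.op .add a b).eval w s = x + y := by
  rw [RamExpr.eval, ha, hb]; exact Nat.mod_eq_of_lt h

theorem eval_mul (ha : a.eval w s = x) (hb : b.eval w s = y) (h : x * y < 2 ^ w) :
    (RamExpr.op .mul a b).eval w s = x * y := by
  rw [RamExpr.eval, ha, hb]; exact Nat.mod_eq_of_lt h

theorem eval_div (ha : a.eval w s = x) (hb : b.eval w s = y) (h : x < 2 ^ w) :
    (RamExpr.op .div a b).eval w s = x / y := by
  rw [RamExpr.eval, ha, hb]; exact Nat.mod_eq_of_lt (lt_of_le_of_lt (Nat.div_le_self _ _) h)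

theorem eval_eq (ha : a.eval w s = x) (hb : b.eval w s = y) (h : 1 < 2 ^ w) :
    (RamExpr.op .eq a b).eval w s = if x = y then 1 else 0 := by
  rw [RamExpr.eval, ha, hb, BinOp.eval]
  by_cases hxy : x = y <;> simp [hxy, Nat.mod_eq_of_lt h]

theorem eval_lt (ha : a.eval w s = x) (hb : b.eval w s = y) (h : 1 < 2 ^ w) :
    (RamExpr.op .lt a b).eval w s = if x < y then 1 else 0 := by
  rw [RamExpr.eval, ha, hb, BinOp.eval]
  by_cases hxy : x < y <;> simp [hxy, Nat.mod_eq_of_lt h]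

theorem eval_and {p q : Prop} [Decidable p] [Decidable q] [Decidable (p ∧ q)]
    (ha : a.eval w s = if p then 1 else 0)
    (hb : b.eval w s = if q then 1 else 0) (h : 1 < 2 ^ w) :
    (RamExpr.op .and a b).eval w s = if p ∧ q then 1 else 0 := by
  rw [RamExpr.eval, ha, hb, BinOp.eval]
  by_cases hp : p <;> by_cases hq : q <;> simp [hp, hq, Nat.mod_eq_of_lt h]

theorem eval_or {p q : Prop} [Decidable p] [Decidable q] [Decidable (p ∨ q)]
    (ha : a.eval w s = if p then 1 else 0)
    (hb : b.eval w s = if q then 1 else 0) (h : 1 < 2 ^ w) :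
    (RamExpr.op .or a b).eval w s = if p ∨ q then 1 else 0 := by
  rw [RamExpr.eval, ha, hb, BinOp.eval]
  by_cases hp : p <;> by_cases hq : q <;> simp [hp, hq, Nat.mod_eq_of_lt h]

end Eval

/-! ## Relations in memory and rules -/

/-- The word length suffices for `R` memory regions of `d ^ A` cells each. -/
structure Fits (w d A R : ℕ) : Prop where
  two_le : 2 ≤ d
  lt : R * d ^ A < 2 ^ w
  pos : 1 ≤ R

theorem Fits.pow_lt {w d A R : ℕ} (h : Fits w d A R) : d ^ A < 2 ^ w :=
  lt_of_le_of_lt (Nat.le_mul_of_pos_left _ h.pos) h.lt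

theorem Fits.pow_pos {w d A R : ℕ} (h : Fits w d A R) : 0 < d ^ A :=
  Nat.pow_pos (by have := h.two_le; omega)

theorem Fits.reg_lt {w d A R : ℕ} (h : Fits w d A R) : R < 2 ^ w :=
  lt_of_le_of_lt (Nat.le_mul_of_pos_right _ h.pow_pos) h.lt

theorem Fits.cell_lt {w d A R q i : ℕ} (h : Fits w d A R) (hq : q < R) (hi : i < d ^ A) :
    q * d ^ A + i < 2 ^ w := by
  have : (q + 1) * d ^ A ≤ R * d ^ A := Nat.mul_le_mul_right _ hq
  have := h.lt
  rw [add_mul] at *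
  omega

theorem cell_inj {N q i q' i' : ℕ} (hi : i < N) (hi' : i' < N)
    (h : q * N + i = q' * N + i') : q = q' ∧ i = i' := by
  have hN : 0 < N := by omega
  have h1 : (i + N * q) / N = q := by
    rw [Nat.add_mul_div_left _ _ hN, Nat.div_eq_of_lt hi, zero_add]
  have h2 : (i' + N * q') / N = q' := by
    rw [Nat.add_mul_div_left _ _ hN, Nat.div_eq_of_lt hi', zero_add]
  have : q = q' := by
    rw [← h1, ← h2]; congr 1; rw [mul_comm N, mul_comm N]; omega
  subst this
  exact ⟨rfl, by omega⟩

/-- The address of cell `i` of region `q`. -/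
def cellE (D A q : ℕ) (i : RamExpr) : RamExpr := .op .add (.op .mul (.const q) (powE D A)) i

theorem cellE_eval {w d A R D q i : ℕ} (h : Fits w d A R) (s : RamState) (hd : s.regs D = d)
    (hq : q < R) (e : RamExpr) (he : e.eval w s = i) (hi : i < d ^ A) :
    (cellE D A q e).eval w s = q * d ^ A + i := by
  have h1 := h.cell_lt hq hi
  have h2 := h.reg_lt
  have h3 := h.two_le
  simp only [cellE, RamExpr.eval, BinOp.eval, he, powE_eval s hd A h.pow_lt (by omega)]
  rw [Nat.mod_eq_of_lt (a := q) (by omega), Nat.mod_eq_of_lt (a := q * d ^ A) (by omega),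
    Nat.mod_eq_of_lt h1]

/-- The number whose base `d` digits are held in the given registers. -/
def hornerE (D : ℕ) : List ℕ → RamExpr
  | [] => .const 0
  | x :: L => .op .add (.reg x) (.op .mul (.reg D) (hornerE D L))

theorem ofDigits_lt {d A : ℕ} (hd : 2 ≤ d) {L : List ℕ} (hL : ∀ x ∈ L, x < d)
    (hA : L.length ≤ A) : Nat.ofDigits d L < d ^ A :=
  lt_of_lt_of_le (Nat.ofDigits_lt_base_pow_length (by omega) hL)
    (Nat.pow_le_pow_right (by omega) hA)

theorem hornerE_eval {w d A R D : ℕ} (h : Fits w d A R) (s : RamState) (hd : s.regs D = d)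
    (L : List ℕ) (hL : ∀ x ∈ L, s.regs x < d) (hA : L.length ≤ A) :
    (hornerE D L).eval w s = Nat.ofDigits d (L.map s.regs) := by
  induction L with
  | nil => simp [hornerE, RamExpr.eval]
  | cons x L ih =>
    have ih := ih (fun y hy => hL y (List.mem_cons_of_mem _ hy)) (by simp at hA; omega)
    have hlt : Nat.ofDigits d ((x :: L).map s.regs) < 2 ^ w :=
      lt_trans (ofDigits_lt (A := A) h.two_le (by simpa using hL) (by simpa using hA)) h.pow_lt
    simp only [hornerE, RamExpr.eval, BinOp.eval, ih, hd, List.map_cons, Nat.ofDigits_cons] at *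
    rw [Nat.mod_eq_of_lt (a := d * _) (by omega), Nat.mod_eq_of_lt hlt]

/-- The nonzero cells of the regions `1, …, Q - 1`. -/
def dbOf (d A Q : ℕ) (mem : ℕ → ℕ) : Set (ℕ × ℕ) :=
  {c | 1 ≤ c.1 ∧ c.1 < Q ∧ c.2 < d ^ A ∧ mem (c.1 * d ^ A + c.2) ≠ 0}

theorem dbOf_setMem {d A Q q i : ℕ} (hq : 1 ≤ q) (hqQ : q < Q) (hi : i < d ^ A) (s : RamState)
    (v : ℕ) (hv : v ≠ 0) :
    dbOf d A Q (s.setMem (q * d ^ A + i) v).mem = insert (q, i) (dbOf d A Q s.mem) := by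
  ext ⟨q', i'⟩
  simp only [dbOf, RamState.setMem_mem, Set.mem_ofPred_eq, Set.mem_insert_iff, Prod.mk.injEq]
  constructor
  · rintro ⟨h1, h2, h3, h4⟩
    by_cases e : q' * d ^ A + i' = q * d ^ A + i
    · exact .inl (cell_inj h3 hi e)
    · rw [if_neg e] at h4; exact .inr ⟨h1, h2, h3, h4⟩
  · rintro (⟨rfl, rfl⟩ | ⟨h1, h2, h3, h4⟩)
    · exact ⟨hq, hqQ, hi, by simpa using hv⟩
    · refine ⟨h1, h2, h3, ?_⟩
      split_ifs <;> assumption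

/-- Quantifier-free formulas over registers and stored relations. -/
inductive Fm where
  | const (b : Bool)
  | eq (x y : ℕ)
  | lt (x y : ℕ)
  | isc (x e : ℕ)
  | sum (x y e z : ℕ)
  | rel (q : ℕ) (L : List ℕ)
  | neg (f : Fm)
  | and (f g : Fm)
  | or (f g : Fm)

namespace Fm

/-- The truth value of a formula; `σ` gives the values of the registers, `B` the relations. -/
def Holds (d : ℕ) (σ : ℕ → ℕ) (B : Set (ℕ × ℕ)) : Fm → Prop
  | const b => b = true
  | eq x y => σ x = σ y
  | lt x y => σ x < σ y
  | isc x e => σ x = e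
  | sum x y e z => σ x + σ y + e = σ z
  | rel q L => (q, Nat.ofDigits d (L.map σ)) ∈ B
  | neg f => ¬ f.Holds d σ B
  | and f g => f.Holds d σ B ∧ g.Holds d σ B
  | or f g => f.Holds d σ B ∨ g.Holds d σ B

/-- The formula as an expression with values `0` and `1`. -/
def toExpr (D A : ℕ) : Fm → RamExpr
  | const b => .const (if b then 1 else 0)
  | eq x y => .op .eq (.reg x) (.reg y)
  | lt x y => .op .lt (.reg x) (.reg y)
  | isc x e => .op .eq (.reg x) (.const e)
  | sum x y e z => .op .eq (.op .add (.op .add (.reg x) (.reg y)) (.const e)) (.reg z)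
  | rel q L => .op .lt (.const 0) (.load (cellE D A q (hornerE D L)))
  | neg f => .op .eq (f.toExpr D A) (.const 0)
  | and f g => .op .and (f.toExpr D A) (g.toExpr D A)
  | or f g => .op .or (f.toExpr D A) (g.toExpr D A)

/-- The registers of the formula satisfy `V` and its relations are within range. -/
def Ok (A Q : ℕ) (V : ℕ → Prop) : Fm → Prop
  | const _ => True
  | eq x y => V x ∧ V y
  | lt x y => V x ∧ V y
  | isc x e => V x ∧ e ≤ 1
  | sum x y e z => V x ∧ V y ∧ e ≤ 1 ∧ V z
  | rel q L => 1 ≤ q ∧ q < Q ∧ (∀ x ∈ L, V x) ∧ L.length ≤ A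
  | neg f => f.Ok A Q V
  | and f g => f.Ok A Q V ∧ g.Ok A Q V
  | or f g => f.Ok A Q V ∧ g.Ok A Q V

theorem holds_congr {d A Q : ℕ} {V : ℕ → Prop} {σ τ : ℕ → ℕ} (h : ∀ x, V x → σ x = τ x)
    (B : Set (ℕ × ℕ)) (f : Fm) (hf : f.Ok A Q V) : f.Holds d σ B ↔ f.Holds d τ B := by
  induction f with
  | const b => rfl
  | eq x y => simp only [Holds, h x hf.1, h y hf.2]
  | lt x y => simp only [Holds, h x hf.1, h y hf.2]
  | isc x e => simp only [Holds, h x hf.1]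
  | sum x y e z => simp only [Holds, h x hf.1, h y hf.2.1, h z hf.2.2.2]
  | rel q L =>
    simp only [Holds]
    rw [List.map_congr_left (fun x hx => h x (hf.2.2.1 x hx))]
  | neg f ih => simp only [Holds, ih hf]
  | and f g ihf ihg => simp only [Holds, ihf hf.1, ihg hf.2]
  | or f g ihf ihg => simp only [Holds, ihf hf.1, ihg hf.2]

open Classical in
-- Truth values are the words `0` and `1`, on which the bitwise operations act as connectives. The
-- bound `hw` leaves room for the sum of two registers and `1`.
theorem toExpr_eval {w d A R Q D : ℕ} (h : Fits w d A R) (hw : 4 * d < 2 ^ w) (hQ : Q ≤ R)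
    (s : RamState) (hd : s.regs D = d) {V : ℕ → Prop} (hV : ∀ x, V x → s.regs x < d)
    (f : Fm) (hf : f.Ok A Q V) :
    (f.toExpr D A).eval w s = if f.Holds d s.regs (dbOf d A Q s.mem) then 1 else 0 := by
  have h2 := h.two_le
  have one : 1 < 2 ^ w := by omega
  induction f with
  | const b => cases b <;> simp [toExpr, RamExpr.eval, Holds, Nat.mod_eq_of_lt one]
  | eq x y => rw [toExpr, eval_eq rfl rfl one]; exact if_congr Iff.rfl rfl rfl
  | lt x y => rw [toExpr, eval_lt rfl rfl one]; exact if_congr Iff.rfl rfl rfl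
  | isc x e =>
    rw [toExpr, eval_eq rfl (eval_const (by have := hf.2; omega)) one]; exact if_congr Iff.rfl rfl rfl
  | sum x y e z =>
    have b1 := hV _ hf.1
    have b2 := hV _ hf.2.1
    have b3 := hf.2.2.1
    rw [toExpr, eval_eq (eval_add (eval_add rfl rfl ?_) (eval_const (by omega)) ?_) rfl one] <;>
      simp only [eval_reg]
    · exact if_congr Iff.rfl rfl rfl
    all_goals omega
  | rel q L =>
    obtain ⟨hq1, hq, hL, hA⟩ := hf
    have hLd : ∀ x ∈ L, s.regs x < d := fun x hx => hV x (hL x hx)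
    have hi : Nat.ofDigits d (L.map s.regs) < d ^ A :=
      ofDigits_lt h2 (by simpa using hLd) (by simpa using hA)
    rw [toExpr, eval_lt (eval_const (by omega)) (eval_load (cellE_eval h s hd (lt_of_lt_of_le hq hQ)
      _ (hornerE_eval h s hd L hLd hA) hi)) one]
    congr 1
    simp [Holds, dbOf, hq1, hq, hi, Nat.pos_iff_ne_zero]
  | neg f ih =>
    rw [toExpr, eval_eq (ih hf) (eval_const (by omega)) one]
    by_cases hh : f.Holds d s.regs (dbOf d A Q s.mem) <;> simp [hh, Holds]
  | and f g ihf ihg => rw [toExpr, eval_and (ihf hf.1) (ihg hf.2) one]; exact if_congr Iff.rfl rfl rfl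
  | or f g ihf ihg => rw [toExpr, eval_or (ihf hf.1) (ihg hf.2) one]; exact if_congr Iff.rfl rfl rfl

/-- The conjunction of a list of formulas. -/
def all (L : List Fm) : Fm := L.foldr .and (.const true)

@[simp] theorem all_holds (d : ℕ) (σ : ℕ → ℕ) (B : Set (ℕ × ℕ)) (L : List Fm) :
    (all L).Holds d σ B ↔ ∀ f ∈ L, f.Holds d σ B := by
  induction L with
  | nil => simp [all, Holds]
  | cons f L ih => simp only [all, List.foldr_cons, Holds] at ih ⊢; simp [ih]

@[simp] theorem all_ok (A Q : ℕ) (V : ℕ → Prop) (L : List Fm) :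
    (all L).Ok A Q V ↔ ∀ f ∈ L, f.Ok A Q V := by
  induction L with
  | nil => simp [all, Ok]
  | cons f L ih => simp only [all, List.foldr_cons, Ok] at ih ⊢; simp [ih]

end Fm

/-- A rule: if the premise holds, then the tuple held in the registers `args` is added to the
relation `hd`. -/
structure Rule where
  prem : Fm
  hd : ℕ
  args : List ℕ

/-- The tuple added by a rule. -/
def Rule.head (d : ℕ) (σ : ℕ → ℕ) (r : Rule) : ℕ × ℕ := (r.hd, Nat.ofDigits d (r.args.map σ))

def Rule.Ok (A Q : ℕ) (V : ℕ → Prop) (r : Rule) : Prop :=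
  r.prem.Ok A Q V ∧ 1 ≤ r.hd ∧ r.hd < Q ∧ (∀ x ∈ r.args, V x) ∧ r.args.length ≤ A

def Rule.prog (D A : ℕ) (r : Rule) : Prog :=
  .ite (r.prem.toExpr D A) (.store (cellE D A r.hd (hornerE D r.args)) (.const 1)) .skip

open Classical in
theorem Rule.run_prog {w d A R Q D : ℕ} (h : Fits w d A R) (hw : 4 * d < 2 ^ w) (hQ : Q ≤ R)
    (s : RamState) (hd : s.regs D = d) {V : ℕ → Prop} (hV : ∀ x, V x → s.regs x < d)
    (r : Rule) (hr : r.Ok A Q V) :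
    (r.prog D A).run w D s = if r.prem.Holds d s.regs (dbOf d A Q s.mem) then
      s.setMem ((r.head d s.regs).1 * d ^ A + (r.head d s.regs).2) 1 else s := by
  obtain ⟨h1, h2, h3, h4, h5⟩ := hr
  have hL : ∀ x ∈ r.args, s.regs x < d := fun x hx => hV x (h4 x hx)
  have hi : Nat.ofDigits d (r.args.map s.regs) < d ^ A :=
    ofDigits_lt h.two_le (by simpa using hL) (by simpa using h5)
  have := h.two_le
  simp only [Rule.prog, Prog.run, Fm.toExpr_eval h hw hQ s hd hV _ h1,
    cellE_eval h s hd (lt_of_lt_of_le h3 hQ) _ (hornerE_eval h s hd _ hL h5) hi, RamExpr.eval,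
    Nat.mod_eq_of_lt (show 1 < 2 ^ w by omega)]
  split_ifs <;> simp_all [Rule.head]

theorem Rule.head_mem {d A Q : ℕ} {V : ℕ → Prop} (r : Rule) (hr : r.Ok A Q V) (h2 : 2 ≤ d)
    (σ : ℕ → ℕ) (hV : ∀ x, V x → σ x < d) :
    1 ≤ (r.head d σ).1 ∧ (r.head d σ).1 < Q ∧ (r.head d σ).2 < d ^ A := by
  obtain ⟨-, h1, h3, h4, h5⟩ := hr
  exact ⟨h1, h3, ofDigits_lt h2 (by simpa using fun x hx => hV x (h4 x hx)) (by simpa using h5)⟩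

/-! ### Nested loops over all assignments of variables -/

namespace Prog

/-- Nested loops over the registers `xs`. -/
def forAll (p : Prog) : List ℕ → Prog
  | [] => p
  | x :: xs => .rep 1 x (forAll p xs)

/-- The programs of a list, one after the other. -/
def seqs (L : List Prog) : Prog := L.foldr .seq .skip

@[simp] theorem keeps_forAll (r : ℕ) (p : Prog) (xs : List ℕ) :
    (p.forAll xs).Keeps r ↔ r ∉ xs ∧ p.Keeps r := by
  induction xs with
  | nil => simp [forAll]
  | cons x xs ih => simp [forAll, Keeps, ih, and_assoc]

theorem wf_forAll {D : ℕ} {p : Prog} {xs : List ℕ} (hn : xs.Nodup) (hD : D ∉ xs)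
    (hk : ∀ x ∈ xs, p.Keeps x) (hDk : p.Keeps D) (hp : p.Wf D) : (p.forAll xs).Wf D := by
  induction xs with
  | nil => exact hp
  | cons x xs ih =>
    simp only [List.nodup_cons, List.mem_cons, not_or] at *
    exact ⟨hD.1, by simp [hn.1, hk x (.inl rfl)], by simp [hD.2, hDk],
      ih hn.2 hD.2 (fun y hy => hk y (.inr hy))⟩

@[simp] theorem keeps_seqs (r : ℕ) (L : List Prog) : (seqs L).Keeps r ↔ ∀ p ∈ L, p.Keeps r := by
  induction L with
  | nil => simp [seqs, Keeps]
  | cons p L ih => simp only [seqs, List.foldr_cons, Keeps] at ih ⊢; simp [ih]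

theorem wf_seqs {D : ℕ} {L : List Prog} (hD : ∀ p ∈ L, p.Keeps D) (hp : ∀ p ∈ L, p.Wf D) :
    (seqs L).Wf D := by
  induction L with
  | nil => simp [seqs, Wf]
  | cons p L ih =>
    simp only [List.mem_cons, forall_eq_or_imp] at hD hp
    exact ⟨hD.1, hp.1, ih hD.2 hp.2⟩

theorem run_seqs_inv {w D : ℕ} {L : List Prog} (I : RamState → Prop)
    (h : ∀ p ∈ L, ∀ s, I s → I (p.run w D s)) (s : RamState) (hs : I s) :
    I ((seqs L).run w D s) := by
  induction L generalizing s with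
  | nil => exact hs
  | cons p L ih =>
    simp only [List.mem_cons, forall_eq_or_imp] at h
    exact ih h.2 _ (h.1 _ hs)

theorem run_seqs_hit {w D : ℕ} {L : List Prog} (I P : RamState → Prop)
    (h : ∀ p ∈ L, ∀ s, I s → I (p.run w D s)) (hP : ∀ p ∈ L, ∀ s, I s → P s → P (p.run w D s))
    (p : Prog) (hp : p ∈ L) (hit : ∀ s, I s → P (p.run w D s)) (s : RamState) (hs : I s) :
    P ((seqs L).run w D s) := by
  induction L generalizing s with
  | nil => simp at hp
  | cons q L ih =>
    simp only [List.mem_cons, forall_eq_or_imp] at h hP hp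
    rcases hp with rfl | hp
    · refine (run_seqs_inv (fun s => I s ∧ P s) ?_ _ ⟨h.1 _ hs, hit _ hs⟩).2
      exact fun p hp s hs => ⟨h.2 p hp s hs.1, hP.2 p hp s hs.1 hs.2⟩
    · exact ih h.2 hP.2 hp _ (h.1 _ hs)

/-- For the inner loops the invariant is strengthened by `u.regs x = i`, which freezes the outer
counter; otherwise the bound on it would be lost when the body is reached. -/
theorem forAll_inv {w D d : ℕ} {p : Prog} {xs : List ℕ} (hn : xs.Nodup) (hD : D ∉ xs)
    (hk : ∀ x ∈ xs, p.Keeps x) (hDk : p.Keeps D) (hw : d < 2 ^ w) (I : RamState → Prop)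
    (hI : ∀ s, ∀ x ∈ xs, ∀ v, I s → I (s.setReg x v))
    (hp : ∀ s, I s → s.regs D = d → (∀ x ∈ xs, s.regs x < d) → I (p.run w D s))
    (s : RamState) (hd : s.regs D = d) (hs : I s) : I ((p.forAll xs).run w D s) := by
  induction xs generalizing s I with
  | nil => exact hp s hs hd (by simp)
  | cons x xs ih =>
    simp only [List.nodup_cons, List.mem_cons, not_or, forall_eq_or_imp] at *
    refine rep_inv (a := 1) (d := d) (by simp [hn.1, hk.1]) (by simp [hD.2, hDk]) hD.1
      (by simpa using hw) s hd (fun _ u => I u) ((hI _).1 _ hs) ?_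
    intro i hi u hu hxi hud
    refine (hI _).1 _ (ih hn.2 hD.2 hk.2 (fun u => I u ∧ u.regs x = i) ?_ ?_ u hud ⟨hu, hxi⟩).1
    · rintro s y hy v ⟨h1, h2⟩
      exact ⟨(hI _).2 y hy v h1, by
        have : x ≠ y := by rintro rfl; exact hn.1 hy
        simp [this, h2]⟩
    · rintro s ⟨h1, h2⟩ h3 h4
      exact ⟨hp s h1 h3 ⟨by rw [h2]; simpa using hi, h4⟩, by rw [run_keeps _ _ _ _ hk.1, h2]⟩

/-- A liveness rule: the loops pass through every assignment `τ`, so what the body achieves at `τ`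
and never destroys holds in the end. The invariant of the outer loop is that `P` holds once its
counter has passed `τ x`. -/
theorem forAll_hit {w D d : ℕ} {p : Prog} {xs : List ℕ} (hn : xs.Nodup) (hD : D ∉ xs)
    (hk : ∀ x ∈ xs, p.Keeps x) (hDk : p.Keeps D) (hw : d < 2 ^ w) (I P : RamState → Prop)
    (hI : ∀ s, ∀ x ∈ xs, ∀ v, I s → I (s.setReg x v))
    (hp : ∀ s, I s → s.regs D = d → (∀ x ∈ xs, s.regs x < d) → I (p.run w D s))
    (hP : ∀ s, ∀ x ∈ xs, ∀ v, P s → P (s.setReg x v))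
    (hpP : ∀ s, I s → P s → s.regs D = d → (∀ x ∈ xs, s.regs x < d) → P (p.run w D s))
    (τ : ℕ → ℕ) (hτ : ∀ x ∈ xs, τ x < d)
    (hit : ∀ s, I s → s.regs D = d → (∀ x ∈ xs, s.regs x = τ x) → P (p.run w D s))
    (s : RamState) (hd : s.regs D = d) (hs : I s) : P ((p.forAll xs).run w D s) := by
  induction xs generalizing s I P with
  | nil => exact hit s hs hd (by simp)
  | cons x xs ih =>
    simp only [List.nodup_cons, List.mem_cons, not_or, forall_eq_or_imp] at *
    have hfix : ∀ i, i < d → ∀ s : RamState, ∀ y ∈ xs, ∀ v, s.regs x = i → (s.setReg y v).regs x = i := by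
      intro i _ s y hy v h2
      have : x ≠ y := by rintro rfl; exact hn.1 hy
      simp [this, h2]
    have := rep_inv (a := 1) (d := d) (p := p.forAll xs) (by simp [hn.1, hk.1]) (by simp [hD.2, hDk]) hD.1
      (by simpa using hw) s hd (fun i u => I u ∧ (τ x < i → P u)) ⟨(hI _).1 _ hs, by simp⟩ ?_
    · exact this.2 (by simpa using hτ.1)
    intro i hi u hu hxi hud
    rw [pow_one] at hi
    have Ist : ∀ s, ∀ y ∈ xs, ∀ v, I s ∧ s.regs x = i →
        I (s.setReg y v) ∧ (s.setReg y v).regs x = i :=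
      fun s y hy v h => ⟨(hI _).2 y hy v h.1, hfix i hi s y hy v h.2⟩
    have Ip : ∀ s, I s ∧ s.regs x = i → s.regs D = d → (∀ x ∈ xs, s.regs x < d) →
        I (p.run w D s) ∧ (p.run w D s).regs x = i :=
      fun s h h3 h4 => ⟨hp s h.1 h3 ⟨by rw [h.2]; exact hi, h4⟩,
        by rw [run_keeps _ _ _ _ hk.1, h.2]⟩
    have inner := forAll_inv hn.2 hD.2 hk.2 hDk hw (fun u => I u ∧ u.regs x = i) Ist Ip u hud
      ⟨hu.1, hxi⟩
    refine ⟨(hI _).1 _ inner.1, fun hlt => (hP _).1 _ ?_⟩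
    rcases Nat.lt_succ_iff_lt_or_eq.mp hlt with hlt | heq
    · refine (forAll_inv hn.2 hD.2 hk.2 hDk hw (fun u => (I u ∧ u.regs x = i) ∧ P u)
        (fun s y hy v h => ⟨Ist s y hy v h.1, (hP _).2 y hy v h.2⟩)
        (fun s h h3 h4 => ⟨Ip s h.1 h3 h4, hpP s h.1.1 h.2 h3 ⟨by rw [h.1.2]; exact hi, h4⟩⟩)
        u hud ⟨⟨hu.1, hxi⟩, hu.2 hlt⟩).2
    · exact ih hn.2 hD.2 hk.2 (fun u => I u ∧ u.regs x = i) P Ist Ip (fun s => (hP s).2)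
        (fun s h1 h2 h3 h4 => hpP s h1.1 h2 h3 ⟨by rw [h1.2]; exact hi, h4⟩)
        hτ.2 (fun s h1 h2 h3 => hit s h1.1 h2 ⟨by rw [h1.2, heq], h3⟩) u hud ⟨hu.1, hxi⟩

end Prog

/-! ### Fixed points of rules by repeated sweeps -/

/-- `s'` arises from `s` by changing registers in `X` and cells of the regions `1, …, Q - 1`. -/
structure Frame (X : Set ℕ) (d A Q : ℕ) (s s' : RamState) : Prop where
  regs : ∀ r, r ∉ X → s'.regs r = s.regs r
  out : s'.out = s.out
  mem : ∀ a, a < d ^ A ∨ Q * d ^ A ≤ a → s'.mem a = s.mem a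

theorem Frame.refl {X : Set ℕ} {d A Q : ℕ} (s : RamState) : Frame X d A Q s s :=
  ⟨fun _ _ => rfl, rfl, fun _ _ => rfl⟩

theorem Frame.trans {X : Set ℕ} {d A Q : ℕ} {s s' s'' : RamState} (h : Frame X d A Q s s')
    (h' : Frame X d A Q s' s'') : Frame X d A Q s s'' :=
  ⟨fun r hr => (h'.regs r hr).trans (h.regs r hr), h'.out.trans h.out,
    fun a ha => (h'.mem a ha).trans (h.mem a ha)⟩

theorem Frame.mono {X Y : Set ℕ} {d A Q : ℕ} {s s' : RamState} (h : Frame X d A Q s s')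
    (hXY : X ⊆ Y) : Frame Y d A Q s s' :=
  ⟨fun r hr => h.regs r (fun h => hr (hXY h)), h.out, h.mem⟩

theorem Frame.setReg {X : Set ℕ} {d A Q : ℕ} {s s' : RamState} (h : Frame X d A Q s s')
    {r : ℕ} (hr : r ∈ X) (v : ℕ) : Frame X d A Q s (s'.setReg r v) :=
  h.trans ⟨fun x hx => by
    have : x ≠ r := by rintro rfl; exact hx hr
    simp [this], rfl, fun _ _ => rfl⟩

theorem Frame.setMem {X : Set ℕ} {d A Q : ℕ} {s s' : RamState} (h : Frame X d A Q s s')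
    {q i : ℕ} (hq : 1 ≤ q) (hqQ : q < Q) (hi : i < d ^ A) (v : ℕ) :
    Frame X d A Q s (s'.setMem (q * d ^ A + i) v) := by
  refine h.trans ⟨fun x hx => rfl, rfl, fun a ha => ?_⟩
  have h1 : 1 * d ^ A ≤ q * d ^ A := Nat.mul_le_mul_right _ hq
  have h2 : (q + 1) * d ^ A ≤ Q * d ^ A := Nat.mul_le_mul_right _ hqQ
  rw [add_mul] at h2
  have : a ≠ q * d ^ A + i := by omega
  simp [this]

/-- The least fixed point of a set of rules with variables `xs`, by `d ^ b` sweeps. -/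
def stratum (D A b z : ℕ) (xs : List ℕ) (rules : List Rule) : Prog :=
  .rep b z ((Prog.seqs (rules.map (Rule.prog D A))).forAll xs)

theorem Rule.keeps_prog (D A x : ℕ) (r : Rule) : (r.prog D A).Keeps x := by
  simp [Rule.prog, Prog.Keeps]

theorem Rule.wf_prog (D A : ℕ) (r : Rule) : (r.prog D A).Wf D := by
  simp [Rule.prog, Prog.Wf]

theorem keeps_rules (D A x : ℕ) (rules : List Rule) :
    (Prog.seqs (rules.map (Rule.prog D A))).Keeps x := by
  simp [Rule.keeps_prog]

theorem keeps_stratum {D A b z x : ℕ} {xs : List ℕ} {rules : List Rule} :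
    (stratum D A b z xs rules).Keeps x ↔ x ≠ z ∧ x ∉ xs := by
  simp [stratum, Prog.Keeps, Rule.keeps_prog]

theorem wf_stratum {D A b z : ℕ} {xs : List ℕ} {rules : List Rule} (hn : xs.Nodup) (hD : D ∉ xs)
    (hz : z ∉ xs) (hDz : D ≠ z) : (stratum D A b z xs rules).Wf D := by
  refine ⟨hDz, ?_, ?_, Prog.wf_forAll hn hD (fun x _ => keeps_rules _ _ _ _) (keeps_rules _ _ _ _)
    (Prog.wf_seqs ?_ ?_)⟩
  · simp [hz, Rule.keeps_prog]
  · simp [hD, Rule.keeps_prog]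
  · simp [Rule.keeps_prog]
  · simp [Rule.wf_prog]

section Stratum

variable {w d A R Q D b z : ℕ} {xs : List ℕ} {rules : List Rule} {Y : ℕ → Prop}

/-- `σ` assigns values below `d` to the variables `xs` and agrees with `ρ` on the constants. -/
def Assigns (d : ℕ) (xs : List ℕ) (Y : ℕ → Prop) (ρ σ : ℕ → ℕ) : Prop :=
  (∀ x ∈ xs, σ x < d) ∧ ∀ x, Y x → σ x = ρ x

/-- `B` is closed under the rules. -/
def ClosedUnder (d : ℕ) (xs : List ℕ) (Y : ℕ → Prop) (rules : List Rule) (ρ : ℕ → ℕ)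
    (B : Set (ℕ × ℕ)) : Prop :=
  ∀ σ, Assigns d xs Y ρ σ → ∀ r ∈ rules, r.prem.Holds d σ B → r.head d σ ∈ B

/-- A rule changes nothing or inserts its head when its premise holds. Hence a property of databases
which survives all such insertions survives the program of the rule. -/
theorem rules_inv (h : Fits w d A R) (hw : 4 * d < 2 ^ w) (hQ : Q ≤ R)
    (hok : ∀ r ∈ rules, r.Ok A Q (fun x => x ∈ xs ∨ Y x))
    {ρ : ℕ → ℕ} (hY : ∀ x, Y x → ρ x < d)
    (I : Set (ℕ × ℕ) → Prop)
    (hI : ∀ B σ, Assigns d xs Y ρ σ → ∀ r ∈ rules, I B → r.prem.Holds d σ B →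
      I (insert (r.head d σ) B))
    (s0 s : RamState) (hs : I (dbOf d A Q s.mem)) (hd : s.regs D = d)
    (hσ : Assigns d xs Y ρ s.regs) (X : Set ℕ) (hf : Frame X d A Q s0 s) (r : Rule)
    (hr : r ∈ rules) :
    I (dbOf d A Q ((r.prog D A).run w D s).mem) ∧ Frame X d A Q s0 ((r.prog D A).run w D s) ∧
      ((r.prog D A).run w D s).regs = s.regs := by
  have hV : ∀ x, (x ∈ xs ∨ Y x) → s.regs x < d := by
    rintro x (hx | hx)
    · exact hσ.1 x hx
    · rw [hσ.2 x hx]; exact hY x hx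
  rw [r.run_prog h hw hQ s hd hV (hok r hr)]
  split_ifs with hh
  · obtain ⟨h1, h2, h3⟩ := r.head_mem (hok r hr) h.two_le s.regs hV
    refine ⟨?_, hf.setMem h1 h2 h3 1, rfl⟩
    rw [dbOf_setMem h1 h2 h3 _ _ one_ne_zero]
    exact hI _ _ hσ r hr hs hh
  · exact ⟨hs, hf, rfl⟩

theorem sweep_inv (h : Fits w d A R) (hw : 4 * d < 2 ^ w) (hQ : Q ≤ R) (hn : xs.Nodup)
    (hD : D ∉ xs) (hok : ∀ r ∈ rules, r.Ok A Q (fun x => x ∈ xs ∨ Y x))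
    (hYx : ∀ x ∈ xs, ¬ Y x)
    {ρ : ℕ → ℕ} (hY : ∀ x, Y x → ρ x < d) (I : Set (ℕ × ℕ) → Prop)
    (hI : ∀ B σ, Assigns d xs Y ρ σ → ∀ r ∈ rules, I B → r.prem.Holds d σ B →
      I (insert (r.head d σ) B))
    (s : RamState) (hs : I (dbOf d A Q s.mem)) (hd : s.regs D = d)
    (hρ : ∀ x, Y x → s.regs x = ρ x) :
    I (dbOf d A Q (((Prog.seqs (rules.map (Rule.prog D A))).forAll xs).run w D s).mem) ∧
      Frame {x | x ∈ xs} d A Q s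
        (((Prog.seqs (rules.map (Rule.prog D A))).forAll xs).run w D s) := by
  have := Prog.forAll_inv (w := w) (D := D) (d := d) hn hD (fun x _ => keeps_rules D A x rules)
    (keeps_rules D A D rules) (by omega)
    (fun u => I (dbOf d A Q u.mem) ∧ Frame {x | x ∈ xs} d A Q s u) ?_ ?_ s hd ⟨hs, .refl s⟩
  · exact this
  · rintro u x hx v ⟨h1, h2⟩
    exact ⟨h1, h2.setReg hx v⟩
  · rintro u ⟨h1, h2⟩ hud hux
    have hσ : Assigns d xs Y ρ u.regs :=
      ⟨hux, fun x hx => by rw [h2.regs x (fun hx' => hYx x hx' hx), hρ x hx]⟩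
    have := Prog.run_seqs_inv (w := w) (D := D) (L := rules.map (Rule.prog D A))
      (fun v => (I (dbOf d A Q v.mem) ∧ Frame {x | x ∈ xs} d A Q s v) ∧ v.regs = u.regs)
      ?_ u ⟨⟨h1, h2⟩, rfl⟩
    · exact this.1
    · intro p hp v hv
      obtain ⟨r, hr, rfl⟩ := List.mem_map.mp hp
      have := rules_inv (D := D) h hw hQ hok hY I hI s v hv.1.1 (by rw [hv.2, hud])
        (by rw [hv.2]; exact hσ) _ hv.1.2 r hr
      exact ⟨⟨this.1, this.2.1⟩, by rw [this.2.2, hv.2]⟩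

/-- Some instance, a rule under an assignment `τ`, is violated at the start. When the sweep arrives
at this instance, either the database has already grown, or it is unchanged, so that the premise
still holds and the missing tuple is inserted now. The distinction is necessary because premises may
contain negations. -/
theorem sweep_progress (h : Fits w d A R) (hw : 4 * d < 2 ^ w) (hQ : Q ≤ R) (hn : xs.Nodup)
    (hD : D ∉ xs) (hok : ∀ r ∈ rules, r.Ok A Q (fun x => x ∈ xs ∨ Y x))
    (hYx : ∀ x ∈ xs, ¬ Y x)
    {ρ : ℕ → ℕ} (hY : ∀ x, Y x → ρ x < d) (s : RamState) (hd : s.regs D = d)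
    (hρ : ∀ x, Y x → s.regs x = ρ x)
    (hc : ¬ ClosedUnder d xs Y rules ρ (dbOf d A Q s.mem)) :
    dbOf d A Q s.mem ⊂
      dbOf d A Q (((Prog.seqs (rules.map (Rule.prog D A))).forAll xs).run w D s).mem := by
  simp only [ClosedUnder, not_forall] at hc
  obtain ⟨τ, hτ, r, hr, hh, hnm⟩ := hc
  set B0 := dbOf d A Q s.mem with hB0
  have Imono : ∀ (B : Set (ℕ × ℕ)) (σ : ℕ → ℕ), Assigns d xs Y ρ σ → ∀ r ∈ rules, B0 ⊆ B →
      r.prem.Holds d σ B → B0 ⊆ insert (r.head d σ) B :=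
    fun B σ _ r _ hB _ => hB.trans (Set.subset_insert _ _)
  have Smono : ∀ (B : Set (ℕ × ℕ)) (σ : ℕ → ℕ), Assigns d xs Y ρ σ → ∀ r ∈ rules, B0 ⊂ B →
      r.prem.Holds d σ B → B0 ⊂ insert (r.head d σ) B :=
    fun B σ _ r _ hB _ => lt_of_lt_of_le hB (Set.subset_insert _ _)
  have hass : ∀ u : RamState, Frame {x | x ∈ xs} d A Q s u → (∀ x ∈ xs, u.regs x < d) →
      Assigns d xs Y ρ u.regs := fun u h2 hux =>
      ⟨hux, fun x hx => by rw [h2.regs x (fun hx' => hYx x hx' hx), hρ x hx]⟩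
  have seqinv : ∀ (J : Set (ℕ × ℕ) → Prop), (∀ (B : Set (ℕ × ℕ)) (σ : ℕ → ℕ),
      Assigns d xs Y ρ σ → ∀ r ∈ rules, J B → r.prem.Holds d σ B → J (insert (r.head d σ) B)) →
      ∀ u : RamState, u.regs D = d → (∀ x ∈ xs, u.regs x < d) →
      Frame {x | x ∈ xs} d A Q s u → J (dbOf d A Q u.mem) → ∀ p ∈ rules.map (Rule.prog D A),
      ∀ v : RamState, (J (dbOf d A Q v.mem) ∧ Frame {x | x ∈ xs} d A Q s v) ∧ v.regs = u.regs →
        (J (dbOf d A Q (p.run w D v).mem) ∧ Frame {x | x ∈ xs} d A Q s (p.run w D v)) ∧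
          (p.run w D v).regs = u.regs := by
    intro J hJ u hud hux hf _ p hp v hv
    obtain ⟨r, hr, rfl⟩ := List.mem_map.mp hp
    have := rules_inv (D := D) h hw hQ hok hY J hJ s v hv.1.1 (by rw [hv.2, hud])
      (by rw [hv.2]; exact hass u hf hux) _ hv.1.2 r hr
    exact ⟨⟨this.1, this.2.1⟩, by rw [this.2.2, hv.2]⟩
  refine Prog.forAll_hit (w := w) (D := D) (d := d) hn hD (fun x _ => keeps_rules D A x rules)
    (keeps_rules D A D rules) (by omega)
    (fun u => B0 ⊆ dbOf d A Q u.mem ∧ Frame {x | x ∈ xs} d A Q s u)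
    (fun u => B0 ⊂ dbOf d A Q u.mem) ?_ ?_ ?_ ?_ τ hτ.1 ?_ s hd ⟨le_rfl, .refl s⟩
  · rintro u x hx v ⟨h1, h2⟩
    exact ⟨h1, h2.setReg hx v⟩
  · rintro u ⟨h1, h2⟩ hud hux
    exact (Prog.run_seqs_inv (w := w) (D := D) (L := rules.map (Rule.prog D A)) _
      (seqinv (fun B => B0 ⊆ B) Imono u hud hux h2 h1) u ⟨⟨h1, h2⟩, rfl⟩).1
  · exact fun u x hx v h1 => h1
  · rintro u ⟨h1, h2⟩ h3 hud hux
    exact (Prog.run_seqs_inv (w := w) (D := D) (L := rules.map (Rule.prog D A)) _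
      (seqinv (fun B => B0 ⊂ B) Smono u hud hux h2 h3) u ⟨⟨h3, h2⟩, rfl⟩).1.1
  · rintro u ⟨h1, h2⟩ hud hux
    have hux' : ∀ x ∈ xs, u.regs x < d := fun x hx => by rw [hux x hx]; exact hτ.1 x hx
    have hpres := seqinv (fun B => B0 ⊆ B) Imono u hud hux' h2 h1
    refine Prog.run_seqs_hit (w := w) (D := D) (L := rules.map (Rule.prog D A))
      (fun v => (B0 ⊆ dbOf d A Q v.mem ∧ Frame {x | x ∈ xs} d A Q s v) ∧ v.regs = u.regs)
      (fun v => B0 ⊂ dbOf d A Q v.mem) hpres ?_ _ (List.mem_map_of_mem hr) ?_ u ⟨⟨h1, h2⟩, rfl⟩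
    · intro p hp v hv hv'
      obtain ⟨r, hr, rfl⟩ := List.mem_map.mp hp
      exact (rules_inv (D := D) h hw hQ hok hY (fun B => B0 ⊂ B) Smono s v hv'
        (by rw [hv.2, hud]) (by rw [hv.2]; exact hass u h2 hux') _ hv.1.2 r hr).1
    · rintro v ⟨⟨h5, h6⟩, h7⟩
      rcases h5.eq_or_ssubset with heq | hss
      · have hV : ∀ x, (x ∈ xs ∨ Y x) → v.regs x < d := by
          rintro x (hx | hx)
          · rw [h7]; exact hux' x hx
          · rw [h7, (hass u h2 hux').2 x hx]; exact hY x hx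
        have hag : ∀ x, (x ∈ xs ∨ Y x) → v.regs x = τ x := by
          rintro x (hx | hx)
          · rw [h7]; exact hux x hx
          · rw [h7, (hass u h2 hux').2 x hx, hτ.2 x hx]
        have hhead : r.head d v.regs = r.head d τ := by
          unfold Rule.head
          rw [List.map_congr_left (fun x hx => hag x ((hok r hr).2.2.2.1 x hx))]
        rw [r.run_prog h hw hQ v (by rw [h7, hud]) hV (hok r hr), if_pos]
        · obtain ⟨g1, g2, g3⟩ := r.head_mem (hok r hr) h.two_le v.regs hV
          rw [dbOf_setMem g1 g2 g3 _ _ one_ne_zero, ← heq, hhead]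
          exact Set.ssubset_insert hnm
        · rw [← heq, Fm.holds_congr hag _ _ (hok r hr).1]
          exact hh
      · exact (rules_inv (D := D) h hw hQ hok hY (fun B => B0 ⊂ B) Smono s v hss
          (by rw [h7, hud]) (by rw [h7]; exact hass u h2 hux') _ h6 r hr).1

theorem dbOf_finite (d A Q : ℕ) (mem : ℕ → ℕ) :
    (dbOf d A Q mem).Finite ∧ (dbOf d A Q mem).ncard ≤ Q * d ^ A := by
  have hsub : dbOf d A Q mem ⊆ ↑(Finset.range Q ×ˢ Finset.range (d ^ A)) := by
    rintro ⟨q, i⟩ ⟨-, h2, h3, -⟩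
    simp_all
  refine ⟨(Finset.finite_toSet _).subset hsub, ?_⟩
  refine (Set.ncard_le_ncard hsub (Finset.finite_toSet _)).trans ?_
  rw [Set.ncard_coe_finset]; simp

/-- The specification of the fixed point computation. -/
theorem stratum_spec (h : Fits w d A R) (hw : 4 * d < 2 ^ w) (hQ : Q ≤ R) (hn : xs.Nodup)
    (hD : D ∉ xs) (hz : z ∉ xs) (hDz : D ≠ z) (hYz : ¬ Y z) (hb : Q * d ^ A < d ^ b)
    (hbw : d ^ b < 2 ^ w)
    (hok : ∀ r ∈ rules, r.Ok A Q (fun x => x ∈ xs ∨ Y x)) (hYx : ∀ x ∈ xs, ¬ Y x)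
    (s : RamState) (hd : s.regs D = d) (hY : ∀ x, Y x → s.regs x < d) :
    Frame {x | x = z ∨ x ∈ xs} d A Q s ((stratum D A b z xs rules).run w D s) ∧
    ClosedUnder d xs Y rules s.regs (dbOf d A Q ((stratum D A b z xs rules).run w D s).mem) ∧
    ∀ I : Set (ℕ × ℕ) → Prop, I (dbOf d A Q s.mem) →
      (∀ B σ, Assigns d xs Y s.regs σ → ∀ r ∈ rules, I B → r.prem.Holds d σ B →
        I (insert (r.head d σ) B)) →
      I (dbOf d A Q ((stratum D A b z xs rules).run w D s).mem) := by
  have hkz : ((Prog.seqs (rules.map (Rule.prog D A))).forAll xs).Keeps z := by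
    simp [hz, Rule.keeps_prog]
  have hkD : ((Prog.seqs (rules.map (Rule.prog D A))).forAll xs).Keeps D := by
    simp [hD, Rule.keeps_prog]
  have hregs : ∀ u, Frame {x | x = z ∨ x ∈ xs} d A Q s u → ∀ x, Y x → u.regs x = s.regs x := by
    intro u hu x hx
    refine hu.regs x ?_
    rintro (rfl | h')
    exacts [hYz hx, hYx x h' hx]
  have main : ∀ I : Set (ℕ × ℕ) → Prop, I (dbOf d A Q s.mem) →
      (∀ B σ, Assigns d xs Y s.regs σ → ∀ r ∈ rules, I B → r.prem.Holds d σ B →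
        I (insert (r.head d σ) B)) →
      Frame {x | x = z ∨ x ∈ xs} d A Q s ((stratum D A b z xs rules).run w D s) ∧
      I (dbOf d A Q ((stratum D A b z xs rules).run w D s).mem) := by
    intro I h0 hI
    refine Prog.rep_inv (a := b) hkz hkD hDz hbw s hd (fun _ u =>
      Frame {x | x = z ∨ x ∈ xs} d A Q s u ∧ I (dbOf d A Q u.mem))
      ⟨(Frame.refl s).setReg (Or.inl rfl) _, h0⟩ ?_
    rintro i hi u ⟨h1, h2⟩ - hud
    obtain ⟨h3, h4⟩ := sweep_inv h hw hQ hn hD hok hYx hY I hI u h2 hud (hregs u h1)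
    exact ⟨(h1.trans (h4.mono (fun x hx => Or.inr hx))).setReg (Or.inl rfl) _, h3⟩
  refine ⟨(main (fun _ => True) trivial (fun _ _ _ _ _ _ _ => trivial)).1, ?_,
    fun I h0 hI => (main I h0 hI).2⟩
  -- Every sweep before saturation adds a tuple, so after `i` sweeps the database is closed or has
  -- at least `i` tuples. By `hb` there are more sweeps than possible tuples, which leaves only
  -- closedness at the end.
  have := Prog.rep_inv (a := b) hkz hkD hDz hbw s hd (fun i u =>
      Frame {x | x = z ∨ x ∈ xs} d A Q s u ∧
      (ClosedUnder d xs Y rules s.regs (dbOf d A Q u.mem) ∨ i ≤ (dbOf d A Q u.mem).ncard))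
      ⟨(Frame.refl s).setReg (Or.inl rfl) _, Or.inr (Nat.zero_le _)⟩ ?_
  · rcases this.2 with h1 | h1
    · exact h1
    · have := (dbOf_finite d A Q ((stratum D A b z xs rules).run w D s).mem).2
      unfold stratum at this; omega
  rintro i hi u ⟨h1, h2⟩ - hud
  by_cases hc : ClosedUnder d xs Y rules s.regs (dbOf d A Q u.mem)
  -- A sweep over a closed database inserts only tuples which are present, so closedness persists.
  · obtain ⟨h3, h4⟩ := sweep_inv h hw hQ hn hD hok hYx hY (fun B => B = dbOf d A Q u.mem) (by
      rintro B σ hσ r hr rfl hh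
      exact Set.insert_eq_of_mem (hc σ hσ r hr hh)) u rfl hud (hregs u h1)
    refine ⟨(h1.trans (h4.mono (fun x hx => Or.inr hx))).setReg (Or.inl rfl) _, Or.inl ?_⟩
    rw [RamState.setReg_mem, h3]; exact hc
  · obtain ⟨-, h4⟩ := sweep_inv h hw hQ hn hD hok hYx hY (fun _ => True)
      (fun _ _ _ _ _ _ _ => trivial) u trivial hud (hregs u h1)
    refine ⟨(h1.trans (h4.mono (fun x hx => Or.inr hx))).setReg (Or.inl rfl) _, Or.inr ?_⟩
    have hs := sweep_progress h hw hQ hn hD hok hYx hY u hud (hregs u h1) hc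
    have := Set.ncard_lt_ncard hs (dbOf_finite _ _ _ _).1
    have := h2.resolve_left hc
    rw [RamState.setReg_mem]; omega

end Stratum

/-! ## Connected sets and partial solutions -/

/-- `b` can be reached from `a` within the set `U`. -/
def Rch (adj : ℕ → ℕ → Prop) (U : Set ℕ) (a b : ℕ) : Prop :=
  a ∈ U ∧ Relation.ReflTransGen (fun x y => adj x y ∧ y ∈ U) a b

namespace Rch

variable {adj : ℕ → ℕ → Prop} {U V : Set ℕ} {a b x : ℕ}

theorem refl (h : a ∈ U) : Rch adj U a a := ⟨h, .refl⟩

theorem left (h : Rch adj U a b) : a ∈ U := h.1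

theorem right (h : Rch adj U a b) : b ∈ U := by
  rcases Relation.ReflTransGen.cases_tail h.2 with h' | ⟨_, _, h'⟩
  · rw [h']; exact h.1
  · exact h'.2

theorem trans (h : Rch adj U a b) (h' : Rch adj U b x) : Rch adj U a x := ⟨h.1, h.2.trans h'.2⟩

theorem tail (h : Rch adj U a b) (h1 : adj b x) (h2 : x ∈ U) : Rch adj U a x :=
  ⟨h.1, h.2.tail ⟨h1, h2⟩⟩

theorem mono (h : Rch adj U a b) (hUV : U ⊆ V) : Rch adj V a b :=
  ⟨hUV h.1, Relation.ReflTransGen.mono (fun _ _ h => ⟨h.1, hUV h.2⟩) _ _ h.2⟩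

/-- Induction along a path. -/
theorem ind {P : ℕ → Prop} (h : Rch adj U a b) (h0 : a ∈ U → P a)
    (hs : ∀ x y, Rch adj U a x → P x → adj x y → y ∈ U → P y) : P b := by
  obtain ⟨h1, h2⟩ := h
  induction h2 with
  | refl => exact h0 h1
  | tail h3 h4 ih => exact hs _ _ ⟨h1, h3⟩ ih h4.1 h4.2

theorem symm (hs : ∀ x y, adj x y → adj y x) (h : Rch adj U a b) : Rch adj U b a := by
  refine h.ind (P := fun b => Rch adj U b a) refl ?_
  intro x y hx ih hxy hy
  exact ((refl hy).tail (hs _ _ hxy) hx.right).trans ih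

/-- All nodes on a path from `a` are themselves reachable from `a`, so the path stays in any set
that contains the reachable nodes. In particular, a component is connected within itself. -/
theorem mono' (h : Rch adj U a b) (hV : ∀ x, Rch adj U a x → x ∈ V) : Rch adj V a b :=
  h.ind (fun ha => .refl (hV _ (.refl ha)))
    (fun _ _ hx ih hxy hy => ih.tail hxy (hV _ (hx.tail hxy hy)))

end Rch

/-- The nodes (below `n`) outside of the boundary `Z`. -/
def Out (n : ℕ) {k : ℕ} (Z : Fin k → ℕ) : Set ℕ := {y | y < n ∧ ∀ i, Z i ≠ y}

/-- The boundary `Z` with position `i` dropped and `v` put in front. -/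
def bsub {t : ℕ} (Z : Fin (t + 1) → ℕ) (i : Fin (t + 1)) (v : ℕ) : Fin (t + 1) → ℕ :=
  Fin.cons v fun m => Z (i.succAbove m)

@[simp] theorem bsub_zero {t : ℕ} (Z : Fin (t + 1) → ℕ) (i v) : bsub Z i v 0 = v := rfl
@[simp] theorem bsub_succ {t : ℕ} (Z : Fin (t + 1) → ℕ) (i v) (m : Fin t) :
    bsub Z i v m.succ = Z (i.succAbove m) := rfl
theorem bsub_bsub {t : ℕ} (Z : Fin (t + 1) → ℕ) (i v x) : bsub (bsub Z i v) 0 x = bsub Z i x := by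
  ext m; refine Fin.cases rfl (fun m => ?_) m; simp

theorem mem_out_bsub {t n : ℕ} {Z : Fin (t + 1) → ℕ} {i v y} :
    y ∈ Out n (bsub Z i v) ↔ y < n ∧ v ≠ y ∧ ∀ m, Z (i.succAbove m) ≠ y := by
  exact and_congr_right fun _ => Fin.forall_fin_succ

theorem mem_out_iff {t n : ℕ} {Z : Fin (t + 1) → ℕ} (i : Fin (t + 1)) {y} :
    y ∈ Out n Z ↔ y < n ∧ Z i ≠ y ∧ ∀ m, Z (i.succAbove m) ≠ y := by
  simp [Out, Fin.forall_iff_succAbove i]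

/-- The number `n` is not a node, so a position with value `n` is empty. Thus `bsub Z i n` drops
position `i` while the number of positions stays `t + 1`. -/
theorem out_bsub_self {t n : ℕ} {Z : Fin (t + 1) → ℕ} {i y} :
    y ∈ Out n (bsub Z i n) ↔ y < n ∧ ∀ m, Z (i.succAbove m) ≠ y := by
  rw [mem_out_bsub]; constructor
  · exact fun h => ⟨h.1, h.2.2⟩
  · exact fun h => ⟨h.1, by omega, h.2⟩

theorem out_bsub_subset {t n : ℕ} {Z : Fin (t + 1) → ℕ} {i v} :
    Out n (bsub Z i v) ⊆ Out n (bsub Z i n) := fun y h => by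
  rw [mem_out_bsub] at h; rw [out_bsub_self]; exact ⟨h.1, h.2.2⟩

theorem out_subset {t n : ℕ} {Z : Fin (t + 1) → ℕ} (i) :
    Out n Z ⊆ Out n (bsub Z i n) := fun y h => by
  rw [mem_out_iff i] at h; rw [out_bsub_self]; exact ⟨h.1, h.2.2⟩

/-- Relations on the positions of a boundary: which positions are selected and which of these are
connected by the part of a solution seen so far. -/
abbrev BState (t : ℕ) : Type := Fin (t + 1) → Fin (t + 1) → Bool

open Classical in
/-- The transitive closure of a relation on positions. -/
noncomputable def clos {t : ℕ} (ρ : Fin (t + 1) → Fin (t + 1) → Prop) : BState t :=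
  fun i j => decide (Relation.TransGen ρ i j)

theorem clos_iff {t : ℕ} {ρ : Fin (t + 1) → Fin (t + 1) → Prop} {i j} :
    clos ρ i j = true ↔ Relation.TransGen ρ i j := by simp [clos]

/-- The state given by the selected positions `s` and the connections `g`. -/
noncomputable def baseST {t : ℕ} (s : Fin (t + 1) → Bool) (g : BState t) : BState t :=
  clos fun a b => s a ∧ s b ∧ (a = b ∨ g a b)

/-- The relation generated by `r₁` and the state `r₂` of the boundary `bsub Z i v`. -/
def joinRel {t : ℕ} (i : Fin (t + 1)) (r₁ r₂ : BState t) (a b : Fin (t + 1)) : Prop :=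
  r₁ a b ∨ ∃ m m' : Fin t, a = i.succAbove m ∧ b = i.succAbove m' ∧ r₂ m.succ m'.succ

/-- The state of the union of two partial solutions. -/
noncomputable def joinST {t : ℕ} (i : Fin (t + 1)) (r₁ r₂ : BState t) : BState t := clos (joinRel i r₁ r₂)

/-- The states `r₁` and `r₂` can be joined. -/
def Compat {t : ℕ} (i : Fin (t + 1)) (r₁ r₂ : BState t) : Prop :=
  (∀ m : Fin t, r₁ (i.succAbove m) (i.succAbove m) = r₂ m.succ m.succ) ∧
    (r₂ 0 0 → ∃ m : Fin t, r₂ 0 m.succ)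

/-- Only the first position is selected. -/
def FinalST {t : ℕ} (r : BState t) : Prop := r 0 0 ∧ ∀ m : Fin t, r m.succ m.succ = false

/-- A coloured graph on the nodes below `n`, with a set of nodes which may be used. -/
structure CGraph (n c : ℕ) where
  adj : ℕ → ℕ → Prop
  col : ℕ → Fin c → Prop
  alive : Set ℕ
  symm : ∀ x y, adj x y → adj y x
  irrefl : ∀ x, ¬ adj x x
  lt : ∀ x y, adj x y → x < n
  alive_lt : ∀ x ∈ alive, x < n

namespace CGraph

variable {n c t : ℕ} (H : CGraph n c)

/-- Connection outside of the boundary. -/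
def Cn (Z : Fin (t + 1) → ℕ) (u x : ℕ) : Prop := Rch H.adj (Out n Z) u x

/-- The node `j` lies in the component of a smaller node of the region. -/
def Seen (Z : Fin (t + 1) → ℕ) (j : ℕ) : Prop :=
  ∃ u < j, H.Cn (bsub Z 0 n) (Z 0) u ∧ H.Cn Z u j

/-- The components of nodes below `j` within the region of `Z`. -/
def Reg (Z : Fin (t + 1) → ℕ) (j : ℕ) : Set ℕ :=
  {x | ∃ u < j, H.Cn (bsub Z 0 n) (Z 0) u ∧ H.Cn Z u x}

open Classical in
/-- The number of nodes of `A` of colour `q` outside of the boundary. -/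
noncomputable def cnt (Z : Fin (t + 1) → ℕ) (A : Finset ℕ) (q : Fin c) : ℕ :=
  (A.filter fun a => (∀ i, Z i ≠ a) ∧ H.col a q).card

open Classical in
/-- The number of nodes of `A` of colour `q`. -/
noncomputable def pk (A : Finset ℕ) (q : Fin c) : ℕ := (A.filter fun a => H.col a q).card

/-- `A` is a partial solution with boundary `Z`, state `r` and Parikh vector `p`. -/
structure Part (r : BState t) (Z : Fin (t + 1) → ℕ) (j : ℕ) (p : Fin c → ℕ) (A : Finset ℕ) : Prop where
  sub : ∀ a ∈ A, a ∈ H.Reg Z j ∨ ∃ i, Z i = a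
  alive : ∀ a ∈ A, a ∈ H.alive
  sel : ∀ i, Z i ∈ A ↔ r i i
  con : ∀ i i', r i i' → Rch H.adj A (Z i) (Z i')
  hit : ∀ a ∈ A, ∃ i, Rch H.adj A a (Z i)
  cnt : ∀ q, H.cnt Z A q = p q

/-- `S` is the node set of a connected subgraph of usable nodes with Parikh vector `M`. -/
def Solves (M : Fin c → ℕ) (S : Finset ℕ) : Prop :=
  S.Nonempty ∧ (∀ a ∈ S, a ∈ H.alive) ∧ (∀ a ∈ S, ∀ b ∈ S, Rch H.adj S a b) ∧ ∀ q, H.pk S q = M q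

/-- Conditions under which the component of `j` can be joined, with first node `v`. -/
structure JoinAt (Z : Fin (t + 1) → ℕ) (i : Fin (t + 1)) (v j : ℕ) : Prop where
  reg : H.Cn (bsub Z 0 n) (Z 0) j
  new : ¬ H.Seen Z j
  drop : ¬ H.Cn (bsub Z i n) j (Z i)
  root : H.Cn (bsub Z i n) j v

open Classical in
/-- Parikh vectors add up. -/
def Adds (p₁ p₂ p : Fin c → ℕ) (r₂ : BState t) (v : ℕ) : Prop :=
  ∀ q, p q = p₁ q + p₂ q + if r₂ 0 0 ∧ H.col v q then 1 else 0

variable {H}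

/-! ### Soundness: derivable facts describe actual sets of nodes -/

theorem Cn.symm {Z : Fin (t + 1) → ℕ} {u x : ℕ} (h : H.Cn Z u x) : H.Cn Z x u :=
  Rch.symm H.symm h

/-- The witness is the set of selected boundary nodes. A node may occupy several positions, so by
`h2` the selection must depend on the node only. Requiring usable nodes also keeps the placeholder
`n` from being selected. -/
theorem part_base {s : Fin (t + 1) → Bool} {g : BState t} {Z : Fin (t + 1) → ℕ}
    (h1 : ∀ i, s i → Z i ∈ H.alive) (h2 : ∀ i i', Z i = Z i' → s i = s i')
    (h3 : ∀ i i', g i i' → Z i = Z i' ∨ H.adj (Z i) (Z i')) :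
    ∃ A, H.Part (baseST s g) Z 0 (fun _ => 0) A := by
  classical
  have hmem : ∀ i, Z i ∈ (Finset.univ.filter fun i => s i = true).image Z ↔ s i = true := by
    intro i
    simp only [Finset.mem_image, Finset.mem_filter, Finset.mem_univ, true_and]
    exact ⟨fun ⟨l, h, e⟩ => by rw [← h2 _ _ e, h], fun h => ⟨i, h, rfl⟩⟩
  refine ⟨(Finset.univ.filter fun i => s i = true).image Z, ?_, ?_, ?_, ?_, ?_, ?_⟩
  · intro a ha
    obtain ⟨i, -, rfl⟩ := Finset.mem_image.mp ha
    exact .inr ⟨i, rfl⟩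
  · intro a ha
    obtain ⟨i, hi, rfl⟩ := Finset.mem_image.mp ha
    exact h1 i (by simpa using hi)
  · intro i
    rw [hmem, baseST, clos_iff]
    constructor
    · exact fun h => .single ⟨h, h, .inl rfl⟩
    · intro h
      obtain ⟨_, h, _⟩ := Relation.TransGen.head'_iff.mp h
      exact h.1
  · intro i i' h
    rw [baseST, clos_iff] at h
    have step : ∀ a b, (s a ∧ s b ∧ (a = b ∨ g a b)) →
        Rch H.adj ((Finset.univ.filter fun i => s i = true).image Z : Finset ℕ) (Z a) (Z b) := by
      rintro a b ⟨ha, hb, hab⟩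
      have ra := Rch.refl (adj := H.adj) (U := ((Finset.univ.filter fun i => s i = true).image Z : Finset ℕ))
        (Finset.mem_coe.mpr ((hmem a).mpr ha))
      rcases hab with rfl | hab
      · exact ra
      · rcases h3 _ _ hab with e | e
        · rwa [← e]
        · exact ra.tail e (Finset.mem_coe.mpr ((hmem b).mpr hb))
    induction h with
    | single h => exact step _ _ h
    | tail _ h ih => exact ih.trans (step _ _ h)
  · intro a ha
    obtain ⟨i, hi, rfl⟩ := Finset.mem_image.mp ha
    exact ⟨i, .refl ha⟩
  · intro q
    simp only [CGraph.cnt, Finset.card_eq_zero, Finset.filter_eq_empty_iff]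
    intro a ha h
    obtain ⟨i, -, rfl⟩ := Finset.mem_image.mp ha
    exact h.1 i rfl

theorem part_skip {r : BState t} {Z : Fin (t + 1) → ℕ} {j : ℕ} {p : Fin c → ℕ} {A : Finset ℕ}
    (h : H.Part r Z j p A) : H.Part r Z (j + 1) p A :=
  ⟨fun a ha => (h.sub a ha).imp (fun ⟨u, hu, h⟩ => ⟨u, by omega, h⟩) id, h.alive, h.sel, h.con,
    h.hit, h.cnt⟩

open Classical in
-- Here `C` is the component being joined. It contains every node of `A₂` off the boundary `Z` and
-- no node of `A₁`, so the counts add up. The correction term is for `v`, which is a boundary node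
-- for the smaller problem but an interior one for the union.
theorem cnt_union {Z : Fin (t + 1) → ℕ} {i : Fin (t + 1)} {v : ℕ} {A₁ A₂ : Finset ℕ}
    (C : Set ℕ) (h1 : ∀ a ∈ A₁, a ∉ C) (h2 : ∀ a ∈ A₂, a ∈ C ∨ ∃ m, Z (i.succAbove m) = a)
    (hZ : ∀ l, Z l ∉ C) (hv : v ∈ C) (q : Fin c) :
    H.cnt Z (A₁ ∪ A₂) q = H.cnt Z A₁ q + H.cnt (bsub Z i v) A₂ q +
      if v ∈ A₂ ∧ H.col v q then 1 else 0 := by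
  have e1 : ∀ a ∈ A₂, (∀ l, Z l ≠ a) ↔ a ∈ C := by
    intro a ha
    constructor
    · intro h
      rcases h2 a ha with h' | ⟨m, h'⟩
      · exact h'
      · exact absurd h' (h _)
    · rintro h l rfl; exact hZ l h
  have e2 : ∀ a ∈ A₂, (∀ l, bsub Z i v l ≠ a) ↔ a ∈ C ∧ a ≠ v := by
    intro a ha
    rw [Fin.forall_fin_succ, ← e1 a ha]
    simp only [bsub_zero, bsub_succ]
    constructor
    · rintro ⟨h3, h4⟩
      refine ⟨?_, fun h => h3 h.symm⟩
      rw [e1 a ha]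
      rcases h2 a ha with h' | ⟨m, h'⟩
      · exact h'
      · exact absurd h' (h4 m)
    · rintro ⟨h3, h4⟩
      exact ⟨fun h => h4 h.symm, fun m => h3 _⟩
  unfold CGraph.cnt
  rw [Finset.filter_union, Finset.card_union_of_disjoint, add_assoc]
  · congr 1
    by_cases hvq : v ∈ A₂ ∧ H.col v q
    · rw [if_pos hvq, ← Finset.card_insert_of_notMem (a := v)]
      · congr 1
        ext a
        simp only [Finset.mem_filter, Finset.mem_insert]
        constructor
        · rintro ⟨h3, h4, h5⟩
          by_cases hav : a = v
          · exact .inl hav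
          · exact .inr ⟨h3, (e2 a h3).mpr ⟨(e1 a h3).mp h4, hav⟩, h5⟩
        · rintro (rfl | ⟨h3, h4, h5⟩)
          · exact ⟨hvq.1, (e1 a hvq.1).mpr hv, hvq.2⟩
          · exact ⟨h3, (e1 a h3).mpr ((e2 a h3).mp h4).1, h5⟩
      · simp only [Finset.mem_filter, not_and]
        intro h3 h4
        exact absurd rfl ((e2 v h3).mp h4).2
    · rw [if_neg hvq, add_zero]
      congr 1
      refine Finset.filter_congr fun a ha => ?_
      rw [e1 a ha, e2 a ha]
      constructor
      · rintro ⟨h3, h4⟩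
        exact ⟨⟨h3, fun hav => hvq ⟨hav ▸ ha, hav ▸ h4⟩⟩, h4⟩
      · rintro ⟨⟨h3, _⟩, h4⟩; exact ⟨h3, h4⟩
  · rw [Finset.disjoint_left]
    intro a ha ha'
    simp only [Finset.mem_filter] at ha ha'
    exact h1 a ha.1 ((e1 a ha'.1).mp ha'.2.1)

/-- A path that avoids the kept positions, and cannot reach the dropped one, avoids the whole
boundary. -/
theorem cn_of_drop {Z : Fin (t + 1) → ℕ} {i : Fin (t + 1)} {j x : ℕ}
    (hd : ¬ H.Cn (bsub Z i n) j (Z i)) (h : H.Cn (bsub Z i n) j x) : H.Cn Z j x := by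
  refine h.mono' fun y hy => ?_
  rw [mem_out_iff i]
  have := out_bsub_self.mp hy.right
  exact ⟨this.1, fun e => hd (e ▸ hy), this.2⟩

/-- The witness is `A₁ ∪ A₂`. By `drop` and `root`, the region of `bsub Z i v` is the component of
`j` outside of `Z`, and by `new` the set `A₁` does not meet it; the two sets share at most boundary
nodes, on whose kept positions `Compat` makes them agree. Its second clause matters for `hit`: once
`v` leaves the boundary, whatever hung on it must be attached to a kept position, or it could never
be connected to the rest. -/
theorem part_join {r₁ r₂ : BState t} {Z : Fin (t + 1) → ℕ} {i : Fin (t + 1)} {v j : ℕ}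
    {p₁ p₂ p : Fin c → ℕ} {A₁ A₂ : Finset ℕ} (h1 : H.Part r₁ Z j p₁ A₁)
    (h2 : H.Part r₂ (bsub Z i v) n p₂ A₂) (hj : H.JoinAt Z i v j) (hc : Compat i r₁ r₂)
    (hp : H.Adds p₁ p₂ p r₂ v) : ∃ A, H.Part (joinST i r₁ r₂) Z (j + 1) p A := by
  classical
  have F0 : ∀ l, ¬ H.Cn Z j (Z l) := fun l h => h.right.2 l rfl
  have Fv : H.Cn Z j v := cn_of_drop hj.drop hj.root
  have F2 : ∀ a ∈ A₂, a ∈ {x | H.Cn Z j x} ∨ ∃ m, Z (i.succAbove m) = a := by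
    intro a ha
    rcases h2.sub a ha with ⟨u, -, h3, h4⟩ | ⟨l, rfl⟩
    · left
      rw [bsub_bsub, bsub_zero] at h3
      exact cn_of_drop hj.drop (hj.root.trans (h3.trans (h4.mono out_bsub_subset)))
    · refine Fin.cases (.inl ?_) (fun m => .inr ⟨m, rfl⟩) l
      exact Fv
  have F3 : ∀ a ∈ A₁, a ∉ {x | H.Cn Z j x} := by
    intro a ha hja
    rcases h1.sub a ha with ⟨u, hu, h3, h4⟩ | ⟨l, rfl⟩
    · exact hj.new ⟨u, hu, h3, h4.trans (Cn.symm hja)⟩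
    · exact F0 l hja
  have m1 : ((A₁ : Finset ℕ) : Set ℕ) ⊆ ((A₁ ∪ A₂ : Finset ℕ) : Set ℕ) := by simp
  have m2 : ((A₂ : Finset ℕ) : Set ℕ) ⊆ ((A₁ ∪ A₂ : Finset ℕ) : Set ℕ) := by simp
  have step : ∀ a b, joinRel i r₁ r₂ a b → Rch H.adj (A₁ ∪ A₂ : Finset ℕ) (Z a) (Z b) := by
    rintro a b (h | ⟨m, m', rfl, rfl, h⟩)
    · exact (h1.con _ _ h).mono m1
    · exact (h2.con _ _ h).mono m2
  have con : ∀ a b, joinST i r₁ r₂ a b → Rch H.adj (A₁ ∪ A₂ : Finset ℕ) (Z a) (Z b) := by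
    intro a b h
    rw [joinST, clos_iff] at h
    induction h with
    | single h => exact step _ _ h
    | tail _ h ih => exact ih.trans (step _ _ h)
  have sel1 : ∀ l, Z l ∈ A₁ ∪ A₂ → Z l ∈ A₁ := by
    intro l hl
    rcases Finset.mem_union.mp hl with h | h
    · exact h
    · rcases F2 _ h with h' | ⟨m, h'⟩
      · exact absurd h' (F0 l)
      · rw [← h'] at h ⊢
        rw [h1.sel, hc.1 m]
        exact (h2.sel m.succ).mp h
  refine ⟨A₁ ∪ A₂, ?_, ?_, ?_, con, ?_, ?_⟩
  · intro a ha
    rcases Finset.mem_union.mp ha with h | h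
    · exact (h1.sub a h).imp (fun ⟨u, hu, h⟩ => ⟨u, by omega, h⟩) id
    · rcases F2 a h with h' | ⟨m, h'⟩
      · exact .inl ⟨j, by omega, hj.reg, h'⟩
      · exact .inr ⟨_, h'⟩
  · intro a ha
    rcases Finset.mem_union.mp ha with h | h
    exacts [h1.alive a h, h2.alive a h]
  · intro l
    constructor
    · intro h
      rw [joinST, clos_iff]
      exact .single (.inl ((h1.sel l).mp (sel1 l h)))
    · exact fun h => (con l l h).left
  · intro a ha
    rcases Finset.mem_union.mp ha with h | h
    · obtain ⟨l, hl⟩ := h1.hit a h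
      exact ⟨l, hl.mono m1⟩
    · obtain ⟨l, hl⟩ := h2.hit a h
      induction l using Fin.cases with
      | zero =>
        obtain ⟨m, hm⟩ := hc.2 ((h2.sel 0).mp hl.right)
        exact ⟨_, (hl.trans (h2.con _ _ hm)).mono m2⟩
      | succ m => exact ⟨_, hl.mono m2⟩
  · intro q
    rw [cnt_union {x | H.Cn Z j x} F3 F2 F0 Fv, h1.cnt, h2.cnt, hp q]
    congr 1
    refine if_congr (and_congr_left fun _ => ?_) rfl rfl
    exact h2.sel 0

/-- If position `0` is the only one selected, every node of `A` can reach only the boundary node `Z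
0`, so `A` is connected. The vector `p` omits that node, hence the correction by `1`. -/
theorem solves_of_part {r : BState t} {Z : Fin (t + 1) → ℕ} {j : ℕ} {p M : Fin c → ℕ} {A : Finset ℕ}
    (h : H.Part r Z j p A) (hr : FinalST r)
    (hM : ∀ q, H.col (Z 0) q ∧ M q = p q + 1 ∨ ¬ H.col (Z 0) q ∧ M q = p q) : H.Solves M A := by
  classical
  have h0 : Z 0 ∈ A := (h.sel 0).mpr hr.1
  have only : ∀ i, Z i ∈ A → i = 0 := by
    intro i
    refine Fin.cases (fun _ => rfl) (fun m hm => ?_) i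
    have := (h.sel _).mp hm
    rw [hr.2 m] at this; cases this
  have to0 : ∀ a ∈ A, Rch H.adj A a (Z 0) := by
    intro a ha
    obtain ⟨i, hi⟩ := h.hit a ha
    rwa [only i hi.right] at hi
  refine ⟨⟨_, h0⟩, h.alive, fun a ha b hb => (to0 a ha).trans ((to0 b hb).symm H.symm), ?_⟩
  intro q
  have hc := h.cnt q
  unfold CGraph.cnt at hc
  unfold CGraph.pk
  have key : ∀ a ∈ A, (∀ i, Z i ≠ a) ↔ a ≠ Z 0 := by
    intro a ha
    constructor
    · exact fun h e => h 0 e.symm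
    · rintro h i rfl
      exact h (by rw [only i ha])
  rcases hM q with ⟨h1, h2⟩ | ⟨h1, h2⟩
  · rw [h2, ← hc, ← Finset.card_insert_of_notMem (a := Z 0)]
    · congr 1
      ext a
      simp only [Finset.mem_filter, Finset.mem_insert]
      constructor
      · rintro ⟨h3, h4⟩
        by_cases e : a = Z 0
        · exact .inl e
        · exact .inr ⟨h3, (key a h3).mpr e, h4⟩
      · rintro (rfl | ⟨h3, -, h4⟩)
        exacts [⟨h0, h1⟩, ⟨h3, h4⟩]
    · simp
  · rw [h2, ← hc]
    congr 1
    refine Finset.filter_congr fun a ha => ?_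
    rw [key a ha]
    constructor
    · exact fun h3 => ⟨fun e => h1 (e ▸ h3), h3⟩
    · exact fun h3 => h3.2

end CGraph

/-! ## Completeness for graphs of bounded treewidth -/

/-- The nodes outside of `C` which are adjacent to a node of `C`. -/
def nbrs (adj : ℕ → ℕ → Prop) (C : Set ℕ) : Set ℕ := {x | x ∉ C ∧ ∃ y ∈ C, adj y x}

/-- Connected sets which can be taken apart by removing one node at a time, such that all
components have at most `t` neighbours. -/
inductive Good (adj : ℕ → ℕ → Prop) (t : ℕ) : Set ℕ → Prop where
  | mk (C : Set ℕ) (v : ℕ) : v ∈ C → (nbrs adj C).encard ≤ t →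
      (∀ u ∈ C, u ≠ v → Good adj t {x | Rch adj (C \ {v}) u x}) → Good adj t C

/-- The elements of `N` are enumerated, and the remaining positions are filled with the placeholder
`n`. -/
theorem exists_cover {t : ℕ} {N : Set ℕ} (hN : N.encard ≤ t) (n : ℕ) :
    ∃ Y : Fin t → ℕ, (∀ m, Y m ∈ N ∨ Y m = n) ∧ ∀ x ∈ N, ∃ m, Y m = x := by
  have hfin : N.Finite := Set.finite_of_encard_le_coe hN
  have hcard : hfin.toFinset.card ≤ t := by
    rw [← Set.ncard_eq_toFinset_card N hfin]
    have := hfin.cast_ncard_eq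
    rw [← this] at hN
    exact_mod_cast hN
  refine ⟨fun m => if h : m.1 < hfin.toFinset.card then hfin.toFinset.orderEmbOfFin rfl ⟨m, h⟩
    else n, fun m => ?_, fun x hx => ?_⟩
  · dsimp only
    split_ifs with h
    · left
      have := Finset.orderEmbOfFin_mem hfin.toFinset rfl ⟨m, h⟩
      exact (Set.Finite.mem_toFinset hfin).mp this
    · exact .inr rfl
  · have : x ∈ Set.range (hfin.toFinset.orderEmbOfFin rfl) := by
      rw [Finset.range_orderEmbOfFin]; simpa using hx
    obtain ⟨i, hi⟩ := this
    exact ⟨⟨i, by omega⟩, by simpa using hi⟩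

/-- Pigeonhole: at most `t` of the `t + 1` positions are needed to represent `N`, so some position
`i` can be given up. -/
theorem exists_drop {t : ℕ} {N : Set ℕ} (hN : N.encard ≤ t) (Z : Fin (t + 1) → ℕ)
    (hZ : ∀ x ∈ N, ∃ i, Z i = x) : ∃ i : Fin (t + 1), ∀ x ∈ N, ∃ m, Z (i.succAbove m) = x := by
  classical
  have hfin : N.Finite := Set.finite_of_encard_le_coe hN
  have hcard : hfin.toFinset.card ≤ t := by
    rw [← Set.ncard_eq_toFinset_card N hfin]
    have := hfin.cast_ncard_eq
    rw [← this] at hN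
    exact_mod_cast hN
  choose! f hf using hZ
  have : ∃ i, i ∉ hfin.toFinset.image f := by
    by_contra! hall
    have h1 : Finset.univ ⊆ hfin.toFinset.image f := fun i _ => hall i
    have h2 := (Finset.card_le_card h1).trans Finset.card_image_le
    simp at h2; omega
  obtain ⟨i, hi⟩ := this
  refine ⟨i, fun x hx => ?_⟩
  have hne : f x ≠ i := by
    rintro rfl
    exact hi (Finset.mem_image_of_mem f (by simpa using hx))
  obtain ⟨m, hm⟩ := Fin.exists_succAbove_eq hne
  exact ⟨m, by rw [hm, hf x hx]⟩

namespace CGraph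

variable {n c t : ℕ} (H : CGraph n c)

/-- A family of facts which is closed under the rules for partial solutions. -/
structure RuleClosed (E : BState t → (Fin (t + 1) → ℕ) → ℕ → (Fin c → ℕ) → Prop) : Prop where
  base : ∀ (s : Fin (t + 1) → Bool) (g : BState t) (Z : Fin (t + 1) → ℕ), (∀ i, Z i ≤ n) →
    (∀ i, s i → Z i ∈ H.alive) → (∀ i i', Z i = Z i' → s i = s i') →
    (∀ i i', g i i' → Z i = Z i' ∨ H.adj (Z i) (Z i')) → E (baseST s g) Z 0 (fun _ => 0)
  skip : ∀ (r : BState t) (Z : Fin (t + 1) → ℕ) (j : ℕ) (p : Fin c → ℕ), (∀ i, Z i ≤ n) →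
    j < n → (∀ q, p q ≤ n) → E r Z j p → E r Z (j + 1) p
  join : ∀ (i : Fin (t + 1)) (r₁ r₂ : BState t) (Z : Fin (t + 1) → ℕ) (v j : ℕ)
    (p₁ p₂ p : Fin c → ℕ), (∀ i, Z i ≤ n) → v < n → j < n → (∀ q, p₁ q ≤ n) → (∀ q, p₂ q ≤ n) →
    (∀ q, p q ≤ n) → E r₁ Z j p₁ → E r₂ (bsub Z i v) n p₂ → H.JoinAt Z i v j → Compat i r₁ r₂ →
    H.Adds p₁ p₂ p r₂ v → E (joinST i r₁ r₂) Z (j + 1) p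

variable (E : BState t → (Fin (t + 1) → ℕ) → ℕ → (Fin c → ℕ) → Prop)

/-- Facts have been found for all partial solutions in `C` with first node `v`. -/
def Elim (C : Set ℕ) (v : ℕ) : Prop :=
  ∀ Z : Fin (t + 1) → ℕ, Z 0 = v → (∀ i, Z i ≤ n) → (∀ m : Fin t, Z m.succ ∉ C) →
    (∀ x ∈ nbrs H.adj C, ∃ m : Fin t, Z m.succ = x) →
    ∀ A : Finset ℕ, (∀ a ∈ A, a ∈ H.alive) → (∀ a ∈ A, a ∈ C ∨ ∃ m : Fin t, Z m.succ = a) →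
      (∀ a ∈ A, ∃ i, Rch H.adj A a (Z i)) →
      ∃ r, E r Z n (H.cnt Z A) ∧ (∀ i x, r i x → Z i ∈ A) ∧
        ∀ i i', Rch H.adj A (Z i) (Z i') → r i i'

variable {H E}

theorem cnt_le (Z : Fin (t + 1) → ℕ) {A : Finset ℕ} (hA : ∀ a ∈ A, a ∈ H.alive) (q : Fin c) :
    H.cnt Z A q ≤ n := by
  classical
  have : A ⊆ Finset.range n := fun a ha => Finset.mem_range.mpr (H.alive_lt a (hA a ha))
  calc _ ≤ A.card := Finset.card_filter_le _ _
    _ ≤ n := by simpa using Finset.card_le_card this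

theorem cn_mono_region {C : Set ℕ} {Z : Fin (t + 1) → ℕ} (hC : ∀ a ∈ C, a < n)
    (hZ : ∀ i, Z i ∉ C) {a b : ℕ} (h : Rch H.adj C a b) : H.Cn Z a b :=
  h.mono fun x hx => ⟨hC x hx, fun i e => hZ i (e ▸ hx)⟩

theorem cn_mem_region {C : Set ℕ} {Z : Fin (t + 1) → ℕ}
    (hN : ∀ x ∈ nbrs H.adj C, ∃ i, Z i = x) {a b : ℕ} (ha : a ∈ C) (h : H.Cn Z a b) : b ∈ C := by
  refine h.ind (P := fun b => b ∈ C) (fun _ => ha) fun x y _ hx hxy hy => ?_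
  by_contra hyC
  obtain ⟨i, hi⟩ := hN y ⟨hyC, x, hx, hxy⟩
  exact hy.2 i hi

/-- A path that leaves `C` does so through a neighbour of `C`, which is one of the nodes `Y m`. Its
initial segment up to the first such node lies in `A'`. -/
theorem rch_hits {C : Set ℕ} {Y : Fin t → ℕ} (hN : ∀ x ∈ nbrs H.adj C, ∃ m, Y m = x)
    {A A' : Finset ℕ} (hA' : ∀ a, a ∈ A' ↔ a ∈ A ∧ (a ∈ C ∨ ∃ m, Y m = a)) {a z : ℕ}
    (h : Rch H.adj A a z) (ha : a ∈ C) (hz : z ∉ C) : ∃ m, Rch H.adj A' a (Y m) := by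
  have : (z ∈ C ∧ Rch H.adj A' a z) ∨ ∃ m, Rch H.adj A' a (Y m) := by
    refine h.ind (P := fun x => (x ∈ C ∧ Rch H.adj A' a x) ∨ ∃ m, Rch H.adj A' a (Y m)) ?_ ?_
    · exact fun haA => .inl ⟨ha, .refl (Finset.mem_coe.mpr ((hA' a).mpr ⟨haA, .inl ha⟩))⟩
    · rintro x y - (⟨hxC, hx⟩ | hx) hxy hy
      · by_cases hyC : y ∈ C
        · exact .inl ⟨hyC, hx.tail hxy (Finset.mem_coe.mpr ((hA' y).mpr ⟨hy, .inl hyC⟩))⟩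
        · obtain ⟨m, rfl⟩ := hN y ⟨hyC, x, hxC, hxy⟩
          exact .inr ⟨m, hx.tail hxy (Finset.mem_coe.mpr ((hA' _).mpr ⟨hy, .inr ⟨m, rfl⟩⟩))⟩
      · exact .inr hx
  exact this.resolve_left fun h => hz h.1

/-- The state of a union is at least the connectivity of the union. -/
theorem joinST_of_rch {i : Fin (t + 1)} {r₁ r₂ : BState t} {Z : Fin (t + 1) → ℕ} {C : Set ℕ}
    {A₁ A₂ : Finset ℕ} (hZ : ∀ l, Z l ∉ C) (hA₁ : ∀ a ∈ A₁, a ∉ C)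
    (hA₂ : ∀ a ∈ A₂, a ∈ C ∨ ∃ m, Z (i.succAbove m) = a)
    (hA : ∀ l, Z l ∈ A₂ → Z l ∈ A₁) (hA' : ∀ m, Z (i.succAbove m) ∈ A₁ → Z (i.succAbove m) ∈ A₂)
    (hN : ∀ x ∈ nbrs H.adj C, ∃ m, Z (i.succAbove m) = x)
    (h1 : ∀ l l', Rch H.adj A₁ (Z l) (Z l') → r₁ l l')
    (h2 : ∀ m m' : Fin t, Rch H.adj A₂ (Z (i.succAbove m)) (Z (i.succAbove m')) →
      r₂ m.succ m'.succ)
    {l l' : Fin (t + 1)} (h : Rch H.adj (A₁ ∪ A₂ : Finset ℕ) (Z l) (Z l')) :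
    joinST i r₁ r₂ l l' := by
  have mem1 : ∀ l, Z l ∈ A₁ ∪ A₂ → Z l ∈ A₁ := fun l h => (Finset.mem_union.mp h).elim id (hA l)
  -- Invariant along a path in the union: the current node is reached, inside one of the two sets,
  -- from a position `m` already related to `l`. A switch between the sets occurs at a boundary
  -- node, where `close` turns the segment just finished into a pair of the joined state.
  set P : ℕ → Prop := fun x => ∃ m, joinST i r₁ r₂ l m ∧
    (Rch H.adj A₁ (Z m) x ∨ ∃ m', m = i.succAbove m' ∧ Rch H.adj A₂ (Z m) x) with hP
  have close : ∀ x k, P x → Z k = x → joinST i r₁ r₂ l k := by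
    rintro x k ⟨m, hm, h3 | ⟨m', rfl, h3⟩⟩ rfl
    · rw [joinST, clos_iff] at hm ⊢
      exact hm.tail (.inl (h1 _ _ h3))
    · have hk : Z k ∈ A₂ := h3.right
      obtain ⟨m'', e⟩ := (hA₂ _ hk).resolve_left (hZ k)
      rw [joinST, clos_iff] at hm ⊢
      rw [← e] at h3
      refine (hm.tail (.inr ⟨m', m'', rfl, rfl, h2 _ _ h3⟩)).tail (.inl (h1 _ _ ?_))
      rw [e]
      exact .refl (Finset.mem_coe.mpr (hA _ hk))
  refine close _ _ (h.ind (P := P) ?_ ?_) rfl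
  · intro hl
    have hl := mem1 l hl
    refine ⟨l, ?_, .inl (.refl hl)⟩
    rw [joinST, clos_iff]
    exact .single (.inl (h1 _ _ (.refl hl)))
  · intro x y hx ih hxy hy
    obtain ⟨m, hm, h3⟩ := id ih
    by_cases hy1 : y ∈ A₁
    · rcases h3 with h3 | ⟨m', rfl, h3⟩
      · exact ⟨m, hm, .inl (h3.tail hxy hy1)⟩
      · rcases hA₂ x h3.right with hxC | ⟨m'', e⟩
        · obtain ⟨k, rfl⟩ := hN y ⟨hA₁ y hy1, x, hxC, hxy⟩
          exact ⟨_, hm, .inr ⟨m', rfl, h3.tail hxy (hA' _ hy1)⟩⟩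
        · have hxA : x ∈ A₁ := by
            have : x ∈ A₂ := h3.right
            rw [← e] at this ⊢; exact hA _ this
          refine ⟨_, close x _ ih e, .inl ?_⟩
          rw [e]
          exact (Rch.refl (Finset.mem_coe.mpr hxA)).tail hxy hy1
    · have hy2 : y ∈ A₂ := (Finset.mem_union.mp hy).resolve_left hy1
      have hyC : y ∈ C := by
        rcases hA₂ y hy2 with h4 | ⟨m'', rfl⟩
        · exact h4
        · exact absurd (hA _ hy2) hy1
      rcases h3 with h3 | ⟨m', rfl, h3⟩
      · obtain ⟨k, rfl⟩ := hN x ⟨hA₁ x h3.right, y, hyC, H.symm _ _ hxy⟩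
        refine ⟨_, close _ _ ih rfl, .inr ⟨k, rfl, ?_⟩⟩
        exact (Rch.refl (Finset.mem_coe.mpr (hA' _ h3.right))).tail hxy hy2
      · exact ⟨_, hm, .inr ⟨m', rfl, h3.tail hxy hy2⟩⟩

theorem joinST_left {i : Fin (t + 1)} {r₁ r₂ : BState t} {l x : Fin (t + 1)}
    (h : joinST i r₁ r₂ l x) : (∃ y, r₁ l y) ∨ ∃ m m' : Fin t, l = i.succAbove m ∧ r₂ m.succ m'.succ := by
  rw [joinST, clos_iff] at h
  obtain ⟨y, h, _⟩ := Relation.TransGen.head'_iff.mp h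
  rcases h with h | ⟨m, m', h3, -, h4⟩
  exacts [.inl ⟨y, h⟩, .inr ⟨m, m', h3, h4⟩]

theorem baseST_of_rch {s : Fin (t + 1) → Bool} {g : BState t} {Z : Fin (t + 1) → ℕ} {A : Finset ℕ}
    (hA : ∀ a ∈ A, ∃ i, Z i = a) (hs : ∀ i, s i = true ↔ Z i ∈ A)
    (hg : ∀ i i', g i i' = true ↔ (Z i = Z i' ∨ H.adj (Z i) (Z i'))) {i i' : Fin (t + 1)}
    (h : Rch H.adj A (Z i) (Z i')) : baseST s g i i' := by
  refine h.ind (P := fun x => ∀ l, Z l = x → baseST s g i l) ?_ ?_ i' rfl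
  · intro hi l hl
    rw [baseST, clos_iff]
    refine .single ⟨(hs i).mpr hi, (hs l).mpr (by rw [hl]; exact hi), .inr ?_⟩
    exact (hg i l).mpr (.inl hl.symm)
  · intro x y hx ih hxy hy l hl
    obtain ⟨k, rfl⟩ := hA x hx.right
    have := ih k rfl
    rw [baseST, clos_iff] at this ⊢
    subst hl
    exact this.tail ⟨(hs k).mpr hx.right, (hs l).mpr hy, .inr ((hg _ _).mpr (.inr hxy))⟩

/-- Given a target set `A`, the derivation follows the counter `j` from `0` to `n`. If `j` is the
least node of a component of `C \ {v}`, the fact for the part of `A` in this component, supplied by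
`ih`, is joined; otherwise `j` is skipped. The hypothesis that every node of `A` is connected to the
boundary passes to the components by `rch_hits`. -/
theorem elim_step (hE : H.RuleClosed E) {C : Set ℕ} {v : ℕ} (hv : v ∈ C) (hC : ∀ a ∈ C, a < n)
    (hconn : ∀ a ∈ C, ∀ b ∈ C, Rch H.adj C a b)
    (ih : ∀ u ∈ C, u ≠ v → (nbrs H.adj {x | Rch H.adj (C \ {v}) u x}).encard ≤ t ∧
      ∃ v' ∈ {x | Rch H.adj (C \ {v}) u x}, H.Elim E {x | Rch H.adj (C \ {v}) u x} v') :
    H.Elim E C v := by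
  classical
  rintro Z rfl hZn hZC hN A hal hAC hhit
  have hXC : ∀ i, bsub Z 0 n i ∉ C := by
    intro i
    refine Fin.cases ?_ (fun m => ?_) i
    · intro h; have := hC _ h; simp at this
    · simpa using hZC m
  have hXN : ∀ x ∈ nbrs H.adj C, ∃ i, bsub Z 0 n i = x := by
    intro x hx
    obtain ⟨m, hm⟩ := hN x hx
    exact ⟨m.succ, by simpa using hm⟩
  have cnX : ∀ b ∈ C, H.Cn (bsub Z 0 n) (Z 0) b := fun b hb =>
    cn_mono_region hC hXC (hconn _ hv _ hb)
  have cnX' : ∀ b, H.Cn (bsub Z 0 n) (Z 0) b → b ∈ C := fun b hb => cn_mem_region hXN hv hb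
  -- the components of the region without its first node
  have comp : ∀ u, u ∈ C → u ≠ Z 0 → ∀ x, Rch H.adj (C \ {Z 0}) u x ↔ H.Cn Z u x := by
    intro u hu hu0 x
    have hZ' : ∀ i, Z i ∉ C \ {Z 0} := by
      intro i
      refine Fin.cases (fun h => h.2 rfl) (fun m h => hZC m h.1) i
    constructor
    · exact fun h => cn_mono_region (fun a ha => hC a ha.1) hZ' h
    · intro h
      refine h.mono' fun y hy => ⟨?_, fun e => hy.right.2 0 e.symm⟩
      exact cn_mem_region hXN hu (hy.mono (out_subset 0))
  -- The part of `A` seen before `j`: boundary nodes, and the components of the region that have a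
  -- node below `j`.
  set Aj : ℕ → Finset ℕ := fun j => A.filter fun a => a ∈ H.Reg Z j ∨ ∃ i, Z i = a with hAj
  have memAj : ∀ j a, a ∈ Aj j ↔ a ∈ A ∧ (a ∈ H.Reg Z j ∨ ∃ i, Z i = a) := by
    intro j a; simp [hAj]
  have main : ∀ j ≤ n, ∃ r, E r Z j (H.cnt Z (Aj j)) ∧ (∀ i x, r i x → Z i ∈ Aj j) ∧
      ∀ i i', Rch H.adj (Aj j) (Z i) (Z i') → r i i' := by
    intro j
    induction j with
    | zero =>
      intro _
      have hA0 : ∀ a ∈ Aj 0, ∃ i, Z i = a := by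
        intro a ha
        rcases ((memAj 0 a).mp ha).2 with ⟨u, hu, -⟩ | h
        · omega
        · exact h
      have hcnt : H.cnt Z (Aj 0) = fun _ => 0 := by
        ext q
        simp only [CGraph.cnt, Finset.card_eq_zero, Finset.filter_eq_empty_iff]
        intro a ha h
        obtain ⟨i, hi⟩ := hA0 a ha
        exact h.1 i hi
      set s : Fin (t + 1) → Bool := fun i => decide (Z i ∈ Aj 0) with hs
      set g : BState t := fun i i' => decide (Z i = Z i' ∨ H.adj (Z i) (Z i')) with hg
      refine ⟨baseST s g, ?_, ?_, ?_⟩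
      · rw [hcnt]
        refine hE.base s g Z hZn (fun i hi => ?_) (fun i i' e => ?_) (fun i i' h => ?_)
        · have : Z i ∈ Aj 0 := by simpa [hs] using hi
          exact hal _ ((memAj _ _).mp this).1
        · simp [hs, e]
        · simpa [hg] using h
      · intro i x h
        rw [baseST, clos_iff] at h
        obtain ⟨_, h, _⟩ := Relation.TransGen.head'_iff.mp h
        simpa [hs] using h.1
      · exact fun i i' h => baseST_of_rch hA0 (fun i => by simp [hs]) (fun i i' => by simp [hg]) h
    | succ j ihj =>
      intro hj
      obtain ⟨r₁, e1, d1, f1⟩ := ihj (by omega)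
      have hAjal : ∀ j, ∀ a ∈ Aj j, a ∈ H.alive := fun j a ha => hal a ((memAj _ _).mp ha).1
      by_cases hjc : j ∈ C ∧ j ≠ Z 0 ∧ ¬ H.Seen Z j
      · obtain ⟨hjC, hj0, hjs⟩ := hjc
        obtain ⟨hcard, v', hv', hel⟩ := ih j hjC hj0
        set C' := {x | Rch H.adj (C \ {Z 0}) j x} with hC'
        have hC'C : ∀ x ∈ C', x ∈ C ∧ x ≠ Z 0 := fun x hx => by
          have : x ∈ C \ {Z 0} := Rch.right hx
          exact ⟨this.1, this.2⟩
        have hjC' : j ∈ C' := Rch.refl ⟨hjC, hj0⟩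
        have hC'cn : ∀ x, x ∈ C' ↔ H.Cn Z j x := comp j hjC hj0
        have hZC' : ∀ l, Z l ∉ C' := fun l h => (Rch.right ((hC'cn _).mp h)).2 l rfl
        have hN' : ∀ x ∈ nbrs H.adj C', ∃ l, Z l = x := by
          rintro x ⟨hx, y, hy, hyx⟩
          by_cases hxC : x ∈ C
          · by_cases hx0 : x = Z 0
            · exact ⟨0, hx0.symm⟩
            · exact absurd (Rch.tail hy hyx ⟨hxC, hx0⟩) hx
          · obtain ⟨m, hm⟩ := hN x ⟨hxC, y, (hC'C y hy).1, hyx⟩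
            exact ⟨_, hm⟩
        -- All neighbours of the component lie on `Z`, and there are at most `t` of them; this frees
        -- a position for its first node `v'`.
        obtain ⟨i, hi⟩ := exists_drop hcard Z hN'
        have hiX : ∀ l, bsub Z i n l ∉ C' := by
          intro l
          refine Fin.cases ?_ (fun m => ?_) l
          · intro h; have := hC _ (hC'C _ h).1; simp at this
          · simpa using hZC' _
        have hiN : ∀ x ∈ nbrs H.adj C', ∃ l, bsub Z i n l = x := fun x hx => by
          obtain ⟨m, hm⟩ := hi x hx
          exact ⟨m.succ, by simpa using hm⟩
        set A' : Finset ℕ := A.filter fun a => a ∈ C' ∨ ∃ m, Z (i.succAbove m) = a with hA'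
        have memA' : ∀ a, a ∈ A' ↔ a ∈ A ∧ (a ∈ C' ∨ ∃ m, Z (i.succAbove m) = a) := by
          intro a; simp [hA']
        have hits : ∀ a ∈ A', a ∈ C' → ∃ m, Rch H.adj A' a (Z (i.succAbove m)) := by
          intro a ha haC
          obtain ⟨l, hl⟩ := hhit a ((memA' a).mp ha).1
          exact rch_hits hi memA' hl haC (hZC' l)
        obtain ⟨r₂, e2, d2, f2⟩ := hel (bsub Z i v') rfl
          (fun l => Fin.cases (by simpa using (hC _ (hC'C _ hv').1).le) (fun m => by simpa using hZn _) l)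
          (fun m => by simpa using hZC' _) (fun x hx => by simpa using hi x hx) A'
          (fun a ha => hal a ((memA' a).mp ha).1) (fun a ha => by simpa using ((memA' a).mp ha).2)
          (fun a ha => by
            rcases ((memA' a).mp ha).2 with h | ⟨m, rfl⟩
            · obtain ⟨m, hm⟩ := hits a ha h
              exact ⟨m.succ, by simpa using hm⟩
            · exact ⟨m.succ, by simpa using Rch.refl (Finset.mem_coe.mpr ha)⟩)
        have selA : ∀ l, Z l ∈ A → Z l ∈ Aj j := fun l h => (memAj _ _).mpr ⟨h, .inr ⟨l, rfl⟩⟩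
        have selA' : ∀ m, Z (i.succAbove m) ∈ A → Z (i.succAbove m) ∈ A' :=
          fun m h => (memA' _).mpr ⟨h, .inr ⟨m, rfl⟩⟩
        have A'A : ∀ a ∈ A', a ∈ A := fun a ha => ((memA' a).mp ha).1
        have AjA : ∀ a ∈ Aj j, a ∈ A := fun a ha => ((memAj _ a).mp ha).1
        have hAjC' : ∀ a ∈ Aj j, a ∉ C' := by
          intro a ha haC
          rcases ((memAj j a).mp ha).2 with ⟨u, hu, h3, h4⟩ | ⟨l, rfl⟩
          · exact hjs ⟨u, hu, h3, h4.trans (Cn.symm ((hC'cn a).mp haC))⟩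
          · exact hZC' l haC
        have hunion : Aj (j + 1) = Aj j ∪ A' := by
          ext a
          rw [Finset.mem_union, memAj, memAj, memA', ← and_or_left]
          refine and_congr_right fun _ => ?_
          constructor
          · rintro (⟨u, hu, h3, h4⟩ | h)
            · rcases Nat.lt_succ_iff_lt_or_eq.mp hu with hu | rfl
              · exact .inl (.inl ⟨u, hu, h3, h4⟩)
              · exact .inr (.inl ((hC'cn a).mpr h4))
            · exact .inl (.inr h)
          · rintro ((⟨u, hu, h⟩ | h) | (h | ⟨m, h⟩))
            · exact .inl ⟨u, by omega, h⟩
            · exact .inr h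
            · exact .inl ⟨j, by omega, cnX j hjC, (hC'cn a).mp h⟩
            · exact .inr ⟨_, h⟩
        have r1iff : ∀ l, r₁ l l = true ↔ Z l ∈ Aj j := fun l =>
          ⟨d1 l l, fun h => f1 l l (.refl h)⟩
        have r2iff : ∀ l, r₂ l l = true ↔ bsub Z i v' l ∈ A' := fun l =>
          ⟨d2 l l, fun h => f2 l l (.refl h)⟩
        have hcnt : ∀ q, H.cnt Z (Aj (j + 1)) q = H.cnt Z (Aj j) q + H.cnt (bsub Z i v') A' q +
            if r₂ 0 0 ∧ H.col v' q then 1 else 0 := by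
          intro q
          rw [hunion, cnt_union C' hAjC' (fun a ha => ((memA' a).mp ha).2) hZC' hv']
          congr 1
          refine if_congr (and_congr_left fun _ => ?_) rfl rfl
          rw [r2iff]; rfl
        refine ⟨joinST i r₁ r₂, ?_, ?_, ?_⟩
        · refine hE.join i r₁ r₂ Z v' j _ _ _ hZn (hC _ (hC'C _ hv').1) (by omega)
            (cnt_le _ (hAjal j)) (cnt_le _ fun a ha => hal a (A'A a ha)) (cnt_le _ (hAjal _))
            e1 e2 ⟨cnX j hjC, hjs, ?_, ?_⟩ ⟨?_, ?_⟩ hcnt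
          · exact fun h => hZC' i (cn_mem_region hiN hjC' h)
          · have : Rch H.adj C' j v' := Rch.mono' (a := j) hv' fun x hx => hx
            exact cn_mono_region (fun a ha => hC a (hC'C a ha).1) hiX this
          · intro m
            rw [Bool.eq_iff_iff, r1iff, r2iff]
            exact ⟨fun h => selA' m (AjA _ h), fun h => selA _ (A'A _ h)⟩
          · intro h
            obtain ⟨m, hm⟩ := hits v' ((r2iff 0).mp h) hv'
            exact ⟨m, f2 0 m.succ hm⟩
        · intro l x h
          rw [hunion, Finset.mem_union]
          rcases joinST_left h with ⟨y, h'⟩ | ⟨m, m', rfl, h'⟩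
          · exact .inl (d1 _ _ h')
          · exact .inr (d2 _ _ h')
        · intro l l' h
          rw [hunion] at h
          exact joinST_of_rch hZC' hAjC' (fun a ha => ((memA' a).mp ha).2)
            (fun l h => selA l (A'A _ h)) (fun m h => selA' m (AjA _ h)) hi f1
            (fun m m' h => f2 m.succ m'.succ h) h
      -- If `j` lies outside the region, on the boundary or in a component treated before, then
      -- nothing new becomes visible and the skip rule applies.
      · have hsame : Aj (j + 1) = Aj j := by
          ext a
          rw [memAj, memAj]
          refine and_congr_right fun _ => or_congr_left ?_
          constructor
          · rintro ⟨u, hu, h3, h4⟩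
            rcases Nat.lt_succ_iff_lt_or_eq.mp hu with hu | rfl
            · exact ⟨u, hu, h3, h4⟩
            · have : H.Seen Z u := by
                by_contra hns
                exact hjc ⟨cnX' u h3, fun e => h4.left.2 0 e.symm, hns⟩
              obtain ⟨u', hu', h5, h6⟩ := this
              exact ⟨u', hu', h5, h6.trans h4⟩
          · rintro ⟨u, hu, h⟩
            exact ⟨u, by omega, h⟩
        rw [hsame]
        exact ⟨r₁, hE.skip r₁ Z j _ hZn (by omega) (cnt_le _ (hAjal j)) e1, d1, f1⟩
  have hAn : Aj n = A := by
    ext a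
    rw [memAj, and_iff_left_iff_imp]
    intro ha
    rcases hAC a ha with h | ⟨m, h⟩
    · by_cases h0 : a = Z 0
      · exact .inr ⟨0, h0.symm⟩
      · exact .inl ⟨a, hC a h, cnX a h, (comp a h h0 a).mp (.refl ⟨h, h0⟩)⟩
    · exact .inr ⟨_, h⟩
  have := main n le_rfl
  rwa [hAn] at this

/-- There is a fact for a full solution with Parikh vector `M`. -/
def Found (H : CGraph n c) (E : BState t → (Fin (t + 1) → ℕ) → ℕ → (Fin c → ℕ) → Prop)
    (M : Fin c → ℕ) : Prop :=
  ∃ r Z p, E r Z n p ∧ FinalST r ∧ (∀ i, Z i ≤ n) ∧ (∀ q, p q ≤ n) ∧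
    ∀ q, H.col (Z 0) q ∧ M q = p q + 1 ∨ ¬ H.col (Z 0) q ∧ M q = p q

/-- Induction on the dismantling of `C`. If the solution `S` contains the removed node `v`, apply
`elim_step` to `A = S`, with `v` at position `0` and the neighbours of `C` elsewhere; none of the
latter is in `S`, so the state is final. If `v ∉ S`, then `S`, being connected, lies in one
component of `C \ {v}`, and the induction hypothesis applies there. -/
theorem complete_of_good (hE : H.RuleClosed E) {C : Set ℕ} (hG : Good H.adj t C)
    (hC : ∀ a ∈ C, a < n) (hconn : ∀ a ∈ C, ∀ b ∈ C, Rch H.adj C a b) :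
    (nbrs H.adj C).encard ≤ t ∧ (∃ v ∈ C, H.Elim E C v) ∧
      ∀ (M : Fin c → ℕ) (S : Finset ℕ), H.Solves M S → (∀ a ∈ S, a ∈ C) → H.Found E M := by
  classical
  induction hG with
  | mk C v hv hN _ ih =>
    have hch : ∀ u ∈ C, u ≠ v → (∀ a ∈ {x | Rch H.adj (C \ {v}) u x}, a < n) ∧
        ∀ a ∈ {x | Rch H.adj (C \ {v}) u x}, ∀ b ∈ {x | Rch H.adj (C \ {v}) u x},
          Rch H.adj {x | Rch H.adj (C \ {v}) u x} a b := by
      intro u hu huv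
      have hr : ∀ a, Rch H.adj (C \ {v}) u a → Rch H.adj {x | Rch H.adj (C \ {v}) u x} u a :=
        fun a ha => ha.mono' fun x hx => hx
      exact ⟨fun a ha => hC a (Rch.right ha).1,
        fun a ha b hb => ((hr a ha).symm H.symm).trans (hr b hb)⟩
    have hel := elim_step hE hv hC hconn fun u hu huv =>
      let h := ih u hu huv (hch u hu huv).1 (hch u hu huv).2
      ⟨h.1, h.2.1⟩
    refine ⟨hN, ⟨v, hv, hel⟩, fun M S hS hSC => ?_⟩
    obtain ⟨hne, hal, hcon, hpk⟩ := id hS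
    by_cases hvS : v ∈ S
    · obtain ⟨Y, hY1, hY2⟩ := exists_cover hN n
      have hnb : ∀ x ∈ nbrs H.adj C, x < n := by
        rintro x ⟨-, y, -, h⟩
        exact H.lt x y (H.symm _ _ h)
      have hYC : ∀ m, Y m ∉ C := by
        intro m h
        rcases hY1 m with h' | h'
        · exact h'.1 h
        · have := hC _ h; omega
      have hle : ∀ i, (Fin.cons v Y : Fin (t + 1) → ℕ) i ≤ n := by
        intro i
        refine Fin.cases ?_ (fun m => ?_) i
        · simpa using (hC v hv).le
        · simp only [Fin.cons_succ]
          rcases hY1 m with h' | h'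
          · exact (hnb _ h').le
          · exact h'.le
      obtain ⟨r, e, f1, f2⟩ := hel (Fin.cons v Y) rfl hle (by simpa using hYC) (by simpa using hY2) S
        hal (fun a ha => .inl (hSC a ha)) (fun a ha => ⟨0, hcon a ha v hvS⟩)
      refine ⟨r, _, _, e, ⟨f2 0 0 (.refl hvS), fun m => ?_⟩, hle, cnt_le _ hal, fun q => ?_⟩
      · by_contra h
        have := f1 m.succ m.succ (by simpa using h)
        exact hYC m (hSC _ (by simpa using this))
      · have key : ∀ a ∈ S, (∀ i, (Fin.cons v Y : Fin (t + 1) → ℕ) i ≠ a) ↔ a ≠ v := by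
          intro a ha
          rw [Fin.forall_fin_succ]
          simp only [Fin.cons_zero, Fin.cons_succ]
          exact ⟨fun h => h.1.symm, fun h => ⟨h.symm, fun m e => hYC m (e ▸ hSC a ha)⟩⟩
        have hp := hpk q
        simp only [Fin.cons_zero]
        by_cases hq : H.col v q
        · refine .inl ⟨hq, ?_⟩
          rw [← hp]
          unfold CGraph.pk CGraph.cnt
          rw [← Finset.card_insert_of_notMem (a := v)]
          · congr 1
            ext a
            simp only [Finset.mem_filter, Finset.mem_insert]
            constructor
            · rintro ⟨h3, h4⟩
              by_cases e : a = v
              · exact .inl e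
              · exact .inr ⟨h3, (key a h3).mpr e, h4⟩
            · rintro (rfl | ⟨h3, -, h4⟩)
              exacts [⟨hvS, hq⟩, ⟨h3, h4⟩]
          · simp only [Finset.mem_filter, not_and]
            intro h3 h4
            exact absurd rfl ((key v h3).mp h4)
        · refine .inr ⟨hq, ?_⟩
          rw [← hp]
          unfold CGraph.pk CGraph.cnt
          congr 1
          refine Finset.filter_congr fun a ha => ?_
          rw [key a ha]
          exact ⟨fun h3 => ⟨fun e => hq (e ▸ h3), h3⟩, fun h3 => h3.2⟩
    · obtain ⟨u, hu⟩ := hne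
      have huv : u ≠ v := fun e => hvS (e ▸ hu)
      refine (ih u (hSC u hu) huv (hch _ (hSC u hu) huv).1 (hch _ (hSC u hu) huv).2).2.2 M S hS ?_
      exact fun a ha => (hcon u hu a ha).mono fun x hx => ⟨hSC x hx, fun e => hvS (e ▸ hx)⟩

theorem complete (hE : H.RuleClosed E)
    (hG : ∀ u < n, Good H.adj t {x | Rch H.adj {y | y < n} u x}) {M : Fin c → ℕ} {S : Finset ℕ}
    (hS : H.Solves M S) : H.Found E M := by
  obtain ⟨⟨u, hu⟩, hal, hcon, hpk⟩ := id hS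
  have hr : ∀ a, Rch H.adj {y | y < n} u a → Rch H.adj {x | Rch H.adj {y | y < n} u x} u a :=
    fun a ha => ha.mono' fun x hx => hx
  have hlt : ∀ a ∈ {x | Rch H.adj {y | y < n} u x}, a < n := by
    intro a ha
    have : a ∈ {y | y < n} := Rch.right ha
    exact this
  exact (complete_of_good hE (hG u (H.alive_lt u (hal u hu))) hlt
     (fun a ha b hb => ((hr a ha).symm H.symm).trans (hr b hb))).2.2 M S hS
    fun a ha => (hcon u hu a ha).mono fun x hx => H.alive_lt x (hal x hx)

end CGraph

/-! ## Treewidth -/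

/-- The adjacency relation of a graph on `Fin n`, for natural numbers. -/
def gAdj {n : ℕ} (G : SimpleGraph (Fin n)) (u v : ℕ) : Prop :=
  ∃ (hu : u < n) (hv : v < n), G.Adj ⟨u, hu⟩ ⟨v, hv⟩

theorem gAdj_symm {n : ℕ} {G : SimpleGraph (Fin n)} (u v : ℕ) (h : gAdj G u v) : gAdj G v u :=
  let ⟨hu, hv, h⟩ := h
  ⟨hv, hu, h.symm⟩

theorem gAdj_irrefl {n : ℕ} {G : SimpleGraph (Fin n)} (u : ℕ) : ¬ gAdj G u u :=
  fun ⟨_, _, h⟩ => G.loopless.irrefl _ h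

/-- A walk inside `s` cannot use an edge with an endpoint outside of `s`. -/
theorem reachable_deleteEdges_of_induce {V : Type*} {T : SimpleGraph V} {s : Set V} {y y' z : V}
    (hz : z ∈ s(y, y')) (hzs : z ∉ s) {a b : V} (ha : a ∈ s) (hb : b ∈ s)
    (h : (T.induce s).Reachable ⟨a, ha⟩ ⟨b, hb⟩) : (T.deleteEdges {s(y, y')}).Reachable a b := by
  let f : T.induce s →g T.deleteEdges {s(y, y')} :=
    ⟨Subtype.val, by
      rintro ⟨u, hu⟩ ⟨v, hv⟩ huv
      rw [SimpleGraph.deleteEdges_adj]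
      refine ⟨huv, fun e => ?_⟩
      rw [Set.mem_singleton_iff] at e
      rw [← e, Sym2.mem_iff] at hz
      rcases hz with rfl | rfl
      exacts [hzs hu, hzs hv]⟩
  exact h.map f

section TreeDecomposition

variable {n t m : ℕ} {T : SimpleGraph (Fin m)} {adj : ℕ → ℕ → Prop} {B : Fin m → Set ℕ}

/-- Walk in the tree from a bag that contains the neighbourhood of `C` towards a bag that meets `C`,
and stop at the first one that does. No neighbour `x` is lost in a step from `y` to `y'`: otherwise
the bags of `x` avoid `y'`, and those of `C` avoid `y`. Together with a bag shared by `x` and a node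
of `C`, they connect `y` to `z`, and hence to `y'`, without the edge `y y'`, although every edge of
a tree is a bridge. -/
theorem exists_bag_meets (hT : T.IsTree) (hadj : ∀ u v, adj u v → ∃ x, u ∈ B x ∧ v ∈ B x)
    (hlt : ∀ u v, adj u v → u < n) (hsymm : ∀ u v, adj u v → adj v u)
    (hconn : ∀ v < n, (T.induce {x | v ∈ B x}).Connected) {C : Set ℕ} (hC : ∀ a ∈ C, a < n)
    (hCc : ∀ a ∈ C, ∀ b ∈ C, Rch adj C a b) {z : Fin m} (hz : ∃ a ∈ C, a ∈ B z) {y : Fin m}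
    (p : T.Walk y z) (hp : p.IsPath) (hy : nbrs adj C ⊆ B y) :
    ∃ y, nbrs adj C ⊆ B y ∧ ∃ a ∈ C, a ∈ B y := by
  induction p with
  | nil => exact ⟨_, hy, hz⟩
  | @cons y y' z hyy' q ih =>
    by_cases hyC : ∃ a ∈ C, a ∈ B y
    · exact ⟨y, hy, hyC⟩
    rw [SimpleGraph.Walk.cons_isPath_iff] at hp
    refine ih hz hp.1 fun x hx => ?_
    by_contra hxy'
    have bridge := SimpleGraph.isAcyclic_iff_forall_adj_isBridge.mp hT.isAcyclic hyy'
    rw [SimpleGraph.isBridge_iff] at bridge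
    push Not at hyC
    obtain ⟨hxC, a0, ha0, hax⟩ := id hx
    obtain ⟨z', ha0z', hxz'⟩ := hadj _ _ hax
    have r1 : (T.deleteEdges {s(y, y')}).Reachable y z' :=
      reachable_deleteEdges_of_induce (z := y') (by simp) hxy' (hy hx) hxz'
        ((hconn x (hlt _ _ (hsymm _ _ hax))).preconnected _ _)
    have inC : ∀ a ∈ C, ∀ z1 z2, a ∈ B z1 → a ∈ B z2 →
        (T.deleteEdges {s(y, y')}).Reachable z1 z2 := fun a ha z1 z2 h1 h2 =>
      reachable_deleteEdges_of_induce (z := y) (by simp) (hyC a ha) h1 h2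
        ((hconn a (hC a ha)).preconnected _ _)
    obtain ⟨a1, ha1, ha1z⟩ := hz
    have r2 : (T.deleteEdges {s(y, y')}).Reachable z' z := by
      refine (hCc a0 ha0 a1 ha1).ind (P := fun a => ∀ z2, a ∈ B z2 →
        (T.deleteEdges {s(y, y')}).Reachable z' z2) ?_ ?_ z ha1z
      · exact fun h z2 h2 => inC a0 h z' z2 ha0z' h2
      · intro a b ha ihab hab hb z2 h2
        obtain ⟨z3, h3, h4⟩ := hadj a b hab
        exact (ihab z3 h3).trans (inC b hb z3 z2 h4 h2)
    have r3 : (T.deleteEdges {s(y, y')}).Reachable y' z := by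
      refine ⟨q.toDeleteEdges _ fun e he h => ?_⟩
      rw [Set.mem_singleton_iff] at h
      subst h
      exact hp.2 (q.fst_mem_support_of_mem_edges he)
    exact bridge ((r1.trans r2).trans r3.symm)

/-- Take the bag of `exists_bag_meets` and a node `v` of `C` in it. The bag has at most `t + 1`
nodes, contains the neighbours of `C` and also `v ∉ nbrs adj C`, which bounds the neighbours by `t`.
A neighbour of a component of `C \ {v}` is `v` or a neighbour of `C`, so the same bag serves in the
recursion, which is on the size of `C`. -/
theorem good_of_decomposition (hT : T.IsTree) (hadj : ∀ u v, adj u v → ∃ x, u ∈ B x ∧ v ∈ B x)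
    (hlt : ∀ u v, adj u v → u < n) (hsymm : ∀ u v, adj u v → adj v u)
    (hconn : ∀ v < n, (T.induce {x | v ∈ B x}).Connected) (hcard : ∀ x, (B x).encard ≤ t + 1)
    (k : ℕ) (C : Set ℕ) (hk : C.ncard ≤ k) (hne : C.Nonempty) (hC : ∀ a ∈ C, a < n)
    (hCc : ∀ a ∈ C, ∀ b ∈ C, Rch adj C a b) (hN : ∃ y, nbrs adj C ⊆ B y) : Good adj t C := by
  have hfin : ∀ C' : Set ℕ, (∀ a ∈ C', a < n) → C'.Finite := fun C' h =>
    (Set.finite_lt_nat n).subset h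
  induction k generalizing C with
  | zero =>
    have := (Set.ncard_eq_zero (hfin C hC)).mp (by omega)
    simp [this] at hne
  | succ k ih =>
    obtain ⟨y, hy⟩ := hN
    obtain ⟨a, ha⟩ := hne
    obtain ⟨⟨z, hz⟩⟩ := (hconn a (hC a ha)).nonempty
    obtain ⟨p, hp⟩ := (hT.connected.preconnected y z).exists_isPath
    obtain ⟨y, hy, v, hv, hvy⟩ := exists_bag_meets hT hadj hlt hsymm hconn hC hCc ⟨a, ha, hz⟩ p hp hy
    refine .mk C v hv ?_ fun u hu huv => ?_
    · have h1 : insert v (nbrs adj C) ⊆ B y := Set.insert_subset hvy hy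
      have h2 := (Set.encard_le_encard h1).trans (hcard y)
      rw [Set.encard_insert_of_notMem (fun h => h.1 hv)] at h2
      exact (ENat.add_le_add_iff_right ENat.one_ne_top).mp h2
    · have hsub : {x | Rch adj (C \ {v}) u x} ⊆ C \ {v} := fun x hx => Rch.right hx
      have hr : ∀ b, Rch adj (C \ {v}) u b → Rch adj {x | Rch adj (C \ {v}) u x} u b :=
        fun b hb => hb.mono' fun x hx => hx
      refine ih _ ?_ ⟨u, .refl ⟨hu, huv⟩⟩ (fun b hb => hC b (hsub hb).1)
        (fun a ha b hb => ((hr a ha).symm hsymm).trans (hr b hb)) ⟨y, ?_⟩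
      · have : {x | Rch adj (C \ {v}) u x}.ncard < C.ncard := by
          refine Set.ncard_lt_ncard ⟨fun x hx => (hsub hx).1, fun h => ?_⟩ (hfin C hC)
          exact (hsub (h hv)).2 rfl
        omega
      · rintro x ⟨hx, b, hb, hbx⟩
        by_cases hxC : x ∈ C
        · by_cases hxv : x = v
          · rw [hxv]; exact hvy
          · exact absurd (Rch.tail hb hbx ⟨hxC, hxv⟩) hx
        · exact hy ⟨hxC, b, (hsub hb).1, hbx⟩

end TreeDecomposition

theorem good_of_treewidthLE {n t : ℕ} {G : SimpleGraph (Fin n)} (h : TreewidthLE G t) (u : ℕ)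
    (hu : u < n) : Good (gAdj G) t {x | Rch (gAdj G) {y | y < n} u x} := by
  obtain ⟨m, T, bag, hT, hadj, hconn, hcard⟩ := h
  have hlt : ∀ u v, gAdj G u v → u < n := fun u v h => h.1
  have hsub : ∀ a ∈ {x | Rch (gAdj G) {y | y < n} u x}, a < n := fun a ha => by
    have : a ∈ {y | y < n} := Rch.right ha
    exact this
  have hr : ∀ b, Rch (gAdj G) {y | y < n} u b →
      Rch (gAdj G) {x | Rch (gAdj G) {y | y < n} u x} u b :=
    fun b hb => hb.mono' fun x hx => hx
  refine good_of_decomposition (T := T) (B := fun x => Fin.val '' (bag x : Set (Fin n))) hT ?_ hlt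
    gAdj_symm ?_ ?_ _ _ le_rfl ⟨u, .refl hu⟩ hsub
    (fun a ha b hb => ((hr a ha).symm gAdj_symm).trans (hr b hb)) ?_
  · rintro u v ⟨hu, hv, huv⟩
    obtain ⟨x, h1, h2⟩ := hadj _ _ huv
    exact ⟨x, ⟨_, h1, rfl⟩, ⟨_, h2, rfl⟩⟩
  · intro v hv
    have e : {x | v ∈ Fin.val '' (bag x : Set (Fin n))} = {x | (⟨v, hv⟩ : Fin n) ∈ bag x} := by
      ext x
      exact ⟨fun ⟨w, h1, h2⟩ => by
        have : (⟨v, hv⟩ : Fin n) = w := Fin.ext h2.symm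
        exact this ▸ h1, fun h => ⟨_, h, rfl⟩⟩
    rw [e]; exact hconn _
  · intro x
    refine (Set.encard_image_le _ _).trans ?_
    rw [Set.encard_coe_eq_coe_finsetCard]
    exact_mod_cast hcard x
  -- A component of the whole graph has no neighbours, so any bag contains them.
  · obtain ⟨y⟩ := hT.connected.nonempty
    refine ⟨y, ?_⟩
    rintro x ⟨hx, b, hb, hbx⟩
    exact absurd (Rch.tail hb hbx (hlt _ _ (gAdj_symm _ _ hbx))) hx

/-! ### Sparsity of graphs of bounded treewidth -/

/-- Every set of nodes contains a node with few neighbours in the set. -/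
theorem exists_low_degree {adj : ℕ → ℕ → Prop} {t : ℕ} {C : Set ℕ} (hG : Good adj t C)
    (hirr : ∀ x, ¬ adj x x) (F : Set ℕ) (hF : F ⊆ C) (hne : F.Nonempty) :
    ∃ u ∈ F, {x | adj u x ∧ (x ∈ F ∨ x ∈ nbrs adj C)}.encard ≤ t := by
  induction hG generalizing F with
  | mk C v hv hN _ ih =>
    by_cases h : ∃ u ∈ F, u ≠ v
    · obtain ⟨u, hu, huv⟩ := h
      have hsub : {x | Rch adj (C \ {v}) u x} ⊆ C \ {v} := fun x hx => Rch.right hx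
      obtain ⟨u', hu', h⟩ := ih u (hF hu) huv (F ∩ {x | Rch adj (C \ {v}) u x})
        Set.inter_subset_right ⟨u, hu, .refl ⟨hF hu, huv⟩⟩
      -- A counted neighbour of `u'` lies in the component of `C \ {v}` or is a neighbour of it; in
      -- both cases it is also counted in the bound for the component.
      refine ⟨u', hu'.1, (Set.encard_le_encard ?_).trans h⟩
      rintro x ⟨hx, hx'⟩
      refine ⟨hx, ?_⟩
      by_cases hxC : x ∈ {x | Rch adj (C \ {v}) u x}
      · refine .inl ⟨hx'.resolve_right fun h => h.1 (hsub hxC).1, hxC⟩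
      · exact .inr ⟨hxC, u', hu'.2, hx⟩
    -- Now `F` is `{v}`, so there are no loops to count and the neighbours in question are
    -- neighbours of `C`.
    · push Not at h
      obtain ⟨u, hu⟩ := hne
      refine ⟨u, hu, (Set.encard_le_encard ?_).trans hN⟩
      rintro x ⟨hx, hxF | hxN⟩
      · rw [h u hu, h x hxF] at hx
        exact absurd hx (hirr v)
      · exact hxN

open Classical in
-- Degeneracy: remove a node with at most `t` neighbours in `F` and use induction. Edges are counted
-- as ordered pairs, so each removal costs at most `2 * t`.
theorem card_edges_le {adj : ℕ → ℕ → Prop} {t n : ℕ} (hirr : ∀ x, ¬ adj x x)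
    (hsymm : ∀ x y, adj x y → adj y x)
    (hG : ∀ u < n, Good adj t {x | Rch adj {y | y < n} u x}) (F : Finset ℕ)
    (hF : ∀ a ∈ F, a < n) : ((F ×ˢ F).filter fun e => adj e.1 e.2).card ≤ 2 * t * F.card := by
  induction F using Finset.strongInduction with
  | H F ih =>
    rcases F.eq_empty_or_nonempty with rfl | ⟨u, hu⟩
    · simp
    obtain ⟨u', hu', h⟩ := exists_low_degree (hG u (hF u hu)) hirr
      (F ∩ {x | Rch adj {y | y < n} u x}) Set.inter_subset_right ⟨u, hu, .refl (hF u hu)⟩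
    have hd : (F.filter fun x => adj u' x).card ≤ t := by
      rw [← Nat.cast_le (α := ℕ∞), ← Set.encard_coe_eq_coe_finsetCard]
      refine (Set.encard_le_encard ?_).trans h
      intro x hx
      rw [Finset.mem_coe, Finset.mem_filter] at hx
      exact ⟨hx.2, .inl ⟨hx.1, Rch.tail hu'.2 hx.2 (hF x hx.1)⟩⟩
    have hu'F : u' ∈ F := hu'.1
    have ih' := ih (F.erase u') (Finset.erase_ssubset hu'F) fun a ha => hF a (Finset.mem_of_mem_erase ha)
    have hsub : ((F ×ˢ F).filter fun e => adj e.1 e.2) ⊆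
        (((F.erase u') ×ˢ (F.erase u')).filter fun e => adj e.1 e.2) ∪
          ((F.filter fun x => adj u' x).image (fun x => (u', x)) ∪
           (F.filter fun x => adj u' x).image (fun x => (x, u'))) := by
      rintro ⟨a, b⟩ hab
      simp only [Finset.mem_filter, Finset.mem_product, Finset.mem_union, Finset.mem_image,
        Finset.mem_erase, Prod.mk.injEq] at hab ⊢
      by_cases ha : a = u'
      · exact .inr (.inl ⟨b, ⟨hab.1.2, ha ▸ hab.2⟩, ha.symm, rfl⟩)
      · by_cases hb : b = u'
        · exact .inr (.inr ⟨a, ⟨hab.1.1, hsymm _ _ (hb ▸ hab.2)⟩, rfl, hb.symm⟩)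
        · exact .inl ⟨⟨⟨ha, hab.1.1⟩, hb, hab.1.2⟩, hab.2⟩
    have h1 := (Finset.card_le_card hsub).trans ((Finset.card_union_le _ _).trans
      (Nat.add_le_add_left (Finset.card_union_le _ _) _))
    have h2 := Finset.card_image_le (s := F.filter fun x => adj u' x) (f := fun x => (u', x))
    have h3 := Finset.card_image_le (s := F.filter fun x => adj u' x) (f := fun x => (x, u'))
    have h4 : F.card = (F.erase u').card + 1 := (Finset.card_erase_add_one hu'F).symm
    rw [h4, mul_add]
    omega

/-! ## The rules for partial solutions as a program -/

namespace Fm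

/-- The conjunction of a finite family of formulas. -/
noncomputable def allF {ι : Type*} [Fintype ι] (f : ι → Fm) : Fm := all (Finset.univ.toList.map f)

@[simp] theorem allF_holds {ι : Type*} [Fintype ι] (d : ℕ) (σ : ℕ → ℕ) (B : Set (ℕ × ℕ))
    (f : ι → Fm) : (allF f).Holds d σ B ↔ ∀ i, (f i).Holds d σ B := by simp [allF]

@[simp] theorem allF_ok {ι : Type*} [Fintype ι] (A Q : ℕ) (V : ℕ → Prop)
    (f : ι → Fm) : (allF f).Ok A Q V ↔ ∀ i, (f i).Ok A Q V := by simp [allF]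

end Fm

/-- The number of a tuple which consists of a boundary and further entries. -/
def code (d : ℕ) {k : ℕ} (Z : Fin k → ℕ) (L : List ℕ) : ℕ := Nat.ofDigits d (List.ofFn Z ++ L)

theorem code_inj {d k : ℕ} (hd : 2 ≤ d) {Z Z' : Fin k → ℕ} {L L' : List ℕ}
    (hZ : ∀ i, Z i < d) (hZ' : ∀ i, Z' i < d) (hL : ∀ x ∈ L, x < d) (hL' : ∀ x ∈ L', x < d)
    (hlen : L.length = L'.length) (h : code d Z L = code d Z' L') : Z = Z' ∧ L = L' := by
  have := Nat.ofDigits_inj_of_len_eq (b := d) (by omega) (L1 := List.ofFn Z ++ L)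
    (L2 := List.ofFn Z' ++ L') (by simp [hlen])
    (by simp only [List.mem_append, List.mem_ofFn]; rintro x (⟨i, rfl⟩ | h); exacts [hZ i, hL _ h])
    (by simp only [List.mem_append, List.mem_ofFn]; rintro x (⟨i, rfl⟩ | h); exacts [hZ' i, hL' _ h]) h
  obtain ⟨h1, h2⟩ := List.append_inj this (by simp)
  exact ⟨List.ofFn_injective h1, h2⟩

/-! Registers: `0, …, c - 1` hold the query `M`. -/

section Layout

variable (c t : ℕ)

/-- The register which holds the number `n` of nodes. -/
def rN : ℕ := c + 1
/-- The register which holds the result of a search. -/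
def rRes : ℕ := c + 2
/-- The counter of fixed point computations. -/
def rSw : ℕ := c + 3
/-- The counter of the search for a minimal set of nodes. -/
def rV : ℕ := c + 4
/-- The first register for the variables of rules. -/
def rBase : ℕ := c + 16
-- Roles in the rules: the boundary; an auxiliary node `u`; the current index `j`; `k`, which is `j
-- + 1` or the next node of a path; `v`, the first node of a component being joined or the end of a
-- path; then the Parikh vectors of two parts and of their union.
def zR (i : Fin (t + 1)) : ℕ := rBase c + i
def uR : ℕ := rBase c + (t + 1)
def jR : ℕ := rBase c + (t + 2)
def kR : ℕ := rBase c + (t + 3)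
def vR : ℕ := rBase c + (t + 4)
def aR (q : Fin c) : ℕ := rBase c + (t + 5 + q)
def bR (q : Fin c) : ℕ := rBase c + (t + 5 + c + q)
def pR (q : Fin c) : ℕ := rBase c + (t + 5 + 2 * c + q)
/-- The registers for the variables of rules. -/
def rVars : List ℕ := (List.range (t + 5 + 3 * c)).map (rBase c + ·)

/-- Memory regions of the relations. -/
def qAdj : ℕ := 1
def qCol (q : Fin c) : ℕ := 2 + q
-- Regions `1, …, c + 1` describe the graph, `qAlive` the nodes still allowed, and those from
-- `qConn` on hold derived relations, which are erased before each fixed point computation. Region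
-- `0` is left to the input graph or to the index.
def qAlive : ℕ := c + 2
def qConn : ℕ := c + 3
def qSeen : ℕ := c + 4
def qFound : ℕ := c + 5
/-- The region for facts with state `r`. -/
noncomputable def qE (r : BState t) : ℕ := c + 6 + (Fintype.equivFin (BState t) r).val
/-- The number of memory regions up to the last relation. -/
noncomputable def qTot : ℕ := c + 6 + Fintype.card (BState t)

/-- As a simp set, this unfolds all register and region numbers, so that `omega` can separate them.
-/
theorem layout : (∀ c, rN c = c + 1) ∧ (∀ c, rRes c = c + 2) ∧ (∀ c, rSw c = c + 3) ∧
    (∀ c, rV c = c + 4) ∧ (∀ c, rBase c = c + 16) ∧ (∀ c t i, zR c t i = c + 16 + i) ∧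
    (∀ c t, uR c t = c + 16 + (t + 1)) ∧ (∀ c t, jR c t = c + 16 + (t + 2)) ∧
    (∀ c t, kR c t = c + 16 + (t + 3)) ∧ (∀ c t, vR c t = c + 16 + (t + 4)) ∧
    (∀ c t q, aR c t q = c + 16 + (t + 5 + q)) ∧ (∀ c t q, bR c t q = c + 16 + (t + 5 + c + q)) ∧
    (∀ c t q, pR c t q = c + 16 + (t + 5 + 2 * c + q)) ∧ (∀ c q, qCol c q = 2 + q) ∧
    (∀ c, qAlive c = c + 2) ∧ (∀ c, qConn c = c + 3) ∧ (∀ c, qSeen c = c + 4) ∧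
    (∀ c, qFound c = c + 5) ∧ (∀ c t, qTot c t = c + 6 + Fintype.card (BState t)) ∧ qAdj = 1 := by
  refine ⟨?_, ?_, ?_, ?_, ?_, ?_, ?_, ?_, ?_, ?_, ?_, ?_, ?_, ?_, ?_, ?_, ?_, ?_, ?_, ?_⟩ <;>
    intros <;> rfl

theorem qE_lt (r : BState t) : qE c t r < qTot c t := by
  have := (Fintype.equivFin (BState t) r).2
  unfold qE qTot; omega

theorem qE_ge (r : BState t) : c + 6 ≤ qE c t r := by unfold qE; omega

theorem qE_inj {r r' : BState t} (h : qE c t r = qE c t r') : r = r' := by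
  unfold qE at h
  exact (Fintype.equivFin (BState t)).injective (Fin.ext (by omega))

theorem mem_rVars {x : ℕ} : x ∈ rVars c t ↔ rBase c ≤ x ∧ x < rBase c + (t + 5 + 3 * c) := by
  simp only [rVars, List.mem_map, List.mem_range]
  constructor
  · rintro ⟨a, h, rfl⟩; omega
  · rintro ⟨h1, h2⟩; exact ⟨x - rBase c, by omega, by omega⟩

theorem nodup_rVars : (rVars c t).Nodup :=
  List.Nodup.map (fun _ _ h => Nat.add_left_cancel h) List.nodup_range

/-- The registers which hold the query and the number of nodes. -/
def IsConst (x : ℕ) : Prop := x < c ∨ x = rN c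

/-- An assignment of values to the variables of rules. -/
def asg (ρ : ℕ → ℕ) (Z : Fin (t + 1) → ℕ) (u j k v : ℕ) (a b p : Fin c → ℕ) (r : ℕ) : ℕ :=
  if r < rBase c then ρ r
  else if h : r - rBase c < t + 1 then Z ⟨r - rBase c, h⟩
  else if r = uR c t then u
  else if r = jR c t then j
  else if r = kR c t then k
  else if r = vR c t then v
  else if h : r - (rBase c + (t + 5)) < c then a ⟨r - (rBase c + (t + 5)), h⟩
  else if h : r - (rBase c + (t + 5 + c)) < c then b ⟨r - (rBase c + (t + 5 + c)), h⟩
  else if h : r - (rBase c + (t + 5 + 2 * c)) < c then p ⟨r - (rBase c + (t + 5 + 2 * c)), h⟩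
  else 0

section Asg

variable {c t} (ρ : ℕ → ℕ) (Z : Fin (t + 1) → ℕ) (u j k v : ℕ) (a b p : Fin c → ℕ)

theorem asg_const {x : ℕ} (hx : x < rBase c) : asg c t ρ Z u j k v a b p x = ρ x := by
  simp [asg, hx]
theorem asg_z (i : Fin (t + 1)) : asg c t ρ Z u j k v a b p (zR c t i) = Z i := by
  have := i.2
  unfold asg; simp only [layout]; rw [if_neg (by omega), dif_pos (by omega)]
  congr 1; ext; dsimp only; omega
theorem asg_u : asg c t ρ Z u j k v a b p (uR c t) = u := by simp [asg, layout]
theorem asg_j : asg c t ρ Z u j k v a b p (jR c t) = j := by simp [asg, layout]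
theorem asg_k : asg c t ρ Z u j k v a b p (kR c t) = k := by simp [asg, layout]
theorem asg_v : asg c t ρ Z u j k v a b p (vR c t) = v := by simp [asg, layout]
theorem asg_a (q : Fin c) : asg c t ρ Z u j k v a b p (aR c t q) = a q := by
  have := q.2
  unfold asg; simp only [layout]
  rw [if_neg (by omega), dif_neg (by omega), if_neg (by omega), if_neg (by omega),
    if_neg (by omega), if_neg (by omega), dif_pos (by omega)]
  congr 1; ext; dsimp only; omega
theorem asg_b (q : Fin c) : asg c t ρ Z u j k v a b p (bR c t q) = b q := by
  have := q.2
  unfold asg; simp only [layout]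
  rw [if_neg (by omega), dif_neg (by omega), if_neg (by omega), if_neg (by omega),
    if_neg (by omega), if_neg (by omega), dif_neg (by omega), dif_pos (by omega)]
  congr 1; ext; dsimp only; omega
theorem asg_p (q : Fin c) : asg c t ρ Z u j k v a b p (pR c t q) = p q := by
  have := q.2
  unfold asg; simp only [layout]
  rw [if_neg (by omega), dif_neg (by omega), if_neg (by omega), if_neg (by omega),
    if_neg (by omega), if_neg (by omega), dif_neg (by omega), dif_neg (by omega),
    dif_pos (by omega)]
  congr 1; ext; dsimp only; omega

theorem asg_lt {d : ℕ} (hd : 0 < d) (hZ : ∀ i, Z i < d) (hu : u < d) (hj : j < d) (hk : k < d)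
    (hv : v < d) (ha : ∀ q, a q < d) (hb : ∀ q, b q < d) (hp : ∀ q, p q < d) {x : ℕ}
    (hx : x ∈ rVars c t) : asg c t ρ Z u j k v a b p x < d := by
  rw [mem_rVars] at hx
  unfold asg
  rw [if_neg (by simp only [layout] at *; omega)]
  split_ifs
  exacts [hZ _, hu, hj, hk, hv, ha _, hb _, hp _, hd]

theorem asg_assigns {d : ℕ} (hd : 0 < d) (hZ : ∀ i, Z i < d) (hu : u < d) (hj : j < d) (hk : k < d)
    (hv : v < d) (ha : ∀ q, a q < d) (hb : ∀ q, b q < d) (hp : ∀ q, p q < d) :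
    Assigns d (rVars c t) (IsConst c) ρ (asg c t ρ Z u j k v a b p) := by
  refine ⟨fun x hx => asg_lt _ _ _ _ _ _ _ _ _ hd hZ hu hj hk hv ha hb hp hx, fun x hx => ?_⟩
  refine asg_const _ _ _ _ _ _ _ _ _ ?_
  rcases hx with h | h <;> simp only [layout] at * <;> omega

end Asg

/-! The rules. -/

/-- Connection of the values of `u` and `x` outside of the boundary `zs`. -/
def connF (zs : Fin (t + 1) → ℕ) (u x : ℕ) : Fm := .rel (qConn c) (List.ofFn zs ++ [u, x])

/-- A node off the boundary reaches itself, and a path from `u` to `v` is prolonged along an edge to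
a node `k` off the boundary. -/
noncomputable def connRules : List Rule :=
  [⟨.and (.lt (uR c t) (rN c)) (.allF fun i : Fin (t + 1) => .neg (.eq (zR c t i) (uR c t))), qConn c,
      List.ofFn (zR c t) ++ [uR c t, uR c t]⟩,
   ⟨.and (connF c t (zR c t) (uR c t) (vR c t)) (.and (.rel qAdj [vR c t, kR c t])
      (.allF fun i : Fin (t + 1) => .neg (.eq (zR c t i) (kR c t)))), qConn c,
      List.ofFn (zR c t) ++ [uR c t, kR c t]⟩]

/-- This rule is not recursive; it has a stratum of its own because `joinRule` negates the relation.
The register `rN` at position `0` drops that position. -/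
noncomputable def seenRules : List Rule :=
  [⟨.and (.lt (uR c t) (jR c t)) (.and (connF c t (bsub (zR c t) 0 (rN c)) (zR c t 0) (uR c t))
      (connF c t (zR c t) (uR c t) (jR c t))), qSeen c, List.ofFn (zR c t) ++ [jR c t]⟩]

/-- The registers of a fact. -/
def factArgs (zs : Fin (t + 1) → ℕ) (j : ℕ) (p : Fin c → ℕ) : List ℕ :=
  List.ofFn zs ++ (j :: List.ofFn p)

noncomputable def factF (r : BState t) (zs : Fin (t + 1) → ℕ) (j : ℕ) (p : Fin c → ℕ) : Fm :=
  .rel (qE c t r) (factArgs c t zs j p)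

/-- There is one rule for each guess of the selected positions `x.1` and the links `x.2`; the
premise verifies the guess. All argument registers range freely, so `j` and `p` have to be pinned to
`0`. -/
noncomputable def baseRule (x : (Fin (t + 1) → Bool) × BState t) : Rule :=
  ⟨.all [.allF fun i : Fin (t + 1) => if x.1 i then .rel (qAlive c) [zR c t i] else .const true,
      .allF fun e : Fin (t + 1) × Fin (t + 1) =>
        if x.1 e.1 = x.1 e.2 then .const true else .neg (.eq (zR c t e.1) (zR c t e.2)),
      .allF fun e : Fin (t + 1) × Fin (t + 1) =>
        if x.2 e.1 e.2 then .or (.eq (zR c t e.1) (zR c t e.2))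
          (.rel qAdj [zR c t e.1, zR c t e.2]) else .const true,
      .isc (jR c t) 0, .allF fun q : Fin c => .isc (pR c t q) 0],
    qE c t (baseST x.1 x.2), factArgs c t (zR c t) (jR c t) (pR c t)⟩

/-- With `u` pinned to `0`, the atom `Fm.sum` expresses `k = j + 1`. -/
noncomputable def skipRule (r : BState t) : Rule :=
  ⟨.all [factF c t r (zR c t) (jR c t) (pR c t), .isc (uR c t) 0,
      .sum (jR c t) (uR c t) 1 (kR c t)],
    qE c t r, factArgs c t (zR c t) (kR c t) (pR c t)⟩

open Classical in
-- Negation is applied only to the input relations and to those of earlier strata, which the fact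
-- rules leave alone. Facts themselves occur positively.
noncomputable def joinRule (x : Fin (t + 1) × BState t × BState t) : Rule :=
  ⟨.all [.const (decide (Compat x.1 x.2.1 x.2.2)),
      factF c t x.2.1 (zR c t) (jR c t) (aR c t),
      factF c t x.2.2 (bsub (zR c t) x.1 (vR c t)) (rN c) (bR c t),
      connF c t (bsub (zR c t) 0 (rN c)) (zR c t 0) (jR c t),
      .neg (.rel (qSeen c) (List.ofFn (zR c t) ++ [jR c t])),
      .neg (connF c t (bsub (zR c t) x.1 (rN c)) (jR c t) (zR c t x.1)),
      connF c t (bsub (zR c t) x.1 (rN c)) (jR c t) (vR c t),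
      .isc (uR c t) 0, .sum (jR c t) (uR c t) 1 (kR c t),
      .allF fun q : Fin c => if x.2.2 0 0 then
        .or (.and (.rel (qCol c q) [vR c t]) (.sum (aR c t q) (bR c t q) 1 (pR c t q)))
          (.and (.neg (.rel (qCol c q) [vR c t])) (.sum (aR c t q) (bR c t q) 0 (pR c t q)))
        else .sum (aR c t q) (bR c t q) 0 (pR c t q)],
    qE c t (joinST x.1 x.2.1 x.2.2), factArgs c t (zR c t) (kR c t) (pR c t)⟩

open Classical in
noncomputable def finalRule (r : BState t) : Rule :=
  ⟨.all [.const (decide (FinalST r)), factF c t r (zR c t) (rN c) (pR c t), .isc (uR c t) 0,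
      .allF fun q : Fin c =>
        .or (.and (.rel (qCol c q) [zR c t 0]) (.sum (pR c t q) (uR c t) 1 q))
          (.and (.neg (.rel (qCol c q) [zR c t 0])) (.sum (pR c t q) (uR c t) 0 q))],
    qFound c, []⟩

noncomputable def factRules : List Rule :=
  Finset.univ.toList.map (baseRule c t) ++ Finset.univ.toList.map (skipRule c t) ++
    Finset.univ.toList.map (joinRule c t) ++ Finset.univ.toList.map (finalRule c t)

/-- The registers which rules may use. -/
def IsVar (x : ℕ) : Prop := x ∈ rVars c t ∨ IsConst c x

theorem isVar_z (i : Fin (t + 1)) : IsVar c t (zR c t i) := .inl ((mem_rVars c t).mpr (by simp only [layout] at *; omega))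
theorem isVar_u : IsVar c t (uR c t) := .inl ((mem_rVars c t).mpr (by simp only [layout] at *; omega))
theorem isVar_j : IsVar c t (jR c t) := .inl ((mem_rVars c t).mpr (by simp only [layout] at *; omega))
theorem isVar_k : IsVar c t (kR c t) := .inl ((mem_rVars c t).mpr (by simp only [layout] at *; omega))
theorem isVar_v : IsVar c t (vR c t) := .inl ((mem_rVars c t).mpr (by simp only [layout] at *; omega))
theorem isVar_a (q : Fin c) : IsVar c t (aR c t q) := .inl ((mem_rVars c t).mpr (by simp only [layout] at *; omega))
theorem isVar_b (q : Fin c) : IsVar c t (bR c t q) := .inl ((mem_rVars c t).mpr (by simp only [layout] at *; omega))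
theorem isVar_p (q : Fin c) : IsVar c t (pR c t q) := .inl ((mem_rVars c t).mpr (by simp only [layout] at *; omega))
theorem isVar_n : IsVar c t (rN c) := .inr (.inr rfl)
theorem isVar_m (q : Fin c) : IsVar c t q := .inr (.inl q.2)
theorem isVar_bsub (i : Fin (t + 1)) {x : ℕ} (hx : IsVar c t x) (l : Fin (t + 1)) :
    IsVar c t (bsub (zR c t) i x l) := by
  refine Fin.cases hx (fun m => isVar_z c t _) l

variable {c t} {A : ℕ}

theorem connF_ok (hA : t + c + 4 ≤ A) {zs : Fin (t + 1) → ℕ} {u x : ℕ} (hz : ∀ i, IsVar c t (zs i))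
    (hu : IsVar c t u) (hx : IsVar c t x) : (connF c t zs u x).Ok A (qTot c t) (IsVar c t) := by
  refine ⟨by simp only [layout] at *; omega, by simp only [layout] at *; omega, ?_, by simp; omega⟩
  simp only [List.mem_append, List.mem_ofFn, List.mem_cons, List.not_mem_nil, or_false]
  rintro y (⟨i, rfl⟩ | rfl | rfl)
  exacts [hz i, hu, hx]

theorem factArgs_ok {zs : Fin (t + 1) → ℕ} {j : ℕ} {p : Fin c → ℕ}
    (hz : ∀ i, IsVar c t (zs i)) (hj : IsVar c t j) (hp : ∀ q, IsVar c t (p q)) :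
    ∀ x ∈ factArgs c t zs j p, IsVar c t x := by
  simp only [factArgs, List.mem_append, List.mem_ofFn, List.mem_cons]
  rintro y (⟨i, rfl⟩ | rfl | ⟨q, rfl⟩)
  exacts [hz i, hj, hp q]

theorem factF_ok (hA : t + c + 4 ≤ A) (r : BState t) {zs : Fin (t + 1) → ℕ} {j : ℕ}
    {p : Fin c → ℕ} (hz : ∀ i, IsVar c t (zs i)) (hj : IsVar c t j) (hp : ∀ q, IsVar c t (p q)) :
    (factF c t r zs j p).Ok A (qTot c t) (IsVar c t) :=
  ⟨by have := qE_ge c t r; omega, qE_lt c t r, factArgs_ok hz hj hp, by simp [factArgs]; omega⟩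

theorem rel_ok (hA : t + c + 4 ≤ A) {q : ℕ} (hq : 1 ≤ q) (hq' : q ≤ c + 5) {L : List ℕ}
    (hL : ∀ x ∈ L, IsVar c t x) (hlen : L.length ≤ t + 2) :
    (Fm.rel q L).Ok A (qTot c t) (IsVar c t) :=
  ⟨hq, by simp only [layout] at *; omega, hL, by omega⟩

theorem connRules_ok (hA : t + c + 4 ≤ A) :
    ∀ r ∈ connRules c t, r.Ok A (qTot c t) (IsVar c t) := by
  have hq : 1 ≤ qConn c ∧ qConn c < qTot c t := ⟨by simp only [layout] at *; omega, by simp only [layout] at *; omega⟩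
  intro r hr
  simp only [connRules, List.mem_cons, List.not_mem_nil, or_false] at hr
  rcases hr with rfl | rfl
  · refine ⟨⟨⟨isVar_u c t, isVar_n c t⟩, ?_⟩, hq.1, hq.2, ?_, by simp; omega⟩
    · simp only [Fm.allF_ok]
      exact fun i => ⟨isVar_z c t i, isVar_u c t⟩
    · simp only [List.mem_append, List.mem_ofFn, List.mem_cons, List.not_mem_nil, or_false]
      rintro y (⟨i, rfl⟩ | rfl | rfl)
      exacts [isVar_z c t i, isVar_u c t, isVar_u c t]
  · refine ⟨⟨connF_ok hA (isVar_z c t) (isVar_u c t) (isVar_v c t), rel_ok hA le_rfl (by simp only [layout] at *; omega) ?_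
      (by simp), ?_⟩, hq.1, hq.2, ?_, by simp; omega⟩
    · simp only [List.mem_cons, List.not_mem_nil, or_false]
      rintro y (rfl | rfl)
      exacts [isVar_v c t, isVar_k c t]
    · simp only [Fm.allF_ok]
      exact fun i => ⟨isVar_z c t i, isVar_k c t⟩
    · simp only [List.mem_append, List.mem_ofFn, List.mem_cons, List.not_mem_nil, or_false]
      rintro y (⟨i, rfl⟩ | rfl | rfl)
      exacts [isVar_z c t i, isVar_u c t, isVar_k c t]

theorem seenArgs_ok : ∀ x ∈ List.ofFn (zR c t) ++ [jR c t], IsVar c t x := by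
  simp only [List.mem_append, List.mem_ofFn, List.mem_cons, List.not_mem_nil, or_false]
  rintro y (⟨i, rfl⟩ | rfl)
  exacts [isVar_z c t i, isVar_j c t]

theorem seenRules_ok (hA : t + c + 4 ≤ A) :
    ∀ r ∈ seenRules c t, r.Ok A (qTot c t) (IsVar c t) := by
  intro r hr
  simp only [seenRules, List.mem_cons, List.not_mem_nil, or_false] at hr
  subst hr
  exact ⟨⟨⟨isVar_u c t, isVar_j c t⟩,
    connF_ok hA (isVar_bsub c t 0 (isVar_n c t)) (isVar_z c t 0) (isVar_u c t),
    connF_ok hA (isVar_z c t) (isVar_u c t) (isVar_j c t)⟩, by simp only [layout] at *; omega, by simp only [layout] at *; omega,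
    seenArgs_ok, by simp; omega⟩

theorem factRules_ok (hA : t + c + 4 ≤ A) :
    ∀ r ∈ factRules c t, r.Ok A (qTot c t) (IsVar c t) := by
  intro r hr
  simp only [factRules, List.mem_append, List.mem_map, Finset.mem_toList, Finset.mem_univ,
    true_and] at hr
  have hargs : ∀ {zs : Fin (t + 1) → ℕ} {j : ℕ} {p : Fin c → ℕ},
      (factArgs c t zs j p).length ≤ A := by intros; simp [factArgs]; omega
  have hq : ∀ r, 1 ≤ qE c t r := fun r => by have := qE_ge c t r; omega
  have hsum : ∀ e ≤ 1, ∀ x y z, IsVar c t x → IsVar c t y → IsVar c t z →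
      (Fm.sum x y e z).Ok A (qTot c t) (IsVar c t) := fun e he x y z hx hy hz => ⟨hx, hy, he, hz⟩
  have hcol : ∀ (q : Fin c) x, IsVar c t x → (Fm.rel (qCol c q) [x]).Ok A (qTot c t) (IsVar c t) :=
    fun q x hx => rel_ok hA (by simp only [layout] at *; omega) (by have := q.2; simp only [layout] at *; omega) (by simpa using hx) (by simp)
  rcases hr with ((⟨x, rfl⟩ | ⟨r, rfl⟩) | ⟨x, rfl⟩) | ⟨r, rfl⟩
  · refine ⟨?_, hq _, qE_lt c t _, factArgs_ok (isVar_z c t) (isVar_j c t) (isVar_p c t), hargs⟩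
    simp only [baseRule, Fm.all_ok, List.mem_cons, List.not_mem_nil, or_false]
    rintro f (rfl | rfl | rfl | rfl | rfl)
    · rw [Fm.allF_ok]; intro i
      split_ifs
      · exact rel_ok hA (by simp only [layout] at *; omega) (by simp only [layout] at *; omega) (by simpa using isVar_z c t i) (by simp)
      · trivial
    · rw [Fm.allF_ok]; intro i
      split_ifs
      · trivial
      · exact ⟨isVar_z c t _, isVar_z c t _⟩
    · rw [Fm.allF_ok]; intro i
      split_ifs
      · refine ⟨⟨isVar_z c t _, isVar_z c t _⟩, rel_ok hA le_rfl (by simp only [layout] at *; omega) ?_ (by simp)⟩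
        simp only [List.mem_cons, List.not_mem_nil, or_false]
        rintro y (rfl | rfl) <;> exact isVar_z c t _
      · trivial
    · exact ⟨isVar_j c t, by omega⟩
    · rw [Fm.allF_ok]; exact fun q => ⟨isVar_p c t q, by omega⟩
  · refine ⟨?_, hq _, qE_lt c t _, factArgs_ok (isVar_z c t) (isVar_k c t) (isVar_p c t), hargs⟩
    simp only [skipRule, Fm.all_ok, List.mem_cons, List.not_mem_nil, or_false]
    rintro f (rfl | rfl | rfl)
    · exact factF_ok hA r (isVar_z c t) (isVar_j c t) (isVar_p c t)
    · exact ⟨isVar_u c t, by omega⟩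
    · exact hsum _ le_rfl _ _ _ (isVar_j c t) (isVar_u c t) (isVar_k c t)
  · refine ⟨?_, hq _, qE_lt c t _, factArgs_ok (isVar_z c t) (isVar_k c t) (isVar_p c t), hargs⟩
    simp only [joinRule, Fm.all_ok, List.mem_cons, List.not_mem_nil, or_false]
    rintro f (rfl | rfl | rfl | rfl | rfl | rfl | rfl | rfl | rfl | rfl)
    · trivial
    · exact factF_ok hA _ (isVar_z c t) (isVar_j c t) (isVar_a c t)
    · exact factF_ok hA _ (isVar_bsub c t _ (isVar_v c t)) (isVar_n c t) (isVar_b c t)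
    · exact connF_ok hA (isVar_bsub c t 0 (isVar_n c t)) (isVar_z c t 0) (isVar_j c t)
    · exact rel_ok hA (by simp only [layout] at *; omega) (by simp only [layout] at *; omega) seenArgs_ok (by simp)
    · exact connF_ok hA (isVar_bsub c t _ (isVar_n c t)) (isVar_j c t) (isVar_z c t _)
    · exact connF_ok hA (isVar_bsub c t _ (isVar_n c t)) (isVar_j c t) (isVar_v c t)
    · exact ⟨isVar_u c t, by omega⟩
    · exact hsum _ le_rfl _ _ _ (isVar_j c t) (isVar_u c t) (isVar_k c t)
    · rw [Fm.allF_ok]; intro q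
      have h0 := hsum 0 (by omega) _ _ _ (isVar_a c t q) (isVar_b c t q) (isVar_p c t q)
      have h1 := hsum 1 (by omega) _ _ _ (isVar_a c t q) (isVar_b c t q) (isVar_p c t q)
      split_ifs
      · exact ⟨⟨hcol q _ (isVar_v c t), h1⟩, hcol q _ (isVar_v c t), h0⟩
      · exact h0
  · refine ⟨?_, by simp only [finalRule, layout]; omega, by simp only [finalRule, layout]; omega,
      by simp [finalRule], by simp [finalRule]⟩
    simp only [finalRule, Fm.all_ok, List.mem_cons, List.not_mem_nil, or_false]
    rintro f (rfl | rfl | rfl | rfl)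
    · trivial
    · exact factF_ok hA r (isVar_z c t) (isVar_n c t) (isVar_p c t)
    · exact ⟨isVar_u c t, by omega⟩
    · rw [Fm.allF_ok]; intro q
      have h0 := hsum 0 (by omega) _ _ _ (isVar_p c t q) (isVar_u c t) (isVar_m c t q)
      have h1 := hsum 1 (by omega) _ _ _ (isVar_p c t q) (isVar_u c t) (isVar_m c t q)
      exact ⟨⟨hcol q _ (isVar_z c t 0), h1⟩, hcol q _ (isVar_z c t 0), h0⟩

end Layout

/-! ## Correctness of the rules -/

section Rules

variable {c t n : ℕ}

/-- The stored facts about connection. -/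
def ConnB (c n : ℕ) {t : ℕ} (B : Set (ℕ × ℕ)) (Z : Fin (t + 1) → ℕ) (u x : ℕ) : Prop :=
  (qConn c, code (n + 1) Z [u, x]) ∈ B

/-- The stored facts about partial solutions. -/
def FactB (c n : ℕ) {t : ℕ} (B : Set (ℕ × ℕ)) (r : BState t) (Z : Fin (t + 1) → ℕ) (j : ℕ)
    (p : Fin c → ℕ) : Prop :=
  (qE c t r, code (n + 1) Z (j :: List.ofFn p)) ∈ B

/-- The stored relations describe the coloured graph `H`. -/
structure Input (H : CGraph n c) (B : Set (ℕ × ℕ)) : Prop where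
  adj : ∀ u ≤ n, ∀ v ≤ n, (qAdj, Nat.ofDigits (n + 1) [u, v]) ∈ B ↔ H.adj u v
  col : ∀ q, ∀ v ≤ n, (qCol c q, Nat.ofDigits (n + 1) [v]) ∈ B ↔ H.col v q
  alive : ∀ v ≤ n, (qAlive c, Nat.ofDigits (n + 1) [v]) ∈ B ↔ v ∈ H.alive

theorem Input.congr {H : CGraph n c} {B B' : Set (ℕ × ℕ)} (h : Input H B)
    (hB : ∀ e : ℕ × ℕ, e.1 ≤ c + 2 → (e ∈ B' ↔ e ∈ B)) : Input H B' :=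
  ⟨fun u hu v hv => (hB _ (by simp [layout])).trans (h.adj u hu v hv),
    fun q v hv => (hB _ (by have := q.2; simp only [layout]; omega)).trans (h.col q v hv),
    fun v hv => (hB _ (by simp [layout])).trans (h.alive v hv)⟩

theorem connF_holds (d : ℕ) (σ : ℕ → ℕ) (B : Set (ℕ × ℕ)) (zs : Fin (t + 1) → ℕ) (u x : ℕ) :
    (connF c t zs u x).Holds d σ B ↔
      (qConn c, code d (fun i => σ (zs i)) [σ u, σ x]) ∈ B := by
  simp only [connF, Fm.Holds, code, List.map_append, List.map_ofFn]; rfl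

theorem factF_holds (d : ℕ) (σ : ℕ → ℕ) (B : Set (ℕ × ℕ)) (r : BState t) (zs : Fin (t + 1) → ℕ)
    (j : ℕ) (p : Fin c → ℕ) : (factF c t r zs j p).Holds d σ B ↔
      (qE c t r, code d (fun i => σ (zs i)) (σ j :: List.ofFn fun q => σ (p q))) ∈ B := by
  simp only [factF, factArgs, Fm.Holds, code, List.map_append, List.map_ofFn, List.map_cons]; rfl

theorem comp_bsub (σ : ℕ → ℕ) (zs : Fin (t + 1) → ℕ) (i : Fin (t + 1)) (x : ℕ) :
    (fun l => σ (bsub zs i x l)) = bsub (fun l => σ (zs l)) i (σ x) := by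
  ext l; refine Fin.cases rfl (fun m => rfl) l

theorem assigns_z {ρ σ : ℕ → ℕ} (hσ : Assigns (n + 1) (rVars c t) (IsConst c) ρ σ)
    (x : ℕ) (hx : x ∈ rVars c t) : σ x ≤ n := Nat.lt_succ_iff.mp (hσ.1 x hx)

theorem assigns_zR {ρ σ : ℕ → ℕ} (hσ : Assigns (n + 1) (rVars c t) (IsConst c) ρ σ)
    (i : Fin (t + 1)) : σ (zR c t i) ≤ n :=
  assigns_z hσ _ ((mem_rVars c t).mpr (by simp only [layout] at *; omega))

theorem assigns_bsub {ρ σ : ℕ → ℕ} (hσ : Assigns (n + 1) (rVars c t) (IsConst c) ρ σ)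
    (i : Fin (t + 1)) {x : ℕ} (hx : σ x ≤ n) (l : Fin (t + 1)) :
    bsub (fun l => σ (zR c t l)) i (σ x) l ≤ n := by
  refine Fin.cases hx (fun m => assigns_zR hσ _) l

variable {ρ : ℕ → ℕ} {H : CGraph n c}

/-- Formulated as an invariant for `stratum_spec`: the rules change `qConn` only, and what is stored
there is true. The set `B0` remembers the other relations, from which the edges are read. -/
theorem conn_sound (hρ : ρ (rN c) = n) (hn : 1 ≤ n) {B0 B : Set (ℕ × ℕ)} (hin : Input H B0)
    (σ : ℕ → ℕ) (hσ : Assigns (n + 1) (rVars c t) (IsConst c) ρ σ) (r : Rule)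
    (hr : r ∈ connRules c t)
    (hB : (∀ e : ℕ × ℕ, e.1 ≠ qConn c → (e ∈ B ↔ e ∈ B0)) ∧
      ∀ Z : Fin (t + 1) → ℕ, (∀ i, Z i ≤ n) → ∀ u ≤ n, ∀ x ≤ n, ConnB c n B Z u x → H.Cn Z u x)
    (hh : r.prem.Holds (n + 1) σ B) :
    (∀ e : ℕ × ℕ, e.1 ≠ qConn c → (e ∈ insert (r.head (n + 1) σ) B ↔ e ∈ B0)) ∧
      ∀ Z : Fin (t + 1) → ℕ, (∀ i, Z i ≤ n) → ∀ u ≤ n, ∀ x ≤ n,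
        ConnB c n (insert (r.head (n + 1) σ) B) Z u x → H.Cn Z u x := by
  have hNn : σ (rN c) = n := (hσ.2 _ (.inr rfl)).trans hρ
  have hu : σ (uR c t) ≤ n := assigns_z hσ _ ((mem_rVars c t).mpr (by simp only [layout] at *; omega))
  have hk : σ (kR c t) ≤ n := assigns_z hσ _ ((mem_rVars c t).mpr (by simp only [layout] at *; omega))
  have hv : σ (vR c t) ≤ n := assigns_z hσ _ ((mem_rVars c t).mpr (by simp only [layout] at *; omega))
  have key : ∃ x ≤ n, r.head (n + 1) σ =
      (qConn c, code (n + 1) (fun i => σ (zR c t i)) [σ (uR c t), x]) ∧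
      H.Cn (fun i => σ (zR c t i)) (σ (uR c t)) x := by
    simp only [connRules, List.mem_cons, List.not_mem_nil, or_false] at hr
    rcases hr with rfl | rfl
    · refine ⟨σ (uR c t), hu, ?_, ?_⟩
      · simp only [Rule.head, code, List.map_append, List.map_ofFn]; rfl
      · simp only [Fm.Holds, Fm.allF_holds] at hh
        exact .refl ⟨by rw [← hNn]; exact hh.1, hh.2⟩
    · refine ⟨σ (kR c t), hk, ?_, ?_⟩
      · simp only [Rule.head, code, List.map_append, List.map_ofFn]; rfl
      · obtain ⟨h1, h2, h3⟩ := hh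
        rw [connF_holds] at h1
        have h2 := (hin.adj _ hv _ hk).mp ((hB.1 _ (by simp [layout])).mp h2)
        rw [Fm.allF_holds] at h3
        exact Rch.tail (hB.2 _ (assigns_zR hσ) _ hu _ hv h1) h2 ⟨H.lt _ _ (H.symm _ _ h2), h3⟩
  obtain ⟨x, hx, hhead, hcn⟩ := key
  rw [hhead]
  refine ⟨fun e he => ?_, fun Z hZ u' hu' x' hx' h => ?_⟩
  · rw [Set.mem_insert_iff, ← hB.1 e he, or_iff_right]
    rintro rfl; exact he rfl
  · rcases h with h | h
    · rw [Prod.mk.injEq] at h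
      obtain ⟨h1, h2⟩ := code_inj (L := [u', x']) (L' := [σ (uR c t), x]) (d := n + 1) (by omega) (fun i => Nat.lt_succ_iff.mpr (hZ i))
        (fun i => Nat.lt_succ_iff.mpr (assigns_zR hσ i)) (by simp; omega) (by simp; omega) rfl h.2
      simp only [List.cons.injEq, and_true] at h2
      rw [h1, h2.1, h2.2]; exact hcn
    · exact hB.2 Z hZ u' hu' x' hx' h

/-- Induction along a path; each step is an instance of a rule under which `B` is closed. The
assignment `asg` sets unused variables to `0`. -/
theorem conn_complete (hρ : ρ (rN c) = n) {B : Set (ℕ × ℕ)} (hin : Input H B)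
    (hcl : ClosedUnder (n + 1) (rVars c t) (IsConst c) (connRules c t) ρ B)
    {Z : Fin (t + 1) → ℕ} (hZ : ∀ i, Z i ≤ n) {u x : ℕ} (h : H.Cn Z u x) : ConnB c n B Z u x := by
  have hZ' : ∀ i, Z i < n + 1 := fun i => Nat.lt_succ_iff.mpr (hZ i)
  have hun : u < n := (Rch.left h).1
  refine h.ind (P := fun x => ConnB c n B Z u x) ?_ ?_
  · intro hu
    have := hcl (asg c t ρ Z u 0 0 0 0 0 0) (asg_assigns _ _ _ _ _ _ _ _ _ (by omega) hZ'
      (by omega) (by omega) (by omega) (by omega) (by simp) (by simp) (by simp)) _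
      (List.mem_cons_self) ?_
    · simp only [Rule.head, List.map_append, List.map_ofFn, Function.comp_def, asg_z, asg_u,
        List.map_cons, List.map_nil] at this; exact this
    · simp only [Fm.Holds, Fm.allF_holds, asg_u, asg_z]
      exact ⟨by rw [asg_const _ _ _ _ _ _ _ _ _ (by simp only [layout]; omega), hρ]; exact hun, hu.2⟩
  · intro x y hx ih hxy hy
    have hxn : x < n := H.lt _ _ hxy
    have hyn : y < n := hy.1
    have := hcl (asg c t ρ Z u 0 y x 0 0 0) (asg_assigns _ _ _ _ _ _ _ _ _ (by omega) hZ'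
      (by omega) (by omega) (by omega) (by omega) (by simp) (by simp) (by simp)) _
      (List.mem_cons_of_mem _ List.mem_cons_self) ?_
    · simp only [Rule.head, List.map_append, List.map_ofFn, Function.comp_def, asg_z, asg_u, asg_k,
        List.map_cons, List.map_nil] at this; exact this
    · refine ⟨?_, ?_, ?_⟩
      · rw [connF_holds]; simp only [asg_z, asg_u, asg_v]; exact ih
      · simp only [Fm.Holds, List.map_cons, List.map_nil, asg_v, asg_k]
        exact (hin.adj _ hxn.le _ hyn.le).mpr hxy
      · simp only [Fm.Holds, Fm.allF_holds, asg_k, asg_z]; exact hy.2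

/-- The stored facts about connection are right. -/
def ConnOk (t : ℕ) (H : CGraph n c) (B : Set (ℕ × ℕ)) : Prop :=
  ∀ Z : Fin (t + 1) → ℕ, (∀ i, Z i ≤ n) → ∀ u ≤ n, ∀ x ≤ n, (ConnB c n B Z u x ↔ H.Cn Z u x)

/-- The stored facts about nodes seen before are right. -/
def SeenOk (t : ℕ) (H : CGraph n c) (B : Set (ℕ × ℕ)) : Prop :=
  ∀ Z : Fin (t + 1) → ℕ, (∀ i, Z i ≤ n) → ∀ j ≤ n,
    ((qSeen c, code (n + 1) Z [j]) ∈ B ↔ H.Seen Z j)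

theorem seen_prem (hρ : ρ (rN c) = n) {B : Set (ℕ × ℕ)} (hconn : ConnOk t H B)
    {σ : ℕ → ℕ} (hσ : Assigns (n + 1) (rVars c t) (IsConst c) ρ σ) {r : Rule}
    (hr : r ∈ seenRules c t) : r.prem.Holds (n + 1) σ B ↔ σ (uR c t) < σ (jR c t) ∧
      H.Cn (bsub (fun i => σ (zR c t i)) 0 n) (σ (zR c t 0)) (σ (uR c t)) ∧
      H.Cn (fun i => σ (zR c t i)) (σ (uR c t)) (σ (jR c t)) := by
  have hNn : σ (rN c) = n := (hσ.2 _ (.inr rfl)).trans hρ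
  have hu : σ (uR c t) ≤ n := assigns_z hσ _ ((mem_rVars c t).mpr (by simp only [layout] at *; omega))
  have hj : σ (jR c t) ≤ n := assigns_z hσ _ ((mem_rVars c t).mpr (by simp only [layout] at *; omega))
  simp only [seenRules, List.mem_cons, List.not_mem_nil, or_false] at hr
  subst hr
  simp only [Fm.Holds, connF_holds, comp_bsub]
  rw [← hconn _ (assigns_zR hσ) _ hu _ hj]
  have := assigns_bsub hσ 0 hNn.le
  rw [hNn] at this ⊢
  rw [← hconn _ this _ (assigns_zR hσ 0) _ hu]
  rfl

theorem seen_head (σ : ℕ → ℕ) {r : Rule} (hr : r ∈ seenRules c t) :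
    r.head (n + 1) σ = (qSeen c, code (n + 1) (fun i => σ (zR c t i)) [σ (jR c t)]) := by
  simp only [seenRules, List.mem_cons, List.not_mem_nil, or_false] at hr
  subst hr
  simp only [Rule.head, code, List.map_append, List.map_ofFn]; rfl

theorem ConnOk.congr {B B' : Set (ℕ × ℕ)} (h : ConnOk t H B)
    (hB : ∀ e : ℕ × ℕ, e.1 ≤ c + 3 → (e ∈ B' ↔ e ∈ B)) : ConnOk t H B' :=
  fun Z hZ u hu x hx => (hB _ (by simp [layout])).trans (h Z hZ u hu x hx)

theorem SeenOk.congr {B B' : Set (ℕ × ℕ)} (h : SeenOk t H B)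
    (hB : ∀ e : ℕ × ℕ, e.1 ≤ c + 4 → (e ∈ B' ↔ e ∈ B)) : SeenOk t H B' :=
  fun Z hZ u hu => (hB _ (by simp [layout])).trans (h Z hZ u hu)

theorem seen_sound (hρ : ρ (rN c) = n) (hn : 1 ≤ n) {B0 B : Set (ℕ × ℕ)} (hconn : ConnOk t H B0)
    (σ : ℕ → ℕ) (hσ : Assigns (n + 1) (rVars c t) (IsConst c) ρ σ) (r : Rule)
    (hr : r ∈ seenRules c t)
    (hB : (∀ e : ℕ × ℕ, e.1 ≠ qSeen c → (e ∈ B ↔ e ∈ B0)) ∧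
      ∀ Z : Fin (t + 1) → ℕ, (∀ i, Z i ≤ n) → ∀ j ≤ n, (qSeen c, code (n + 1) Z [j]) ∈ B → H.Seen Z j)
    (hh : r.prem.Holds (n + 1) σ B) :
    (∀ e : ℕ × ℕ, e.1 ≠ qSeen c → (e ∈ insert (r.head (n + 1) σ) B ↔ e ∈ B0)) ∧
      ∀ Z : Fin (t + 1) → ℕ, (∀ i, Z i ≤ n) → ∀ j ≤ n,
        (qSeen c, code (n + 1) Z [j]) ∈ insert (r.head (n + 1) σ) B → H.Seen Z j := by
  have hj : σ (jR c t) ≤ n := assigns_z hσ _ ((mem_rVars c t).mpr (by simp only [layout] at *; omega))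
  have hconnB : ConnOk t H B := hconn.congr fun e he => hB.1 e (by simp only [layout]; omega)
  rw [seen_prem hρ hconnB hσ hr] at hh
  rw [seen_head σ hr]
  refine ⟨fun e he => ?_, fun Z hZ j hj' h => ?_⟩
  · rw [Set.mem_insert_iff, ← hB.1 e he, or_iff_right]
    rintro rfl; exact he rfl
  · rcases h with h | h
    · rw [Prod.mk.injEq] at h
      obtain ⟨h1, h2⟩ := code_inj (L := [j]) (L' := [σ (jR c t)]) (d := n + 1) (by omega) (fun i => Nat.lt_succ_iff.mpr (hZ i))
        (fun i => Nat.lt_succ_iff.mpr (assigns_zR hσ i)) (by simp; omega) (by simp; omega) rfl h.2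
      simp only [List.cons.injEq, and_true] at h2
      rw [h1, h2]; exact ⟨_, hh⟩
    · exact hB.2 Z hZ j hj' h

theorem seen_complete (hρ : ρ (rN c) = n) {B : Set (ℕ × ℕ)} (hconn : ConnOk t H B)
    (hcl : ClosedUnder (n + 1) (rVars c t) (IsConst c) (seenRules c t) ρ B)
    {Z : Fin (t + 1) → ℕ} (hZ : ∀ i, Z i ≤ n) {j : ℕ} (hj : j ≤ n) (h : H.Seen Z j) :
    (qSeen c, code (n + 1) Z [j]) ∈ B := by
  have hZ' : ∀ i, Z i < n + 1 := fun i => Nat.lt_succ_iff.mpr (hZ i)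
  obtain ⟨u, hu, h1, h2⟩ := h
  have hmem : (⟨_, _, _⟩ : Rule) ∈ seenRules c t := List.mem_cons_self
  have hσ := asg_assigns (c := c) (t := t) ρ Z u j 0 0 0 0 0 (d := n + 1) (by omega) hZ'
      (by omega) (by omega) (by omega) (by omega) (by simp) (by simp) (by simp)
  have := hcl _ hσ _ hmem ?_
  · rw [seen_head _ hmem] at this
    simpa only [asg_z, asg_j] using this
  · rw [seen_prem hρ hconn hσ hmem]
    simp only [asg_z, asg_u, asg_j]
    exact ⟨hu, h1, h2⟩

/-- The stored facts about partial solutions are right. -/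
def FactsSound (H : CGraph n c) (ρ : ℕ → ℕ) (t : ℕ) (B : Set (ℕ × ℕ)) : Prop :=
  (∀ (r : BState t) (Z : Fin (t + 1) → ℕ), (∀ i, Z i ≤ n) → ∀ j ≤ n, ∀ p : Fin c → ℕ,
    (∀ q, p q ≤ n) → FactB c n B r Z j p → ∃ A, H.Part r Z j p A) ∧
  ((qFound c, 0) ∈ B → ∃ S, H.Solves (fun q => ρ q) S)

theorem factsSound_insert (hn : 1 ≤ n) {B : Set (ℕ × ℕ)} {r : BState t} {Z : Fin (t + 1) → ℕ}
    (hZ : ∀ i, Z i ≤ n) {j : ℕ} (hj : j ≤ n) {p : Fin c → ℕ} (hp : ∀ q, p q ≤ n)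
    (hB : FactsSound H ρ t B) (h : ∃ A, H.Part r Z j p A) :
    FactsSound H ρ t (insert (qE c t r, code (n + 1) Z (j :: List.ofFn p)) B) := by
  refine ⟨fun r' Z' hZ' j' hj' p' hp' hmem => ?_, fun hmem => ?_⟩
  · rcases hmem with e | hmem
    · rw [Prod.mk.injEq] at e
      have hlist : ∀ (j : ℕ) (p : Fin c → ℕ), j ≤ n → (∀ q, p q ≤ n) →
          ∀ x ∈ j :: List.ofFn p, x < n + 1 := by
        simp only [List.mem_cons, List.mem_ofFn]
        rintro j p hj hp x (rfl | ⟨q, rfl⟩)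
        exacts [by omega, Nat.lt_succ_iff.mpr (hp q)]
      obtain ⟨h1, h2⟩ := code_inj (d := n + 1) (by omega) (fun i => Nat.lt_succ_iff.mpr (hZ' i))
        (fun i => Nat.lt_succ_iff.mpr (hZ i)) (hlist j' p' hj' hp') (hlist j p hj hp) (by simp) e.2
      rw [List.cons.injEq] at h2
      obtain rfl := qE_inj c t e.1
      obtain rfl := List.ofFn_injective h2.2
      rw [h1, h2.1]
      exact h
    · exact hB.1 r' Z' hZ' j' hj' p' hp' hmem
  · rcases hmem with e | hmem
    · rw [Prod.mk.injEq] at e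
      have h1 := e.1
      have := qE_ge c t r
      simp only [layout] at h1
      omega
    · exact hB.2 hmem

theorem factRule_head {σ : ℕ → ℕ} {prem : Fm} {r : BState t} {j : ℕ} :
    (Rule.mk prem (qE c t r) (factArgs c t (zR c t) j (pR c t))).head (n + 1) σ =
      (qE c t r, code (n + 1) (fun i => σ (zR c t i)) (σ j :: List.ofFn fun q => σ (pR c t q))) := by
  simp only [Rule.head, factArgs, code, List.map_append, List.map_ofFn, List.map_cons]; rfl

theorem join_cond_holds {d : ℕ} {σ : ℕ → ℕ} {B : Set (ℕ × ℕ)} (b : Bool) (q : Fin c) :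
    (if b = true then
        Fm.or (.and (.rel (qCol c q) [vR c t]) (.sum (aR c t q) (bR c t q) 1 (pR c t q)))
          (.and (.neg (.rel (qCol c q) [vR c t])) (.sum (aR c t q) (bR c t q) 0 (pR c t q)))
        else .sum (aR c t q) (bR c t q) 0 (pR c t q)).Holds d σ B ↔
      if b = true then
        ((qCol c q, Nat.ofDigits d [σ (vR c t)]) ∈ B ∧
            σ (aR c t q) + σ (bR c t q) + 1 = σ (pR c t q) ∨
          (qCol c q, Nat.ofDigits d [σ (vR c t)]) ∉ B ∧
            σ (aR c t q) + σ (bR c t q) + 0 = σ (pR c t q))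
      else σ (aR c t q) + σ (bR c t q) + 0 = σ (pR c t q) := by
  split_ifs <;> rfl

/-- `part_base`, `part_skip`, `part_join` and `solves_of_part` provide the sets that justify the
four kinds of rules. Since `B` agrees with `B0` on the earlier strata, the equivalences `hconn` and
`hseen` also justify the negated premises. -/
theorem facts_sound (hρ : ρ (rN c) = n) (hn : 1 ≤ n) {B0 B : Set (ℕ × ℕ)} (hin : Input H B0)
    (hconn : ConnOk t H B0) (hseen : SeenOk t H B0)
    (σ : ℕ → ℕ) (hσ : Assigns (n + 1) (rVars c t) (IsConst c) ρ σ) (r : Rule)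
    (hr : r ∈ factRules c t)
    (hB : (∀ e : ℕ × ℕ, e.1 ≤ c + 4 → (e ∈ B ↔ e ∈ B0)) ∧ FactsSound H ρ t B)
    (hh : r.prem.Holds (n + 1) σ B) :
    (∀ e : ℕ × ℕ, e.1 ≤ c + 4 → (e ∈ insert (r.head (n + 1) σ) B ↔ e ∈ B0)) ∧
      FactsSound H ρ t (insert (r.head (n + 1) σ) B) := by
  classical
  have hNn : σ (rN c) = n := (hσ.2 _ (.inr rfl)).trans hρ
  have hM : ∀ q : Fin c, σ q = ρ q := fun q => hσ.2 _ (.inl q.2)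
  have hz := assigns_zR hσ
  have hu : σ (uR c t) ≤ n := assigns_z hσ _ ((mem_rVars c t).mpr (by simp only [layout] at *; omega))
  have hj : σ (jR c t) ≤ n := assigns_z hσ _ ((mem_rVars c t).mpr (by simp only [layout] at *; omega))
  have hk : σ (kR c t) ≤ n := assigns_z hσ _ ((mem_rVars c t).mpr (by simp only [layout] at *; omega))
  have hv : σ (vR c t) ≤ n := assigns_z hσ _ ((mem_rVars c t).mpr (by simp only [layout] at *; omega))
  have ha : ∀ q, σ (aR c t q) ≤ n := fun q =>
    assigns_z hσ _ ((mem_rVars c t).mpr (by simp only [layout] at *; omega))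
  have hb : ∀ q, σ (bR c t q) ≤ n := fun q =>
    assigns_z hσ _ ((mem_rVars c t).mpr (by simp only [layout] at *; omega))
  have hp : ∀ q, σ (pR c t q) ≤ n := fun q =>
    assigns_z hσ _ ((mem_rVars c t).mpr (by simp only [layout] at *; omega))
  have hinB : Input H B := hin.congr fun e he => hB.1 e (by omega)
  have hconnB : ConnOk t H B := hconn.congr fun e he => hB.1 e (by omega)
  have hseenB : SeenOk t H B := hseen.congr fun e he => hB.1 e he
  refine ⟨fun e he => ?_, ?_⟩
  · rw [Set.mem_insert_iff, ← hB.1 e he, or_iff_right]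
    intro h
    have h1 : e.1 = r.hd := by rw [h]; rfl
    have h2 : c + 5 ≤ r.hd := by
      have hq : ∀ r, c + 5 ≤ qE c t r := fun r => by have := qE_ge c t r; omega
      simp only [factRules, List.mem_append, List.mem_map, Finset.mem_toList, Finset.mem_univ,
        true_and] at hr
      rcases hr with ((⟨x, rfl⟩ | ⟨r, rfl⟩) | ⟨x, rfl⟩) | ⟨r, rfl⟩
      exacts [hq _, hq _, hq _, le_rfl]
    omega
  simp only [factRules, List.mem_append, List.mem_map, Finset.mem_toList, Finset.mem_univ,
    true_and] at hr
  rcases hr with ((⟨⟨s, g⟩, rfl⟩ | ⟨r, rfl⟩) | ⟨⟨i, r₁, r₂⟩, rfl⟩) | ⟨r, rfl⟩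
  · simp only [baseRule, Fm.all_holds, List.mem_cons, List.not_mem_nil, or_false, forall_eq_or_imp,
      forall_eq, Fm.allF_holds] at hh
    obtain ⟨h1, h2, h3, h4, h5⟩ := hh
    rw [baseRule, factRule_head]
    have hj0 : σ (jR c t) = 0 := h4
    have hp0 : (fun q => σ (pR c t q)) = fun _ => 0 := funext h5
    rw [hj0]
    refine factsSound_insert hn hz (by omega) hp hB.2 ?_
    rw [hp0]
    refine CGraph.part_base (fun i hi => ?_) (fun i i' e => ?_) (fun i i' h => ?_)
    · have := h1 i
      rw [if_pos hi] at this
      exact (hinB.alive _ (hz i)).mp this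
    · have := h2 (i, i')
      by_contra hne
      rw [if_neg hne] at this
      exact this e
    · have := h3 (i, i')
      rw [if_pos h] at this
      exact this.imp id fun h => (hinB.adj _ (hz i) _ (hz i')).mp h
  · simp only [skipRule, Fm.all_holds, List.mem_cons, List.not_mem_nil, or_false, forall_eq_or_imp,
      forall_eq, factF_holds] at hh
    obtain ⟨h1, h2, h3⟩ := hh
    rw [skipRule, factRule_head]
    have h2 : σ (uR c t) = 0 := h2
    have h3 : σ (jR c t) + σ (uR c t) + 1 = σ (kR c t) := h3
    refine factsSound_insert hn hz hk hp hB.2 ?_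
    obtain ⟨A, hA⟩ := hB.2.1 r _ hz _ hj _ hp h1
    rw [← h3, h2]
    exact ⟨A, CGraph.part_skip hA⟩
  · simp only [joinRule, Fm.all_holds, List.mem_cons, List.not_mem_nil, or_false, forall_eq_or_imp,
      forall_eq, factF_holds, Fm.allF_holds, join_cond_holds, comp_bsub, hNn] at hh
    obtain ⟨h1, h2, h3, h4, h5, h6, h7, h8, h9, h10⟩ := hh
    have hX : ∀ i l, bsub (fun l => σ (zR c t l)) i n l ≤ n := fun i l => by
      have := assigns_bsub hσ i hNn.le l
      rwa [hNn] at this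
    simp only [Fm.Holds, connF_holds, comp_bsub, hNn, List.map_append, List.map_ofFn,
      List.map_cons, List.map_nil] at h1 h4 h5 h6 h7 h8 h9
    rw [joinRule, factRule_head]
    obtain ⟨A₁, hA₁⟩ := hB.2.1 _ _ hz _ hj _ ha h2
    obtain ⟨A₂, hA₂⟩ := hB.2.1 _ _ (assigns_bsub hσ i hv) _ le_rfl _ hb h3
    refine factsSound_insert hn hz hk hp hB.2 ?_
    have hk' : σ (kR c t) = σ (jR c t) + 1 := by omega
    rw [hk']
    refine CGraph.part_join hA₁ hA₂ ⟨?_, ?_, ?_, ?_⟩ (of_decide_eq_true h1) ?_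
    · exact (hconnB _ (hX 0) _ (hz 0) _ hj).mp h4
    · exact fun h => h5 ((hseenB _ hz _ hj).mpr h)
    · exact fun h => h6 ((hconnB _ (hX i) _ hj _ (hz i)).mpr h)
    · exact (hconnB _ (hX i) _ hj _ hv).mp h7
    · intro q
      have := h10 q
      by_cases hr0 : r₂ 0 0 = true
      · rw [if_pos hr0, hinB.col q _ hv] at this
        rcases this with ⟨h11, h12⟩ | ⟨h11, h12⟩
        · rw [if_pos ⟨hr0, h11⟩, h12]
        · rw [if_neg (fun h => h11 h.2), h12]
      · rw [if_neg hr0] at this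
        rw [if_neg (fun h => hr0 h.1), this]
  · simp only [finalRule, Fm.all_holds, List.mem_cons, List.not_mem_nil, or_false, forall_eq_or_imp,
      forall_eq, factF_holds, Fm.allF_holds, hNn] at hh
    obtain ⟨h1, h2, h3, h4⟩ := hh
    have h3 : σ (uR c t) = 0 := h3
    obtain ⟨A, hA⟩ := hB.2.1 _ _ hz _ le_rfl _ hp h2
    refine ⟨fun r' Z' hZ' j' hj' p' hp' hmem => ?_, fun hmem => ?_⟩
    · rcases hmem with e | hmem
      · have h5 : qE c t r' = qFound c := by
          have := congrArg Prod.fst e; exact this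
        have := qE_ge c t r'
        simp only [layout] at h5
        omega
      · exact hB.2.1 r' Z' hZ' j' hj' p' hp' hmem
    · refine ⟨A, CGraph.solves_of_part hA (of_decide_eq_true h1) fun q => ?_⟩
      have := h4 q
      simp only [Fm.Holds, List.map_cons, List.map_nil, hinB.col q _ (hz 0), hM, h3] at this
      rcases this with ⟨h5, h6⟩ | ⟨h5, h6⟩
      · exact .inl ⟨h5, by omega⟩
      · exact .inr ⟨h5, by omega⟩

/-- Translates closedness under the encoded rules into the abstract `RuleClosed`, so that the
graph-theoretic completeness argument is free of encodings. -/
theorem facts_complete (hρ : ρ (rN c) = n) {B : Set (ℕ × ℕ)} (hin : Input H B)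
    (hconn : ConnOk t H B) (hseen : SeenOk t H B)
    (hcl : ClosedUnder (n + 1) (rVars c t) (IsConst c) (factRules c t) ρ B) :
    H.RuleClosed (FactB (t := t) c n B) ∧
      (H.Found (FactB (t := t) c n B) (fun q => ρ q) → (qFound c, 0) ∈ B) := by
  classical
  have lt : ∀ {x}, x ≤ n → x < n + 1 := fun h => Nat.lt_succ_iff.mpr h
  have hN : ∀ (Z : Fin (t + 1) → ℕ) u j k v a b p, asg c t ρ Z u j k v a b p (rN c) = n :=
    fun Z u j k v a b p => by rw [asg_const _ _ _ _ _ _ _ _ _ (by simp only [layout]; omega), hρ]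
  have hMa : ∀ (Z : Fin (t + 1) → ℕ) u j k v a b p, ∀ q : Fin c,
      asg c t ρ Z u j k v a b p q = ρ q :=
    fun Z u j k v a b p q => asg_const _ _ _ _ _ _ _ _ _ (by simp only [layout]; omega)
  have mem : ∀ r, r ∈ factRules c t ↔ (((∃ x, baseRule c t x = r) ∨ ∃ x, skipRule c t x = r) ∨
      ∃ x, joinRule c t x = r) ∨ ∃ x, finalRule c t x = r := by
    intro r
    simp only [factRules, List.mem_append, List.mem_map, Finset.mem_toList, Finset.mem_univ,
      true_and]
  refine ⟨⟨?_, ?_, ?_⟩, ?_⟩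
  · intro s g Z hZ h1 h2 h3
    have := hcl (asg c t ρ Z 0 0 0 0 0 0 0) (asg_assigns _ _ _ _ _ _ _ _ _ (by omega)
      (fun i => lt (hZ i)) (by omega) (by omega) (by omega) (by omega) (by simp) (by simp) (by simp))
      _ ((mem _).mpr (.inl (.inl (.inl ⟨(s, g), rfl⟩)))) ?_
    · rw [baseRule, factRule_head] at this
      simp only [asg_z, asg_j, asg_p] at this; exact this
    · simp only [baseRule, Fm.all_holds, List.mem_cons, List.not_mem_nil, or_false,
        forall_eq_or_imp, forall_eq, Fm.allF_holds]
      refine ⟨fun i => ?_, fun i => ?_, fun i => ?_, asg_j .., fun q => asg_p ..⟩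
      · split_ifs with h
        · simp only [Fm.Holds, List.map_cons, List.map_nil, asg_z]
          exact (hin.alive _ (hZ i)).mpr (h1 i h)
        · rfl
      · split_ifs with h
        · rfl
        · simp only [Fm.Holds, asg_z]
          exact fun e => h (h2 _ _ e)
      · split_ifs with h
        · simp only [Fm.Holds, List.map_cons, List.map_nil, asg_z]
          exact (h3 _ _ h).imp id fun h => (hin.adj _ (hZ _) _ (hZ _)).mpr h
        · rfl
  · intro r Z j p hZ hj hp hE
    have := hcl (asg c t ρ Z 0 j (j + 1) 0 0 0 p) (asg_assigns _ _ _ _ _ _ _ _ _ (by omega)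
      (fun i => lt (hZ i)) (by omega) (by omega) (by omega) (by omega) (by simp) (by simp)
      (fun q => lt (hp q))) _ ((mem _).mpr (.inl (.inl (.inr ⟨r, rfl⟩)))) ?_
    · rw [skipRule, factRule_head] at this
      simp only [asg_z, asg_k, asg_p] at this; exact this
    · simp only [skipRule, Fm.all_holds, List.mem_cons, List.not_mem_nil, or_false,
        forall_eq_or_imp, forall_eq, factF_holds, Fm.Holds, asg_u, asg_z, asg_j, asg_k, asg_p]
      exact ⟨hE, trivial, trivial⟩
  · intro i r₁ r₂ Z v j p₁ p₂ p hZ hv hj hp₁ hp₂ hp hE₁ hE₂ hJ hC hA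
    have hX : ∀ i l, bsub Z i n l ≤ n := fun i l =>
      Fin.cases le_rfl (fun m => hZ _) l
    have := hcl (asg c t ρ Z 0 j (j + 1) v p₁ p₂ p) (asg_assigns _ _ _ _ _ _ _ _ _ (by omega)
      (fun i => lt (hZ i)) (by omega) (by omega) (by omega) (by omega) (fun q => lt (hp₁ q))
      (fun q => lt (hp₂ q)) (fun q => lt (hp q))) _
      ((mem _).mpr (.inl (.inr ⟨(i, r₁, r₂), rfl⟩))) ?_
    · rw [joinRule, factRule_head] at this
      simp only [asg_z, asg_k, asg_p] at this; exact this
    · simp only [joinRule, Fm.all_holds, List.mem_cons, List.not_mem_nil, or_false,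
        forall_eq_or_imp, forall_eq, factF_holds, connF_holds, Fm.Holds, Fm.allF_holds,
        join_cond_holds, comp_bsub, hN, asg_u, asg_z, asg_j, asg_k, asg_p, asg_v, asg_a, asg_b,
        List.map_append, List.map_ofFn, List.map_cons, List.map_nil, Function.comp_def]
      refine ⟨decide_eq_true hC, hE₁, hE₂, (hconn _ (hX 0) _ (hZ 0) _ hj.le).mpr hJ.reg, ?_, ?_,
        (hconn _ (hX i) _ hj.le _ hv.le).mpr hJ.root, trivial, trivial, fun q => ?_⟩
      · exact fun h => hJ.new ((hseen _ hZ _ hj.le).mp h)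
      · exact fun h => hJ.drop ((hconn _ (hX i) _ hj.le _ (hZ i)).mp h)
      · have := hA q
        rw [hin.col q _ hv.le]
        by_cases hr0 : r₂ 0 0 = true
        · rw [if_pos hr0]
          by_cases hq : H.col v q
          · rw [if_pos ⟨hr0, hq⟩] at this
            exact .inl ⟨hq, this.symm⟩
          · rw [if_neg fun h => hq h.2] at this
            exact .inr ⟨hq, this.symm⟩
        · rw [if_neg hr0]
          rw [if_neg fun h => hr0 h.1] at this
          exact this.symm
  · rintro ⟨r, Z, p, hE, hF, hZ, hp, hcol⟩
    have := hcl (asg c t ρ Z 0 0 0 0 0 0 p) (asg_assigns _ _ _ _ _ _ _ _ _ (by omega)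
      (fun i => lt (hZ i)) (by omega) (by omega) (by omega) (by omega) (by simp) (by simp)
      (fun q => lt (hp q))) _ ((mem _).mpr (.inr ⟨r, rfl⟩)) ?_
    · exact this
    · simp only [finalRule, Fm.all_holds, List.mem_cons, List.not_mem_nil, or_false,
        forall_eq_or_imp, forall_eq, factF_holds, Fm.Holds, Fm.allF_holds, hN, hMa, asg_u, asg_z,
        asg_p, List.map_cons, List.map_nil, hin.col _ _ (hZ 0)]
      refine ⟨decide_eq_true hF, hE, trivial, fun q => ?_⟩
      rcases hcol q with ⟨h1, h2⟩ | ⟨h1, h2⟩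
      · exact .inl ⟨h1, by dsimp only at h2; omega⟩
      · exact .inr ⟨h1, by dsimp only at h2; omega⟩

end Rules

/-! ## Clearing memory regions -/

section Clear

variable {w d A R Q D z : ℕ}

theorem dbOf_setMem_zero {q i : ℕ} (hi : i < d ^ A) (s : RamState) :
    dbOf d A Q (s.setMem (q * d ^ A + i) 0).mem = dbOf d A Q s.mem \ {(q, i)} := by
  ext ⟨q', i'⟩
  simp only [dbOf, RamState.setMem_mem, Set.mem_ofPred_eq, Set.mem_sdiff, Set.mem_singleton_iff,
    Prod.mk.injEq]
  constructor
  · rintro ⟨h1, h2, h3, h4⟩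
    by_cases e : q' * d ^ A + i' = q * d ^ A + i
    · simp [e] at h4
    · rw [if_neg e] at h4
      exact ⟨⟨h1, h2, h3, h4⟩, by rintro ⟨rfl, rfl⟩; exact e rfl⟩
  · rintro ⟨⟨h1, h2, h3, h4⟩, h5⟩
    refine ⟨h1, h2, h3, ?_⟩
    rwa [if_neg]
    exact fun e => h5 (cell_inj h3 hi e)

/-- Set all cells of the memory region `q` to `0`. -/
def clearRegion (D A z q : ℕ) : Prog := .rep A z (.store (cellE D A q (.reg z)) (.const 0))

/-- Set all cells of some memory regions to `0`. -/
def clearRegions (D A z : ℕ) (L : List ℕ) : Prog := .seqs (L.map (clearRegion D A z))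

@[simp] theorem keeps_clearRegion {x q : ℕ} : (clearRegion D A z q).Keeps x ↔ x ≠ z := by
  simp [clearRegion, Prog.Keeps]

theorem keeps_clearRegions {x : ℕ} {L : List ℕ} (h : x ≠ z) : (clearRegions D A z L).Keeps x := by
  simp [clearRegions, h]

theorem wf_clearRegions (h : D ≠ z) {L : List ℕ} : (clearRegions D A z L).Wf D := by
  refine Prog.wf_seqs ?_ ?_
  · simp [h]
  · simp [clearRegion, Prog.Keeps, Prog.Wf, h]

theorem clearRegion_spec (h : Fits w d A R) (hQ : Q ≤ R) (hDz : D ≠ z) {q : ℕ} (hq : 1 ≤ q)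
    (hqQ : q < Q) (s : RamState) (hd : s.regs D = d) :
    Frame {z} d A Q s ((clearRegion D A z q).run w D s) ∧
    dbOf d A Q ((clearRegion D A z q).run w D s).mem = {e ∈ dbOf d A Q s.mem | e.1 ≠ q} := by
  have := Prog.rep_inv (p := .store (cellE D A q (.reg z)) (.const 0)) (a := A) (x := z)
    (by simp [Prog.Keeps]) (by simp [Prog.Keeps]) hDz h.pow_lt s hd
    (fun i u => Frame {z} d A Q s u ∧
      dbOf d A Q u.mem = {e ∈ dbOf d A Q s.mem | ¬ (e.1 = q ∧ e.2 < i)})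
    ⟨(Frame.refl s).setReg (Set.mem_singleton z) 0, by simp⟩ ?_
  · refine ⟨this.1, this.2.trans ?_⟩
    ext e
    refine and_congr_right fun he => ?_
    have := he.2.2.1
    tauto
  · rintro i hi u ⟨h1, h2⟩ hx hud
    have hc := cellE_eval h u hud (lt_of_lt_of_le hqQ hQ) (.reg z) hx hi
    rw [Prog.run, hc, RamExpr.eval, Nat.zero_mod]
    refine ⟨(h1.setMem hq hqQ hi 0).setReg (Set.mem_singleton z) _, ?_⟩
    rw [RamState.setReg_mem, dbOf_setMem_zero hi, h2]
    ext ⟨q', i'⟩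
    simp only [Set.mem_sdiff, Set.mem_ofPred_eq, Set.mem_singleton_iff, Prod.mk.injEq, and_assoc]
    refine and_congr_right fun he => ?_
    constructor
    · rintro ⟨a1, a2⟩ ⟨a3, a4⟩
      rcases Nat.lt_succ_iff_lt_or_eq.mp a4 with a5 | a5
      exacts [a1 ⟨a3, a5⟩, a2 ⟨a3, a5⟩]
    · intro a
      exact ⟨fun b => a ⟨b.1, by omega⟩, fun b => a ⟨b.1, by omega⟩⟩

theorem clearRegions_spec (h : Fits w d A R) (hQ : Q ≤ R) (hDz : D ≠ z) {L : List ℕ}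
    (hL : ∀ q ∈ L, 1 ≤ q ∧ q < Q) (s : RamState) (hd : s.regs D = d) :
    Frame {z} d A Q s ((clearRegions D A z L).run w D s) ∧
    dbOf d A Q ((clearRegions D A z L).run w D s).mem = {e ∈ dbOf d A Q s.mem | e.1 ∉ L} := by
  induction L generalizing s with
  | nil => exact ⟨Frame.refl s, by simp [clearRegions, Prog.seqs, Prog.run]⟩
  | cons q L ih =>
    obtain ⟨h1, h2⟩ := clearRegion_spec h hQ hDz (hL q (by simp)).1 (hL q (by simp)).2 s hd
    obtain ⟨h3, h4⟩ := ih (fun q hq => hL q (by simp [hq])) ((clearRegion D A z q).run w D s)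
      (by rw [h1.regs D hDz, hd])
    refine ⟨h1.trans h3, h4.trans ?_⟩
    rw [h2]
    ext e
    simp only [Set.mem_ofPred_eq, List.mem_cons, not_or, and_assoc]

end Clear

/-! ## Deciding whether there is a solution -/

section Decide

variable (c t A : ℕ)

/-- The registers which are changed by the search for partial solutions. -/
def workRegs : Set ℕ := {x | x = rSw c ∨ x ∈ rVars c t}

/-- Compute all facts; the fact `qFound` says whether there is a solution. -/
noncomputable def decideP : Prog :=
  .seq (clearRegions c A (rSw c) ((List.range (qTot c t)).filter (qConn c ≤ ·)))
    (.seq (stratum c A (A + qTot c t) (rSw c) (rVars c t) (connRules c t))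
      (.seq (stratum c A (A + qTot c t) (rSw c) (rVars c t) (seenRules c t))
        (stratum c A (A + qTot c t) (rSw c) (rVars c t) (factRules c t))))

variable {c t A}

theorem decideP_regs : c ∉ rVars c t ∧ rSw c ∉ rVars c t ∧ c ≠ rSw c ∧ ¬ IsConst c (rSw c) ∧
    ∀ x ∈ rVars c t, ¬ IsConst c x := by
  simp only [mem_rVars, IsConst, layout]
  refine ⟨by omega, by omega, by omega, by omega, fun x => by omega⟩

theorem keeps_decideP {x : ℕ} (h : x ∉ workRegs c t) : (decideP c t A).Keeps x := by
  simp only [workRegs, Set.mem_ofPred_eq, not_or] at h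
  exact ⟨keeps_clearRegions h.1, keeps_stratum.mpr h, keeps_stratum.mpr h, keeps_stratum.mpr h⟩

theorem notMem_workRegs {x : ℕ} (hx : x < c + 3 ∨ x = c + 4 ∨ c + 4 < x ∧ x < c + 16) :
    x ∉ workRegs c t := by
  simp only [workRegs, Set.mem_ofPred_eq, mem_rVars, layout]; omega

theorem wf_decideP : (decideP c t A).Wf c := by
  obtain ⟨h1, h2, h3, h4, h5⟩ := decideP_regs (c := c) (t := t)
  have hs : ∀ rules, (stratum c A (A + qTot c t) (rSw c) (rVars c t) rules).Wf c :=
    fun rules => wf_stratum (nodup_rVars c t) h1 h2 h3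
  have hk : ∀ rules, (stratum c A (A + qTot c t) (rSw c) (rVars c t) rules).Keeps c :=
    fun rules => keeps_stratum.mpr ⟨h3, h1⟩
  exact ⟨keeps_clearRegions h3, wf_clearRegions h3, hk _, hs _, hk _, hs _, hs _⟩

theorem fits_of_lt {w d A Q : ℕ} (hd : 2 ≤ d) (hw : d ^ (A + Q + 1) < 2 ^ w) :
    Fits w d A (Q + 1) := by
  refine ⟨hd, ?_, by omega⟩
  have h1 : Q + 1 < d ^ (Q + 1) := Nat.lt_pow_self (by omega)
  calc (Q + 1) * d ^ A ≤ d ^ (Q + 1) * d ^ A := Nat.mul_le_mul_right _ h1.le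
    _ = d ^ (A + Q + 1) := by ring
    _ < 2 ^ w := hw

/-- The strata are computed in the order connection, seen, facts. Once a stratum is finished, its
relation is exact: the invariant of `stratum_spec` gives soundness, closedness gives completeness.
Exactness is what permits the next stratum to negate it. The hypothesis `hG` is used only for the
completeness of the last stratum. -/
theorem decideP_spec {w n : ℕ} (hn : 1 ≤ n) (hA : t + c + 4 ≤ A)
    (hw : (n + 1) ^ (A + qTot c t + 1) < 2 ^ w) {H : CGraph n c}
    (hG : ∀ u < n, Good H.adj t {x | Rch H.adj {y | y < n} u x})
    (s : RamState) (hd : s.regs c = n + 1) (hN : s.regs (rN c) = n)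
    (hM : ∀ q : Fin c, s.regs q ≤ n) (hin : Input H (dbOf (n + 1) A (qTot c t) s.mem)) :
    Frame (workRegs c t) (n + 1) A (qTot c t) s ((decideP c t A).run w c s) ∧
    (∀ e : ℕ × ℕ, e.1 ≤ c + 2 → (e ∈ dbOf (n + 1) A (qTot c t) ((decideP c t A).run w c s).mem ↔
      e ∈ dbOf (n + 1) A (qTot c t) s.mem)) ∧
    ((qFound c, 0) ∈ dbOf (n + 1) A (qTot c t) ((decideP c t A).run w c s).mem ↔
      ∃ S, H.Solves (fun q => s.regs q) S) := by
  obtain ⟨r1, r2, r3, r4, r5⟩ := decideP_regs (c := c) (t := t)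
  have hf := fits_of_lt (by omega) hw
  have hQ : qTot c t ≤ qTot c t + 1 := by omega
  have hpow : ∀ {a b}, a ≤ b → (n + 1) ^ a ≤ (n + 1) ^ b :=
    fun h => Nat.pow_le_pow_right (by omega) h
  have hw4 : 4 * (n + 1) < 2 ^ w := by
    have : (n + 1) ^ 3 ≤ (n + 1) ^ (A + qTot c t + 1) := hpow (by omega)
    have : 2 * 2 * (n + 1) ≤ (n + 1) * (n + 1) * (n + 1) := by gcongr <;> omega
    have e : (n + 1) ^ 3 = (n + 1) * (n + 1) * (n + 1) := by ring
    omega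
  -- From `Q < (n + 1) ^ Q`: the exponent `A + qTot c t` of the sweep loop gives more sweeps than
  -- there are tuples.
  have hb : qTot c t * (n + 1) ^ A < (n + 1) ^ (A + qTot c t) := by
    rw [add_comm A, pow_add]
    exact Nat.mul_lt_mul_of_pos_right (Nat.lt_pow_self (by omega)) hf.pow_pos
  have hbw : (n + 1) ^ (A + qTot c t) < 2 ^ w := lt_of_le_of_lt (hpow (by omega)) hw
  have sp := fun rules hok => stratum_spec (rules := rules) hf hw4 hQ (nodup_rVars c t) r1 r2 r3 r4
    hb hbw hok r5
  have hcl : ∀ q ∈ (List.range (qTot c t)).filter (qConn c ≤ ·), 1 ≤ q ∧ q < qTot c t := by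
    simp only [List.mem_filter, List.mem_range, layout, decide_eq_true_eq]
    intro q; omega
  have hkd : c ∉ workRegs c t := notMem_workRegs (by omega)
  have hkN : rN c ∉ workRegs c t := notMem_workRegs (by simp only [layout]; omega)
  have hkM : ∀ q : Fin c, (q : ℕ) ∉ workRegs c t := fun q => notMem_workRegs (by have := q.2; omega)
  have hYu : ∀ u : RamState, Frame (workRegs c t) (n + 1) A (qTot c t) s u →
      ∀ x, IsConst c x → u.regs x < n + 1 := by
    rintro u hu x (hx | rfl)
    · rw [hu.regs x (hkM ⟨x, hx⟩)]; exact Nat.lt_succ_of_le (hM ⟨x, hx⟩)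
    · rw [hu.regs _ hkN, hN]; omega
  obtain ⟨f0, e0⟩ := clearRegions_spec hf hQ r3 hcl s hd
  rw [decideP, Prog.run, Prog.run, Prog.run]
  set s0 := (clearRegions c A (rSw c) ((List.range (qTot c t)).filter (qConn c ≤ ·))).run w c s
  replace f0 : Frame (workRegs c t) (n + 1) A (qTot c t) s s0 := f0.mono fun x hx => .inl hx
  have old0 : ∀ e : ℕ × ℕ, e.1 ≤ c + 2 → (e ∈ dbOf (n + 1) A (qTot c t) s0.mem ↔
      e ∈ dbOf (n + 1) A (qTot c t) s.mem) := by
    intro e he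
    rw [e0]
    refine and_iff_left ?_
    simp only [List.mem_filter, layout, decide_eq_true_eq]; omega
  have new0 : ∀ e : ℕ × ℕ, c + 3 ≤ e.1 → e ∉ dbOf (n + 1) A (qTot c t) s0.mem := by
    intro e he h
    have := h.2.1
    rw [e0] at h
    refine h.2 ?_
    simp only [List.mem_filter, List.mem_range, layout, decide_eq_true_eq] at *; omega
  have hin0 : Input H (dbOf (n + 1) A (qTot c t) s0.mem) := hin.congr old0
  obtain ⟨f1, c1, i1⟩ := sp _ (connRules_ok hA) s0 (by rw [f0.regs _ hkd, hd]) (hYu s0 f0)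
  set s1 := (stratum c A (A + qTot c t) (rSw c) (rVars c t) (connRules c t)).run w c s0
  replace f1 := f0.trans f1
  have hN0 := (f0.regs _ hkN).trans hN
  have hN1 := (f1.regs _ hkN).trans hN
  obtain ⟨old1, snd1⟩ := i1 _ ⟨fun e _ => Iff.rfl, fun Z hZ u hu x hx h =>
      absurd h (new0 _ (by simp only [layout]; omega))⟩
    (fun B σ hσ r hr hB hh => conn_sound hN0 hn hin0 σ hσ r hr hB hh)
  have hin1 := hin0.congr fun e he => old1 e (by simp only [layout]; omega)
  have conn1 : ConnOk t H (dbOf (n + 1) A (qTot c t) s1.mem) := fun Z hZ u hu x hx =>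
    ⟨snd1 Z hZ u hu x hx, fun h => conn_complete hN0 hin1 c1 hZ h⟩
  obtain ⟨f2, c2, i2⟩ := sp _ (seenRules_ok hA) s1 (by rw [f1.regs _ hkd, hd]) (hYu s1 f1)
  set s2 := (stratum c A (A + qTot c t) (rSw c) (rVars c t) (seenRules c t)).run w c s1
  replace f2 := f1.trans f2
  have hN2 := (f2.regs _ hkN).trans hN
  obtain ⟨old2, snd2⟩ := i2 _ ⟨fun e _ => Iff.rfl, fun Z hZ j hj h =>
      absurd ((old1 _ (by simp only [layout]; omega)).mp h) (new0 _ (by simp only [layout]; omega))⟩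
    (fun B σ hσ r hr hB hh => seen_sound hN1 hn conn1 σ hσ r hr hB hh)
  have hin2 := hin1.congr fun e he => old2 e (by simp only [layout]; omega)
  have conn2 := conn1.congr fun e he => old2 e (by simp only [layout]; omega)
  have seen2 : SeenOk t H (dbOf (n + 1) A (qTot c t) s2.mem) := fun Z hZ j hj =>
    ⟨snd2 Z hZ j hj, fun h => seen_complete hN1 conn2 c2 hZ hj h⟩
  obtain ⟨f3, c3, i3⟩ := sp _ (factRules_ok hA) s2 (by rw [f2.regs _ hkd, hd]) (hYu s2 f2)
  set s3 := (stratum c A (A + qTot c t) (rSw c) (rVars c t) (factRules c t)).run w c s2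
  replace f3 := f2.trans f3
  have new2 : ∀ e : ℕ × ℕ, c + 5 ≤ e.1 → e ∉ dbOf (n + 1) A (qTot c t) s2.mem := by
    intro e he h
    refine new0 e (by omega) ?_
    rwa [← old1 _ (by simp only [layout]; omega), ← old2 _ (by simp only [layout]; omega)]
  obtain ⟨old3, snd3⟩ := i3 _ ⟨fun e _ => Iff.rfl, fun r Z hZ j hj p hp h =>
      absurd h (new2 _ (by have := qE_ge c t r; simp only [layout] at *; omega)), fun h =>
      absurd h (new2 _ (by simp only [layout]; omega))⟩
    (fun B σ hσ r hr hB hh => facts_sound hN2 hn hin2 conn2 seen2 σ hσ r hr hB hh)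
  have hin3 := hin2.congr fun e he => old3 e (by omega)
  have conn3 := conn2.congr fun e he => old3 e (by omega)
  have seen3 := seen2.congr old3
  have hM2 : (fun q : Fin c => s2.regs q) = fun q : Fin c => s.regs q :=
    funext fun q => f2.regs _ (hkM q)
  obtain ⟨hE, hF⟩ := facts_complete hN2 hin3 conn3 seen3 c3
  refine ⟨f3, fun e he => ?_, fun h => ?_, fun ⟨S, hS⟩ => ?_⟩
  · rw [old3 e (by omega), old2 e (by simp only [layout]; omega),
      old1 e (by simp only [layout]; omega), old0 e he]
  · have := snd3.2 h
    rwa [hM2] at this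
  · rw [← hM2] at hS
    exact hF (CGraph.complete hE hG hS)

end Decide

/-! ## Finding a solution -/

theorem load_ne_zero_iff {w d A R Q D q i : ℕ} (h : Fits w d A R) (hQ : Q ≤ R) (s : RamState)
    (hd : s.regs D = d) (hq : 1 ≤ q) (hqQ : q < Q) (e : RamExpr) (he : e.eval w s = i)
    (hi : i < d ^ A) :
    (RamExpr.load (cellE D A q e)).eval w s ≠ 0 ↔ (q, i) ∈ dbOf d A Q s.mem := by
  rw [eval_load (cellE_eval h s hd (lt_of_lt_of_le hqQ hQ) e he hi)]
  exact ⟨fun h0 => ⟨hq, hqQ, hi, h0⟩, fun h0 => h0.2.2.2⟩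

namespace CGraph

variable {n c : ℕ} (H : CGraph n c)

/-- The graph in which only the nodes of `X` may be used. -/
def restrict (X : Set ℕ) : CGraph n c where
  adj := H.adj
  col := H.col
  alive := {x | x ∈ X ∧ x < n}
  symm := H.symm
  irrefl := H.irrefl
  lt := H.lt
  alive_lt := fun _ h => h.2

theorem Solves.mono {X Y : Set ℕ} {M : Fin c → ℕ} {S : Finset ℕ} (h : (H.restrict X).Solves M S)
    (hXY : ∀ a ∈ S, a ∈ X → a ∈ Y) : (H.restrict Y).Solves M S :=
  ⟨h.1, fun a ha => ⟨hXY a ha (h.2.1 a ha).1, (h.2.1 a ha).2⟩, h.2.2⟩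

/-- If no node of `X` can be spared, a solution inside `X` must use all of `X`; so the set of
allowed nodes itself is the solution. -/
theorem solves_of_minimal {X : Set ℕ} {M : Fin c → ℕ} (hX : ∀ x ∈ X, x < n)
    (h : ∃ S, (H.restrict X).Solves M S)
    (hmin : ∀ v < n, v ∈ X → ¬ ∃ S, (H.restrict (X \ {v})).Solves M S) :
    ∃ S : Finset ℕ, (H.restrict X).Solves M S ∧ ∀ v, v ∈ X ↔ v ∈ S := by
  obtain ⟨S, hS⟩ := h
  refine ⟨S, hS, fun v => ⟨fun hv => ?_, fun hv => (hS.2.1 v hv).1⟩⟩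
  by_contra hvS
  exact hmin v (hX v hv) hv ⟨S, hS.mono _ fun a ha haX => ⟨haX, fun e => hvS (e ▸ ha)⟩⟩

end CGraph

section Solve

variable (c t A : ℕ)

/-- The memory cell which says whether the node in register `rV` may be used. -/
def aliveE : RamExpr := cellE c A (qAlive c) (.reg (rV c))

/-- Whether there is a solution, according to the facts computed. -/
def foundE : RamExpr := .load (cellE c A (qFound c) (.const 0))

/-- Allow all nodes. -/
def initAlive : Prog :=
  .seq (clearRegion c A (rV c) (qAlive c))
    (.rep 1 (rV c) (.ite (.op .lt (.reg (rV c)) (.reg (rN c))) (.store (aliveE c A) (.const 1))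
      .skip))

/-- Forbid the node in register `rV` if there is a solution without it. -/
noncomputable def tryRemove : Prog :=
  .seq (.store (aliveE c A) (.const 0)) (.seq (decideP c t A)
    (.ite (foundE c A) .skip (.store (aliveE c A) (.const 1))))

/-- Forbid nodes until the remaining nodes form a solution. Register `rRes` says whether there is
one. -/
noncomputable def solveP : Prog :=
  .seq (initAlive c A) (.seq (decideP c t A)
    (.ite (foundE c A) (.seq (.rep 1 (rV c) (tryRemove c t A)) (.assign (rRes c) (.const 1)))
      (.assign (rRes c) (.const 0))))

/-- The registers which are changed by the search for a solution. -/
def solveRegs : Set ℕ := {x | x = rRes c ∨ x = rV c ∨ x ∈ workRegs c t}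

variable {c t A}

theorem keeps_tryRemove {x : ℕ} (h : x ∉ workRegs c t) : (tryRemove c t A).Keeps x :=
  ⟨trivial, keeps_decideP h, trivial, trivial⟩

theorem keeps_solveP {x : ℕ} (h : x ∉ solveRegs c t) : (solveP c t A).Keeps x := by
  simp only [solveRegs, Set.mem_ofPred_eq, not_or] at h
  exact ⟨⟨keeps_clearRegion.mpr h.2.1, h.2.1, trivial, trivial⟩, keeps_decideP h.2.2,
    ⟨⟨h.2.1, keeps_tryRemove h.2.2⟩, h.1⟩, h.1⟩

theorem notMem_solveRegs {x : ℕ} (hx : x < c + 2 ∨ c + 4 < x ∧ x < c + 16) :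
    x ∉ solveRegs c t := by
  simp only [solveRegs, Set.mem_ofPred_eq, not_or]
  exact ⟨by simp only [layout]; omega, by simp only [layout]; omega, notMem_workRegs (by omega)⟩

theorem wf_solveP : (solveP c t A).Wf c := by
  have h1 : c ≠ rV c := by simp only [layout]; omega
  have h2 : c ∉ workRegs c t := notMem_workRegs (by omega)
  have h3 : rV c ∉ workRegs c t := notMem_workRegs (.inr (.inl (by simp only [layout])))
  exact ⟨⟨keeps_clearRegion.mpr h1, h1, trivial, trivial⟩,
    ⟨keeps_clearRegion.mpr h1, ⟨h1, trivial, trivial, trivial⟩,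
      ⟨h1, ⟨trivial, trivial⟩, ⟨trivial, trivial⟩, trivial, trivial⟩⟩,
    keeps_decideP h2, wf_decideP,
    ⟨⟨h1, keeps_tryRemove h2⟩, ⟨h1, keeps_tryRemove h3, keeps_tryRemove h2,
      trivial, trivial, keeps_decideP h2, wf_decideP, trivial, trivial⟩, trivial⟩, trivial⟩

variable {w n : ℕ}

/-- In the state `u`, the graph is stored as in `s`, and `X` is the set of allowed nodes. -/
structure Allows (t A n : ℕ) (s u : RamState) (X : Set ℕ) : Prop where
  frame : Frame (solveRegs c t) (n + 1) A (qTot c t) s u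
  old : ∀ e : ℕ × ℕ, e.1 ≤ c + 1 → (e ∈ dbOf (n + 1) A (qTot c t) u.mem ↔
    e ∈ dbOf (n + 1) A (qTot c t) s.mem)
  alive : ∀ v ≤ n, ((qAlive c, v) ∈ dbOf (n + 1) A (qTot c t) u.mem ↔ v ∈ X)

section

variable {s u : RamState} {X : Set ℕ}

theorem Allows.insert (hA : 1 ≤ A) (h : Allows (c := c) t A n s u X) {v : ℕ} (hv : v ≤ n) :
    Allows (c := c) t A n s (u.setMem (qAlive c * (n + 1) ^ A + v) 1) (insert v X) := by
  have h1 : 1 ≤ qAlive c := by simp only [layout]; omega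
  have h2 : qAlive c < qTot c t := by simp only [layout]; omega
  have h3 : v < (n + 1) ^ A := lt_of_lt_of_le (Nat.lt_succ_of_le hv) (Nat.le_self_pow (by omega) _)
  refine ⟨h.frame.setMem h1 h2 h3 1, fun e he => ?_, fun x hx => ?_⟩
  · rw [dbOf_setMem h1 h2 h3 _ _ one_ne_zero, Set.mem_insert_iff, h.old e he, or_iff_right]
    rintro rfl; simp only [layout] at he; omega
  · rw [dbOf_setMem h1 h2 h3 _ _ one_ne_zero, Set.mem_insert_iff, h.alive x hx, Set.mem_insert_iff]
    simp

theorem Allows.remove (hA : 1 ≤ A) (h : Allows (c := c) t A n s u X) {v : ℕ} (hv : v ≤ n) :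
    Allows (c := c) t A n s (u.setMem (qAlive c * (n + 1) ^ A + v) 0) (X \ {v}) := by
  have h1 : 1 ≤ qAlive c := by simp only [layout]; omega
  have h2 : qAlive c < qTot c t := by simp only [layout]; omega
  have h3 : v < (n + 1) ^ A := lt_of_lt_of_le (Nat.lt_succ_of_le hv) (Nat.le_self_pow (by omega) _)
  refine ⟨h.frame.setMem h1 h2 h3 0, fun e he => ?_, fun x hx => ?_⟩
  · rw [dbOf_setMem_zero h3, Set.mem_sdiff, h.old e he, and_iff_left]
    rintro rfl; simp only [layout] at he; omega
  · rw [dbOf_setMem_zero h3, Set.mem_sdiff, h.alive x hx, Set.mem_sdiff]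
    simp

theorem Allows.setReg (h : Allows (c := c) t A n s u X) {r : ℕ} (hr : r ∈ solveRegs c t) (v : ℕ) :
    Allows (c := c) t A n s (u.setReg r v) X := ⟨h.frame.setReg hr v, h.old, h.alive⟩

theorem Allows.congr (h : Allows (c := c) t A n s u X) {Y : Set ℕ}
    (hXY : ∀ v ≤ n, (v ∈ X ↔ v ∈ Y)) : Allows (c := c) t A n s u Y :=
  ⟨h.frame, h.old, fun v hv => (h.alive v hv).trans (hXY v hv)⟩

theorem rV_mem : rV c ∈ solveRegs c t := .inr (.inl rfl)

end

/-- The relations of the coloured graph `H` are stored. -/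
structure GraphStored (H : CGraph n c) (B : Set (ℕ × ℕ)) : Prop where
  adj : ∀ u ≤ n, ∀ v ≤ n, (qAdj, Nat.ofDigits (n + 1) [u, v]) ∈ B ↔ H.adj u v
  col : ∀ q, ∀ v ≤ n, (qCol c q, v) ∈ B ↔ H.col v q

theorem initAlive_spec (hA : t + c + 4 ≤ A) (hw : (n + 1) ^ (A + qTot c t + 1) < 2 ^ w) (hn : 1 ≤ n)
    (s : RamState) (hd : s.regs c = n + 1) (hN : s.regs (rN c) = n) :
    Allows (c := c) t A n s ((initAlive c A).run w c s) {x | x < n} := by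
  have hf := fits_of_lt (by omega) hw
  have hdz : c ≠ rV c := by simp only [layout]; omega
  have hNz : rN c ≠ rV c := by simp only [layout]; omega
  have hq : qAlive c < qTot c t := by simp only [layout]; omega
  obtain ⟨f1, e1⟩ := clearRegion_spec (Q := qTot c t) hf (by omega) hdz (q := qAlive c)
    (by simp only [layout]; omega) hq s hd
  have hw1 : (n + 1) ^ 1 < 2 ^ w :=
    lt_of_le_of_lt (Nat.pow_le_pow_right (by omega) (by omega)) hw
  rw [pow_one] at hw1
  have hr := Prog.rep_inv (w := w) (D := c) (d := n + 1) (a := 1) (x := rV c)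
    (p := .ite (.op .lt (.reg (rV c)) (.reg (rN c))) (.store (aliveE c A) (.const 1)) .skip)
    ⟨trivial, trivial⟩ ⟨trivial, trivial⟩ hdz (by rwa [pow_one])
    ((clearRegion c A (rV c) (qAlive c)).run w c s) (by rw [f1.regs _ hdz, hd])
    (fun i u => Allows (c := c) t A n s u {x | x < n ∧ x < i}) ?_ ?_
  · refine Allows.congr hr fun v hv => ?_
    simp only [pow_one, Set.mem_ofPred_eq]; omega
  · refine Allows.setReg ⟨f1.mono ?_, fun e he => ?_, fun v hv => ?_⟩ rV_mem 0
    · rintro x rfl; exact rV_mem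
    · rw [e1]
      refine and_iff_left ?_
      simp only [layout]; omega
    · rw [e1]; simp
  · intro i hi u hu hx hud
    rw [pow_one] at hi
    have hun : u.regs (rN c) = n := by
      rw [hu.frame.regs _ (notMem_solveRegs (by simp only [layout]; omega)), hN]
    have hi' : i < (n + 1) ^ A := lt_of_lt_of_le hi (Nat.le_self_pow (by omega) _)
    rw [Prog.run, eval_lt (eval_reg.trans hx) (eval_reg.trans hun) (by omega)]
    refine Allows.setReg ?_ rV_mem _
    by_cases hin : i < n
    · rw [if_pos hin, if_pos one_ne_zero, Prog.run, aliveE,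
        cellE_eval hf u hud (by omega) (.reg (rV c)) hx hi', eval_const (by omega)]
      refine (hu.insert (by omega) hin.le).congr fun v hv => ?_
      simp only [Set.mem_insert_iff, Set.mem_ofPred_eq]; omega
    · rw [if_neg hin, if_neg (by simp), Prog.run]
      refine hu.congr fun v hv => ?_
      simp only [Set.mem_ofPred_eq]; omega

section

variable {H : CGraph n c} {s u : RamState} {X : Set ℕ}

theorem Allows.input (h : Allows (c := c) t A n s u X) (hX : ∀ x ∈ X, x < n)
    (hs : GraphStored H (dbOf (n + 1) A (qTot c t) s.mem)) :
    Input (H.restrict X) (dbOf (n + 1) A (qTot c t) u.mem) := by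
  refine ⟨fun x hx y hy => ?_, fun q v hv => ?_, fun v hv => ?_⟩
  · rw [h.old _ (by simp only [layout]; omega)]; exact hs.adj x hx y hy
  · rw [Nat.ofDigits_singleton, h.old _ (by have := q.2; simp only [layout]; omega)]
    exact hs.col q v hv
  · rw [Nat.ofDigits_singleton, h.alive v hv]
    exact ⟨fun hv => ⟨hv, hX v hv⟩, fun hv => hv.1⟩

theorem Allows.decideP (hn : 1 ≤ n) (hA : t + c + 4 ≤ A)
    (hw : (n + 1) ^ (A + qTot c t + 1) < 2 ^ w)
    (hG : ∀ u < n, Good H.adj t {x | Rch H.adj {y | y < n} u x})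
    (hd : s.regs c = n + 1) (hN : s.regs (rN c) = n) (hM : ∀ q : Fin c, s.regs q ≤ n)
    (hs : GraphStored H (dbOf (n + 1) A (qTot c t) s.mem)) (hX : ∀ x ∈ X, x < n)
    (h : Allows (c := c) t A n s u X) :
    Allows (c := c) t A n s ((decideP c t A).run w c u) X ∧
    (((foundE c A).eval w ((_root_.decideP c t A).run w c u) ≠ 0) ↔
      ∃ S, (H.restrict X).Solves (fun q => s.regs q) S) := by
  have hk := fun r hr => h.frame.regs r (notMem_solveRegs hr)
  have hud := (hk c (by omega)).trans hd
  have huM : ∀ q : Fin c, u.regs q = s.regs q := fun q => hk q (by have := q.2; omega)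
  obtain ⟨f1, o1, r1⟩ := decideP_spec (H := H.restrict X) hn hA hw hG u hud
    ((hk _ (by simp only [layout]; omega)).trans hN) (fun q => by rw [huM]; exact hM q)
    (h.input hX hs)
  refine ⟨⟨h.frame.trans (f1.mono fun x hx => .inr (.inr hx)), fun e he => ?_, fun v hv => ?_⟩, ?_⟩
  · rw [o1 e (by omega), h.old e he]
  · rw [o1 _ (by simp only [layout]; omega), h.alive v hv]
  · have hf := fits_of_lt (Q := qTot c t) (by omega) hw
    rw [foundE, load_ne_zero_iff (Q := qTot c t) hf (by omega) _
      (by rw [f1.regs _ (notMem_workRegs (by omega)), hud])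
      (by simp only [layout]; omega) (by simp only [layout]; omega) (.const 0) (by simp [RamExpr.eval])
      hf.pow_pos, r1]
    simp only [huM]

/-- Self-reduction: one decision for the full graph, then one for every node on trial removal.
Afterwards the allowed nodes are minimal, and `solves_of_minimal` applies. -/
theorem solveP_spec (hn : 1 ≤ n) (hA : t + c + 4 ≤ A)
    (hw : (n + 1) ^ (A + qTot c t + 1) < 2 ^ w) (hH : H.alive = {x | x < n})
    (hG : ∀ u < n, Good H.adj t {x | Rch H.adj {y | y < n} u x})
    (hd : s.regs c = n + 1) (hN : s.regs (rN c) = n) (hM : ∀ q : Fin c, s.regs q ≤ n)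
    (hs : GraphStored H (dbOf (n + 1) A (qTot c t) s.mem)) :
    ∃ X : Set ℕ, Allows (c := c) t A n s ((solveP c t A).run w c s) X ∧
    ((((solveP c t A).run w c s).regs (rRes c) = 1 ∧
        ∃ S : Finset ℕ, H.Solves (fun q => s.regs q) S ∧ ∀ v, v ∈ X ↔ v ∈ S) ∨
      (((solveP c t A).run w c s).regs (rRes c) = 0 ∧ ¬ ∃ S, H.Solves (fun q => s.regs q) S)) := by
  have hf := fits_of_lt (Q := qTot c t) (by omega) hw
  have hw1 : (n + 1) ^ 1 < 2 ^ w :=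
    lt_of_le_of_lt (Nat.pow_le_pow_right (by omega) (by omega)) hw
  rw [pow_one] at hw1
  have hfull : H.restrict {x | x < n} = H := by
    obtain ⟨a, b, al, _, _, _, _⟩ := H
    obtain rfl : al = {x | x < n} := hH
    simp [CGraph.restrict]
  have i0 := initAlive_spec hA hw hn s hd hN
  obtain ⟨i1, h1⟩ := i0.decideP (X := {x | x < n}) hn hA hw hG hd hN hM hs (fun x hx => hx)
  have hres : rRes c ∈ solveRegs c t := .inl rfl
  rw [solveP, Prog.run, Prog.run, Prog.run]
  rw [hfull] at h1
  by_cases hsol : ∃ S, H.Solves (fun q => s.regs q) S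
  swap
  · refine ⟨{x | x < n}, ?_, .inr ⟨?_, hsol⟩⟩
    · rw [if_neg (fun h => hsol (h1.mp h))]; exact i1.setReg hres _
    · rw [if_neg (fun h => hsol (h1.mp h))]; simp [Prog.run, RamExpr.eval]
  rw [if_pos (h1.mpr hsol), Prog.run]
  set s1 := (decideP c t A).run w c ((initAlive c A).run w c s)
  have hk1 := fun r hr => i1.frame.regs r (notMem_solveRegs hr)
  have hcw : c ∉ workRegs c t := notMem_workRegs (by omega)
  have hvw : rV c ∉ workRegs c t := notMem_workRegs (.inr (.inl (by simp only [layout])))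
  have hr := Prog.rep_inv (w := w) (D := c) (d := n + 1) (a := 1) (x := rV c)
    (p := tryRemove c t A) (keeps_tryRemove hvw) (keeps_tryRemove hcw)
    (by simp only [layout]; omega) (by rwa [pow_one]) s1 (by rw [hk1 _ (by omega), hd])
    -- The last clause says that each node kept so far is indispensable. It persists when further
    -- nodes are removed, as a solution in a smaller set is one in the larger set.
    (fun i u => ∃ X, Allows (c := c) t A n s u X ∧ (∀ x ∈ X, x < n) ∧ (∀ x < n, i ≤ x → x ∈ X) ∧
      (∃ S, (H.restrict X).Solves (fun q => s.regs q) S) ∧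
      ∀ v < i, v ∈ X → ¬ ∃ S, (H.restrict (X \ {v})).Solves (fun q => s.regs q) S) ?_ ?_
  · obtain ⟨X, hX, hXn, -, hXs, hmin⟩ := hr
    obtain ⟨S, hS, hXS⟩ := H.solves_of_minimal hXn hXs
      fun v hv => hmin v (by rw [pow_one]; omega)
    refine ⟨X, hX.setReg hres _, .inl ⟨?_, S, ?_, hXS⟩⟩
    · rw [Prog.run, RamState.setReg_regs, if_pos rfl, eval_const (by omega)]
    · rw [← hfull]; exact hS.mono _ fun a ha haX => hXn a haX
  · exact ⟨_, i1.setReg rV_mem 0, fun x hx => hx, fun x hx _ => hx, by rwa [hfull],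
      fun v hv => absurd hv (by omega)⟩
  · rintro i hi u ⟨X, hX, hXn, hXi, hXs, hmin⟩ hx hud
    rw [pow_one] at hi
    have hi' : i < (n + 1) ^ A := lt_of_lt_of_le hi (Nat.le_self_pow (by omega) _)
    have hal : ∀ v : RamState, v.regs c = n + 1 → v.regs (rV c) = i →
        (aliveE c A).eval w v = qAlive c * (n + 1) ^ A + i := fun v hv hvi =>
      cellE_eval hf v hv (by simp only [layout]; omega) (.reg (rV c)) hvi hi'
    rw [tryRemove, Prog.run, Prog.run, Prog.run, Prog.run, hal u hud hx, eval_const (by omega)]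
    have hX' : ∀ x ∈ X \ {i}, x < n := fun x hx => hXn x hx.1
    obtain ⟨i2, h2⟩ := (hX.remove (by omega) (Nat.lt_succ_iff.mp hi)).decideP hn hA hw hG hd hN hM
      hs hX'
    by_cases hs2 : ∃ S, (H.restrict (X \ {i})).Solves (fun q => s.regs q) S
    · rw [if_pos (h2.mpr hs2), Prog.run]
      refine ⟨_, i2.setReg rV_mem _, hX', fun x hx hix => ⟨hXi x hx (by omega), ?_⟩, hs2, ?_⟩
      · simp only [Set.mem_singleton_iff]; omega
      · rintro v hv ⟨hvX, hvi⟩ ⟨S, hS⟩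
        simp only [Set.mem_singleton_iff] at hvi
        exact hmin v (by omega) hvX ⟨S, hS.mono _ fun a _ h => ⟨h.1.1, h.2⟩⟩
    -- The loop also visits `i = n`, which is not a node; its removal changes nothing, so that case
    -- belongs to the previous branch.
    · have hin : i < n := by
        by_contra hin
        refine hs2 (by
          obtain ⟨S, hS⟩ := hXs
          exact ⟨S, hS.mono _ fun a _ h => ⟨h, by
            have := hXn a h
            simp only [Set.mem_singleton_iff]; omega⟩⟩)
      have hiX := hXi i hin le_rfl
      rw [if_neg (fun h => hs2 (h2.mp h)), Prog.run, hal _ ?_ ?_, eval_const (by omega)]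
      · refine ⟨X, ((i2.insert (by omega) hin.le).congr ?_).setReg rV_mem _, hXn,
          fun x hx hix => hXi x hx (by omega), hXs, fun v hv hvX => ?_⟩
        · intro v hv
          simp only [Set.mem_insert_iff, Set.mem_sdiff, Set.mem_singleton_iff]
          by_cases hvi : v = i <;> simp [hvi, hiX]
        · rcases Nat.lt_succ_iff_lt_or_eq.mp hv with h | rfl
          exacts [hmin v h hvX, hs2]
      · rw [i2.frame.regs _ (notMem_solveRegs (by omega)), hd]
      · rw [Prog.run_keeps _ _ _ _ (keeps_decideP hvw)]; exact hx

end

end Solve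

/-! ## Matches and solutions -/

section Matches

variable {n c : ℕ}

/-- A coloured graph, with natural numbers as nodes. -/
def graphOf (G : SimpleGraph (Fin n)) (col : Fin n → Fin c) : CGraph n c where
  adj := gAdj G
  col v q := ∃ h : v < n, col ⟨v, h⟩ = q
  alive := {x | x < n}
  symm := gAdj_symm
  irrefl := gAdj_irrefl
  lt := fun _ _ h => h.1
  alive_lt := fun _ h => h

variable {G : SimpleGraph (Fin n)} {col : Fin n → Fin c}

theorem rch_val_of_reachable {H : G.Subgraph} {S : Finset (Fin n)} (hS : H.verts = (S : Set (Fin n)))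
    {a b : H.verts} (h : H.coe.Reachable a b) :
    Rch (gAdj G) (S.map Fin.valEmbedding : Finset ℕ) (a : Fin n) (b : Fin n) := by
  have mem : ∀ x : H.verts, (x.1 : ℕ) ∈ (S.map Fin.valEmbedding : Finset ℕ) := fun x => by
    have : x.1 ∈ (S : Set (Fin n)) := hS ▸ x.2
    exact Finset.mem_coe.mpr (Finset.mem_map_of_mem Fin.valEmbedding (Finset.mem_coe.mp this))
  rw [SimpleGraph.reachable_iff_reflTransGen] at h
  induction h with
  | refl => exact .refl (mem a)
  | tail h1 h2 ih => exact ih.tail ⟨Fin.is_lt _, Fin.is_lt _, H.adj_sub h2⟩ (mem _)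

/-- A connected subgraph with node set `S` exists exactly if the subgraph induced by `S` is
connected, so only reachability inside `S` matters. -/
theorem isConnectedNodeSet_iff {S : Finset (Fin n)} :
    IsConnectedNodeSet G S ↔ S.Nonempty ∧ ∀ a ∈ S, ∀ b ∈ S,
      Rch (gAdj G) (S.map Fin.valEmbedding : Finset ℕ) (a : Fin n) (b : Fin n) := by
  constructor
  · rintro ⟨H, hH, hS⟩
    rw [SimpleGraph.Subgraph.connected_iff] at hH
    refine ⟨by rw [← Finset.coe_nonempty, ← hS]; exact hH.2, fun a ha b hb => ?_⟩
    have ha' : a ∈ H.verts := by rw [hS]; exact ha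
    have hb' : b ∈ H.verts := by rw [hS]; exact hb
    exact rch_val_of_reachable hS (hH.1.coe ⟨a, ha'⟩ ⟨b, hb'⟩)
  · rintro ⟨hne, h⟩
    refine ⟨(⊤ : G.Subgraph).induce S, ?_, rfl⟩
    rw [SimpleGraph.Subgraph.connected_iff]
    refine ⟨⟨?_⟩, hne⟩
    rintro ⟨a, ha⟩ ⟨b, hb⟩
    have key := (h a ha b hb).ind (P := fun x => ∃ (hx : x < n) (hxS : (⟨x, hx⟩ : Fin n) ∈ S),
      ((⊤ : G.Subgraph).induce S).coe.Reachable ⟨a, ha⟩ ⟨⟨x, hx⟩, hxS⟩)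
      (fun _ => ⟨a.2, ha, .refl _⟩) ?_
    · obtain ⟨_, _, h⟩ := key
      exact h
    · rintro x y - ⟨hx, hxS, hr⟩ ⟨_, hy, hxy⟩ hyS
      have hyS' : (⟨y, hy⟩ : Fin n) ∈ S := by
        simp only [Finset.mem_coe, Finset.mem_map, Fin.valEmbedding_apply] at hyS
        obtain ⟨z, hz, rfl⟩ := hyS
        exact hz
      refine ⟨hy, hyS', hr.trans (SimpleGraph.Adj.reachable ?_)⟩
      exact ⟨hxS, hyS', hxy⟩

theorem isMatch_iff_solves {M : Fin c → ℕ} {S : Finset (Fin n)} :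
    IsMatch G col M S ↔ (graphOf G col).Solves M (S.map Fin.valEmbedding) := by
  classical
  have hpk : ∀ q, (graphOf G col).pk (S.map Fin.valEmbedding) q = parikh col S q := by
    intro q
    unfold CGraph.pk parikh
    rw [Finset.filter_map, Finset.card_map]
    congr 1
    ext v
    simp [graphOf]
  rw [IsMatch, isConnectedNodeSet_iff, CGraph.Solves, Finset.map_nonempty, and_assoc]
  refine and_congr_right fun _ => ?_
  simp only [hpk, Finset.mem_map, Fin.valEmbedding_apply, forall_exists_index, and_imp,
    forall_apply_eq_imp_iff₂]
  refine ⟨fun h => ⟨fun a ha => a.2, h.1, h.2⟩, fun h => h.2⟩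

theorem exists_isMatch_iff {M : Fin c → ℕ} :
    (∃ S, IsMatch G col M S) ↔ ∃ S, (graphOf G col).Solves M S := by
  constructor
  · rintro ⟨S, hS⟩
    exact ⟨_, isMatch_iff_solves.mp hS⟩
  · rintro ⟨S, hS⟩
    refine ⟨(Finset.univ : Finset (Fin n)).filter (fun v => (v : ℕ) ∈ S), isMatch_iff_solves.mpr ?_⟩
    convert hS
    ext v
    simp only [Finset.mem_map, Finset.mem_filter, Finset.mem_univ, true_and, Fin.valEmbedding_apply]
    exact ⟨by rintro ⟨a, ha, rfl⟩; exact ha, fun hv => ⟨⟨v, hS.2.1 v hv⟩, hv, rfl⟩⟩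

theorem listsNodes_of_solves {M : Fin c → ℕ} {S : Finset ℕ} (hS : (graphOf G col).Solves M S)
    {L : List ℕ} (hL : L.Nodup) (hLS : ∀ v, v ∈ L ↔ v ∈ S) :
    ∃ S', IsMatch G col M S' ∧ ListsNodes L S' := by
  have hlt : ∀ v ∈ L, v < n := fun v hv => hS.2.1 v ((hLS v).mp hv)
  let f : {v // v ∈ L} → Fin n := fun v => ⟨v.1, hlt v.1 v.2⟩
  have hval : (L.attach.map f).map Fin.val = L := by
    rw [List.map_map]
    exact L.attach_map_subtype_val
  refine ⟨(L.attach.map f).toFinset, ?_, L.attach.map f, List.Nodup.of_map Fin.val (by rwa [hval]),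
    rfl, hval.symm⟩
  rw [isMatch_iff_solves]
  convert hS
  ext v
  rw [← hLS v]
  conv_rhs => rw [← hval]
  simp

theorem card_of_solves {H : CGraph n c} (hcol : ∀ v < n, ∃! q, H.col v q) {M : Fin c → ℕ}
    {S : Finset ℕ} (hS : H.Solves M S) : S.card = ∑ q, M q := by
  classical
  have : S.card = ∑ q, H.pk S q := by
    unfold CGraph.pk
    simp only [Finset.card_filter]
    rw [Finset.sum_comm, Finset.card_eq_sum_ones]
    refine Finset.sum_congr rfl fun v hv => ?_
    obtain ⟨q, hq, huq⟩ := hcol v (H.alive_lt v (hS.2.1 v hv))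
    rw [Finset.sum_eq_single q (fun q' _ hq' => if_neg fun h => hq' (huq q' h)) (by simp),
      if_pos hq]
  rw [this]
  exact Finset.sum_congr rfl fun q _ => hS.2.2.2 q

theorem graphOf_col (v : ℕ) (hv : v < n) : ∃! q, (graphOf G col).col v q :=
  ⟨col ⟨v, hv⟩, ⟨hv, rfl⟩, fun _ h => h.2.symm⟩

theorem le_of_solves {H : CGraph n c} {M : Fin c → ℕ} {S : Finset ℕ} (hS : H.Solves M S)
    (q : Fin c) : M q ≤ n := by
  classical
  rw [← hS.2.2.2 q, CGraph.pk]
  calc _ ≤ S.card := Finset.card_filter_le _ _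
    _ ≤ (Finset.range n).card := Finset.card_le_card fun v hv =>
      Finset.mem_range.mpr (H.alive_lt v (hS.2.1 v hv))
    _ = n := Finset.card_range n

end Matches

/-! ## Buckets of frequencies -/

section Buckets

/-- The step from one frequency to the next: the number of the bucket of the last frequency, and
the start of the next bucket. -/
def bucketStep (q x : ℕ) (s : ℕ × ℕ) : ℕ × ℕ := if x = s.2 then (s.1 + 1, x + x / q + 1) else s

/-- The state after the frequencies below `x`. -/
def bucketState (q : ℕ) : ℕ → ℕ × ℕ
  | 0 => (0, 1)
  | x + 1 => bucketStep q x (bucketState q x)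

/-- The number of the bucket of the frequency `x`: a bucket which starts at `s` ends at
`s + s / q`. -/
def bucket (q x : ℕ) : ℕ := (bucketState q (x + 1)).1

variable {q : ℕ}

theorem bucketState_le (x : ℕ) : x ≤ (bucketState q x).2 := by
  induction x with
  | zero => simp [bucketState]
  | succ x ih =>
    simp only [bucketState, bucketStep]
    split_ifs with h
    · dsimp only; generalize x / q = z; omega
    · omega

theorem bucketState_mono {x y : ℕ} (h : x ≤ y) : (bucketState q x).1 ≤ (bucketState q y).1 := by
  induction y, h using Nat.le_induction with
  | base => rfl
  | succ y _ ih =>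
    refine ih.trans ?_
    simp only [bucketState, bucketStep]
    split_ifs <;> simp

theorem bucket_mono {x y : ℕ} (h : x ≤ y) : bucket q x ≤ bucket q y := bucketState_mono (by omega)

theorem bucketState_one : bucketState q 1 = (0, 1) := by simp [bucketState, bucketStep]

theorem bucket_le (x : ℕ) : bucket q x ≤ x := by
  induction x with
  | zero => simp [bucket, bucketState_one]
  | succ x ih =>
    have : (bucketState q (x + 1 + 1)).1 ≤ (bucketState q (x + 1)).1 + 1 := by
      rw [bucketState, bucketStep]; split_ifs <;> simp
    unfold bucket at *; omega

/-- The frequencies in a bucket differ by a small factor only. -/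
theorem exists_bucket_start (x : ℕ) : ∃ s ≤ x, ∀ y, x ≤ y → bucket q y = bucket q x → y ≤ s + s / q := by
  -- The witness `s` is the start of the bucket of `x`; the recorded start of the next bucket does
  -- not change within a bucket.
  have inv : ∀ x, ∃ s ≤ x, (bucketState q (x + 1)).2 ≤ s + s / q + 1 := by
    intro x
    induction x with
    | zero => exact ⟨0, le_rfl, by simp [bucketState_one]⟩
    | succ x ih =>
      obtain ⟨s, hs, h⟩ := ih
      rw [bucketState, bucketStep]
      split_ifs
      · exact ⟨x + 1, le_rfl, le_rfl⟩
      · exact ⟨s, by omega, h⟩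
  obtain ⟨s, hs, h⟩ := inv x
  refine ⟨s, hs, fun y hy hb => ?_⟩
  have key : ∀ y, x ≤ y → bucket q y = bucket q x →
      (bucketState q (y + 1)).2 = (bucketState q (x + 1)).2 := by
    intro y hy
    induction y, hy using Nat.le_induction with
    | base => exact fun _ => rfl
    | succ y hy ih =>
      intro hb
      have h1 : bucket q y = bucket q x :=
        le_antisymm ((bucket_mono (by omega)).trans hb.le) (bucket_mono hy)
      have h2 := ih h1
      have h3 : bucketState q (y + 1 + 1) = bucketStep q (y + 1) (bucketState q (y + 1)) := rfl
      unfold bucketStep at h3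
      split_ifs at h3 with h4
      · unfold bucket at hb h1
        rw [h3] at hb
        dsimp only at hb; omega
      · rw [h3, h2]
  have := bucketState_le (q := q) (y + 1)
  have := key y hy hb
  omega

/-- Division by `0` gives `0`, so for `q = 0` the bucket that starts at `s` also ends at `s`. Exact
tables are thus a special case. -/
theorem bucket_zero_inj {x y : ℕ} (h : bucket 0 x = bucket 0 y) : x = y := by
  wlog hxy : x ≤ y generalizing x y
  · exact (this h.symm (by omega)).symm
  obtain ⟨s, hs, h'⟩ := exists_bucket_start (q := 0) x
  have := h' y hxy h.symm
  simp at this; omega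

/-- If `s` is the start of the common bucket and `x ≤ y`, then `y ≤ s + s / q ≤ (1 + ε) * s ≤ (1 +
ε) * x`. -/
theorem bucket_ratio {ε : ℝ} (hq : 1 / ε ≤ q) (hε : 0 < ε) {x y : ℕ} (h : bucket q x = bucket q y) :
    (y : ℝ) ≤ (1 + ε) * x := by
  have hx : (0 : ℝ) ≤ x := Nat.cast_nonneg x
  rcases le_total y x with hxy | hxy
  · have : (y : ℝ) ≤ x := Nat.cast_le.mpr hxy
    nlinarith
  · obtain ⟨s, hs, h'⟩ := exists_bucket_start (q := q) x
    have h1 : (y : ℝ) ≤ s + (s / q : ℕ) := by exact_mod_cast h' y hxy h.symm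
    have h2 : ((s / q : ℕ) : ℝ) ≤ s / q := Nat.cast_div_le
    have hq0 : (0 : ℝ) < q := lt_of_lt_of_le (by positivity) hq
    have h3 : (s : ℝ) / q ≤ ε * s := by
      rw [div_le_iff₀ hq0]
      rw [div_le_iff₀ hε] at hq
      have : (0 : ℝ) ≤ s := Nat.cast_nonneg s
      nlinarith
    have h4 : (s : ℝ) ≤ x := Nat.cast_le.mpr hs
    nlinarith

/-- The bucket after the one that starts at `x` starts at `x + ⌊x / q⌋ + 1`, which is at least `x *
(1 + 1 / q)`. -/
theorem bucket_pow_le (hq : 0 < q) (x : ℕ) :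
    (1 + 1 / (q : ℝ)) ^ (bucketState q x).1 ≤ (bucketState q x).2 := by
  induction x with
  | zero => simp [bucketState]
  | succ x ih =>
    rw [bucketState, bucketStep]
    split_ifs with h
    · dsimp only
      rw [← h] at ih
      have hq' : (0 : ℝ) < q := Nat.cast_pos.mpr hq
      have h1 : (x : ℝ) / q ≤ (x / q : ℕ) + 1 := by
        rw [div_le_iff₀ hq']
        have := Nat.lt_div_mul_add hq (a := x)
        have h2 : x ≤ (x / q + 1) * q := by rw [add_mul, one_mul]; omega
        exact_mod_cast h2
      rw [pow_succ]
      calc _ ≤ (x : ℝ) * (1 + 1 / q) := by gcongr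
        _ = x + x / q := by ring
        _ ≤ x + ((x / q : ℕ) + 1) := by gcongr
        _ = _ := by push_cast; ring
    · exact ih

/-- Bucket number `k ≥ 1` starts at `(1 + 1 / q) ^ (k - 1)` or later; take logarithms. -/
theorem bucket_le_log (hq : 0 < q) {x : ℕ} (hx : 1 ≤ x) :
    (bucket q x : ℝ) ≤ 1 + Real.log x / Real.log (1 + 1 / (q : ℝ)) := by
  have hq' : (0 : ℝ) < q := Nat.cast_pos.mpr hq
  have h1 : 0 < Real.log (1 + 1 / (q : ℝ)) := Real.log_pos (by simp [hq'])
  have key : ∀ x, 1 ≤ x → bucket q x = 0 ∨ (1 + 1 / (q : ℝ)) ^ (bucket q x - 1) ≤ x := by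
    intro x hx
    induction x, hx using Nat.le_induction with
    | base => right; simp [bucket, bucketState, bucketStep]
    | succ x hx ih =>
      unfold bucket at *
      rw [bucketState, bucketStep]
      split_ifs with h
      · right
        have := bucket_pow_le hq (x + 1)
        rw [← h] at this
        simpa using this
      · exact ih.imp id fun h => h.trans (by simp)
  have hlog : 0 ≤ Real.log x := Real.log_natCast_nonneg x
  rcases key x hx with h | h
  · rw [h]; push_cast; positivity
  · have hpos : 1 ≤ bucket q x := by
      have : bucket q 1 ≤ bucket q x := bucket_mono hx
      have h2 : bucket q 1 = 1 := by simp [bucket, bucketState, bucketStep]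
      omega
    have := Real.log_le_log (by positivity) h
    rw [Real.log_pow] at this
    have h3 : ((bucket q x - 1 : ℕ) : ℝ) = bucket q x - 1 := by push_cast [hpos]; ring
    rw [h3, ← le_div_iff₀ h1] at this
    linarith

end Buckets

/-! ## Tables of solutions -/

/-- The power `e ^ a` of an expression. -/
def powOf (e : RamExpr) : ℕ → RamExpr
  | 0 => .const 1
  | a + 1 => .op .mul (powOf e a) e

theorem powOf_eval {w x : ℕ} {s : RamState} {e : RamExpr} (he : e.eval w s = x) (a : ℕ)
    (h : ∀ b ≤ a, x ^ b < 2 ^ w) : (powOf e a).eval w s = x ^ a := by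
  induction a with
  | zero => exact eval_const (by simpa using h 0 le_rfl)
  | succ a ih =>
    rw [pow_succ]
    exact eval_mul (ih fun b hb => h b (by omega)) he (by rw [← pow_succ]; exact h _ le_rfl)

/-- The number with the given digits in base `b`. -/
def digitsE (b : RamExpr) : List RamExpr → RamExpr
  | [] => .const 0
  | e :: es => .op .add e (.op .mul b (digitsE b es))

theorem digitsE_eval {w L : ℕ} {s : RamState} {b : RamExpr} (hb : b.eval w s = L) (hL : 2 ≤ L)
    (es : List RamExpr) (hes : ∀ e ∈ es, e.eval w s < L) (hw : L ^ es.length < 2 ^ w) :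
    (digitsE b es).eval w s = Nat.ofDigits L (es.map (RamExpr.eval w s)) := by
  induction es with
  | nil => simp [digitsE, RamExpr.eval]
  | cons e es ih =>
    have h1 : L ^ es.length < 2 ^ w :=
      lt_of_le_of_lt (Nat.pow_le_pow_right (by omega) (by simp)) hw
    have h2 : Nat.ofDigits L ((e :: es).map (RamExpr.eval w s)) < L ^ (e :: es).length := by
      refine (Nat.ofDigits_lt_base_pow_length (by omega) ?_).trans_eq (by simp)
      simpa using hes
    rw [List.map_cons, Nat.ofDigits_cons] at h2 ⊢
    have h3 : L * Nat.ofDigits L (es.map (RamExpr.eval w s)) < 2 ^ w := by omega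
    exact eval_add rfl (eval_mul hb (ih (fun e he => hes e (by simp [he])) h1) h3) (h2.trans hw)

/-- The address of a cell of a table, for the buckets `κ` of the frequencies. -/
def cellAddr {c : ℕ} (N L : ℕ) (κ : Fin c → ℕ) : ℕ :=
  N + 2 + Nat.ofDigits L (List.ofFn κ) * (c * N + 1)

/-- The length of a table. -/
def tableLen (c N L : ℕ) : ℕ := N + 2 + L ^ c * (c * N + 1)

theorem ofDigits_ofFn_lt {c L : ℕ} (hL : 2 ≤ L) {κ : Fin c → ℕ} (hκ : ∀ q, κ q < L) :
    Nat.ofDigits L (List.ofFn κ) < L ^ c := by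
  refine (Nat.ofDigits_lt_base_pow_length (by omega) ?_).trans_eq (by simp)
  simp only [List.mem_ofFn]; rintro x ⟨q, rfl⟩; exact hκ q

theorem cellAddr_lt {c N L : ℕ} (hL : 2 ≤ L) {κ : Fin c → ℕ} (hκ : ∀ q, κ q < L) :
    cellAddr N L κ + c * N < tableLen c N L := by
  have h := ofDigits_ofFn_lt hL hκ
  unfold cellAddr tableLen
  have : (Nat.ofDigits L (List.ofFn κ) + 1) * (c * N + 1) ≤ L ^ c * (c * N + 1) :=
    Nat.mul_le_mul_right _ h
  rw [add_mul, one_mul] at this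
  omega

theorem cellAddr_disjoint {c N L i j : ℕ} (hL : 2 ≤ L) {κ κ' : Fin c → ℕ} (hκ : ∀ q, κ q < L)
    (hκ' : ∀ q, κ' q < L) (hi : i ≤ c * N) (hj : j ≤ c * N)
    (h : cellAddr N L κ + i = cellAddr N L κ' + j) : κ = κ' := by
  have h1 := cell_inj (N := c * N + 1) (q := Nat.ofDigits L (List.ofFn κ))
    (q' := Nat.ofDigits L (List.ofFn κ')) (Nat.lt_succ_of_le hi) (Nat.lt_succ_of_le hj)
    (by unfold cellAddr at h; omega)
  refine List.ofFn_injective (Nat.ofDigits_inj_of_len_eq (b := L) (by omega) (by simp) ?_ ?_ h1.1)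
  all_goals simp only [List.mem_ofFn]; rintro x ⟨q, rfl⟩
  exacts [hκ q, hκ' q]

/-- The nodes stored in the cell at address `a` of a table. -/
def cellNodes (T : ℕ → ℕ) (a : ℕ) : List ℕ := (List.range (T a)).map fun j => T (a + 1 + j)

/-- A cell of the table `T` holds a solution with frequencies in the same buckets as `M`. -/
def CellGood {n c : ℕ} (H : CGraph n c) (N : ℕ) (β : ℕ → ℕ) (T : ℕ → ℕ) (M : Fin c → ℕ) : Prop :=
  ∃ M' : Fin c → ℕ, (∀ q, M' q ≤ N) ∧ (∀ q, β (M' q) = β (M q)) ∧ ∃ S, H.Solves M' S ∧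
    (cellNodes T (cellAddr N (β N + 1) fun q => β (M q))).Nodup ∧
    ∀ v, v ∈ cellNodes T (cellAddr N (β N + 1) fun q => β (M q)) ↔ v ∈ S

/-- The table begins with the largest frequency `N` and the buckets of all frequencies. -/
structure TableHead (N : ℕ) (β : ℕ → ℕ) (T : ℕ → ℕ) : Prop where
  size : T 0 = N
  bucket : ∀ m ≤ N, T (1 + m) = β m

/-- `T` is a table of solutions for the frequencies up to `N`, in buckets given by `β`. -/
structure IsTable {n c : ℕ} (H : CGraph n c) (N : ℕ) (β : ℕ → ℕ) (T : ℕ → ℕ) : Prop where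
  head : TableHead N β T
  le : ∀ i < tableLen c N (β N + 1), T i ≤ n
  cell : ∀ M : Fin c → ℕ, (∀ q, M q ≤ N) →
    (T (cellAddr N (β N + 1) fun q => β (M q)) = 0 ∧ ¬ ∃ S, H.Solves M S) ∨ CellGood H N β T M

section Expressions

variable (c : ℕ) (ld : RamExpr → RamExpr)

/-- The largest frequency, where `ld` reads from the table. -/
def topE : RamExpr := ld (.const 0)
/-- The bucket of a frequency. -/
def bucketE (e : RamExpr) : RamExpr := ld (.op .add (.const 1) e)
/-- The number of buckets. -/
def countE : RamExpr := .op .add (bucketE ld (topE ld)) (.const 1)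
/-- The number of words of a cell. -/
def widthE : RamExpr := .op .add (.op .mul (.const c) (topE ld)) (.const 1)
/-- The address of the cell for the frequencies in registers `0, …, c - 1`. -/
def addrE : RamExpr := .op .add (.op .add (topE ld) (.const 2))
  (.op .mul (digitsE (countE ld) (List.ofFn fun q : Fin c => bucketE ld (.reg q))) (widthE c ld))
/-- The length of the table. -/
def lenE : RamExpr := .op .add (.op .add (topE ld) (.const 2))
  (.op .mul (powOf (countE ld) c) (widthE c ld))

variable {c ld} {w N : ℕ} {β T : ℕ → ℕ} {s : RamState}

theorem tableLen_bounds {L : ℕ} (hL : 2 ≤ L) : N + 2 < tableLen c N L ∧ c * N + 1 < tableLen c N L ∧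
    L ^ c < tableLen c N L := by
  have h1 : 1 * (c * N + 1) ≤ L ^ c * (c * N + 1) := Nat.mul_le_mul_right _ (Nat.pow_pos (by omega))
  have h2 : L ^ c * 1 ≤ L ^ c * (c * N + 1) := Nat.mul_le_mul_left _ (by omega)
  have h3 : 0 < L ^ c := Nat.pow_pos (by omega)
  unfold tableLen
  omega

theorem topE_eval (hT : TableHead N β T)
    (hld : ∀ e i, e.eval w s = i → i < N + 2 → (ld e).eval w s = T i) :
    (topE ld).eval w s = N := by
  rw [topE, hld _ 0 (by simp [RamExpr.eval]) (by omega), hT.size]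

theorem bucketE_eval (hT : TableHead N β T) (hw : N + 2 < 2 ^ w)
    (hld : ∀ e i, e.eval w s = i → i < N + 2 → (ld e).eval w s = T i) {e : RamExpr} {m : ℕ}
    (he : e.eval w s = m) (hm : m ≤ N) : (bucketE ld e).eval w s = β m := by
  rw [bucketE, hld _ (1 + m) (eval_add (eval_const (by omega)) he (by omega)) (by omega),
    hT.bucket m hm]

theorem countE_eval (hT : TableHead N β T) (hw : N + 2 < 2 ^ w) (hβ : β N ≤ N)
    (hld : ∀ e i, e.eval w s = i → i < N + 2 → (ld e).eval w s = T i) :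
    (countE ld).eval w s = β N + 1 :=
  eval_add (bucketE_eval hT hw hld (topE_eval hT hld) le_rfl) (eval_const (by omega)) (by omega)

theorem widthE_eval (hT : TableHead N β T) (hw : c * N + 1 < 2 ^ w) (hcw : c < 2 ^ w)
    (hld : ∀ e i, e.eval w s = i → i < N + 2 → (ld e).eval w s = T i) :
    (widthE c ld).eval w s = c * N + 1 :=
  eval_add (eval_mul (eval_const hcw) (topE_eval hT hld) (by omega))
    (eval_const (by omega)) (by omega)

theorem lt_of_tableLen {x L : ℕ} (hL : 2 ≤ L) (hw : tableLen c N L < 2 ^ w)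
    (hx : x = c ∨ x ≤ N + 2 ∨ x ≤ c * N + 1 ∨ x ≤ L ^ c) : x < 2 ^ w := by
  obtain ⟨h1, h2, h3⟩ := tableLen_bounds (c := c) (N := N) hL
  have : c < L ^ c := Nat.lt_pow_self (by omega)
  omega

/-- The size of the expression depends on `c` only, so an address costs constant time. The loader
`ld` is a parameter because the table lies at address `0` in a query, but behind the relations while
it is built. -/
theorem addrE_eval (hT : TableHead N β T) (hL : 1 ≤ β N) (hβ : β N ≤ N)
    (hmono : ∀ x ≤ N, β x ≤ β N) (hw : tableLen c N (β N + 1) < 2 ^ w)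
    (hld : ∀ e i, e.eval w s = i → i < N + 2 → (ld e).eval w s = T i)
    (hM : ∀ q : Fin c, s.regs q ≤ N) :
    (addrE c ld).eval w s = cellAddr N (β N + 1) fun q : Fin c => β (s.regs q) := by
  have hL' : 2 ≤ β N + 1 := by omega
  have h1 := lt_of_tableLen hL' hw (.inr (.inl le_rfl))
  have hb : ∀ q : Fin c, (bucketE ld (.reg q)).eval w s = β (s.regs q) :=
    fun q => bucketE_eval hT h1 hld rfl (hM q)
  have hlt := cellAddr_lt (N := N) hL' (κ := fun q : Fin c => β (s.regs q))
    (fun q => Nat.lt_succ_of_le (hmono _ (hM q)))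
  have hd : (digitsE (countE ld) (List.ofFn fun q : Fin c => bucketE ld (.reg q))).eval w s =
      Nat.ofDigits (β N + 1) (List.ofFn fun q : Fin c => β (s.regs q)) := by
    rw [digitsE_eval (countE_eval hT h1 hβ hld) hL', List.map_ofFn]
    · congr 2; funext q; exact hb q
    · simp only [List.mem_ofFn]
      rintro e ⟨q, rfl⟩
      rw [hb]; exact Nat.lt_succ_of_le (hmono _ (hM q))
    · rw [List.length_ofFn]; exact lt_of_tableLen hL' hw (.inr (.inr (.inr le_rfl)))
  have h2 := hlt
  unfold cellAddr at h2
  exact eval_add (eval_add (topE_eval hT hld) (eval_const (by omega)) h1)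
    (eval_mul hd (widthE_eval hT (lt_of_tableLen hL' hw (.inr (.inr (.inl le_rfl))))
      (lt_of_tableLen hL' hw (.inl rfl)) hld) (by omega)) (by omega)

theorem lenE_eval (hT : TableHead N β T) (hL : 1 ≤ β N) (hβ : β N ≤ N)
    (hw : tableLen c N (β N + 1) < 2 ^ w)
    (hld : ∀ e i, e.eval w s = i → i < N + 2 → (ld e).eval w s = T i) :
    (lenE c ld).eval w s = tableLen c N (β N + 1) := by
  have hL' : 2 ≤ β N + 1 := by omega
  have h1 := lt_of_tableLen hL' hw (.inr (.inl le_rfl))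
  have h2 := hw
  unfold tableLen at h2
  refine eval_add (eval_add (topE_eval hT hld) (eval_const (by omega)) h1)
    (eval_mul (powOf_eval (countE_eval hT h1 hβ hld) c fun b hb => ?_)
      (widthE_eval hT (lt_of_tableLen hL' hw (.inr (.inr (.inl le_rfl))))
      (lt_of_tableLen hL' hw (.inl rfl)) hld) (by omega)) (by omega)
  exact lt_of_tableLen hL' hw (.inr (.inr (.inr (Nat.pow_le_pow_right (by omega) hb))))

/-- Whether one of the registers `0, …, c - 1` exceeds the value of `e`. -/
def exceedsE (c : ℕ) (e : RamExpr) : RamExpr :=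
  (List.range c).foldr (fun q f => .op .or (.op .lt e (.reg q)) f) (.const 0)

open Classical in
theorem exceedsE_eval {e : RamExpr} {x : ℕ} (he : e.eval w s = x) (hw : 1 < 2 ^ w) :
    (exceedsE c e).eval w s = if ∃ q : Fin c, x < s.regs q then 1 else 0 := by
  have key : ∀ L : List ℕ, (L.foldr (fun q f => RamExpr.op .or (.op .lt e (.reg q)) f)
      (.const 0)).eval w s = if ∃ q ∈ L, x < s.regs q then 1 else 0 := by
    intro L
    induction L with
    | nil => simp [RamExpr.eval]
    | cons q L ih =>
      rw [List.foldr_cons, eval_or (p := x < s.regs q) (q := ∃ q ∈ L, x < s.regs q)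
        (eval_lt he eval_reg hw) ih hw]
      simp
  rw [exceedsE, key]
  congr 1
  simp only [List.mem_range, eq_iff_iff]
  exact ⟨fun ⟨q, hq, h⟩ => ⟨⟨q, hq⟩, h⟩, fun ⟨q, h⟩ => ⟨q, q.2, h⟩⟩

end Expressions

/-! ## Looking up solutions in a table -/

section Lookup

variable (c : ℕ)

/-- List the nodes in the cell whose address is in register `c + 5`. -/
def emitCell : RamProg :=
  .seq (.assign (c + 6) (.op .add (.reg (c + 5)) (.load (.reg (c + 5)))))
    (.loop (.op .lt (.reg (c + 5)) (.reg (c + 6)))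
      (.seq (.assign (c + 5) (.op .add (.reg (c + 5)) (.const 1))) (.emit (.load (.reg (c + 5))))))

/-- Look up the frequencies in registers `0, …, c - 1` in a table at address `0`. -/
def lookupP : RamProg := .seq (.assign (c + 5) (addrE c .load)) (emitCell c)

/-- Look up the frequencies in the table, or run the program `F` if one of them is too large. -/
def queryP (F : RamProg) : RamProg := .ite (exceedsE c (topE .load)) F (lookupP c)

variable {c}

/-- This loop is a plain word-RAM loop, not a bounded-loop program: its number of rounds must be the
length of the list, not a power of `n + 1`, for the query time to be linear in the output. -/
theorem emitCell_exec {w : ℕ} {s : RamState} {a : ℕ} (ha : s.regs (c + 5) = a)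
    (hw : a + s.mem a < 2 ^ w) (hw1 : 1 < 2 ^ w) :
    ∃ t s', RamExec w (emitCell c) s t s' ∧ t ≤ 20 + 20 * s.mem a ∧
      s'.out = s.out ++ cellNodes s.mem a ∧ s'.mem = s.mem := by
  have key : ∀ (k i : ℕ) (u : RamState), i + k = s.mem a → u.regs (c + 5) = a + i →
      u.regs (c + 6) = a + s.mem a → u.mem = s.mem →
      ∃ t u', RamExec w (.loop (.op .lt (.reg (c + 5)) (.reg (c + 6)))
        (.seq (.assign (c + 5) (.op .add (.reg (c + 5)) (.const 1)))
          (.emit (.load (.reg (c + 5)))))) u t u' ∧ t ≤ 4 + 20 * k ∧ u'.mem = s.mem ∧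
        u'.out = u.out ++ (List.range k).map fun j => s.mem (a + 1 + (i + j)) := by
    intro k
    induction k with
    | zero =>
      intro i u hi h1 h2 h3
      refine ⟨_, u, .loop_false ?_, by simp [RamExpr.cost], h3, by simp⟩
      rw [eval_lt (eval_reg.trans h1) (eval_reg.trans h2) hw1, if_neg (by omega)]
    | succ k ih =>
      intro i u hi h1 h2 h3
      have hv : (RamExpr.op .add (.reg (c + 5)) (.const 1)).eval w u = a + (i + 1) :=
        (eval_add (eval_reg.trans h1) (eval_const hw1) (by omega)).trans (by omega)
      have e1 := RamExec.assign (w := w) (c + 5) (.op .add (.reg (c + 5)) (.const 1)) u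
      rw [hv] at e1
      obtain ⟨t, u', e2, ht, hm, ho⟩ := ih (i + 1)
        ⟨Function.update u.regs (c + 5) (a + (i + 1)), u.mem, u.out ++ [s.mem (a + (i + 1))]⟩ (by omega)
        (by simp) (by simp [h2]) h3
      have e3 := RamExec.emit (w := w) (.load (.reg (c + 5)))
        ⟨Function.update u.regs (c + 5) (a + (i + 1)), u.mem, u.out⟩
      simp only [RamExpr.eval, Function.update_self, h3] at e3
      simp only [h3] at e1 e2
      refine ⟨_, u', .loop_true ?_ (.seq e1 e3) e2, ?_, hm, ?_⟩
      · rw [eval_lt (eval_reg.trans h1) (eval_reg.trans h2) hw1, if_pos (by omega)]; simp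
      · simp only [RamExpr.cost]; omega
      · rw [ho, List.range_succ_eq_map, List.map_cons, List.map_map]
        simp only [List.append_assoc, List.singleton_append, Function.comp_def]
        congr 2
        · congr 1; omega
        · refine List.map_congr_left fun j _ => ?_
          congr 1; omega
  have hv : (RamExpr.op .add (.reg (c + 5)) (.load (.reg (c + 5)))).eval w s = a + s.mem a :=
    eval_add (eval_reg.trans ha) (eval_load (eval_reg.trans ha)) hw
  have e1 := RamExec.assign (w := w) (c + 6) (.op .add (.reg (c + 5)) (.load (.reg (c + 5)))) s
  rw [hv] at e1
  obtain ⟨t, u', e2, ht, hm, ho⟩ := key (s.mem a) 0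
    ⟨Function.update s.regs (c + 6) (a + s.mem a), s.mem, s.out⟩ (by omega) (by simp [ha]) (by simp) rfl
  refine ⟨_, u', .seq e1 e2, ?_, ?_, hm⟩
  · simp only [RamExpr.cost]; omega
  · rw [ho, cellNodes]; simp

theorem cellNodes_congr {T T' : ℕ → ℕ} {a len : ℕ} (h : ∀ i < len, T' i = T i) (ha : a < len)
    (hl : a + T a < len) : cellNodes T' a = cellNodes T a := by
  unfold cellNodes
  rw [h a ha]
  refine List.map_congr_left fun j hj => h _ ?_
  rw [List.mem_range] at hj; omega

variable {w n N : ℕ} {β T : ℕ → ℕ} {H : CGraph n c}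

theorem queryP_exec_lookup (hT : IsTable H N β T) (hL : 1 ≤ β N) (hβ : β N ≤ N)
    (hmono : ∀ x ≤ N, β x ≤ β N) (hw : tableLen c N (β N + 1) < 2 ^ w)
    (hcol : ∀ v < n, ∃! q, H.col v q) (F : RamProg) {M : Fin c → ℕ} (hM : ∀ q, M q ≤ N)
    {s : RamState} (hs : ∀ q : Fin c, s.regs q = M q) (hmem : ∀ i < tableLen c N (β N + 1), s.mem i = T i) :
    ∃ t s', RamExec w (queryP c F) s t s' ∧
      t ≤ (exceedsE c (topE .load)).cost + (addrE c .load).cost + 22 +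
        20 * T (cellAddr N (β N + 1) fun q => β (M q)) ∧
      s'.out = s.out ++ cellNodes T (cellAddr N (β N + 1) fun q => β (M q)) ∧ s'.mem = s.mem := by
  have hL' : 2 ≤ β N + 1 := by omega
  obtain ⟨hb1, -, -⟩ := tableLen_bounds (c := c) (N := N) hL'
  have hw1 : 1 < 2 ^ w := by omega
  have hld : ∀ (u : RamState), u.mem = s.mem → ∀ e i, e.eval w u = i → i < N + 2 →
      (RamExpr.load e).eval w u = T i := fun u hu e i he hi => by
    rw [eval_load he, hu, hmem i (by omega)]
  have ha := addrE_eval hT.head hL hβ hmono hw (hld s rfl) (fun q : Fin c => by rw [hs]; exact hM q)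
  simp only [hs] at ha
  have hlt := cellAddr_lt (N := N) hL' (κ := fun q : Fin c => β (M q))
    (fun q => Nat.lt_succ_of_le (hmono _ (hM q)))
  -- A stored solution has at most `N` nodes of each colour. Hence the list stays inside its cell,
  -- and no address overflows.
  have hsz : T (cellAddr N (β N + 1) fun q => β (M q)) ≤ c * N := by
    rcases hT.cell M hM with h | ⟨M', hM', -, S, hS, hnd, hmemS⟩
    · omega
    · have h1 := card_of_solves hcol hS
      have h2 : (cellNodes T (cellAddr N (β N + 1) fun q => β (M q))).toFinset = S := by
        ext v; rw [List.mem_toFinset, hmemS]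
      rw [← h2, List.toFinset_card_of_nodup hnd] at h1
      have h3 : ∑ q, M' q ≤ ∑ _q : Fin c, N := Finset.sum_le_sum fun q _ => hM' q
      simp [cellNodes] at h1 h3
      omega
  set a := cellAddr N (β N + 1) fun q => β (M q)
  have e0 := RamExec.assign (w := w) (c + 5) (addrE c .load) s
  rw [ha] at e0
  have hma : s.mem a = T a := hmem a (by omega)
  obtain ⟨t, s', e1, ht, ho, hm⟩ := emitCell_exec (c := c) (w := w)
    (s := ⟨Function.update s.regs (c + 5) a, s.mem, s.out⟩) (a := a) (by simp)
    (by dsimp only; omega) hw1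
  dsimp only at ht ho
  refine ⟨_, s', .ite_false ?_ (.seq e0 e1), by omega, ?_, hm⟩
  · rw [exceedsE_eval (topE_eval hT.head (hld s rfl)) hw1, if_neg]
    rintro ⟨q, hq⟩
    rw [hs] at hq
    have := hM q
    omega
  · rw [ho, cellNodes_congr hmem (by omega) (by omega)]

end Lookup

/-! ## Filling relations and tables -/

theorem Prog.run_seq (w D : ℕ) (p q : Prog) (s : RamState) :
    (Prog.seq p q).run w D s = q.run w D (p.run w D s) := rfl

/-- The memory region after the relations. -/
def tab (d A Q : ℕ) (mem : ℕ → ℕ) (i : ℕ) : ℕ := mem (Q * d ^ A + i)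

section Tab

variable {X : Set ℕ} {d A Q : ℕ} {s s' : RamState}

theorem Frame.tab (h : Frame X d A Q s s') : tab d A Q s'.mem = tab d A Q s.mem :=
  funext fun i => h.mem _ (.inr (by omega))

theorem tab_setMem (i v : ℕ) :
    tab d A Q (s.setMem (Q * d ^ A + i) v).mem = Function.update (tab d A Q s.mem) i v := by
  ext j
  simp [tab, Function.update_apply]

end Tab

section Fill

variable {w d A R Q D : ℕ}

/-- Insert all tuples which satisfy the condition `e` into the relation `q`. -/
def fillP (D A q : ℕ) (xs : List ℕ) (e : RamExpr) : Prog :=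
  (Prog.ite e (.store (cellE D A q (hornerE D xs)) (.const 1)) .skip).forAll xs

theorem keeps_fillP {q x : ℕ} {xs : List ℕ} {e : RamExpr} (hx : x ∉ xs) :
    (fillP D A q xs e).Keeps x := by
  simp [fillP, hx, Prog.Keeps]

theorem wf_fillP {q : ℕ} {xs : List ℕ} {e : RamExpr} (hn : xs.Nodup) (hD : D ∉ xs) :
    (fillP D A q xs e).Wf D :=
  Prog.wf_forAll hn hD (fun _ _ => ⟨trivial, trivial⟩) ⟨trivial, trivial⟩ ⟨trivial, trivial⟩

/-- The upper bound on the new relation is an invariant of the loops, the lower bound comes from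
`forAll_hit`. The test `e` need only be right in states which differ from `s` within the frame, for
these are the states in which it is evaluated. -/
theorem fillP_spec (h : Fits w d A R) (hQ : Q ≤ R) {q : ℕ} (hq : 1 ≤ q) (hqQ : q < Q) {xs : List ℕ}
    (hn : xs.Nodup) (hD : D ∉ xs) (hlen : xs.length ≤ A) (hdw : d < 2 ^ w) (s : RamState)
    (hd : s.regs D = d) {e : RamExpr} (P : (ℕ → ℕ) → Prop)
    (hP : ∀ σ τ, (∀ x ∈ xs, σ x = τ x) → P σ → P τ)
    (he : ∀ u, Frame {x | x ∈ xs} d A Q s u → (∀ x ∈ xs, u.regs x < d) →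
      (e.eval w u ≠ 0 ↔ P u.regs)) :
    Frame {x | x ∈ xs} d A Q s ((fillP D A q xs e).run w D s) ∧
    dbOf d A Q ((fillP D A q xs e).run w D s).mem = dbOf d A Q s.mem ∪
      {f | f.1 = q ∧ ∃ σ : ℕ → ℕ, (∀ x ∈ xs, σ x < d) ∧ P σ ∧ f.2 = Nat.ofDigits d (xs.map σ)} := by
  set N := {f : ℕ × ℕ | f.1 = q ∧ ∃ σ : ℕ → ℕ, (∀ x ∈ xs, σ x < d) ∧ P σ ∧
    f.2 = Nat.ofDigits d (xs.map σ)} with hN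
  set p := Prog.ite e (.store (cellE D A q (hornerE D xs)) (.const 1)) .skip with hp
  have h1 : 1 < 2 ^ w := by have := h.two_le; omega
  have run : ∀ u : RamState, u.regs D = d → (∀ x ∈ xs, u.regs x < d) → p.run w D u =
      if e.eval w u ≠ 0 then u.setMem (q * d ^ A + Nat.ofDigits d (xs.map u.regs)) 1 else u := by
    intro u hu hux
    have hl : Nat.ofDigits d (xs.map u.regs) < d ^ A :=
      ofDigits_lt h.two_le (by simpa using hux) (by simpa using hlen)
    rw [hp]
    simp only [Prog.run]
    rw [cellE_eval h u hu (by omega) _ (hornerE_eval h u hu xs hux hlen) hl, eval_const h1]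
  have step : ∀ u, Frame {x | x ∈ xs} d A Q s u → u.regs D = d → (∀ x ∈ xs, u.regs x < d) →
      Frame {x | x ∈ xs} d A Q s (p.run w D u) ∧ dbOf d A Q (p.run w D u).mem =
        dbOf d A Q u.mem ∪ {f | P u.regs ∧ f = (q, Nat.ofDigits d (xs.map u.regs))} := by
    intro u hu hud hux
    have hl : Nat.ofDigits d (xs.map u.regs) < d ^ A :=
      ofDigits_lt h.two_le (by simpa using hux) (by simpa using hlen)
    rw [run u hud hux]
    by_cases hPu : P u.regs
    · rw [if_pos ((he u hu hux).mpr hPu)]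
      refine ⟨hu.setMem hq hqQ hl 1, ?_⟩
      rw [dbOf_setMem hq hqQ hl _ _ one_ne_zero]
      ext f; simp [hPu, or_comm]
    · rw [if_neg fun h => hPu ((he u hu hux).mp h)]
      exact ⟨hu, by simp [hPu]⟩
  have kx : ∀ x ∈ xs, p.Keeps x := fun _ _ => ⟨trivial, trivial⟩
  have kD : p.Keeps D := ⟨trivial, trivial⟩
  have inv := Prog.forAll_inv (w := w) hn hD kx kD hdw
    (fun u => Frame {x | x ∈ xs} d A Q s u ∧ dbOf d A Q s.mem ⊆ dbOf d A Q u.mem ∧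
      dbOf d A Q u.mem ⊆ dbOf d A Q s.mem ∪ N)
    (fun u x hx v hu => ⟨hu.1.setReg hx v, hu.2⟩) (fun u hu hud hux => by
      obtain ⟨s1, s2⟩ := step u hu.1 hud hux
      refine ⟨s1, ?_, ?_⟩ <;> rw [s2]
      · exact hu.2.1.trans Set.subset_union_left
      · refine Set.union_subset hu.2.2 ?_
        rintro f ⟨hPu, rfl⟩
        exact .inr ⟨rfl, u.regs, hux, hPu, rfl⟩) s hd
    ⟨Frame.refl s, subset_rfl, Set.subset_union_left⟩
  refine ⟨inv.1, Set.Subset.antisymm inv.2.2 (Set.union_subset inv.2.1 ?_)⟩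
  rintro ⟨q', i⟩ ⟨h2, σ, hσ, hPσ, h3⟩
  dsimp only at h2 h3
  subst h2 h3
  refine Prog.forAll_hit (w := w) hn hD kx kD hdw (fun u => Frame {x | x ∈ xs} d A Q s u)
    (fun u => (q', Nat.ofDigits d (xs.map σ)) ∈ dbOf d A Q u.mem) (fun u x hx v hu => hu.setReg hx v)
    (fun u hu hud hux => (step u hu hud hux).1) (fun u x hx v hu => hu)
    (fun u hu hPu hud hux => by rw [(step u hu hud hux).2]; exact .inl hPu) σ hσ
    (fun u hu hud hux => ?_) s hd (Frame.refl s)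
  rw [(step u hu hud fun x hx => by rw [hux x hx]; exact hσ x hx).2]
  refine .inr ⟨hP σ _ (fun x hx => (hux x hx).symm) hPσ, ?_⟩
  rw [List.map_congr_left hux]

end Fill

/-! ## Reading the input graph -/

section Read

variable (c A : ℕ)

/-- The entry of the adjacency matrix for the nodes in registers `c + 5` and `c + 6`. -/
def adjE : RamExpr :=
  .op .mul (.op .and (.op .lt (.reg (c + 5)) (.reg (rN c))) (.op .lt (.reg (c + 6)) (.reg (rN c))))
    (.load (.op .add (.op .add (.op .add (.const 1) (.reg (rN c)))
      (.op .mul (.reg (c + 5)) (.reg (rN c)))) (.reg (c + 6))))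

/-- Whether the node in register `c + 5` has colour `q`. -/
def colE (q : ℕ) : RamExpr :=
  .op .and (.op .lt (.reg (c + 5)) (.reg (rN c)))
    (.op .eq (.load (.op .add (.const 1) (.reg (c + 5)))) (.const q))

/-- Store the relations of the input graph. -/
def readP : Prog :=
  .seq (.assign (rN c) (.load (.const 0))) (.seq (fillP c A qAdj [c + 5, c + 6] (adjE c))
    (.seqs ((List.range c).map fun q => fillP c A (2 + q) [c + 5] (colE c q))))

/-- The auxiliary registers. -/
def auxRegs (c : ℕ) : Set ℕ := {x | c + 5 ≤ x ∧ x < c + 16}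

variable {c A}

theorem wf_readP : (readP c A).Wf c ∧ (readP c A).Keeps c := by
  have h1 : c ≠ rN c := by simp only [layout]; omega
  have h2 : ∀ q : ℕ, (fillP c A (2 + q) [c + 5] (colE c q)).Keeps c := fun q => keeps_fillP (by simp)
  have h3 : (fillP c A qAdj [c + 5, c + 6] (adjE c)).Keeps c := keeps_fillP (by simp)
  have h4 : (Prog.seqs ((List.range c).map fun q => fillP c A (2 + q) [c + 5] (colE c q))).Keeps c := by
    simp [h2]
  refine ⟨⟨h1, trivial, h3, wf_fillP (by simp) (by simp), Prog.wf_seqs ?_ ?_⟩, h1, h3, h4⟩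
  · simp [h2]
  · simp only [List.mem_map]; rintro p ⟨q, -, rfl⟩; exact wf_fillP (by simp) (by simp)

theorem rn_notin_auxRegs {x : ℕ} (h : x < c + 5) : x ∉ auxRegs c := by
  simp only [auxRegs, Set.mem_ofPred_eq]; omega

variable {w n t : ℕ} {G : SimpleGraph (Fin n)} {col : Fin n → Fin c}

theorem graphMem_adj {u v : ℕ} (hu : u < n) (hv : v < n) :
    graphMem G col (1 + n + u * n + v) = 1 ∧ gAdj G u v ∨
      graphMem G col (1 + n + u * n + v) = 0 ∧ ¬ gAdj G u v := by
  classical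
  unfold graphMem
  rw [if_neg (by omega), dif_neg (by omega)]
  have key : (∃ u' v' : Fin n, G.Adj u' v' ∧ 1 + n + u * n + v = 1 + n + u' * n + v') ↔ gAdj G u v := by
    constructor
    · rintro ⟨u', v', h, e⟩
      obtain ⟨rfl, rfl⟩ := cell_inj (N := n) hv v'.2 (show u * n + v = u' * n + v' by omega)
      exact ⟨u'.2, v'.2, h⟩
    · rintro ⟨_, _, h⟩
      exact ⟨_, _, h, rfl⟩
  by_cases h : gAdj G u v
  · rw [if_pos (key.mpr h)]; exact .inl ⟨rfl, h⟩
  · rw [if_neg fun h' => h (key.mp h')]; exact .inr ⟨rfl, h⟩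

theorem graphMem_col {v : ℕ} (hv : v < n) : graphMem G col (1 + v) = col ⟨v, hv⟩ := by
  unfold graphMem
  rw [if_neg (by omega), dif_pos (by omega)]
  congr 2
  ext; simp

/-- The memory behind the input is zero, so all relations and the table start out empty. -/
theorem graphMem_zero {a : ℕ} (ha : 1 + n + n * n ≤ a) : graphMem G col a = 0 := by
  classical
  unfold graphMem
  rw [if_neg (by omega), dif_neg (by omega), if_neg]
  rintro ⟨u, v, -, e⟩
  have h1 : (u + 1) * n ≤ n * n := Nat.mul_le_mul_right _ u.2
  have h2 := v.2
  rw [add_mul] at h1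
  omega

theorem input_lt (hn : 1 ≤ n) (hA : 3 ≤ A) : 1 + n + n * n < (n + 1) ^ A := by
  have h1 : (n + 1) ^ 3 ≤ (n + 1) ^ A := Nat.pow_le_pow_right (by omega) hA
  have h2 : (n + 1) ^ 3 = n * n * n + 3 * (n * n) + 3 * n + 1 := by ring
  omega

/-- The last clause, that nothing else is stored, is needed to count the tuples which the linear
index has to keep. -/
theorem readP_spec (hn : 1 ≤ n) (hA : t + c + 4 ≤ A) (hw : (n + 1) ^ (A + qTot c t + 1) < 2 ^ w)
    (s : RamState) (hd : s.regs c = n + 1) (hs : s.mem = graphMem G col) :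
    Frame {x | x = rN c ∨ x ∈ auxRegs c} (n + 1) A (qTot c t) s ((readP c A).run w c s) ∧
    ((readP c A).run w c s).regs (rN c) = n ∧
    GraphStored (graphOf G col) (dbOf (n + 1) A (qTot c t) ((readP c A).run w c s).mem) ∧
    ∀ e ∈ dbOf (n + 1) A (qTot c t) ((readP c A).run w c s).mem,
      (∃ u v, gAdj G u v ∧ e = (qAdj, Nat.ofDigits (n + 1) [u, v])) ∨
      ∃ v q, (graphOf G col).col v q ∧ e = (qCol c q, v) := by
  have hf := fits_of_lt (Q := qTot c t) (by omega) hw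
  have hQ : qTot c t ≤ qTot c t + 1 := by omega
  have hin := input_lt hn (show 3 ≤ A by omega)
  have hpw := hf.pow_lt
  have hnw : n + 1 < 2 ^ w := by
    have := Nat.le_self_pow (n := A) (by omega) (n + 1); omega
  have hqA : qAdj < qTot c t := by simp only [layout]; omega
  have hqc : ∀ q < c, 2 + q < qTot c t := fun q hq => by simp only [layout]; omega
  set s0 : RamState := (Prog.assign (rN c) (.load (.const 0))).run w c s with hs0
  have hN0 : s0.regs (rN c) = n := by
    rw [hs0, Prog.run, RamState.setReg_regs, if_pos rfl, eval_load (x := 0) (by simp [RamExpr.eval]), hs]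
    simp [graphMem]
  have hmem0 : s0.mem = graphMem G col := hs
  have hd0 : s0.regs c = n + 1 := by
    rw [hs0, Prog.run, RamState.setReg_regs, if_neg (by simp only [layout]; omega), hd]
  have hdb0 : dbOf (n + 1) A (qTot c t) s0.mem = ∅ := by
    ext ⟨q, i⟩
    simp only [dbOf, Set.mem_ofPred_eq, Set.mem_empty_iff_false, iff_false]
    rintro ⟨h1, -, -, h4⟩
    refine h4 ?_
    rw [hmem0]
    have : 1 * (n + 1) ^ A ≤ q * (n + 1) ^ A := Nat.mul_le_mul_right _ h1
    exact graphMem_zero (by omega)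
  have hreg : ∀ u, Frame {x | x = rN c ∨ x ∈ auxRegs c} (n + 1) A (qTot c t) s u →
      ∀ a, a ≤ 1 + n + n * n → u.mem a = graphMem G col a := fun u hu a ha => by
    rw [hu.mem a (.inl (by omega)), hs]
  have f0 : Frame {x | x = rN c ∨ x ∈ auxRegs c} (n + 1) A (qTot c t) s s0 :=
    (Frame.refl s).setReg (.inl rfl) _
  have sub2 : {x | x ∈ [c + 5, c + 6]} ⊆ {x | x = rN c ∨ x ∈ auxRegs c} := by
    intro x hx
    simp only [List.mem_cons, List.not_mem_nil, or_false, Set.mem_ofPred_eq] at hx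
    refine .inr ?_
    simp only [auxRegs, Set.mem_ofPred_eq]; omega
  have sub1 : {x | x ∈ [c + 5]} ⊆ {x | x = rN c ∨ x ∈ auxRegs c} := by
    intro x hx
    exact sub2 (by simp only [List.mem_cons, List.not_mem_nil, or_false, Set.mem_ofPred_eq] at hx ⊢; omega)
  obtain ⟨f1, e1⟩ := fillP_spec (w := w) (e := adjE c) hf hQ (q := qAdj) (xs := [c + 5, c + 6])
    (by simp [layout]) hqA (by simp) (by simp) (by simp; omega) hnw s0 hd0
    (fun σ => gAdj G (σ (c + 5)) (σ (c + 6))) (by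
      intro σ τ h hσ
      rw [← h (c + 5) (by simp), ← h (c + 6) (by simp)]; exact hσ) (by
      intro u hu hux
      have h5 : u.regs (c + 5) ≤ n := Nat.lt_succ_iff.mp (hux _ (by simp))
      have h6 : u.regs (c + 6) ≤ n := Nat.lt_succ_iff.mp (hux _ (by simp))
      have hNu : u.regs (rN c) = n := by
        rw [hu.regs _ (by simp [layout]), hN0]
      have h7 : u.regs (c + 5) * n ≤ n * n := Nat.mul_le_mul_right _ h5
      have hld : (RamExpr.load (.op .add (.op .add (.op .add (.const 1) (.reg (rN c)))
          (.op .mul (.reg (c + 5)) (.reg (rN c)))) (.reg (c + 6)))).eval w u =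
          u.mem (1 + n + u.regs (c + 5) * n + u.regs (c + 6)) := by
        have : 2 * (n + 1) ^ A ≤ (n + 1) ^ (A + qTot c t + 1) := by
          calc 2 * (n + 1) ^ A ≤ (n + 1) * (n + 1) ^ A := Nat.mul_le_mul_right _ (by omega)
            _ = (n + 1) ^ (A + 1) := by ring
            _ ≤ _ := Nat.pow_le_pow_right (by omega) (by omega)
        exact eval_load (eval_add (eval_add (eval_add (eval_const (by omega)) hNu (by omega))
          (eval_mul rfl hNu (by omega)) (by omega)) rfl (by omega))
      have hand : (RamExpr.op .and (.op .lt (.reg (c + 5)) (.reg (rN c)))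
          (.op .lt (.reg (c + 6)) (.reg (rN c)))).eval w u =
          if u.regs (c + 5) < n ∧ u.regs (c + 6) < n then 1 else 0 := by
        rw [eval_and (p := u.regs (c + 5) < n) (q := u.regs (c + 6) < n)
          (eval_lt (w := w) (a := .reg (c + 5)) (b := .reg (rN c)) rfl hNu (by omega))
          (eval_lt (w := w) (a := .reg (c + 6)) (b := .reg (rN c)) rfl hNu (by omega)) (by omega)]
      by_cases hlt : u.regs (c + 5) < n ∧ u.regs (c + 6) < n
      · rw [if_pos hlt] at hand
        have h8 : (u.regs (c + 5) + 1) * n ≤ n * n := Nat.mul_le_mul_right _ hlt.1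
        rw [add_mul] at h8
        have hm : u.mem (1 + n + u.regs (c + 5) * n + u.regs (c + 6)) =
            graphMem G col (1 + n + u.regs (c + 5) * n + u.regs (c + 6)) :=
          hreg u (f0.trans (hu.mono sub2)) _ (by omega)
        rw [hm] at hld
        rcases graphMem_adj (G := G) (col := col) hlt.1 hlt.2 with ⟨g1, g2⟩ | ⟨g1, g2⟩
        · rw [adjE, eval_mul hand (hld.trans g1) (by omega)]; simp [g2]
        · rw [adjE, eval_mul hand (hld.trans g1) (by omega)]; simp [g2]
      · rw [if_neg hlt] at hand
        rw [adjE, eval_mul hand rfl (by omega), zero_mul]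
        simp only [ne_eq, not_true_eq_false, false_iff]
        exact fun ⟨a, b, _⟩ => hlt ⟨a, b⟩)
  set s1 := (fillP c A qAdj [c + 5, c + 6] (adjE c)).run w c s0 with hs1
  replace f1 := f0.trans (f1.mono sub2)
  have hc5 : ∀ u, Frame {x | x = rN c ∨ x ∈ auxRegs c} (n + 1) A (qTot c t) s u →
      u.regs (rN c) = n → u.regs c = n + 1 → ∀ q < c,
      Frame {x | x ∈ [c + 5]} (n + 1) A (qTot c t) u ((fillP c A (2 + q) [c + 5] (colE c q)).run w c u) ∧
      dbOf (n + 1) A (qTot c t) ((fillP c A (2 + q) [c + 5] (colE c q)).run w c u).mem =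
        dbOf (n + 1) A (qTot c t) u.mem ∪ {f | f.1 = 2 + q ∧ ∃ h : f.2 < n, (col ⟨f.2, h⟩ : ℕ) = q} := by
    intro u hu huN hud q hq
    obtain ⟨g1, g2⟩ := fillP_spec (w := w) (e := colE c q) hf hQ (q := 2 + q) (xs := [c + 5])
      (by omega) (hqc q hq) (by simp) (by simp) (by simp; omega) hnw u hud
      (fun σ => ∃ h : σ (c + 5) < n, (col ⟨σ (c + 5), h⟩ : ℕ) = q) (by
        intro σ τ h hσ
        have := h (c + 5) (by simp)
        simp only [← this]; exact hσ) (by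
        intro v hv hvx
        have h5 : v.regs (c + 5) ≤ n := Nat.lt_succ_iff.mp (hvx _ (by simp))
        have hNv : v.regs (rN c) = n := by
          rw [hv.regs _ (by simp [layout]), huN]
        have hld : (RamExpr.load (.op .add (.const 1) (.reg (c + 5)))).eval w v =
            graphMem G col (1 + v.regs (c + 5)) := by
          rw [eval_load (x := 1 + v.regs (c + 5)) (eval_add (eval_const (by omega)) rfl (by omega)),
            hreg v (hu.trans (hv.mono sub1)) _ (by have := Nat.zero_le (n * n); omega)]
        have hcw : q < 2 ^ w := by
          have : c < (n + 1) ^ A := lt_of_lt_of_le (Nat.lt_pow_self (by omega : 1 < n + 1))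
            (Nat.pow_le_pow_right (by omega) (by omega))
          omega
        rw [colE, eval_and (p := v.regs (c + 5) < n) (q := graphMem G col (1 + v.regs (c + 5)) = q)
          (eval_lt (w := w) (a := .reg (c + 5)) (b := .reg (rN c)) rfl hNv (by omega))
          (eval_eq hld (eval_const hcw) (by omega)) (by omega)]
        by_cases hlt : v.regs (c + 5) < n
        · rw [graphMem_col hlt]; simp [hlt]
        · simp [hlt])
    refine ⟨g1, g2.trans ?_⟩
    congr 1
    ext ⟨q', i⟩
    simp only [Set.mem_ofPred_eq, List.map_cons, List.map_nil, Nat.ofDigits_singleton]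
    refine and_congr_right fun _ => ⟨?_, ?_⟩
    · rintro ⟨σ, -, ⟨h, h1⟩, rfl⟩; exact ⟨h, h1⟩
    · rintro ⟨h, h1⟩
      exact ⟨fun _ => i, fun _ _ => by dsimp only; omega, ⟨h, h1⟩, rfl⟩
  have fin : ∀ L : List ℕ, (∀ q ∈ L, q < c) → ∀ u,
      Frame {x | x = rN c ∨ x ∈ auxRegs c} (n + 1) A (qTot c t) s u →
      u.regs (rN c) = n → u.regs c = n + 1 →
      Frame {x | x ∈ [c + 5]} (n + 1) A (qTot c t) u
        ((Prog.seqs (L.map fun q => fillP c A (2 + q) [c + 5] (colE c q))).run w c u) ∧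
      dbOf (n + 1) A (qTot c t)
        ((Prog.seqs (L.map fun q => fillP c A (2 + q) [c + 5] (colE c q))).run w c u).mem =
      dbOf (n + 1) A (qTot c t) u.mem ∪
        {f | ∃ q ∈ L, f.1 = 2 + q ∧ ∃ h : f.2 < n, (col ⟨f.2, h⟩ : ℕ) = q} := by
    intro L hL
    induction L with
    | nil => intro u hu _ _; exact ⟨Frame.refl u, by simp [Prog.seqs, Prog.run]⟩
    | cons q L ih =>
      intro u hu huN hud
      obtain ⟨g1, g2⟩ := hc5 u hu huN hud q (hL q (by simp))
      obtain ⟨g3, g4⟩ := ih (fun q hq => hL q (by simp [hq])) _ (hu.trans (g1.mono sub1))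
        ((g1.regs _ (by simp [layout])).trans huN) ((g1.regs _ (by simp)).trans hud)
      refine ⟨g1.trans g3, g4.trans ?_⟩
      rw [g2, Set.union_assoc]
      congr 1
      ext f
      simp only [Set.mem_union, Set.mem_ofPred_eq, List.mem_cons, exists_eq_or_imp]
  obtain ⟨g1, g2⟩ := fin (List.range c) (by simp) s1 f1
    (by rw [hs1, Prog.run_keeps _ _ _ _ (keeps_fillP (by simp [layout])), hN0])
    (by rw [hs1, Prog.run_keeps _ _ _ _ (keeps_fillP (by simp)), hd0])
  rw [readP, Prog.run_seq, Prog.run_seq, ← hs0, ← hs1]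
  refine ⟨f1.trans (g1.mono sub1), ?_, ⟨fun u hu v hv => ?_, fun q v hv => ?_⟩, fun e he => ?_⟩
  · rw [g1.regs _ (by simp [layout]), hs1, Prog.run_keeps _ _ _ _ (keeps_fillP (by simp [layout])), hN0]
  · rw [g2, e1, hdb0, Set.empty_union]
    simp only [Set.mem_union, Set.mem_ofPred_eq, true_and]
    constructor
    · rintro (⟨σ, hσ, h1, h2⟩ | ⟨q, -, h, -⟩)
      · have := Nat.ofDigits_inj_of_len_eq (b := n + 1) (L1 := [u, v])
          (L2 := [c + 5, c + 6].map σ) (by omega) (by simp) (by simp; omega)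
          (by simpa using hσ) h2
        simp only [List.map_cons, List.map_nil, List.cons.injEq, and_true] at this
        rw [← this.1, ← this.2] at h1
        exact h1
      · simp only [layout] at h; omega
    · intro h
      exact .inl ⟨fun x => if x = c + 5 then u else v, by simp; omega, by simpa using (show gAdj G u v from h), by simp⟩
  · rw [g2, e1, hdb0, Set.empty_union]
    simp only [Set.mem_union, Set.mem_ofPred_eq, layout]
    constructor
    · rintro (⟨h, -⟩ | ⟨q', -, h, h1, h2⟩)
      · omega
      · exact ⟨h1, Fin.ext (by omega)⟩
    · rintro ⟨h, h1⟩
      exact .inr ⟨q, by simp, rfl, h, by rw [h1]⟩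
  · rw [g2, e1, hdb0, Set.empty_union] at he
    rcases he with ⟨h1, σ, -, h2, h3⟩ | ⟨q, -, h1, h2, h3⟩
    · exact .inl ⟨_, _, h2, Prod.ext h1 h3⟩
    · exact .inr ⟨e.2, col ⟨e.2, h2⟩, ⟨h2, rfl⟩, Prod.ext (by rw [h1, ← h3]; rfl) rfl⟩

end Read

/-! ## Building the head of a table -/

/-- The state `u` agrees with `s` on registers outside of `X` and on memory below `B`. -/
structure Below (X : Set ℕ) (B : ℕ) (s u : RamState) : Prop where
  regs : ∀ r, r ∉ X → u.regs r = s.regs r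
  out : u.out = s.out
  mem : ∀ a < B, u.mem a = s.mem a

namespace Below

variable {X : Set ℕ} {B : ℕ} {s u v : RamState}

theorem refl (s : RamState) : Below X B s s := ⟨fun _ _ => rfl, rfl, fun _ _ => rfl⟩

theorem trans (h : Below X B s u) (h' : Below X B u v) : Below X B s v :=
  ⟨fun r hr => (h'.regs r hr).trans (h.regs r hr), h'.out.trans h.out,
    fun a ha => (h'.mem a ha).trans (h.mem a ha)⟩

theorem setReg (h : Below X B s u) {r : ℕ} (hr : r ∈ X) (x : ℕ) : Below X B s (u.setReg r x) :=
  h.trans ⟨fun y hy => by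
    have : y ≠ r := by rintro rfl; exact hy hr
    simp [this], rfl, fun _ _ => rfl⟩

theorem setMem (h : Below X B s u) {a : ℕ} (ha : B ≤ a) (x : ℕ) : Below X B s (u.setMem a x) :=
  h.trans ⟨fun _ _ => rfl, rfl, fun b hb => by
    have : b ≠ a := by omega
    simp [this]⟩

theorem dbOf {d A Q : ℕ} (h : Below X (Q * d ^ A) s u) :
    dbOf d A Q u.mem = dbOf d A Q s.mem := by
  ext ⟨q, i⟩
  simp only [_root_.dbOf, Set.mem_ofPred_eq]
  refine and_congr_right fun _ => and_congr_right fun h2 => and_congr_right fun h3 => ?_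
  have : (q + 1) * d ^ A ≤ Q * d ^ A := Nat.mul_le_mul_right _ h2
  rw [add_mul] at this
  rw [h.mem _ (by omega)]

end Below

theorem mem_auxRegs {c x : ℕ} (h : c + 5 ≤ x ∧ x < c + 16) : x ∈ auxRegs c := h

/-- The table up to `N` fits into a memory region. -/
theorem tableLen_le {c n N L A : ℕ} (hn : 1 ≤ n) (hN : N ≤ n) (hL : L ≤ n + 1) (hA : 2 * c + 3 ≤ A) :
    tableLen c N L ≤ (n + 1) ^ A := by
  have h1 : c + 1 ≤ (n + 1) ^ c := Nat.lt_pow_self (by omega)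
  have h2 : c * N + 1 ≤ (n + 1) ^ (c + 1) := by
    calc c * N + 1 ≤ (c + 1) * (n + 1) := by nlinarith
      _ ≤ (n + 1) ^ c * (n + 1) := Nat.mul_le_mul_right _ h1
      _ = _ := by ring
  have h3 : L ^ c ≤ (n + 1) ^ c := Nat.pow_le_pow_left hL c
  have h4 : L ^ c * (c * N + 1) ≤ (n + 1) ^ (2 * c + 1) := by
    calc _ ≤ (n + 1) ^ c * (n + 1) ^ (c + 1) := Nat.mul_le_mul h3 h2
      _ = _ := by ring
  have h5 : (n + 1) ^ (2 * c + 3) ≤ (n + 1) ^ A := Nat.pow_le_pow_right (by omega) hA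
  have h6 : n + 1 ≤ (n + 1) ^ (2 * c + 1) := Nat.le_self_pow (by omega) _
  have h7 : 4 * (n + 1) ^ (2 * c + 1) ≤ (n + 1) ^ (2 * c + 3) := by
    rw [show 2 * c + 3 = 2 + (2 * c + 1) by ring, pow_add _ 2]
    exact Nat.mul_le_mul_right _ (by nlinarith)
  unfold tableLen
  omega

section Head

variable (c t A q a : ℕ)

/-- The address of an entry of the table under construction. -/
noncomputable def tabE (e : RamExpr) : RamExpr := cellE c A (qTot c t) e

/-- Compute the largest `N` with `N ^ a ≤ n`. -/
def topP : Prog :=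
  .seq (.assign (c + 7) (.const 0)) (.rep 1 (c + 5)
    (.ite (.op .lt (.reg (rN c)) (powOf (.reg (c + 5)) a)) .skip (.assign (c + 7) (.reg (c + 5)))))

/-- Compute the buckets of all frequencies. -/
noncomputable def bucketsP : Prog :=
  .seq (.store (tabE c t A (.const 0)) (.reg (c + 7)))
    (.seq (.assign (c + 8) (.const 0)) (.seq (.assign (c + 9) (.const 1)) (.rep 1 (c + 5) (.seq
      (.ite (.op .eq (.reg (c + 5)) (.reg (c + 9)))
        (.seq (.assign (c + 8) (.op .add (.reg (c + 8)) (.const 1)))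
          (.assign (c + 9) (.op .add (.op .add (.reg (c + 5)) (.op .div (.reg (c + 5)) (.const q)))
            (.const 1)))) .skip)
      (.ite (.op .lt (.reg (c + 7)) (.reg (c + 5))) .skip
        (.store (tabE c t A (.op .add (.const 1) (.reg (c + 5)))) (.reg (c + 8))))))))

variable {c t A q a}

theorem keeps_topP {x : ℕ} (hx : x ∉ auxRegs c) : (topP c a).Keeps x := by
  simp only [auxRegs, Set.mem_ofPred_eq, not_and_or, not_le, not_lt] at hx
  simp only [topP, Prog.Keeps]
  (repeat' apply And.intro) <;> first | trivial | omega

theorem keeps_bucketsP {x : ℕ} (hx : x ∉ auxRegs c) : (bucketsP c t A q).Keeps x := by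
  simp only [auxRegs, Set.mem_ofPred_eq, not_and_or, not_le, not_lt] at hx
  simp only [bucketsP, Prog.Keeps]
  (repeat' apply And.intro) <;> first | trivial | omega

theorem wf_topP : (topP c a).Wf c := by
  simp only [topP, Prog.Keeps, Prog.Wf]
  (repeat' apply And.intro) <;> first | trivial | omega

theorem wf_bucketsP : (bucketsP c t A q).Wf c := by
  simp only [bucketsP, Prog.Keeps, Prog.Wf]
  (repeat' apply And.intro) <;> first | trivial | omega

variable {w n : ℕ}

/-- An integer root: `a = 1` gives `N = n` for a full table, and `a = c + 1` gives the threshold of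
the linear index. -/
theorem topP_spec (ha : 1 ≤ a) (haA : a ≤ A) (hw : (n + 1) ^ (A + qTot c t + 1) < 2 ^ w) (hn : 1 ≤ n)
    (B : ℕ) (s : RamState) (hd : s.regs c = n + 1) (hN : s.regs (rN c) = n) :
    Below (auxRegs c) B s ((topP c a).run w c s) ∧ ((topP c a).run w c s).mem = s.mem ∧
    ∃ N, ((topP c a).run w c s).regs (c + 7) = N ∧ N ≤ n ∧ N ^ a ≤ n ∧ n < (N + 1) ^ a := by
  have hpow : ∀ {a}, a ≤ A → (n + 1) ^ a < 2 ^ w :=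
    fun h => lt_of_le_of_lt (Nat.pow_le_pow_right (by omega) (by omega)) hw
  have hw1 : n + 1 < 2 ^ w := by simpa using hpow (a := 1) (by omega)
  have hr := Prog.rep_inv (w := w) (D := c) (d := n + 1) (a := 1) (x := c + 5)
    (p := .ite (.op .lt (.reg (rN c)) (powOf (.reg (c + 5)) a)) .skip
      (.assign (c + 7) (.reg (c + 5)))) (by simp [Prog.Keeps]) (by simp [Prog.Keeps]) (by omega)
    (by rwa [pow_one]) ((Prog.assign (c + 7) (.const 0)).run w c s) (by simp [Prog.run, hd])
    (fun i u => Below (auxRegs c) B s u ∧ u.mem = s.mem ∧ u.regs (c + 7) ≤ n ∧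
      u.regs (c + 7) ^ a ≤ n ∧ ∀ x < i, x ^ a ≤ n → x ≤ u.regs (c + 7)) ?_ ?_
  · obtain ⟨h1, h2, h3, h4, h5⟩ := hr
    refine ⟨h1, h2, _, rfl, h3, h4, ?_⟩
    rw [topP, Prog.run_seq]
    by_contra! hcon
    have h6 := Nat.le_self_pow (show a ≠ 0 by omega)
      (((Prog.rep 1 (c + 5) (.ite (.op .lt (.reg (rN c)) (powOf (.reg (c + 5)) a)) .skip
        (.assign (c + 7) (.reg (c + 5))))).run w c
        ((Prog.assign (c + 7) (.const 0)).run w c s)).regs (c + 7) + 1)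
    have := h5 _ (by rw [pow_one]; omega) hcon
    omega
  · refine ⟨(Below.refl s).setReg (mem_auxRegs (by omega)) _ |>.setReg (mem_auxRegs (by omega)) _,
      rfl, ?_⟩
    simp only [Prog.run, RamState.setReg_regs, eval_const (show 0 < 2 ^ w by omega)]
    simp [show a ≠ 0 by omega]
  · rintro i hi u ⟨h1, h2, h3, h4, h5⟩ hx hud
    rw [pow_one] at hi
    have hNu : u.regs (rN c) = n := by
      rw [h1.regs _ (rn_notin_auxRegs (by simp only [layout]; omega)), hN]
    have hp : (powOf (.reg (c + 5)) a).eval w u = i ^ a :=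
      powOf_eval (eval_reg.trans hx) a fun b hb =>
        lt_of_le_of_lt (Nat.pow_le_pow_left (by omega) b) (hpow (by omega))
    rw [Prog.run, eval_lt (eval_reg.trans hNu) hp (by omega)]
    have h75 : c + 7 ≠ c + 5 := by omega
    by_cases hlt : n < i ^ a
    · rw [if_pos hlt, if_pos one_ne_zero, Prog.run]
      refine ⟨h1.setReg (mem_auxRegs (by omega)) _, h2, ?_⟩
      simp only [RamState.setReg_regs, if_neg h75]
      refine ⟨h3, h4, fun x hx hxa => ?_⟩
      rcases Nat.lt_succ_iff_lt_or_eq.mp hx with h | rfl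
      exacts [h5 x h hxa, absurd hlt (by omega)]
    · rw [if_neg hlt, if_neg (by simp), Prog.run, eval_reg, hx]
      refine ⟨(h1.setReg (mem_auxRegs (by omega)) _).setReg (mem_auxRegs (by omega)) _, h2, ?_⟩
      simp only [RamState.setReg_regs, if_neg h75, if_true]
      exact ⟨by omega, by omega, fun x hx _ => by omega⟩

theorem tabE_eval (hn : 1 ≤ n) (hw : (n + 1) ^ (A + qTot c t + 1) < 2 ^ w) (u : RamState)
    (hd : u.regs c = n + 1) {e : RamExpr} {i : ℕ} (he : e.eval w u = i) (hi : i < (n + 1) ^ A) :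
    (tabE c t A e).eval w u = qTot c t * (n + 1) ^ A + i :=
  cellE_eval (fits_of_lt (Q := qTot c t) (by omega) hw) u hd (by omega) e he hi

/-- Registers `c + 8` and `c + 9` carry `bucketState q i`. The loop always runs up to `n`, and
stores nothing for frequencies above `N`. The assumption `q ≤ A` ensures that the constant `q` is a
word. -/
theorem bucketsP_spec (hn : 1 ≤ n) (hA : 2 * c + 3 ≤ A) (hq : q ≤ A)
    (hw : (n + 1) ^ (A + qTot c t + 1) < 2 ^ w) (s : RamState) (hd : s.regs c = n + 1)
    {N : ℕ} (hN : s.regs (c + 7) = N) (hNn : N ≤ n)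
    (hT : ∀ i < (n + 1) ^ A, tab (n + 1) A (qTot c t) s.mem i = 0) :
    Below (auxRegs c) (qTot c t * (n + 1) ^ A) s ((bucketsP c t A q).run w c s) ∧
    ((bucketsP c t A q).run w c s).regs (c + 7) = N ∧
    TableHead N (bucket q) (tab (n + 1) A (qTot c t) ((bucketsP c t A q).run w c s).mem) ∧
    ∀ i < (n + 1) ^ A, tab (n + 1) A (qTot c t) ((bucketsP c t A q).run w c s).mem i ≤ n ∧
      (N + 2 ≤ i → tab (n + 1) A (qTot c t) ((bucketsP c t A q).run w c s).mem i = 0) := by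
  have hpow : ∀ {a}, a ≤ A → (n + 1) ^ a < 2 ^ w :=
    fun h => lt_of_le_of_lt (Nat.pow_le_pow_right (by omega) (by omega)) hw
  have hw2 : 2 * n + 2 < 2 ^ w := by
    have := hpow (a := 2) (by omega)
    nlinarith
  have hqw : q < 2 ^ w := lt_of_lt_of_le (Nat.lt_pow_self (show 1 < n + 1 by omega)) (hpow hq).le
  have hlen : n + 2 ≤ (n + 1) ^ A := by
    have h1 : (n + 1) ^ 2 ≤ (n + 1) ^ A := Nat.pow_le_pow_right (by omega) (by omega)
    nlinarith
  set D := (n + 1) ^ A with hD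
  set Q := qTot c t with hQ
  have haux : ∀ {x}, c + 5 ≤ x ∧ x < c + 16 → x ∈ auxRegs c := mem_auxRegs
  set s1 := (Prog.store (tabE c t A (.const 0)) (.reg (c + 7))).run w c s with hs1
  have es1 : s1 = s.setMem (Q * D + 0) N := by
    rw [hs1, Prog.run, tabE_eval hn hw s hd (eval_const (by omega)) (by omega), eval_reg, hN]
  set s3 := (Prog.assign (c + 9) (.const 1)).run w c ((Prog.assign (c + 8) (.const 0)).run w c s1)
    with hs3
  have es3 : s3 = ((s.setMem (Q * D + 0) N).setReg (c + 8) 0).setReg (c + 9) 1 := by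
    rw [hs3, Prog.run, Prog.run, eval_const (by omega), eval_const (by omega), es1]
  have hr := Prog.rep_inv (w := w) (D := c) (d := n + 1) (a := 1) (x := c + 5)
    (p := .seq (.ite (.op .eq (.reg (c + 5)) (.reg (c + 9)))
        (.seq (.assign (c + 8) (.op .add (.reg (c + 8)) (.const 1)))
          (.assign (c + 9) (.op .add (.op .add (.reg (c + 5)) (.op .div (.reg (c + 5)) (.const q)))
            (.const 1)))) .skip)
      (.ite (.op .lt (.reg (c + 7)) (.reg (c + 5))) .skip
        (.store (tabE c t A (.op .add (.const 1) (.reg (c + 5)))) (.reg (c + 8)))))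
    (by simp [Prog.Keeps]) (by simp [Prog.Keeps]) (by omega) (by rw [pow_one]; omega)
    s3 (by rw [es3]; simp [hd])
    (fun i u => Below (auxRegs c) (Q * D) s u ∧ u.regs (c + 7) = N ∧
      u.regs (c + 8) = (bucketState q i).1 ∧ u.regs (c + 9) = (bucketState q i).2 ∧
      tab (n + 1) A Q u.mem 0 = N ∧ (∀ m < i, m ≤ N → tab (n + 1) A Q u.mem (1 + m) = bucket q m) ∧
      ∀ j < D, tab (n + 1) A Q u.mem j ≤ n ∧ (N + 2 ≤ j → tab (n + 1) A Q u.mem j = 0)) ?_ ?_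
  · obtain ⟨h1, h2, -, -, h5, h6, h7⟩ := hr
    rw [bucketsP, Prog.run_seq, Prog.run_seq, Prog.run_seq, ← hs1, ← hs3]
    exact ⟨h1, h2, ⟨h5, fun m hm => h6 m (by rw [pow_one]; omega) hm⟩, h7⟩
  · have etab : tab (n + 1) A Q (s3.setReg (c + 5) 0).mem =
        Function.update (tab (n + 1) A Q s.mem) 0 N := by
      rw [es3]; exact tab_setMem 0 N
    rw [etab, es3]
    refine ⟨?_, by simp [hN], by simp [bucketState], by simp [bucketState], by simp,
      fun m hm => absurd hm (by omega), fun j hj => ?_⟩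
    · exact ((((Below.refl s).setMem (by omega) _).setReg (haux (by omega)) _).setReg
        (haux (by omega)) _).setReg (haux (by omega)) _
    · rw [Function.update_apply, hT j hj]
      split_ifs with h
      · exact ⟨hNn, by omega⟩
      · exact ⟨by omega, fun _ => rfl⟩
  · rintro i hi u ⟨h1, h2, h3, h4, h5, h6, h7⟩ hx hud
    rw [pow_one] at hi
    rw [Prog.run_seq]
    set p1 := Prog.ite (.op .eq (.reg (c + 5)) (.reg (c + 9)))
        (.seq (.assign (c + 8) (.op .add (.reg (c + 8)) (.const 1)))
          (.assign (c + 9) (.op .add (.op .add (.reg (c + 5)) (.op .div (.reg (c + 5)) (.const q)))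
            (.const 1)))) .skip with hp1
    have hb1 : (bucketState q i).1 ≤ n := by
      rcases Nat.eq_zero_or_pos i with rfl | h0
      · simp [bucketState]
      · have := bucket_le (q := q) (i - 1)
        unfold bucket at this
        rw [Nat.sub_add_cancel h0] at this; omega
    obtain ⟨v, hv, hv1, hv2, hv3⟩ : ∃ v, p1.run w c u = v ∧ v.mem = u.mem ∧
        Below (auxRegs c) (Q * D) s v ∧ v.regs (c + 7) = N ∧ v.regs c = n + 1 ∧
        v.regs (c + 5) = i ∧ v.regs (c + 8) = (bucketState q (i + 1)).1 ∧
        v.regs (c + 9) = (bucketState q (i + 1)).2 := by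
      refine ⟨_, rfl, ?_⟩
      rw [hp1, Prog.run, eval_eq (eval_reg.trans hx) (eval_reg.trans h4) (by omega), bucketState,
        bucketStep]
      by_cases he : i = (bucketState q i).2
      · rw [if_pos he, if_pos one_ne_zero, if_pos he, Prog.run_seq]
        have e1 : (Prog.assign (c + 8) (.op .add (.reg (c + 8)) (.const 1))).run w c u =
            u.setReg (c + 8) ((bucketState q i).1 + 1) := by
          rw [Prog.run, eval_add (eval_reg.trans h3) (eval_const (by omega)) (by omega)]
        have hx' : (u.setReg (c + 8) ((bucketState q i).1 + 1)).regs (c + 5) = i := by simp [hx]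
        have hdiv : i / q ≤ i := Nat.div_le_self _ _
        generalize hz : i / q = z at hdiv
        have e2 : (Prog.assign (c + 9) (.op .add (.op .add (.reg (c + 5))
            (.op .div (.reg (c + 5)) (.const q))) (.const 1))).run w c
              (u.setReg (c + 8) ((bucketState q i).1 + 1)) =
            (u.setReg (c + 8) ((bucketState q i).1 + 1)).setReg (c + 9) (i + z + 1) := by
          rw [Prog.run, eval_add (eval_add (eval_reg.trans hx') ((eval_div (eval_reg.trans hx') (eval_const hqw) (by omega)).trans hz)
            (by omega)) (eval_const (by omega)) (by omega)]
        rw [e1, e2]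
        refine ⟨rfl, (h1.setReg (haux (by omega)) _).setReg (haux (by omega)) _, ?_⟩
        simp [h2, hud, hx]
      · rw [if_neg he, if_neg (by simp), if_neg he, Prog.run]
        exact ⟨rfl, h1, h2, hud, hx, h3, h4⟩
    obtain ⟨hv3, hvd, hvx, hv4, hv5⟩ := hv3
    rw [hv, Prog.run, eval_lt (eval_reg.trans hv3) (eval_reg.trans hvx) (by omega)]
    have htv : tab (n + 1) A Q v.mem = tab (n + 1) A Q u.mem := by rw [hv1]
    by_cases hlt : N < i
    · rw [if_pos hlt, if_pos one_ne_zero, Prog.run]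
      refine ⟨hv2.setReg (haux (by omega)) _, by simp [hv3], by simp [hv4], by simp [hv5], ?_, ?_, ?_⟩
      all_goals rw [RamState.setReg_mem, htv]
      · exact h5
      · intro m hm hmN; exact h6 m (by omega) hmN
      · exact h7
    · rw [if_neg hlt, if_neg (by simp), Prog.run, tabE_eval hn hw v hvd
        (eval_add (eval_const (by omega)) (eval_reg.trans hvx) (by omega)) (by omega), eval_reg, hv4]
      refine ⟨(hv2.setMem (Nat.le_add_right _ _) _).setReg (haux (by omega)) _, by simp [hv3], by simp [hv4],
        by simp [hv5], ?_, ?_, ?_⟩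
      all_goals rw [RamState.setReg_mem, tab_setMem, htv]
      · rw [Function.update_apply, if_neg (by omega), h5]
      · intro m hm hmN
        rw [Function.update_apply]
        split_ifs with h
        · obtain rfl : m = i := by omega
          rfl
        · exact h6 m (by omega) hmN
      · intro j hj
        rw [Function.update_apply]
        split_ifs with h
        · have := bucket_le (q := q) i
          unfold bucket at this
          exact ⟨by omega, fun h' => by omega⟩
        · exact h7 j hj

end Head

/-! ## Building a table -/

section Build

variable (c t A : ℕ)

/-- Reading from the table under construction. -/
noncomputable def loadTab (e : RamExpr) : RamExpr := .load (tabE c t A e)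

/-- Write the allowed nodes to the cell for the frequencies in registers `0, …, c - 1`. -/
noncomputable def writeP : Prog :=
  .seq (.assign (c + 10) (addrE c (loadTab c t A))) (.seq (.assign (c + 11) (.const 0))
    (.seq (.rep 1 (c + 5) (.ite (.load (cellE c A (qAlive c) (.reg (c + 5))))
      (.seq (.assign (c + 11) (.op .add (.reg (c + 11)) (.const 1)))
        (.store (tabE c t A (.op .add (.reg (c + 10)) (.reg (c + 11)))) (.reg (c + 5)))) .skip))
      (.store (tabE c t A (.reg (c + 10))) (.reg (c + 11)))))

/-- Find a solution for the frequencies in registers `0, …, c - 1`, and store it. -/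
noncomputable def bodyP : Prog :=
  .ite (exceedsE c (.reg (c + 7))) .skip
    (.seq (solveP c t A) (.ite (.reg (rRes c)) (writeP c t A) .skip))

variable {c t A}

theorem keeps_writeP {x : ℕ} (hx : x ≠ c + 5 ∧ x ≠ c + 10 ∧ x ≠ c + 11) : (writeP c t A).Keeps x :=
  ⟨hx.2.1, hx.2.2, ⟨hx.1, ⟨hx.2.2, trivial⟩, trivial⟩, trivial⟩

theorem wf_writeP : (writeP c t A).Wf c := by
  simp only [writeP, Prog.Keeps, Prog.Wf]
  (repeat' apply And.intro) <;> first | trivial | omega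

theorem keeps_bodyP {x : ℕ} (hx : x < c + 2 ∨ x = c + 7) : (bodyP c t A).Keeps x :=
  ⟨trivial, keeps_solveP (notMem_solveRegs (by omega)), keeps_writeP (by omega), trivial⟩

theorem wf_bodyP : (bodyP c t A).Wf c :=
  ⟨trivial, keeps_solveP (notMem_solveRegs (by omega)), wf_solveP, wf_writeP, trivial⟩

variable {w n N : ℕ} {β : ℕ → ℕ} {H : CGraph n c}

theorem loadTab_eval (hn : 1 ≤ n) (hw : (n + 1) ^ (A + qTot c t + 1) < 2 ^ w) {u : RamState}
    (hd : u.regs c = n + 1) {e : RamExpr} {i : ℕ} (he : e.eval w u = i) (hi : i < (n + 1) ^ A) :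
    (loadTab c t A e).eval w u = tab (n + 1) A (qTot c t) u.mem i :=
  eval_load (tabE_eval hn hw u hd he hi)

open Classical in
-- The nodes are written behind the first word of the cell, which receives their number last.
-- Entries left over from a longer list do no harm, as only as many nodes are read as the first word
-- says.
theorem writeP_spec (hn : 1 ≤ n) (hA : 1 ≤ A) (hw : (n + 1) ^ (A + qTot c t + 1) < 2 ^ w)
    (hL : 1 ≤ β N) (hβ : β N ≤ N) (hmono : ∀ x ≤ N, β x ≤ β N)
    (hlen : tableLen c N (β N + 1) ≤ (n + 1) ^ A) (u : RamState) (hd : u.regs c = n + 1)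
    (hT : TableHead N β (tab (n + 1) A (qTot c t) u.mem)) (hM : ∀ q : Fin c, u.regs q ≤ N)
    {S : Finset ℕ} (hS : ∀ v ≤ n, ((qAlive c, v) ∈ dbOf (n + 1) A (qTot c t) u.mem ↔ v ∈ S))
    (hSn : ∀ v ∈ S, v < n) (hcard : S.card ≤ c * N)
    (hle : ∀ j < (n + 1) ^ A, tab (n + 1) A (qTot c t) u.mem j ≤ n) {a : ℕ}
    (ha : a = cellAddr N (β N + 1) fun q : Fin c => β (u.regs q)) :
    Below (auxRegs c) (qTot c t * (n + 1) ^ A) u ((writeP c t A).run w c u) ∧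
    (∀ j, (j < a ∨ a + c * N < j) → tab (n + 1) A (qTot c t) ((writeP c t A).run w c u).mem j =
      tab (n + 1) A (qTot c t) u.mem j) ∧
    tab (n + 1) A (qTot c t) ((writeP c t A).run w c u).mem a = S.card ∧
    (cellNodes (tab (n + 1) A (qTot c t) ((writeP c t A).run w c u).mem) a).Nodup ∧
    (∀ v, v ∈ cellNodes (tab (n + 1) A (qTot c t) ((writeP c t A).run w c u).mem) a ↔ v ∈ S) ∧
    ∀ j < (n + 1) ^ A, tab (n + 1) A (qTot c t) ((writeP c t A).run w c u).mem j ≤ n := by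
  have hpow : ∀ {a}, a ≤ A → (n + 1) ^ a < 2 ^ w :=
    fun h => lt_of_le_of_lt (Nat.pow_le_pow_right (by omega) (by omega)) hw
  have hw1 : n + 1 < 2 ^ w := by simpa using hpow (a := 1) hA
  have hlw : tableLen c N (β N + 1) < 2 ^ w := lt_of_le_of_lt hlen (hpow le_rfl)
  have hL' : 2 ≤ β N + 1 := by omega
  have hb := (tableLen_bounds (c := c) (N := N) hL').1
  have hSn' : S.card ≤ n := by
    have : S ⊆ Finset.range n := fun v hv => Finset.mem_range.mpr (hSn v hv)
    simpa using Finset.card_le_card this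
  have hld : ∀ e i, e.eval w u = i → i < N + 2 →
      (loadTab c t A e).eval w u = tab (n + 1) A (qTot c t) u.mem i :=
    fun e i he hi => loadTab_eval hn hw hd he (by omega)
  have hav : (addrE c (loadTab c t A)).eval w u = a := by
    rw [addrE_eval hT hL hβ hmono hlw hld hM, ha]
  have hlt := cellAddr_lt (N := N) hL' (κ := fun q : Fin c => β (u.regs q))
    (fun q => Nat.lt_succ_of_le (hmono _ (hM q)))
  rw [← ha] at hlt
  have hf := fits_of_lt (Q := qTot c t) (by omega) hw
  set D := (n + 1) ^ A with hD
  set Q := qTot c t with hQ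
  set T := tab (n + 1) A Q u.mem with hTdef
  -- `F i` is the list written before round `i`.
  let F : ℕ → List ℕ := fun i => (List.range i).filter (· ∈ S)
  have hF : ∀ i, (F i).length ≤ S.card := by
    intro i
    have h1 : (F i).toFinset ⊆ S := by
      intro v hv
      simp only [F, List.mem_toFinset, List.mem_filter, decide_eq_true_eq] at hv
      exact hv.2
    rw [← List.toFinset_card_of_nodup (List.Nodup.filter _ List.nodup_range)]
    exact Finset.card_le_card h1
  have hFs : ∀ i, F (i + 1) = if i ∈ S then F i ++ [i] else F i := by
    intro i
    simp only [F, List.range_succ, List.filter_append]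
    by_cases h : i ∈ S <;> simp [h]
  have haux : ∀ {x}, c + 5 ≤ x ∧ x < c + 16 → x ∈ auxRegs c := mem_auxRegs
  set s2 := (Prog.assign (c + 11) (.const 0)).run w c
    ((Prog.assign (c + 10) (addrE c (loadTab c t A))).run w c u) with hs2
  have es2 : s2 = (u.setReg (c + 10) a).setReg (c + 11) 0 := by
    rw [hs2, Prog.run, Prog.run, hav, eval_const (by omega)]
  have hr := Prog.rep_inv (w := w) (D := c) (d := n + 1) (a := 1) (x := c + 5)
    (p := .ite (.load (cellE c A (qAlive c) (.reg (c + 5))))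
      (.seq (.assign (c + 11) (.op .add (.reg (c + 11)) (.const 1)))
        (.store (tabE c t A (.op .add (.reg (c + 10)) (.reg (c + 11)))) (.reg (c + 5)))) .skip)
    (by simp [Prog.Keeps]) (by simp [Prog.Keeps]) (by omega) (by rwa [pow_one]) s2
    (by rw [es2]; simp [hd])
    (fun i v => Below (auxRegs c) (Q * D) u v ∧ v.regs (c + 10) = a ∧
      v.regs (c + 11) = (F i).length ∧
      (∀ j, (j ≤ a ∨ a + (F i).length < j) → tab (n + 1) A Q v.mem j = T j) ∧
      ((List.range (F i).length).map fun j => tab (n + 1) A Q v.mem (a + 1 + j)) = F i ∧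
      ∀ j < D, tab (n + 1) A Q v.mem j ≤ n) ?_ ?_
  · obtain ⟨h1, h2, h3, h4, h5, h6⟩ := hr
    rw [writeP, Prog.run_seq, Prog.run_seq, Prog.run_seq, ← hs2]
    generalize (Prog.rep 1 (c + 5) _).run w c s2 = v at h1 h2 h3 h4 h5 h6
    rw [pow_one] at h3 h4 h5
    have hmem : ∀ x, x ∈ F (n + 1) ↔ x ∈ S := by
      intro x
      simp only [F, List.mem_filter, List.mem_range, decide_eq_true_eq, and_iff_right_iff_imp]
      exact fun hx => by have := hSn x hx; omega
    have hnd : (F (n + 1)).Nodup := List.Nodup.filter _ List.nodup_range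
    have hcd : (F (n + 1)).length = S.card := by
      rw [← List.toFinset_card_of_nodup hnd]
      congr 1
      ext x; rw [List.mem_toFinset, hmem]
    have hvd : v.regs c = n + 1 := by rw [h1.regs _ (rn_notin_auxRegs (by omega)), hd]
    rw [Prog.run, tabE_eval hn hw v hvd (eval_reg.trans h2) (by omega), eval_reg, h3]
    have hcell : cellNodes (tab (n + 1) A Q (v.setMem (Q * D + a) (F (n + 1)).length).mem) a =
        F (n + 1) := by
      rw [tab_setMem, cellNodes, Function.update_self]
      conv_rhs => rw [← h5]
      refine List.map_congr_left fun j _ => ?_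
      rw [Function.update_apply, if_neg (by omega)]
    refine ⟨h1.setMem (Nat.le_add_right _ _) _, fun j hj => ?_, ?_, by rw [hcell]; exact hnd,
      fun x => by rw [hcell]; exact hmem x, fun j hj => ?_⟩
    all_goals rw [tab_setMem, Function.update_apply]
    · rw [if_neg (by omega), h4 j (by have := hF (n + 1); omega)]
    · rw [if_pos rfl, hcd]
    · split_ifs
      · omega
      · exact h6 j hj
  · rw [es2]
    refine ⟨(((Below.refl u).setReg (haux (by omega)) _).setReg (haux (by omega)) _).setReg
      (haux (by omega)) _, by simp, by simp [F], fun j _ => rfl, by simp [F], hle⟩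
  · rintro i hi v ⟨h1, h2, h3, h4, h5, h6⟩ hx hvd
    rw [pow_one] at hi
    have hiD : i < D := lt_of_lt_of_le hi (Nat.le_self_pow (by omega) _)
    have hal : (RamExpr.load (cellE c A (qAlive c) (.reg (c + 5)))).eval w v ≠ 0 ↔ i ∈ S := by
      rw [load_ne_zero_iff (Q := Q) hf (by omega) v hvd (by simp only [layout]; omega)
        (by simp only [hQ, layout]; omega) (.reg (c + 5)) hx hiD, h1.dbOf, hS i (by omega)]
    rw [Prog.run]
    by_cases hiS : i ∈ S
    · rw [if_pos (hal.mpr hiS), Prog.run_seq]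
      have hlen1 : (F i).length + 1 ≤ S.card := by
        have := hF (i + 1)
        rw [hFs, if_pos hiS] at this
        simpa using this
      have e1 : (Prog.assign (c + 11) (.op .add (.reg (c + 11)) (.const 1))).run w c v =
          v.setReg (c + 11) ((F i).length + 1) := by
        rw [Prog.run, eval_add (eval_reg.trans h3) (eval_const (by omega)) (by omega)]
      rw [e1, Prog.run, tabE_eval (i := a + ((F i).length + 1)) hn hw _ (by simp [hvd])
        (eval_add (by simp [h2]) (by simp) (by omega)) (by omega), eval_reg]
      have e2 : (v.setReg (c + 11) ((F i).length + 1)).regs (c + 5) = i := by simp [hx]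
      rw [e2, hFs, if_pos hiS, List.length_append, List.length_singleton]
      refine ⟨((h1.setReg (haux (by omega)) _).setMem (Nat.le_add_right _ _) _).setReg (haux (by omega)) _,
        by simp [h2], by simp, fun j hj => ?_, ?_, fun j hj => ?_⟩
      all_goals rw [RamState.setReg_mem, tab_setMem, RamState.setReg_mem]
      · rw [Function.update_apply, if_neg (by omega), h4 j (by omega)]
      · rw [List.range_succ, List.map_append, List.map_singleton]
        congr 1
        · conv_rhs => rw [← h5]
          refine List.map_congr_left fun j hj => ?_
          rw [List.mem_range] at hj
          rw [Function.update_apply, if_neg (by omega)]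
        · rw [Function.update_apply, if_pos (by omega)]
      · rw [Function.update_apply]
        split_ifs
        · omega
        · exact h6 j hj
    · rw [if_neg fun h => hiS (hal.mp h), Prog.run, hFs, if_neg hiS]
      exact ⟨h1.setReg (haux (by omega)) _, by simp [h2], by simp [h3], h4, h5, h6⟩

/-- The invariant of the construction of a table. -/
structure TableInv (H : CGraph n c) (t A N : ℕ) (β : ℕ → ℕ) (B0 : Set (ℕ × ℕ)) (u : RamState) :
    Prop where
  regD : u.regs c = n + 1
  regN : u.regs (rN c) = n
  top : u.regs (c + 7) = N
  out : u.out = []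
  db : ∀ e : ℕ × ℕ, e.1 ≤ c + 1 → (e ∈ dbOf (n + 1) A (qTot c t) u.mem ↔ e ∈ B0)
  head : TableHead N β (tab (n + 1) A (qTot c t) u.mem)
  le : ∀ j < (n + 1) ^ A, tab (n + 1) A (qTot c t) u.mem j ≤ n
  cell : ∀ M : Fin c → ℕ, (∀ q, M q ≤ N) →
    tab (n + 1) A (qTot c t) u.mem (cellAddr N (β N + 1) fun q => β (M q)) = 0 ∨
      CellGood H N β (tab (n + 1) A (qTot c t) u.mem) M

theorem card_le_of_solves (hcol : ∀ v < n, ∃! q, H.col v q) {M : Fin c → ℕ} {S : Finset ℕ}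
    (hS : H.Solves M S) (hM : ∀ q, M q ≤ N) : S.card ≤ c * N := by
  rw [card_of_solves hcol hS]
  calc ∑ q, M q ≤ ∑ _q : Fin c, N := Finset.sum_le_sum fun q _ => hM q
    _ = c * N := by simp

theorem CellGood.size_le (hcol : ∀ v < n, ∃! q, H.col v q) {T : ℕ → ℕ} {M : Fin c → ℕ}
    (h : CellGood H N β T M) : T (cellAddr N (β N + 1) fun q => β (M q)) ≤ c * N := by
  obtain ⟨M', hM', -, S, hS, hnd, hmem⟩ := h
  have h2 : (cellNodes T (cellAddr N (β N + 1) fun q => β (M q))).toFinset = S := by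
    ext v; rw [List.mem_toFinset, hmem]
  have h1 := card_le_of_solves hcol hS hM'
  rw [← h2, List.toFinset_card_of_nodup hnd] at h1
  simpa [cellNodes] using h1

theorem CellGood.congr {T T' : ℕ → ℕ} {M : Fin c → ℕ} (h : CellGood H N β T M)
    (hcol : ∀ v < n, ∃! q, H.col v q)
    (hT : ∀ i ≤ c * N, T' ((cellAddr N (β N + 1) fun q => β (M q)) + i) =
      T ((cellAddr N (β N + 1) fun q => β (M q)) + i)) : CellGood H N β T' M := by
  have hsz := h.size_le hcol
  obtain ⟨M', hM', hb, S, hS, hnd, hmem⟩ := h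
  have : cellNodes T' (cellAddr N (β N + 1) fun q => β (M q)) =
      cellNodes T (cellAddr N (β N + 1) fun q => β (M q)) := by
    unfold cellNodes
    have h0 := hT 0 (by omega)
    rw [add_zero] at h0
    rw [h0]
    refine List.map_congr_left fun j hj => ?_
    rw [List.mem_range] at hj
    rw [add_assoc, hT _ (by omega)]
  exact ⟨M', hM', hb, S, hS, by rwa [this], by rwa [this]⟩

/-- Several frequency vectors share a cell, and a later one may overwrite the solution of an earlier
one; the cell remains good, since only the buckets of the stored solution matter. Solutions are
nonempty, so a filled cell never becomes `0` again. Other cells are disjoint from the one written.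
-/
theorem bodyP_spec (hn : 1 ≤ n) (hA : t + c + 4 ≤ A) (hw : (n + 1) ^ (A + qTot c t + 1) < 2 ^ w)
    (hH : H.alive = {x | x < n}) (hG : ∀ u < n, Good H.adj t {x | Rch H.adj {y | y < n} u x})
    (hcol : ∀ v < n, ∃! q, H.col v q) {B0 : Set (ℕ × ℕ)} (hB0 : GraphStored H B0)
    (hNn : N ≤ n) (hL : 1 ≤ β N) (hβ : β N ≤ N) (hmono : ∀ x ≤ N, β x ≤ β N)
    (hlen : tableLen c N (β N + 1) ≤ (n + 1) ^ A) {u : RamState} (hu : TableInv H t A N β B0 u) :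
    TableInv H t A N β B0 ((bodyP c t A).run w c u) ∧
    (∀ M : Fin c → ℕ, (∀ q, M q ≤ N) →
      tab (n + 1) A (qTot c t) u.mem (cellAddr N (β N + 1) fun q => β (M q)) ≠ 0 →
      tab (n + 1) A (qTot c t) ((bodyP c t A).run w c u).mem
        (cellAddr N (β N + 1) fun q => β (M q)) ≠ 0) ∧
    ((∀ q : Fin c, u.regs q ≤ N) → (∃ S, H.Solves (fun q => u.regs q) S) →
      tab (n + 1) A (qTot c t) ((bodyP c t A).run w c u).mem
        (cellAddr N (β N + 1) fun q : Fin c => β (u.regs q)) ≠ 0) := by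
  classical
  have hw1 : 1 < 2 ^ w := by
    have : (n + 1) ^ 1 ≤ (n + 1) ^ (A + qTot c t + 1) := Nat.pow_le_pow_right (by omega) (by omega)
    rw [pow_one] at this; omega
  rw [bodyP, Prog.run, exceedsE_eval (eval_reg.trans hu.top) hw1]
  by_cases hex : ∃ q : Fin c, N < u.regs q
  · rw [if_pos hex, if_pos one_ne_zero, Prog.run]
    refine ⟨hu, fun _ _ h => h, fun h => ?_⟩
    obtain ⟨q, hq⟩ := hex
    have := h q; omega
  rw [if_neg hex, if_neg (by simp), Prog.run_seq]
  push Not at hex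
  have hst : GraphStored H (dbOf (n + 1) A (qTot c t) u.mem) :=
    ⟨fun x hx y hy => (hu.db _ (by simp only [layout]; omega)).trans (hB0.adj x hx y hy),
      fun q v hv => (hu.db _ (by have := q.2; simp only [layout]; omega)).trans (hB0.col q v hv)⟩
  obtain ⟨X, hX, hres⟩ := solveP_spec hn hA hw hH hG hu.regD hu.regN
    (fun q => (hex q).trans hNn) hst
  set v := (solveP c t A).run w c u with hv
  have hreg : ∀ r, (r < c + 2 ∨ c + 4 < r ∧ r < c + 16) → v.regs r = u.regs r :=
    fun r hr => hX.frame.regs r (notMem_solveRegs hr)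
  have htab := hX.frame.tab
  have hvi : TableInv H t A N β B0 v := by
    refine ⟨(hreg c (by omega)).trans hu.regD, (hreg _ (by simp only [layout]; omega)).trans hu.regN,
      (hreg _ (by omega)).trans hu.top, hX.frame.out.trans hu.out,
      fun e he => (hX.old e he).trans (hu.db e he), ?_, ?_, ?_⟩
    all_goals rw [htab]
    exacts [hu.head, hu.le, hu.cell]
  have hMv : ∀ q : Fin c, v.regs q = u.regs q := fun q => hreg q (by have := q.2; omega)
  rw [← htab, Prog.run, eval_reg]
  rcases hres with ⟨h1, S, hS, hXS⟩ | ⟨h1, hno⟩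
  · rw [h1, if_pos one_ne_zero]
    have hSn : ∀ x ∈ S, x < n := fun x hx => H.alive_lt x (hS.2.1 x hx)
    obtain ⟨f1, g1, g2, g3, g4, g5⟩ := writeP_spec (S := S) hn (by omega) hw hL hβ hmono hlen v hvi.regD
      hvi.head (fun q => by rw [hMv]; exact hex q)
      (fun x hx => (hX.alive x hx).trans (hXS x)) hSn (card_le_of_solves hcol hS hex) hvi.le rfl
    simp only [hMv] at g1 g2 g3 g4
    have hL' : 2 ≤ β N + 1 := by omega
    have hκ : ∀ M : Fin c → ℕ, (∀ q, M q ≤ N) → ∀ q, β (M q) < β N + 1 :=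
      fun M hM q => Nat.lt_succ_of_le (hmono _ (hM q))
    have hother : ∀ M : Fin c → ℕ, (∀ q, M q ≤ N) →
        (fun q : Fin c => β (u.regs q)) ≠ (fun q => β (M q)) → ∀ i ≤ c * N,
        tab (n + 1) A (qTot c t) ((writeP c t A).run w c v).mem
          ((cellAddr N (β N + 1) fun q => β (M q)) + i) =
        tab (n + 1) A (qTot c t) v.mem ((cellAddr N (β N + 1) fun q => β (M q)) + i) := by
      intro M hM hne i hi
      refine g1 _ ?_
      by_contra! hcon
      refine hne (cellAddr_disjoint (N := N) (j := i) (i := (cellAddr N (β N + 1) fun q => β (M q)) + i -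
        cellAddr N (β N + 1) fun q : Fin c => β (u.regs q)) hL' (hκ _ hex) (hκ M hM) (by omega) hi ?_)
      omega
    have hpos : S.card ≠ 0 := Finset.card_ne_zero.mpr hS.1
    refine ⟨⟨?_, ?_, ?_, f1.out.trans hvi.out, fun e he => ?_, ?_, g5, fun M hM => ?_⟩,
      fun M hM h => ?_, fun _ _ => by rw [g2]; exact hpos⟩
    · rw [Prog.run_keeps _ _ _ _ (keeps_writeP (by omega)), hvi.regD]
    · rw [Prog.run_keeps _ _ _ _ (keeps_writeP (by simp only [layout]; omega)), hvi.regN]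
    · rw [Prog.run_keeps _ _ _ _ (keeps_writeP (by omega)), hvi.top]
    · rw [f1.dbOf]; exact hvi.db e he
    · have hge : N + 2 ≤ cellAddr N (β N + 1) fun q : Fin c => β (u.regs q) := by
        unfold cellAddr; omega
      exact ⟨by rw [g1 _ (by omega), hvi.head.size],
        fun m hm => by rw [g1 _ (by omega), hvi.head.bucket m hm]⟩
    · by_cases hc : (fun q : Fin c => β (u.regs q)) = fun q => β (M q)
      · right
        rw [hc] at g3 g4
        exact ⟨fun q => u.regs q, hex, fun q => congrFun hc q, S, hS, g3, g4⟩
      · have hoth := hother M hM hc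
        refine (hvi.cell M hM).imp (fun h => ?_) (fun h => h.congr hcol hoth)
        have := hoth 0 (by omega)
        rw [add_zero] at this
        rw [this, h]
    · by_cases hc : (fun q : Fin c => β (u.regs q)) = fun q => β (M q)
      · rw [← hc, g2]; exact hpos
      · have := hother M hM hc 0 (by omega)
        rw [add_zero] at this
        rwa [this]
  · rw [h1, if_neg (by simp), Prog.run]
    exact ⟨hvi, fun _ _ h => h, fun _ h => absurd h hno⟩

end Build

/-! ## The program which builds an index -/

section Builder

variable (c t A q a : ℕ)

/-- Compute a table. -/
noncomputable def tableP : Prog :=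
  .seq (readP c A) (.seq (topP c a) (.seq (bucketsP c t A q) ((bodyP c t A).forAll (List.range c))))

/-- Output the table. -/
noncomputable def emitTabP : Prog :=
  .rep A (c + 5) (.ite (.op .lt (.reg (c + 5)) (lenE c (loadTab c t A)))
    (.emit (loadTab c t A (.reg (c + 5)))) .skip)

/-- Output the number of nodes, the addresses of the nonzero cells of the relations which describe
the graph, and a final `0`. -/
def emitGraphP : Prog :=
  .seq (.emit (.reg (rN c))) (.seq (.rep (A + (c + 2)) (c + 5)
    (.ite (.op .lt (.reg (c + 5)) (powE c A)) .skip
      (.ite (.op .lt (.reg (c + 5)) (.op .mul (.const (c + 2)) (powE c A)))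
        (.ite (.load (.reg (c + 5))) (.emit (.reg (c + 5))) .skip) .skip)))
    (.emit (.const 0)))

variable {c t A q a}

theorem wf_tableP : (tableP c t A q a).Wf c := by
  have h : ∀ x ∈ List.range c, (bodyP c t A).Keeps x := fun x hx =>
    keeps_bodyP (.inl (by rw [List.mem_range] at hx; omega))
  exact ⟨wf_readP.2, wf_readP.1, keeps_topP (rn_notin_auxRegs (by omega)), wf_topP,
    keeps_bucketsP (rn_notin_auxRegs (by omega)), wf_bucketsP,
    Prog.wf_forAll List.nodup_range (by simp) h (keeps_bodyP (by omega)) wf_bodyP⟩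

theorem keeps_tableP : (tableP c t A q a).Keeps c :=
  ⟨wf_readP.2, keeps_topP (rn_notin_auxRegs (by omega)), keeps_bucketsP (rn_notin_auxRegs (by omega)),
    by simp [keeps_bodyP (c := c) (t := t) (A := A) (x := c) (by omega)]⟩

theorem wf_emitTabP : (emitTabP c t A).Wf c ∧ (emitTabP c t A).Keeps c := by
  simp [emitTabP, Prog.Wf, Prog.Keeps]

theorem wf_emitGraphP : (emitGraphP c A).Wf c ∧ (emitGraphP c A).Keeps c := by
  simp [emitGraphP, Prog.Wf, Prog.Keeps]

variable {w n N : ℕ} {β : ℕ → ℕ}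

/-- The relations in `B0` describe the graph, and contain nothing else. -/
structure GraphExact {G : SimpleGraph (Fin n)} {col : Fin n → Fin c} (B0 : Set (ℕ × ℕ)) : Prop where
  stored : GraphStored (graphOf G col) B0
  only : ∀ e ∈ B0, (∃ u v, gAdj G u v ∧ e = (qAdj, Nat.ofDigits (n + 1) [u, v])) ∨
    ∃ v q, (graphOf G col).col v q ∧ e = (qCol c q, v)

theorem one_le_bucket {N : ℕ} (hN : 1 ≤ N) : 1 ≤ bucket q N := by
  have : bucket q 1 = 1 := by simp [bucket, bucketState, bucketStep]
  have := bucket_mono (q := q) hN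
  omega

/-- The loop over registers `0, …, c - 1` tries all frequency vectors. The invariant says that cells
are empty or good; that empty cells are justified needs the liveness rule `forAll_hit`. -/
theorem tableP_spec {G : SimpleGraph (Fin n)} {col : Fin n → Fin c} (htw : TreewidthLE G t)
    (hn : 1 ≤ n) (ha : 1 ≤ a) (haA : a ≤ A) (hqA : q ≤ A) (hA : t + c + 4 ≤ A) (hcA : 2 * c + 3 ≤ A)
    (hw : (n + 1) ^ (A + qTot c t + 1) < 2 ^ w)
    (s : RamState) (hd : s.regs c = n + 1) (hs : s.mem = graphMem G col) (hout : s.out = []) :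
    ∃ N B0, 1 ≤ N ∧ N ≤ n ∧ N ^ a ≤ n ∧ n < (N + 1) ^ a ∧ GraphExact (G := G) (col := col) B0 ∧
      TableInv (graphOf G col) t A N (bucket q) B0 ((tableP c t A q a).run w c s) ∧
      IsTable (graphOf G col) N (bucket q)
        (tab (n + 1) A (qTot c t) ((tableP c t A q a).run w c s).mem) := by
  rw [tableP, Prog.run_seq, Prog.run_seq, Prog.run_seq]
  obtain ⟨f1, N1, g1, x1⟩ := readP_spec hn hA hw s hd hs
  set s1 := (readP c A).run w c s
  have d1 : s1.regs c = n + 1 := by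
    rw [f1.regs c, hd]
    simp only [auxRegs, Set.mem_ofPred_eq, layout]; omega
  obtain ⟨f2, m2, N, h2, hNn, hNa, hnN⟩ := topP_spec ha haA hw hn (qTot c t * (n + 1) ^ A) s1 d1 N1
  set s2 := (topP c a).run w c s1
  have d2 : s2.regs c = n + 1 := (f2.regs _ (rn_notin_auxRegs (by omega))).trans d1
  have hin := input_lt hn (show 3 ≤ A by omega)
  have ht2 : ∀ i < (n + 1) ^ A, tab (n + 1) A (qTot c t) s2.mem i = 0 := by
    intro i _
    rw [m2, f1.tab, tab, hs]
    refine graphMem_zero ?_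
    have : 1 * (n + 1) ^ A ≤ qTot c t * (n + 1) ^ A :=
      Nat.mul_le_mul_right _ (by simp only [layout]; omega)
    omega
  obtain ⟨f3, h3, T3, l3⟩ := bucketsP_spec hn hcA hqA hw s2 d2 h2 hNn ht2
  set s3 := (bucketsP c t A q).run w c s2
  have hN1 : 1 ≤ N := by
    by_contra hN0
    obtain rfl : N = 0 := by omega
    rw [zero_add, one_pow] at hnN
    omega
  have hL : 1 ≤ bucket q N := one_le_bucket hN1
  have hβ := bucket_le (q := q) N
  have hmono : ∀ x ≤ N, bucket q x ≤ bucket q N := fun x hx => bucket_mono hx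
  have hlen : tableLen c N (bucket q N + 1) ≤ (n + 1) ^ A := tableLen_le hn hNn (by omega) hcA
  have hcol := graphOf_col (G := G) (col := col)
  have hdb3 := f3.dbOf (d := n + 1) (A := A) (Q := qTot c t)
  rw [f2.dbOf] at hdb3
  have hB0 := GraphExact.mk g1 x1
  have hge : ∀ M : Fin c → ℕ, (∀ x, M x ≤ N) →
      N + 2 ≤ (cellAddr N (bucket q N + 1) fun x => bucket q (M x)) ∧
      (cellAddr N (bucket q N + 1) fun x => bucket q (M x)) < (n + 1) ^ A := by
    intro M hM
    have := cellAddr_lt (N := N) (L := bucket q N + 1) (by omega) (κ := fun x => bucket q (M x))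
      (fun x => Nat.lt_succ_of_le (hmono _ (hM x)))
    exact ⟨by unfold cellAddr; omega, by omega⟩
  have inv3 : TableInv (graphOf G col) t A N (bucket q) (dbOf (n + 1) A (qTot c t) s1.mem) s3 := by
    refine ⟨(f3.regs _ (rn_notin_auxRegs (by omega))).trans d2, ?_, h3, ?_, fun e _ => by rw [hdb3],
      T3, fun j hj => (l3 j hj).1, fun M hM => .inl ?_⟩
    · rw [f3.regs _ (rn_notin_auxRegs (by simp only [layout]; omega)),
        f2.regs _ (rn_notin_auxRegs (by simp only [layout]; omega)), N1]
    · rw [f3.out, f2.out, f1.out, hout]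
    · exact (l3 _ (hge M hM).2).2 (hge M hM).1
  have hw1 : n + 1 < 2 ^ w := by
    have : (n + 1) ^ 1 ≤ (n + 1) ^ (A + qTot c t + 1) := Nat.pow_le_pow_right (by omega) (by omega)
    rw [pow_one] at this; omega
  have hk : ∀ x ∈ List.range c, (bodyP c t A).Keeps x := fun x hx =>
    keeps_bodyP (.inl (by rw [List.mem_range] at hx; omega))
  have hkc : (bodyP c t A).Keeps c := keeps_bodyP (by omega)
  have hset : ∀ u : RamState, ∀ x ∈ List.range c, ∀ v,
      TableInv (graphOf G col) t A N (bucket q) (dbOf (n + 1) A (qTot c t) s1.mem) u →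
      TableInv (graphOf G col) t A N (bucket q) (dbOf (n + 1) A (qTot c t) s1.mem) (u.setReg x v) := by
    intro u x hx v hu
    rw [List.mem_range] at hx
    refine ⟨?_, ?_, ?_, hu.out, hu.db, hu.head, hu.le, hu.cell⟩
    · rw [RamState.setReg_regs, if_neg (by omega), hu.regD]
    · rw [RamState.setReg_regs, if_neg (by simp only [layout]; omega), hu.regN]
    · rw [RamState.setReg_regs, if_neg (by omega), hu.top]
  have step := fun u (hu : TableInv (graphOf G col) t A N (bucket q)
      (dbOf (n + 1) A (qTot c t) s1.mem) u) =>
    bodyP_spec hn hA hw rfl (fun u hu => good_of_treewidthLE htw u hu) hcol g1 hNn hL hβ hmono hlen hu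
  have fin := Prog.forAll_inv (w := w) List.nodup_range (by simp) hk hkc hw1 _ hset
    (fun u hu _ _ => (step u hu).1) s3 inv3.regD inv3
  refine ⟨N, _, hN1, hNn, hNa, hnN, hB0, fin, fin.head, fun i hi => fin.le i (by omega), fun M hM => ?_⟩
  rcases fin.cell M hM with h0 | h
  swap
  · exact .inr h
  -- If `M` had a solution, the cell would be nonzero after the round for `M`, and it would have
  -- stayed so.
  refine .inl ⟨h0, fun hsol => ?_⟩
  have hMn : ∀ x ∈ List.range c, (fun x => if h : x < c then M ⟨x, h⟩ else 0) x < n + 1 := by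
    intro x hx
    rw [List.mem_range] at hx
    simp only [hx, dif_pos]
    have := hM ⟨x, hx⟩
    omega
  refine Prog.forAll_hit (w := w) List.nodup_range (by simp) hk hkc hw1 _
    (fun u => tab (n + 1) A (qTot c t) u.mem (cellAddr N (bucket q N + 1) fun x => bucket q (M x)) ≠ 0)
    hset (fun u hu _ _ => (step u hu).1) (fun u x _ v hu => hu)
    (fun u hu hP _ _ => (step u hu).2.1 M hM hP) _ hMn (fun u hu _ hreg => ?_) s3 inv3.regD inv3 h0
  have hMu : (fun x : Fin c => u.regs x) = M := by
    funext x
    rw [hreg x (by simp)]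
    simp
  have := (step u hu).2.2 (fun x => by rw [congrFun hMu x]; exact hM x) (by rw [hMu]; exact hsol)
  have e : (fun x : Fin c => bucket q (u.regs x)) = fun x => bucket q (M x) :=
    funext fun x => by rw [congrFun hMu x]
  rwa [e] at this

/-- The number of rounds must be a power of `n + 1`, so a whole region is scanned and a test cuts
the output at the length of the table. -/
theorem emitTabP_spec (hn : 1 ≤ n) (hw : (n + 1) ^ (A + qTot c t + 1) < 2 ^ w) (hL : 1 ≤ β N)
    (hβ : β N ≤ N) (hlen : tableLen c N (β N + 1) ≤ (n + 1) ^ A) (s : RamState)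
    (hd : s.regs c = n + 1) (hT : TableHead N β (tab (n + 1) A (qTot c t) s.mem)) :
    ((emitTabP c t A).run w c s).mem = s.mem ∧
    (∀ r, r ≠ c + 5 → ((emitTabP c t A).run w c s).regs r = s.regs r) ∧
    ((emitTabP c t A).run w c s).out = s.out ++
      (List.range (tableLen c N (β N + 1))).map (tab (n + 1) A (qTot c t) s.mem) := by
  have hpow : (n + 1) ^ A < 2 ^ w :=
    lt_of_le_of_lt (Nat.pow_le_pow_right (by omega) (by omega)) hw
  have hb := (tableLen_bounds (c := c) (N := N) (L := β N + 1) (by omega)).1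
  set len := tableLen c N (β N + 1) with hlendef
  set T := tab (n + 1) A (qTot c t) s.mem with hTdef
  have hr := Prog.rep_inv (w := w) (D := c) (d := n + 1) (a := A) (x := c + 5)
    (p := .ite (.op .lt (.reg (c + 5)) (lenE c (loadTab c t A)))
      (.emit (loadTab c t A (.reg (c + 5)))) .skip)
    (by simp [Prog.Keeps]) (by simp [Prog.Keeps]) (by omega) hpow s hd
    (fun i u => u.mem = s.mem ∧ (∀ r, r ≠ c + 5 → u.regs r = s.regs r) ∧
      u.out = s.out ++ (List.range (min i len)).map T) ?_ ?_
  · rw [min_eq_right hlen] at hr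
    exact hr
  · exact ⟨rfl, fun r hr => by simp [hr], by simp⟩
  · rintro i hi u ⟨h1, h2, h3⟩ hx hud
    have hld : ∀ e j, e.eval w u = j → j < N + 2 → (loadTab c t A e).eval w u = T j :=
      fun e j he hj => by rw [loadTab_eval hn hw hud he (by omega), h1]
    rw [Prog.run, eval_lt (eval_reg.trans hx) (lenE_eval hT hL hβ (by omega) hld) (by omega)]
    have hset : ∀ u' : RamState, (∀ r, r ≠ c + 5 → u'.regs r = s.regs r) →
        ∀ r, r ≠ c + 5 → (u'.setReg (c + 5) (i + 1)).regs r = s.regs r := by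
      intro u' hu' r hr
      rw [RamState.setReg_regs, if_neg hr, hu' r hr]
    by_cases hil : i < len
    · rw [if_pos hil, if_pos one_ne_zero, Prog.run, loadTab_eval hn hw hud (eval_reg.trans hx) hi]
      refine ⟨h1, hset _ h2, ?_⟩
      rw [RamState.setReg_out, min_eq_left (by omega), List.range_succ, List.map_append, h1, h3,
        min_eq_left (by omega), List.append_assoc]
      rfl
    · rw [if_neg hil, if_neg (by simp), Prog.run]
      refine ⟨h1, hset _ h2, ?_⟩
      rw [RamState.setReg_out, h3, min_eq_right (by omega), min_eq_right (by omega)]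

/-- The graph is stored as the list of addresses of its nonzero cells, so that restoring it takes
one store per entry. These addresses are at least `(n + 1) ^ A`, hence `0` can mark the end of the
list. -/
theorem emitGraphP_spec (hn : 1 ≤ n) (hw : (n + 1) ^ (A + qTot c t + 1) < 2 ^ w) (s : RamState)
    (hd : s.regs c = n + 1) (hN : s.regs (rN c) = n) :
    ∃ E : List ℕ, ((emitGraphP c A).run w c s).out = s.out ++ n :: (E ++ [0]) ∧ E.Nodup ∧
      ∀ x, x ∈ E ↔ (n + 1) ^ A ≤ x ∧ x < (c + 2) * (n + 1) ^ A ∧ s.mem x ≠ 0 := by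
  classical
  have hpow : ∀ {a}, a ≤ A + qTot c t + 1 → (n + 1) ^ a < 2 ^ w :=
    fun h => lt_of_le_of_lt (Nat.pow_le_pow_right (by omega) (by omega)) hw
  have hcq : c + 2 ≤ qTot c t := by simp only [layout]; omega
  have hc2 : (c + 2) * (n + 1) ^ A ≤ (n + 1) ^ (A + (c + 2)) := by
    rw [add_comm A, pow_add]
    exact Nat.mul_le_mul_right _ (Nat.lt_pow_self (by omega)).le
  have hcw : c + 2 < 2 ^ w :=
    lt_of_le_of_lt (Nat.lt_pow_self (show 1 < n + 1 by omega)).le (hpow (a := c + 2) (by omega))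
  have hDw := hpow (a := A) (by omega)
  have hAw := hpow (a := A + (c + 2)) (by omega)
  set D := (n + 1) ^ A with hD
  let P : ℕ → Prop := fun x => D ≤ x ∧ x < (c + 2) * D ∧ s.mem x ≠ 0
  set s1 := (Prog.emit (.reg (rN c))).run w c s with hs1
  have es1 : s1.mem = s.mem ∧ s1.regs = s.regs ∧ s1.out = s.out ++ [n] := by
    refine ⟨rfl, rfl, ?_⟩
    rw [hs1, Prog.run, eval_reg, hN]
  have hr := Prog.rep_inv (w := w) (D := c) (d := n + 1) (a := A + (c + 2)) (x := c + 5)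
    (p := .ite (.op .lt (.reg (c + 5)) (powE c A)) .skip
      (.ite (.op .lt (.reg (c + 5)) (.op .mul (.const (c + 2)) (powE c A)))
        (.ite (.load (.reg (c + 5))) (.emit (.reg (c + 5))) .skip) .skip))
    (by simp [Prog.Keeps]) (by simp [Prog.Keeps]) (by omega) hAw s1 (by rw [es1.2.1, hd])
    (fun i u => u.mem = s.mem ∧ u.out = s.out ++ [n] ++ (List.range i).filter P) ?_ ?_
  · obtain ⟨h1, h2⟩ := hr
    refine ⟨(List.range ((n + 1) ^ (A + (c + 2)))).filter P, ?_, List.Nodup.filter _ List.nodup_range,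
      fun x => ?_⟩
    · rw [emitGraphP, Prog.run_seq, Prog.run_seq, ← hs1]
      rw [Prog.run, h2, eval_const (by omega)]
      simp
    · simp only [List.mem_filter, List.mem_range, decide_eq_true_eq]
      exact ⟨fun h => h.2, fun h => ⟨by have := h.2.1; omega, h⟩⟩
  · exact ⟨es1.1, by simp [es1.2.2]⟩
  · rintro i hi u ⟨h1, h2⟩ hx hud
    have hp : (powE c A).eval w u = D := powE_eval u hud A hDw (by omega)
    rw [List.range_succ, List.filter_append]
    have key : ∀ v : RamState, v.mem = s.mem ∧ v.out = u.out ++ [i].filter P →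
        (v.setReg (c + 5) (i + 1)).mem = s.mem ∧ (v.setReg (c + 5) (i + 1)).out =
          s.out ++ [n] ++ ((List.range i).filter P ++ [i].filter P) := by
      rintro v ⟨h3, h4⟩
      exact ⟨h3, by rw [RamState.setReg_out, h4, h2, List.append_assoc]⟩
    refine key _ ?_
    have hno : ¬ P i → u.mem = s.mem ∧ u.out = u.out ++ [i].filter P := fun h => ⟨h1, by simp [h]⟩
    rw [Prog.run, eval_lt (eval_reg.trans hx) hp (by omega)]
    by_cases g1 : i < D
    · rw [if_pos g1, if_pos one_ne_zero, Prog.run]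
      exact hno fun h => by have := h.1; omega
    · rw [if_neg g1, if_neg (by simp), Prog.run, eval_lt (eval_reg.trans hx)
        (eval_mul (eval_const hcw) hp (by omega)) (by omega)]
      by_cases g2 : i < (c + 2) * D
      · rw [if_pos g2, if_pos one_ne_zero, Prog.run, eval_load (eval_reg.trans hx), h1]
        by_cases g3 : s.mem i = 0
        · rw [if_neg (by simpa using g3), Prog.run]
          exact hno fun h => h.2.2 g3
        · rw [if_pos g3, Prog.run, eval_reg, hx]
          have hP : P i := ⟨by omega, g2, g3⟩
          exact ⟨h1, by simp [hP]⟩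
      · rw [if_neg g2, if_neg (by simp), Prog.run]
        exact hno fun h => g2 h.2.1

end Builder

/-! ## Building indexes -/

theorem WordsFit.pow_lt {K n w k : ℕ} (h : WordsFit K n w) (hn : 1 ≤ n) (hk : k < K) :
    (n + 1) ^ k < 2 ^ w :=
  calc (n + 1) ^ k < (n + 1) ^ K := Nat.pow_lt_pow_right (by omega) hk
    _ ≤ (2 ^ (Nat.log 2 n + 1)) ^ K :=
      Nat.pow_le_pow_left (Nat.lt_pow_succ_log_self (by omega) n) K
    _ = 2 ^ (K * (Nat.log 2 n + 1)) := by rw [← pow_mul, mul_comm]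
    _ ≤ 2 ^ w := Nat.pow_le_pow_right (by omega) h

/-- Run the bounded-loop program `P`, where the number of rounds of a loop is a power of `n + 1`. -/
def builder (c : ℕ) (P : Prog) : RamProg :=
  .seq (.assign c (.op .add (.load (.const 0)) (.const 1))) (P.toRam c)

/-- The state in which a builder runs its program. -/
noncomputable def builderState {n c : ℕ} (G : SimpleGraph (Fin n)) (col : Fin n → Fin c) : RamState :=
  ⟨Function.update (fun _ => 0) c (n + 1), graphMem G col, []⟩

theorem exists_builds (c : ℕ) (P : Prog) (hP : P.Wf c) : ∃ D d : ℕ, ∀ (n : ℕ)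
    (G : SimpleGraph (Fin n)) (col : Fin n → Fin c) (w : ℕ), 1 ≤ n → WordsFit (P.maxExp + 2) n w →
      Builds w (builder c P) G col (D * n ^ d) (P.run w c (builderState G col)).out := by
  obtain ⟨D, d, h⟩ := P.bound_le c
  -- The `5` pays for loading `n + 1` into register `c`, and `2 ^ d` comes from `(n + 1) ^ d ≤ (2 *
  -- n) ^ d`.
  refine ⟨D * 2 ^ d + 5, d, fun n G col w hn hw => ?_⟩
  have hw1 := hw.pow_lt hn (k := 1) (by omega)
  rw [pow_one] at hw1
  have e0 := RamExec.assign (w := w) c (.op .add (.load (.const 0)) (.const 1))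
    ⟨fun _ => 0, graphMem G col, []⟩
  have hv : (RamExpr.op .add (.load (.const 0)) (.const 1)).eval w
      ⟨fun _ => 0, graphMem G col, []⟩ = n + 1 :=
    eval_add ((eval_load (eval_const (by omega))).trans (by simp [graphMem])) (eval_const (by omega)) hw1
  rw [hv] at e0
  obtain ⟨t, ht, e1⟩ := P.exec w c (n + 1) (by omega) hP (hw.pow_lt hn (by omega)) (by omega)
    (builderState G col) (by simp [builderState])
  refine ⟨_, _, .seq e0 e1, ?_, rfl⟩
  have h1 := h (n + 1) (by omega)
  have h2 : (n + 1) ^ d ≤ 2 ^ d * n ^ d := by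
    rw [← mul_pow]; exact Nat.pow_le_pow_left (by omega) d
  have h3 : D * (n + 1) ^ d ≤ D * 2 ^ d * n ^ d := by
    rw [mul_assoc]; exact Nat.mul_le_mul_left _ h2
  have h4 : 0 < n ^ d := Nat.pow_pos (by omega)
  simp only [RamExpr.cost]
  rw [add_mul]
  omega

theorem treewidthLE_self {n : ℕ} (G : SimpleGraph (Fin n)) : TreewidthLE G n := by
  refine ⟨1, ⊥, fun _ => Finset.univ, .of_subsingleton, fun u v _ => ⟨0, by simp, by simp⟩,
    fun v => ?_, fun _ => by simp⟩
  have : Nonempty {x : Fin 1 | v ∈ (Finset.univ : Finset (Fin n))} := ⟨⟨0, by simp⟩⟩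
  exact .of_subsingleton

/-- Running the construction with `t = n` proves existence for every graph. Cost is irrelevant here,
so the word length may be chosen as the very power of `n + 1` that has to be below `2 ^ w`. -/
theorem exists_isTable {n c : ℕ} (hn : 1 ≤ n) (G : SimpleGraph (Fin n)) (col : Fin n → Fin c) (q : ℕ) :
    ∃ T, IsTable (graphOf G col) n (bucket q) T := by
  set A := 2 * c + n + q + 4
  obtain ⟨N, B0, -, h1, h2, h3, -, -, h⟩ := tableP_spec (c := c) (A := A) (q := q) (a := 1)
    (treewidthLE_self G) hn le_rfl (by omega) (by omega) (by omega) (by omega)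
    Nat.lt_two_pow_self (builderState G col) (by simp [builderState]) rfl rfl
  obtain rfl : N = n := by rw [pow_one] at h2 h3; omega
  exact ⟨_, h⟩

/-- The list of the words of a table. -/
def tableList (c N L : ℕ) (T : ℕ → ℕ) : List ℕ := (List.range (tableLen c N L)).map T

theorem length_tableList {c N L : ℕ} {T : ℕ → ℕ} : (tableList c N L T).length = tableLen c N L := by
  simp [tableList]

theorem storedIn_tableList {c N L : ℕ} {T mem : ℕ → ℕ} {J : List ℕ}
    (h : StoredIn (tableList c N L T ++ J) mem) {i : ℕ} (hi : i < tableLen c N L) : mem i = T i := by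
  rw [h i (by rw [List.length_append, length_tableList]; omega),
    List.getElem_append_left (by rwa [length_tableList])]
  simp [tableList]

theorem exists_builds_table (c t q : ℕ) : ∃ (B : RamProg) (K D d : ℕ),
    ∀ (n : ℕ) (G : SimpleGraph (Fin n)) (col : Fin n → Fin c) (w : ℕ),
      1 ≤ n → TreewidthLE G t → WordsFit K n w → ∃ T, IsTable (graphOf G col) n (bucket q) T ∧
        Builds w B G col (D * n ^ d) (tableList c n (bucket q n + 1) T) := by
  set A := 2 * c + t + q + 4
  set P := Prog.seq (tableP c t A q 1) (emitTabP c t A)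
  obtain ⟨D, d, h⟩ := exists_builds c P ⟨keeps_tableP, wf_tableP, wf_emitTabP.1⟩
  refine ⟨builder c P, P.maxExp + 2 + (A + qTot c t + 2), D, d, fun n G col w hn htw hw => ?_⟩
  have hw' := hw.pow_lt hn (k := A + qTot c t + 1) (by omega)
  obtain ⟨N, B0, hN1, h1, h2, h3, -, hinv, hT⟩ := tableP_spec (c := c) (A := A) (q := q) (a := 1)
    htw hn le_rfl (by omega) (by omega) (by omega) (by omega) hw'
    (builderState G col) (by simp [builderState]) rfl rfl
  obtain rfl : N = n := by rw [pow_one] at h2 h3; omega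
  have hb := bucket_le (q := q) N
  have hemit := (emitTabP_spec hn hw' (one_le_bucket hn) hb
    (tableLen_le hn le_rfl (by omega) (by omega)) _ hinv.regD hT.head).2.2
  rw [hinv.out, List.nil_append] at hemit
  refine ⟨_, hT, ?_⟩
  have hB := h N G col w hn (le_trans (Nat.mul_le_mul_right _ (by omega)) hw)
  rwa [show (P.run w c (builderState G col)).out = _ from hemit] at hB

/-! ## Querying tables -/

section Query

variable {c n w N q : ℕ} {G : SimpleGraph (Fin n)} {col : Fin n → Fin c} {T : ℕ → ℕ}

theorem queryP_lookup (hT : IsTable (graphOf G col) N (bucket q) T) (hN : 1 ≤ N)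
    (hw : tableLen c N (bucket q N + 1) < 2 ^ w) (F : RamProg) {M : Fin c → ℕ} (hM : ∀ i, M i ≤ N)
    {s : RamState} (hs : ∀ i : Fin c, s.regs i = M i) (hout : s.out = [])
    (hmem : ∀ i < tableLen c N (bucket q N + 1), s.mem i = T i) :
    ∃ t s' m, RamExec w (queryP c F) s t s' ∧ s'.mem = s.mem ∧
      t ≤ (exceedsE c (topE .load)).cost + (addrE c .load).cost + 22 + 20 * m ∧
      ((s'.out = [] ∧ m = 0 ∧ ¬ ∃ S, IsMatch G col M S) ∨
        ∃ M' S, (∀ i, bucket q (M' i) = bucket q (M i)) ∧ m = ∑ i, M' i ∧ IsMatch G col M' S ∧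
          ListsNodes s'.out S) := by
  obtain ⟨t, s', e, ht, ho, hm⟩ := queryP_exec_lookup hT (one_le_bucket hN) (bucket_le N)
    (fun x hx => bucket_mono hx) hw graphOf_col F hM hs hmem
  rw [hout, List.nil_append] at ho
  refine ⟨t, s', _, e, hm, ht, ?_⟩
  rcases hT.cell M hM with ⟨h0, hno⟩ | ⟨M', -, hb, S, hS, hnd, hmemS⟩
  · rw [h0]
    refine .inl ⟨?_, rfl, fun h => hno (exists_isMatch_iff.mp h)⟩
    rw [ho, cellNodes, h0]; rfl
  · obtain ⟨S', hS', hL⟩ := listsNodes_of_solves hS hnd hmemS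
    refine .inr ⟨M', S', hb, ?_, hS', by rwa [ho]⟩
    have h2 : (cellNodes T (cellAddr N (bucket q N + 1) fun i => bucket q (M i))).toFinset = S := by
      ext v; rw [List.mem_toFinset, hmemS]
    rw [← card_of_solves graphOf_col hS, ← h2, List.toFinset_card_of_nodup hnd]
    simp [cellNodes]

/-- A bound on the time of a query to a table, where the frequencies in a bucket differ by a factor
of at most `r`. -/
def queryTime (c r : ℕ) : ℕ := (exceedsE c (topE .load)).cost + (addrE c .load).cost + 22 + 20 * r

/-- Since `|M| ≥ 1`, additive constants are absorbed into a multiple of `|M|`, and the listed nodes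
number at most `r * |M|` by `hr`. If a frequency exceeds `n` there is no match, so the fallback
program may be `skip`. -/
theorem isIndex_tableList (hT : IsTable (graphOf G col) n (bucket q) T) (hn : 1 ≤ n)
    (hw : tableLen c n (bucket q n + 1) < 2 ^ w) {Good : (Fin c → ℕ) → List ℕ → Prop} {r : ℕ}
    (hr : ∀ x y, bucket q x = bucket q y → y ≤ r * x)
    (hnil : ∀ M, (¬ ∃ S, IsMatch G col M S) → Good M [])
    (hgood : ∀ M M' S out, (∀ i, bucket q (M' i) = bucket q (M i)) → IsMatch G col M' S →
      ListsNodes out S → Good M out) :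
    IsIndex w (queryP c .skip) Good (fun m => queryTime c r * m) (tableList c n (bucket q n + 1) T) := by
  have hb := (tableLen_bounds (c := c) (N := n) (L := bucket q n + 1)
    (by have := one_le_bucket (q := q) hn; omega)).1
  refine ⟨fun x hx => ?_, fun M _ h1 mem _ hmem => ?_⟩
  · simp only [tableList, List.mem_map, List.mem_range] at hx
    obtain ⟨i, hi, rfl⟩ := hx
    have := hT.le i hi
    omega
  have hmem' : ∀ i < tableLen c n (bucket q n + 1), mem i = T i := fun i hi =>
    storedIn_tableList (J := []) (by rwa [List.append_nil]) hi
  have hregs : ∀ i : Fin c, queryRegs M i = M i := fun i => by simp [queryRegs]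
  have hconst : ∀ k, k ≤ k * ∑ i, M i := fun k => Nat.le_mul_of_pos_right _ h1
  by_cases hM : ∀ i, M i ≤ n
  · obtain ⟨t, s', m, e, hm, ht, h⟩ := queryP_lookup hT hn hw .skip hM
      (s := ⟨queryRegs M, mem, []⟩) hregs rfl hmem'
    refine ⟨t, s', e, ?_, ?_, by rwa [hm]⟩
    · have hmr : m ≤ r * ∑ i, M i := by
        rcases h with ⟨-, rfl, -⟩ | ⟨M', S, hb, rfl, -⟩
        · exact Nat.zero_le _
        · rw [Finset.mul_sum]
          exact Finset.sum_le_sum fun i _ => hr _ _ (hb i).symm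
      have := hconst ((exceedsE c (topE .load)).cost + (addrE c .load).cost + 22)
      dsimp only [queryTime]
      rw [add_mul, mul_assoc]
      omega
    · rcases h with ⟨h2, -, hno⟩ | ⟨M', S, hb, -, hS, hL⟩
      · rw [h2]; exact hnil M hno
      · exact hgood M M' S _ hb hS hL
  · push Not at hM
    refine ⟨_, _, .ite_true ?_ (.skip _), ?_, hnil M fun h => ?_, hmem⟩
    · rw [exceedsE_eval (topE_eval hT.head fun e i he hi => by
        rw [eval_load he]; exact hmem' i (by omega)) (by omega), if_pos]
      · simp
      · obtain ⟨i, hi⟩ := hM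
        exact ⟨i, hi.trans_eq (hregs i).symm⟩
    · have := hconst (queryTime c r)
      dsimp only [queryTime] at this ⊢
      omega
    · obtain ⟨i, hi⟩ := hM
      obtain ⟨S, hS⟩ := exists_isMatch_iff.mp h
      exact absurd (le_of_solves hS i) (by omega)

theorem isIndex_exact (hT : IsTable (graphOf G col) n (bucket 0) T) (hn : 1 ≤ n)
    (hw : tableLen c n (bucket 0 n + 1) < 2 ^ w) :
    IsIndex w (queryP c .skip) (ExactAnswer G col) (fun m => queryTime c 1 * m)
      (tableList c n (bucket 0 n + 1) T) := by
  refine isIndex_tableList hT hn hw (fun x y h => by rw [bucket_zero_inj h, one_mul])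
    (fun M h => .inr ⟨rfl, h⟩) fun M M' S out hb hS hL => .inl ⟨S, ?_, hL⟩
  obtain rfl : M' = M := funext fun i => bucket_zero_inj (hb i)
  exact hS

theorem isIndex_approx {ε : ℝ} (hε : 0 < ε) (hq : 1 / ε ≤ q)
    (hT : IsTable (graphOf G col) n (bucket q) T) (hn : 1 ≤ n)
    (hw : tableLen c n (bucket q n + 1) < 2 ^ w) :
    IsIndex w (queryP c .skip) (ApproxAnswer ε G col) (fun m => queryTime c ⌈1 + ε⌉₊ * m)
      (tableList c n (bucket q n + 1) T) := by
  refine isIndex_tableList hT hn hw (fun x y h => ?_)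
    (fun M h => .inr ⟨rfl, h⟩) fun M M' S out hb hS hL => .inl ⟨S, ⟨hS.1, fun i => ?_⟩, hL⟩
  · have h1 := bucket_ratio hq hε h
    have h2 : (1 + ε) * (x : ℝ) ≤ ⌈1 + ε⌉₊ * x :=
      mul_le_mul_of_nonneg_right (Nat.le_ceil _) (Nat.cast_nonneg x)
    exact_mod_cast h1.trans h2
  · rw [hS.2 i]
    exact ⟨bucket_ratio hq hε (hb i).symm, bucket_ratio hq hε (hb i)⟩

end Query

/-! ## The space of tables -/

theorem tableLen_exact_le (c : ℕ) {n : ℕ} (hn : 1 ≤ n) :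
    tableLen c n (bucket 0 n + 1) ≤ (3 + 2 ^ c * (c + 1)) * n ^ (c + 1) := by
  have hb : (bucket 0 n + 1) ^ c ≤ 2 ^ c * n ^ c := by
    rw [← mul_pow]
    exact Nat.pow_le_pow_left (by have := bucket_le (q := 0) n; omega) c
  have h1 : c * n + 1 ≤ (c + 1) * n := by rw [add_mul]; omega
  have h2 : (bucket 0 n + 1) ^ c * (c * n + 1) ≤ 2 ^ c * n ^ c * ((c + 1) * n) := Nat.mul_le_mul hb h1
  have h3 : n ≤ n ^ (c + 1) := Nat.le_self_pow (by omega) n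
  have h4 : 2 ^ c * n ^ c * ((c + 1) * n) = 2 ^ c * (c + 1) * n ^ (c + 1) := by ring
  unfold tableLen
  rw [add_mul]
  omega

theorem exists_tableLen_approx_le (c : ℕ) {q : ℕ} (hq : 0 < q) : ∃ C : ℕ, ∀ n : ℕ, 2 ≤ n →
    (tableLen c n (bucket q n + 1) : ℝ) ≤ C * (n * Real.log n ^ c) := by
  have hl : 0 < Real.log (1 + 1 / (q : ℝ)) := by
    have : (0 : ℝ) < q := Nat.cast_pos.mpr hq
    exact Real.log_pos (by simp [this])
  have hl2 : 0 < Real.log 2 := Real.log_pos (by norm_num)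
  -- Chosen so that the number of buckets is at most `κ * log n`: for `n ≥ 2` the additive constant
  -- `2` is at most `2 * log n / log 2`. The first summand of `C0` bounds the head of the table, of
  -- length `n + 2 ≤ 2 * n`.
  set κ : ℝ := 2 / Real.log 2 + 1 / Real.log (1 + 1 / (q : ℝ)) with hκ
  set C0 : ℝ := 2 * (1 / Real.log 2) ^ c + κ ^ c * (c + 1) with hC0
  refine ⟨⌈C0⌉₊, fun n hn => ?_⟩
  have hn2 : (2 : ℝ) ≤ n := by exact_mod_cast hn
  have hlog : Real.log 2 ≤ Real.log n := Real.log_le_log (by norm_num) hn2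
  have hlogn : 0 < Real.log n := hl2.trans_le hlog
  have hone : 1 ≤ Real.log n / Real.log 2 := (one_le_div hl2).mpr hlog
  have hb : ((bucket q n : ℝ) + 1) ≤ κ * Real.log n := by
    have := bucket_le_log hq (x := n) (by omega)
    have e : κ * Real.log n = 2 * (Real.log n / Real.log 2) +
        Real.log n / Real.log (1 + 1 / (q : ℝ)) := by rw [hκ]; ring
    rw [e]; linarith
  have hb' : ((bucket q n : ℝ) + 1) ^ c ≤ κ ^ c * Real.log n ^ c := by
    rw [← mul_pow]; exact pow_le_pow_left₀ (by positivity) hb c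
  have hone' : 1 ≤ (1 / Real.log 2) ^ c * Real.log n ^ c := by
    rw [← mul_pow, one_div_mul_eq_div]; exact one_le_pow₀ hone
  have h1 : ((c : ℝ) * n + 1) ≤ (c + 1) * n := by linarith
  calc (tableLen c n (bucket q n + 1) : ℝ)
      = (n + 2) * 1 + ((bucket q n : ℝ) + 1) ^ c * (c * n + 1) := by
        unfold tableLen; push_cast; ring
    _ ≤ (2 * n) * ((1 / Real.log 2) ^ c * Real.log n ^ c) +
        (κ ^ c * Real.log n ^ c) * ((c + 1) * n) := by
        refine add_le_add (mul_le_mul (by linarith) hone' (by norm_num) (by positivity)) ?_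
        exact mul_le_mul hb' h1 (by positivity) (by positivity)
    _ = C0 * (n * Real.log n ^ c) := by rw [hC0]; ring
    _ ≤ _ := mul_le_mul_of_nonneg_right (Nat.le_ceil _) (by positivity)

/-! ## Answering queries with the stored graph -/

section Restart

variable (c t A : ℕ)

/-- Set all memory cells whose addresses are listed from the address in register `c + 6` on, up to
the first `0`, to `1`. -/
def reloadP : Prog :=
  .rep A (c + 5) (.ite (.load (.reg (c + 6)))
    (.seq (.store (.load (.reg (c + 6))) (.const 1))
      (.assign (c + 6) (.op .add (.reg (c + 6)) (.const 1)))) .skip)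

/-- List the allowed nodes. -/
def emitAliveP : Prog :=
  .rep 1 (c + 5) (.ite (.load (cellE c A (qAlive c) (.reg (c + 5)))) (.emit (.reg (c + 5))) .skip)

/-- Restore the relations of the stored graph and list the nodes of a solution. -/
noncomputable def restartP : Prog :=
  .seq (clearRegions c A (c + 5) ((List.range (c + 1)).map (· + 1))) (.seq (reloadP c A)
    (.ite (exceedsE c (.reg (rN c))) .skip
      (.seq (solveP c t A) (.ite (.reg (rRes c)) (emitAliveP c A) .skip))))

/-- Prepare the registers for `restartP`: the graph is stored after the table. -/
def locateP : RamProg :=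
  .seq (.assign (c + 6) (lenE c .load)) (.seq (.assign (rN c) (.load (.reg (c + 6))))
    (.seq (.assign (c + 6) (.op .add (.reg (c + 6)) (.const 1)))
      (.assign c (.op .add (.reg (rN c)) (.const 1)))))

variable {c t A}

theorem keeps_reloadP {x : ℕ} (h : x ≠ c + 5 ∧ x ≠ c + 6) : (reloadP c A).Keeps x :=
  ⟨h.1, ⟨trivial, h.2⟩, trivial⟩

theorem wf_restartP : (restartP c t A).Wf c := by
  refine ⟨keeps_clearRegions (by omega), wf_clearRegions (by omega), keeps_reloadP (by omega),
    ?_, trivial, keeps_solveP (notMem_solveRegs (by omega)), wf_solveP, ?_, trivial⟩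
  all_goals simp [reloadP, emitAliveP, Prog.Wf, Prog.Keeps]

variable {w d n : ℕ}

/-- Once the pointer reaches the terminating `0`, it stays there and the remaining rounds do
nothing. The stores go to addresses from `d ^ A` on, so they cannot damage the list that is being
read. -/
theorem reloadP_spec {R Q : ℕ} (h : Fits w d A R) (s : RamState) (hd : s.regs c = d)
    {p : ℕ} (hp : s.regs (c + 6) = p) {E : List ℕ} (hlen : p + E.length < d ^ A)
    (hE : ∀ x ∈ E, d ^ A ≤ x ∧ x < Q * d ^ A) (hmem : ∀ (j : ℕ) (hj : j < E.length), s.mem (p + j) = E[j])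
    (hend : s.mem (p + E.length) = 0) :
    Frame {c + 5, c + 6} d A Q s ((reloadP c A).run w c s) ∧
      ∀ a, ((reloadP c A).run w c s).mem a ≠ 0 ↔ s.mem a ≠ 0 ∨ a ∈ E := by
  have hpos := h.pow_pos
  have hpw := h.pow_lt
  have := Prog.rep_inv (w := w) (D := c) (d := d) (a := A) (x := c + 5)
    (p := .ite (.load (.reg (c + 6))) (.seq (.store (.load (.reg (c + 6))) (.const 1))
      (.assign (c + 6) (.op .add (.reg (c + 6)) (.const 1)))) .skip)
    (by simp [Prog.Keeps]) (by simp [Prog.Keeps]) (by omega) hpw s hd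
    (fun i u => Frame {c + 5, c + 6} d A Q s u ∧ u.regs (c + 6) = p + min i E.length ∧
      ∀ a, u.mem a ≠ 0 ↔ s.mem a ≠ 0 ∨ a ∈ E.take i) ?_ ?_
  · rw [List.take_of_length_le (by omega)] at this
    exact ⟨this.1, this.2.2⟩
  · exact ⟨(Frame.refl s).setReg (by simp) 0, by simp [hp], by simp⟩
  · rintro i hi u ⟨h1, h2, h3⟩ hx hud
    rw [Prog.run, eval_load (eval_reg.trans h2), h1.mem _ (.inl (by omega))]
    by_cases hil : i < E.length
    · rw [min_eq_left hil.le, hmem i hil] at *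
      have hx := hE E[i] (List.getElem_mem hil)
      have hv : (RamExpr.load (.reg (c + 6))).eval w u = E[i] := by
        rw [eval_load (eval_reg.trans h2), h1.mem _ (.inl (by omega)), hmem i hil]
      rw [if_pos (by omega), Prog.run_seq, Prog.run, Prog.run, hv, eval_const (by omega),
        eval_add (a := .reg (c + 6)) (x := p + i) (s := u.setMem E[i] 1) (eval_reg.trans h2)
          (eval_const (by omega)) (by omega)]
      have hfr : Frame {c + 5, c + 6} d A Q u (u.setMem E[i] 1) := by
        refine ⟨fun _ _ => rfl, rfl, fun a ha => ?_⟩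
        rw [RamState.setMem_mem, if_neg (by omega)]
      refine ⟨((h1.trans hfr).setReg (by simp) _).setReg (by simp) _, ?_, fun a => ?_⟩
      · simp
        omega
      · simp only [RamState.setReg_mem, RamState.setMem_mem]
        rw [List.take_succ_eq_append_getElem hil, List.mem_append, List.mem_singleton]
        by_cases ha : a = E[i]
        · simp [ha]
        · rw [if_neg ha, h3 a]; tauto
    · rw [min_eq_right (by omega)] at *
      rw [hend, if_neg (by simp), Prog.run]
      refine ⟨h1.setReg (by simp) _, ?_, fun a => ?_⟩
      · rw [RamState.setReg_regs, if_neg (by omega), h2, min_eq_right (by omega)]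
      · rw [RamState.setReg_mem, h3, List.take_of_length_le (by omega),
          List.take_of_length_le (by omega)]

open Classical in
theorem emitAliveP_spec (hn : 1 ≤ n) (hA : 1 ≤ A) (hw : (n + 1) ^ (A + qTot c t + 1) < 2 ^ w)
    (s : RamState) (hd : s.regs c = n + 1) :
    ((emitAliveP c A).run w c s).mem = s.mem ∧ ((emitAliveP c A).run w c s).out = s.out ++
      (List.range (n + 1)).filter fun v => (qAlive c, v) ∈ dbOf (n + 1) A (qTot c t) s.mem := by
  have hf := fits_of_lt (Q := qTot c t) (by omega) hw
  have hw1 : (n + 1) ^ 1 < 2 ^ w :=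
    lt_of_le_of_lt (Nat.pow_le_pow_right (by omega) (by omega)) hw
  have hA1 : (n + 1) ^ 1 ≤ (n + 1) ^ A := Nat.pow_le_pow_right (by omega) hA
  have := Prog.rep_inv (w := w) (D := c) (d := n + 1) (a := 1) (x := c + 5)
    (p := .ite (.load (cellE c A (qAlive c) (.reg (c + 5)))) (.emit (.reg (c + 5))) .skip)
    ⟨trivial, trivial⟩ ⟨trivial, trivial⟩ (by omega) hw1 s hd
    (fun i u => u.mem = s.mem ∧ u.out = s.out ++
      (List.range i).filter fun v => (qAlive c, v) ∈ dbOf (n + 1) A (qTot c t) s.mem)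
    ⟨rfl, by simp⟩ ?_
  · rwa [pow_one] at this
  · rintro i hi u ⟨h1, h2⟩ hx hud
    have hal := load_ne_zero_iff (Q := qTot c t) hf (by omega) u hud (q := qAlive c)
      (by simp only [layout]; omega) (by simp only [layout]; omega) (.reg (c + 5)) hx (by omega)
    rw [Prog.run, List.range_succ, List.filter_append]
    rw [h1] at hal
    by_cases ha : (qAlive c, i) ∈ dbOf (n + 1) A (qTot c t) s.mem
    · rw [if_pos (hal.mpr ha), Prog.run, eval_reg, hx]
      exact ⟨h1, by simp [h2, ha]⟩
    · rw [if_neg (fun h => ha (hal.mp h)), Prog.run]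
      exact ⟨h1, by simp [h2, ha]⟩

variable {G : SimpleGraph (Fin n)} {col : Fin n → Fin c}

/-- The memory outside of the index is arbitrary, so the graph relations are cleared before they are
restored; all other relations are reset by `solveP` itself. The index lies in region `0`, which is
never written. -/
theorem restartP_spec (htw : TreewidthLE G t) (hn : 1 ≤ n) (hA : t + c + 4 ≤ A)
    (hw : (n + 1) ^ (A + qTot c t + 1) < 2 ^ w) {B0 : Set (ℕ × ℕ)}
    (hB0 : GraphStored (graphOf G col) B0) (s : RamState) (hd : s.regs c = n + 1)
    (hN : s.regs (rN c) = n) {p : ℕ} (hp : s.regs (c + 6) = p) (hout : s.out = []) {E : List ℕ}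
    (hlen : p + E.length < (n + 1) ^ A)
    (hE : ∀ x ∈ E, (n + 1) ^ A ≤ x ∧ x < (c + 2) * (n + 1) ^ A)
    (hEB : ∀ q i, 1 ≤ q → q ≤ c + 1 → i < (n + 1) ^ A → (q * (n + 1) ^ A + i ∈ E ↔ (q, i) ∈ B0))
    (hmem : ∀ (j : ℕ) (hj : j < E.length), s.mem (p + j) = E[j]) (hend : s.mem (p + E.length) = 0)
    {M : Fin c → ℕ} (hM : ∀ q : Fin c, s.regs q = M q) :
    (∀ a < (n + 1) ^ A, ((restartP c t A).run w c s).mem a = s.mem a) ∧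
      ExactAnswer G col M ((restartP c t A).run w c s).out := by
  classical
  have hf := fits_of_lt (Q := qTot c t) (by omega) hw
  have hQ : qTot c t ≤ qTot c t + 1 := by omega
  have hcQ : c + 2 ≤ qTot c t := by simp only [layout]; omega
  have hw1 : 1 < 2 ^ w := lt_of_le_of_lt (Nat.one_le_pow _ _ (by omega)) hw
  obtain ⟨f1, e1⟩ := clearRegions_spec (z := c + 5) hf hQ (by omega)
    (L := (List.range (c + 1)).map (· + 1)) (by simp; omega) s hd
  rw [restartP, Prog.run_seq, Prog.run_seq]
  set s1 := (clearRegions c A (c + 5) ((List.range (c + 1)).map (· + 1))).run w c s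
  have hs1 : ∀ r, r ≠ c + 5 → s1.regs r = s.regs r := fun r hr => f1.regs r hr
  obtain ⟨f2, e2⟩ := reloadP_spec (c := c) hf s1 (by rw [hs1 _ (by omega), hd])
    (p := p) (by rw [hs1 _ (by omega), hp]) hlen
    (fun x hx => ⟨(hE x hx).1, (hE x hx).2.trans_le (Nat.mul_le_mul_right _ hcQ)⟩)
    (fun j hj => by rw [f1.mem _ (.inl (by omega)), hmem j hj])
    (by rw [f1.mem _ (.inl (by omega)), hend])
  set s2 := (reloadP c A).run w c s1
  have hs2 : ∀ r, r ≠ c + 5 → r ≠ c + 6 → s2.regs r = s.regs r := fun r h5 h6 => by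
    rw [f2.regs r (by simp [h5, h6]), hs1 r h5]
  have hdb : ∀ q i, 1 ≤ q → q ≤ c + 1 → i < (n + 1) ^ A →
      ((q, i) ∈ dbOf (n + 1) A (qTot c t) s2.mem ↔ (q, i) ∈ B0) := by
    intro q i h1 h2 h3
    rw [← hEB q i h1 h2 h3]
    have hno : (q, i) ∉ dbOf (n + 1) A (qTot c t) s1.mem := by
      rw [e1]
      rintro ⟨-, h⟩
      simp only [List.mem_map, List.mem_range, not_exists, not_and] at h
      exact h (q - 1) (by omega) (by omega)
    have hz : s1.mem (q * (n + 1) ^ A + i) = 0 := by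
      by_contra h
      exact hno ⟨h1, by dsimp only; omega, h3, h⟩
    have := e2 (q * (n + 1) ^ A + i)
    rw [hz] at this
    simp only [ne_eq, not_true_eq_false, false_or] at this
    rw [← this]
    exact ⟨fun h => h.2.2.2, fun h => ⟨h1, by dsimp only; omega, h3, h⟩⟩
  have hst : GraphStored (graphOf G col) (dbOf (n + 1) A (qTot c t) s2.mem) := by
    refine ⟨fun x hx y hy => (hdb _ _ (by simp only [layout]; omega) (by simp only [layout]; omega)
      ?_).trans (hB0.adj x hx y hy), fun q v hv => (hdb _ _ (by simp only [layout]; omega)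
      (by have := q.2; simp only [layout]; omega) ?_).trans (hB0.col q v hv)⟩
    · refine (Nat.ofDigits_lt_base_pow_length (by omega) ?_).trans_le
        (Nat.pow_le_pow_right (by omega) (show [x, y].length ≤ A by simp; omega))
      simp; omega
    · exact (show v < (n + 1) ^ 1 by rw [pow_one]; omega).trans_le (Nat.pow_le_pow_right (by omega) (by omega))
  have hM2 : ∀ q : Fin c, s2.regs q = M q := fun q => by
    rw [hs2 _ (by have := q.2; omega) (by have := q.2; omega), hM]
  have hN2 : s2.regs (rN c) = n := by
    rw [hs2 _ (by simp only [layout]; omega) (by simp only [layout]; omega), hN]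
  have hd2 : s2.regs c = n + 1 := by rw [hs2 _ (by omega) (by omega), hd]
  have hm2 : ∀ a < (n + 1) ^ A, s2.mem a = s.mem a := fun a ha => by
    rw [f2.mem a (.inl ha), f1.mem a (.inl ha)]
  have ho2 : s2.out = [] := by rw [f2.out, f1.out, hout]
  rw [Prog.run, exceedsE_eval (eval_reg.trans hN2) hw1]
  by_cases hex : ∃ q : Fin c, n < s2.regs q
  · rw [if_pos hex, if_pos one_ne_zero, Prog.run]
    refine ⟨hm2, .inr ⟨ho2, fun h => ?_⟩⟩
    obtain ⟨q, hq⟩ := hex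
    obtain ⟨S, hS⟩ := exists_isMatch_iff.mp h
    rw [hM2] at hq
    exact absurd (le_of_solves hS q) (by omega)
  · rw [if_neg hex, if_neg (by simp), Prog.run_seq]
    push Not at hex
    obtain ⟨X, hX, hres⟩ := solveP_spec hn hA hw rfl (fun u hu => good_of_treewidthLE htw u hu)
      hd2 hN2 hex hst
    simp only [hM2] at hres
    set s3 := (solveP c t A).run w c s2
    have hm3 : ∀ a < (n + 1) ^ A, s3.mem a = s.mem a := fun a ha => by
      rw [hX.frame.mem a (.inl ha), hm2 a ha]
    have ho3 : s3.out = [] := hX.frame.out.trans ho2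
    rw [Prog.run, eval_reg]
    rcases hres with ⟨h1, S, hS, hXS⟩ | ⟨h1, hno⟩
    · rw [h1, if_pos one_ne_zero]
      obtain ⟨g1, g2⟩ := emitAliveP_spec (t := t) hn (by omega) hw s3
        (by rw [hX.frame.regs _ (notMem_solveRegs (by omega)), hd2])
      rw [ho3, List.nil_append] at g2
      rw [g1, g2]
      refine ⟨hm3, .inl (listsNodes_of_solves hS (List.nodup_range.filter _) fun v => ?_)⟩
      simp only [List.mem_filter, List.mem_range, decide_eq_true_eq]
      constructor
      · rintro ⟨h2, h3⟩
        exact (hXS v).mp ((hX.alive v (by omega)).mp h3)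
      · intro h
        have : v < n := (graphOf G col).alive_lt v (hS.2.1 v h)
        exact ⟨by omega, (hX.alive v (by omega)).mpr ((hXS v).mpr h)⟩
    · rw [h1, if_neg (by simp), Prog.run]
      exact ⟨hm3, .inr ⟨ho3, fun h => hno (exists_isMatch_iff.mp h)⟩⟩

theorem locateP_exec {N : ℕ} {β T : ℕ → ℕ} (hT : TableHead N β T) (hL : 1 ≤ β N) (hβ : β N ≤ N)
    {s : RamState} (hmem : ∀ i < tableLen c N (β N + 1), s.mem i = T i)
    (hs : s.mem (tableLen c N (β N + 1)) = n) (hw : tableLen c N (β N + 1) + 1 < 2 ^ w)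
    (hnw : n + 1 < 2 ^ w) :
    ∃ s', RamExec w (locateP c) s ((lenE c .load).cost + 12) s' ∧ s'.mem = s.mem ∧ s'.out = s.out ∧
      s'.regs c = n + 1 ∧ s'.regs (rN c) = n ∧ s'.regs (c + 6) = tableLen c N (β N + 1) + 1 ∧
      ∀ r < c, s'.regs r = s.regs r := by
  have hb := (tableLen_bounds (c := c) (N := N) (L := β N + 1) (by omega)).1
  have h1 : (lenE c .load).eval w s = tableLen c N (β N + 1) :=
    lenE_eval hT hL hβ (by omega) fun e i he hi => by rw [eval_load he, hmem i (by omega)]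
  set len := tableLen c N (β N + 1)
  have e1 := RamExec.assign (w := w) (c + 6) (lenE c .load) s
  rw [h1] at e1
  have e2 := RamExec.assign (w := w) (rN c) (.load (.reg (c + 6)))
    ⟨Function.update s.regs (c + 6) len, s.mem, s.out⟩
  rw [eval_load (a := .reg (c + 6)) (x := len) (by simp [RamExpr.eval])] at e2
  dsimp only at e2
  rw [hs] at e2
  set r2 := Function.update (Function.update s.regs (c + 6) len) (rN c) n
  have hr2 : r2 (c + 6) = len ∧ r2 (rN c) = n := by
    simp [r2, rN]
  have e3 := RamExec.assign (w := w) (c + 6) (.op .add (.reg (c + 6)) (.const 1)) ⟨r2, s.mem, s.out⟩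
  rw [eval_add (a := .reg (c + 6)) (x := len) (eval_reg.trans hr2.1) (eval_const (by omega)) hw] at e3
  dsimp only at e3
  set r3 := Function.update r2 (c + 6) (len + 1)
  have hr3 : r3 (c + 6) = len + 1 ∧ r3 (rN c) = n := by
    simp [r3, r2, rN]
  have e4 := RamExec.assign (w := w) c (.op .add (.reg (rN c)) (.const 1)) ⟨r3, s.mem, s.out⟩
  rw [eval_add (a := .reg (rN c)) (x := n) (eval_reg.trans hr3.2) (eval_const (by omega)) hnw] at e4
  dsimp only at e4
  have e := RamExec.seq e1 (.seq e2 (.seq e3 e4))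
  simp only [RamExpr.cost] at e
  have hN : c + 1 = rN c := rfl
  refine ⟨⟨Function.update r3 c (n + 1), s.mem, s.out⟩, ?_, rfl, rfl, Function.update_self _ _ _,
    (Function.update_of_ne (by omega) _ _).trans hr3.2,
    (Function.update_of_ne (by omega) _ _).trans hr3.1, fun r hr => ?_⟩
  · rw [show (lenE c .load).cost + 12 = (lenE c .load).cost + 1 +
      (1 + 1 + 1 + (1 + 1 + 1 + 1 + (1 + 1 + 1 + 1))) by omega]
    exact e
  · have h1 : r ≠ c := by omega
    have h2 : r ≠ c + 6 := by omega
    have h3 : r ≠ rN c := by omega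
    simp [r3, r2, h1, h2, h3]

end Restart

/-! ## The index of linear size -/

theorem IsIndex.mono {c w : ℕ} {Q : RamProg} {Good : (Fin c → ℕ) → List ℕ → Prop} {f g : ℕ → ℕ}
    {I : List ℕ} (h : IsIndex w Q Good f I) (hfg : ∀ m, f m ≤ g m) : IsIndex w Q Good g I :=
  ⟨h.words, fun M h1 h2 mem h3 h4 =>
    let ⟨t, s', e, ht, r⟩ := h.answers M h1 h2 mem h3 h4
    ⟨t, s', e, ht.trans (hfg _), r⟩⟩

section Linear

variable {c t A n w N : ℕ} {G : SimpleGraph (Fin n)} {col : Fin n → Fin c} {T : ℕ → ℕ}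

/-- The listed addresses stem from at most `2 * t * n` ordered edges and one colour per node. -/
theorem length_le_of_graphExact (htw : TreewidthLE G t) {B0 : Set (ℕ × ℕ)}
    (hB0 : GraphExact (G := G) (col := col) B0) {D : ℕ} {E : List ℕ} (hnd : E.Nodup)
    (hE : ∀ x ∈ E, ∃ e ∈ B0, x = e.1 * D + e.2) : E.length ≤ (2 * t + 1) * n := by
  classical
  let X := ((Finset.range n ×ˢ Finset.range n).filter fun e => gAdj G e.1 e.2).image
    fun e => qAdj * D + Nat.ofDigits (n + 1) [e.1, e.2]
  let Y := (Finset.univ : Finset (Fin n)).image fun v => qCol c (col v) * D + (v : ℕ)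
  have hsub : E.toFinset ⊆ X ∪ Y := by
    intro x hx
    rw [List.mem_toFinset] at hx
    obtain ⟨e, he, rfl⟩ := hE x hx
    rw [Finset.mem_union]
    rcases hB0.only e he with ⟨u, v, huv, rfl⟩ | ⟨v, q, ⟨hv, rfl⟩, rfl⟩
    · refine .inl (Finset.mem_image.mpr ⟨(u, v), ?_, rfl⟩)
      simp only [Finset.mem_filter, Finset.mem_product, Finset.mem_range]
      exact ⟨⟨huv.1, huv.2.1⟩, huv⟩
    · exact .inr (Finset.mem_image.mpr ⟨⟨v, hv⟩, Finset.mem_univ _, rfl⟩)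
  have h1 : X.card ≤ 2 * t * n := by
    refine Finset.card_image_le.trans ?_
    have := card_edges_le gAdj_irrefl gAdj_symm (fun u hu => good_of_treewidthLE htw u hu)
      (Finset.range n) (fun a ha => Finset.mem_range.mp ha)
    rwa [Finset.card_range] at this
  have h2 : Y.card ≤ n := Finset.card_image_le.trans (by simp)
  rw [← List.toFinset_card_of_nodup hnd]
  have h3 := (Finset.card_le_card hsub).trans (Finset.card_union_le X Y)
  rw [add_mul]
  omega

theorem tableLen_root_le (hN : 1 ≤ N) (h : N ^ (c + 1) ≤ n) :
    tableLen c N (bucket 0 N + 1) ≤ (3 + 2 ^ c * (c + 1)) * n :=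
  (tableLen_exact_le c hN).trans (Nat.mul_le_mul_left _ h)

/-- Query a table, or search the stored graph. -/
noncomputable def linearQuery (c t A : ℕ) : RamProg :=
  queryP c (.seq (locateP c) ((restartP c t A).toRam c))

/-- A constant for the time of `linearQuery`. -/
def linearTime (c D : ℕ) : ℕ := queryTime c 1 + (lenE c .load).cost + 13 + D

/-- Small frequencies are answered by the table. A frequency above `N` makes `|M|` so large that the
polynomial time of a search in the restored graph is affordable. By `hlen` the index fits into
region `0`, and so survives the search. -/
theorem isIndex_linear (htw : TreewidthLE G t) (hn : 1 ≤ n) (hA : t + c + 4 ≤ A)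
    (hw : (n + 1) ^ (A + qTot c t + 1) < 2 ^ w) (hw' : (n + 1) ^ (restartP c t A).maxExp < 2 ^ w)
    (hT : IsTable (graphOf G col) N (bucket 0) T) (hN : 1 ≤ N)
    (hnN : n < (N + 1) ^ (c + 1)) {B0 : Set (ℕ × ℕ)} (hB0 : GraphStored (graphOf G col) B0)
    {E : List ℕ} (hlen : tableLen c N (bucket 0 N + 1) + E.length + 2 ≤ (n + 1) ^ A)
    (hE : ∀ x ∈ E, (n + 1) ^ A ≤ x ∧ x < (c + 2) * (n + 1) ^ A)
    (hEB : ∀ q i, 1 ≤ q → q ≤ c + 1 → i < (n + 1) ^ A → (q * (n + 1) ^ A + i ∈ E ↔ (q, i) ∈ B0))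
    {D e : ℕ} (hD : (restartP c t A).bound (n + 1) c ≤ D * (n + 1) ^ e) :
    IsIndex w (linearQuery c t A) (ExactAnswer G col)
      (fun m => linearTime c D * m ^ ((c + 1) * e + 1))
      (tableList c N (bucket 0 N + 1) T ++ n :: (E ++ [0])) := by
  have hf := fits_of_lt (Q := qTot c t) (by omega) hw
  have hcQ : c + 2 ≤ qTot c t + 1 := by simp only [layout]; omega
  have hnw : n + 1 < 2 ^ w := by
    have : (n + 1) ^ 1 ≤ (n + 1) ^ (A + qTot c t + 1) := Nat.pow_le_pow_right (by omega) (by omega)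
    rw [pow_one] at this; omega
  have hAw := hf.pow_lt
  have hcw : (c + 2) * (n + 1) ^ A < 2 ^ w :=
    lt_of_le_of_lt (Nat.mul_le_mul_right _ hcQ) hf.lt
  have hb := (tableLen_bounds (c := c) (N := N) (L := bucket 0 N + 1)
    (by have := one_le_bucket (q := 0) hN; omega)).1
  refine ⟨fun x hx => ?_, fun M _ h1 mem _ hmem => ?_⟩
  · simp only [tableList, List.mem_append, List.mem_map, List.mem_range, List.mem_cons,
      List.not_mem_nil, or_false] at hx
    rcases hx with ⟨i, hi, rfl⟩ | rfl | hx | rfl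
    · have := hT.le i hi
      omega
    · omega
    · exact (hE x hx).2.trans hcw
    · omega
  have hmem' : ∀ i < tableLen c N (bucket 0 N + 1), mem i = T i := fun i hi =>
    storedIn_tableList hmem hi
  have hrest : ∀ (j : ℕ) (hj : j < (n :: (E ++ [0])).length),
      mem (tableLen c N (bucket 0 N + 1) + j) = (n :: (E ++ [0]))[j] := by
    intro j hj
    rw [hmem _ (by rw [List.length_append, length_tableList]; omega), List.getElem_append_right
      (by rw [length_tableList]; omega)]
    congr 1
    rw [length_tableList]; omega
  have hregs : ∀ i : Fin c, queryRegs M i = M i := fun i => by simp [queryRegs]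
  set m := ∑ i, M i with hm
  have hpow : ∀ k, k ≤ k * m ^ ((c + 1) * e + 1) := fun k =>
    Nat.le_mul_of_pos_right _ (Nat.pow_pos h1)
  have hm1 : m ≤ m ^ ((c + 1) * e + 1) := Nat.le_self_pow (by omega) m
  by_cases hM : ∀ i, M i ≤ N
  · obtain ⟨τ, s', m', ex, hmm, ht, h⟩ := queryP_lookup (w := w) hT hN (by omega)
      (.seq (locateP c) ((restartP c t A).toRam c)) hM
      (s := ⟨queryRegs M, mem, []⟩) hregs rfl hmem'
    have hm' : m' ≤ m := by
      rcases h with ⟨-, rfl, -⟩ | ⟨M', S, hb, rfl, -⟩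
      · exact Nat.zero_le _
      · exact Finset.sum_le_sum fun i _ => (bucket_zero_inj (hb i)).le
    refine ⟨τ, s', ex, ?_, ?_, by rwa [hmm]⟩
    · have h2 := hpow ((exceedsE c (topE .load)).cost + (addrE c .load).cost + 22)
      have h3 := hpow ((lenE c .load).cost + 13 + D)
      dsimp only [linearTime, queryTime]
      rw [add_assoc, add_assoc, add_mul, add_mul]
      omega
    · rcases h with ⟨h2, -, hno⟩ | ⟨M', S, hb, -, hS, hL⟩
      · exact .inr ⟨h2, hno⟩
      · obtain rfl : M' = M := funext fun i => bucket_zero_inj (hb i)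
        exact .inl ⟨S, hS, hL⟩
  · push Not at hM
    obtain ⟨i, hi⟩ := hM
    have hMm : M i ≤ m := Finset.single_le_sum (f := M) (fun _ _ => Nat.zero_le _) (Finset.mem_univ i)
    -- The threshold at work: `n < (N + 1) ^ (c + 1)` and `N + 1 ≤ M i ≤ m`.
    have hnm : n + 1 ≤ m ^ (c + 1) :=
      hnN.trans_le (Nat.pow_le_pow_left (by omega) _)
    obtain ⟨s1, e1, hm1', ho1, hd1, hN1, hp1, hr1⟩ := locateP_exec (n := n) (w := w)
      (s := ⟨queryRegs M, mem, []⟩) hT.head (one_le_bucket hN) (bucket_le N) hmem'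
      (hrest 0 (by simp)) (by omega) hnw
    dsimp only at hm1' ho1 hr1
    obtain ⟨τ, hτ, e2⟩ := (restartP c t A).exec w c (n + 1) (by omega) wf_restartP hw'
      (by omega) s1 hd1
    obtain ⟨g1, g2⟩ := restartP_spec htw hn hA hw hB0 s1 hd1 hN1 hp1 ho1 (E := E) (by omega) hE hEB
      (fun j hj => by
        have := hrest (j + 1) (by simp; omega)
        rw [hm1', add_assoc, add_comm 1 j, this]
        simp [List.getElem_append_left hj])
      (by
        have := hrest (E.length + 1) (by simp)
        rw [hm1', add_assoc, add_comm 1 E.length, this]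
        simp) (M := M) (fun q => (hr1 q q.2).trans (hregs q))
    refine ⟨_, _, .ite_true ?_ (.seq e1 e2), ?_, g2, fun j hj => ?_⟩
    · rw [exceedsE_eval (topE_eval hT.head fun e i he hi => by
        rw [eval_load he]; exact hmem' i (by omega)) (by omega), if_pos]
      · simp
      · exact ⟨i, hi.trans_eq (hregs i).symm⟩
    · have h2 := hpow (queryTime c 1 + (lenE c .load).cost + 13)
      have h3 : D * (n + 1) ^ e ≤ D * m ^ ((c + 1) * e + 1) := by
        refine Nat.mul_le_mul_left _ ?_
        calc (n + 1) ^ e ≤ (m ^ (c + 1)) ^ e := Nat.pow_le_pow_left hnm e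
          _ = m ^ ((c + 1) * e) := (pow_mul _ _ _).symm
          _ ≤ _ := Nat.pow_le_pow_right h1 (by omega)
      have h4 : (exceedsE c (topE .load)).cost ≤ queryTime c 1 := by unfold queryTime; omega
      dsimp only [linearTime]
      rw [add_mul]
      omega
    · have hj' : j < (n + 1) ^ A := by
        simp only [List.length_append, length_tableList, List.length_cons, List.length_nil] at hj
        omega
      rw [g1 j hj', hm1', hmem j hj]

end Linear

theorem exists_linear_index (c t : ℕ) : ∃ (B Q : RamProg) (K C D d k : ℕ),
    ∀ (n : ℕ) (G : SimpleGraph (Fin n)) (col : Fin n → Fin c) (w : ℕ),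
      1 ≤ n → TreewidthLE G t → WordsFit K n w →
        ∃ I : List ℕ, Builds w B G col (D * n ^ d) I ∧ I.length ≤ C * n ∧
          IsIndex w Q (ExactAnswer G col) (fun m => C * m ^ k) I := by
  -- The sum of `2 * c + 3`, for the table, and `2 * t + 3`, which leaves room for the `O(t * n)`
  -- words of the graph; so the whole index fits into one region.
  set A := 2 * c + 2 * t + 6 with hA
  set P := Prog.seq (tableP c t A 0 (c + 1)) (.seq (emitTabP c t A) (emitGraphP c A)) with hP
  obtain ⟨D, d, hB⟩ := exists_builds c P
    ⟨keeps_tableP, wf_tableP, wf_emitTabP.2, wf_emitTabP.1, wf_emitGraphP.1⟩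
  obtain ⟨D', e, hR⟩ := (restartP c t A).bound_le c
  -- The summands account for the table, the list of graph cells, and the two words for `n` and the
  -- final `0`.
  set space := 3 + 2 ^ c * (c + 1) + (2 * t + 1) + 2 with hspace
  refine ⟨builder c P, linearQuery c t A,
    P.maxExp + 2 + ((restartP c t A).maxExp + (A + qTot c t + 2)), space + linearTime c D', D, d,
    (c + 1) * e + 1, fun n G col w hn htw hw => ?_⟩
  have hw' := hw.pow_lt hn (k := A + qTot c t + 1) (by omega)
  obtain ⟨N, B0, hN1, hNn, hNa, hnN, hB0, hinv, hT⟩ := tableP_spec (c := c) (A := A) (q := 0)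
    (a := c + 1) htw hn (by omega) (by omega) (by omega) (by omega) (by omega) hw'
    (builderState G col) (by simp [builderState]) rfl rfl
  set s1 := (tableP c t A 0 (c + 1)).run w c (builderState G col)
  have hb := bucket_le (q := 0) N
  obtain ⟨m2, r2, o2⟩ := emitTabP_spec hn hw' (one_le_bucket hN1) hb
    (tableLen_le hn hNn (by omega) (by omega)) s1 hinv.regD hT.head
  set s2 := (emitTabP c t A).run w c s1
  obtain ⟨E, o3, hnd, hE⟩ := emitGraphP_spec hn hw' s2 (by rw [r2 c (by omega), hinv.regD])
    (by rw [r2 _ (by simp only [layout]; omega), hinv.regN])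
  rw [o2, hinv.out, List.nil_append] at o3
  rw [m2] at hE
  have hcQ : c + 2 ≤ qTot c t := by simp only [layout]; omega
  have hEB : ∀ q i, 1 ≤ q → q ≤ c + 1 → i < (n + 1) ^ A →
      (q * (n + 1) ^ A + i ∈ E ↔ (q, i) ∈ B0) := by
    intro q i h1 h2 h3
    rw [hE, ← hinv.db (q, i) h2]
    have h4 : 1 * (n + 1) ^ A ≤ q * (n + 1) ^ A := Nat.mul_le_mul_right _ h1
    have h5 : (q + 1) * (n + 1) ^ A ≤ (c + 2) * (n + 1) ^ A := Nat.mul_le_mul_right _ (by omega)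
    rw [add_mul] at h5
    exact ⟨fun h => ⟨h1, by dsimp only; omega, h3, h.2.2⟩, fun h => ⟨by omega, by omega, h.2.2.2⟩⟩
  have hpos : 0 < (n + 1) ^ A := Nat.pow_pos (by omega)
  have hlenE : E.length ≤ (2 * t + 1) * n := by
    refine length_le_of_graphExact htw hB0 hnd (D := (n + 1) ^ A) fun x hx => ?_
    have hx' := (hE x).mp hx
    have hdm := Nat.div_add_mod' x ((n + 1) ^ A)
    refine ⟨(x / (n + 1) ^ A, x % (n + 1) ^ A), (hEB _ _ ?_ ?_ (Nat.mod_lt _ hpos)).mp ?_, hdm.symm⟩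
    · exact (Nat.one_le_div_iff hpos).mpr hx'.1
    · exact Nat.lt_succ_iff.mp ((Nat.div_lt_iff_lt_mul hpos).mpr hx'.2.1)
    · rwa [hdm]
  have hlen : tableLen c N (bucket 0 N + 1) + E.length + 2 ≤ (n + 1) ^ A := by
    have h1 := tableLen_le (c := c) (A := 2 * c + 3) (L := bucket 0 N + 1) hn hNn (by omega) le_rfl
    have h2 : n + 1 ≤ (n + 1) ^ (2 * c + 3) := Nat.le_self_pow (by omega) _
    have h3 : (2 * t + 2) * (n + 1) ≤ (2 * t + 2) * (n + 1) ^ (2 * c + 3) := Nat.mul_le_mul_left _ h2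
    have h4 : 2 * t + 3 < (n + 1) ^ (2 * t + 3) := Nat.lt_pow_self (by omega)
    have h5 : (2 * t + 3) * (n + 1) ^ (2 * c + 3) ≤ (n + 1) ^ (2 * t + 3) * (n + 1) ^ (2 * c + 3) :=
      Nat.mul_le_mul_right _ h4.le
    rw [← pow_add, show 2 * t + 3 + (2 * c + 3) = A by omega] at h5
    have h6 : (2 * t + 1) * n + 2 ≤ (2 * t + 2) * (n + 1) := by nlinarith
    have h7 : (2 * t + 3) * (n + 1) ^ (2 * c + 3) =
      (2 * t + 2) * (n + 1) ^ (2 * c + 3) + (n + 1) ^ (2 * c + 3) := by ring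
    omega
  have hlin := isIndex_linear (D := D') (e := e) htw hn (by omega) hw' (hw.pow_lt hn (by omega)) hT hN1
    hnN hB0.stored hlen (fun x hx => ⟨((hE x).mp hx).1, ((hE x).mp hx).2.1⟩) hEB (hR _ (by omega))
  refine ⟨_, ?_, ?_, hlin.mono fun m => Nat.mul_le_mul_right _ (by omega)⟩
  · have h := hB n G col w hn (le_trans (Nat.mul_le_mul_right _ (by omega)) hw)
    rwa [show (P.run w c (builderState G col)).out = _ from o3] at h
  · have h1 := tableLen_root_le hN1 hNa
    simp only [List.length_append, length_tableList, List.length_cons, List.length_nil]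
    rw [hspace, add_mul, add_mul, add_mul]
    omega

/-! ### The main theorem -/

theorem lemma1 (c : ℕ) :
    -- the exact index, which can be built in polynomial time for bounded treewidth
    (∃ (Q : RamProg) (K C : ℕ),
      (∀ (n : ℕ) (G : SimpleGraph (Fin n)) (col : Fin n → Fin c) (w : ℕ),
        1 ≤ n → WordsFit K n w →
          ∃ I : List ℕ, I.length ≤ C * n ^ (c + 1) ∧
            IsIndex w Q (ExactAnswer G col) (fun m => C * m) I) ∧
      ∀ t : ℕ, ∃ (B : RamProg) (K' D d : ℕ),
        ∀ (n : ℕ) (G : SimpleGraph (Fin n)) (col : Fin n → Fin c) (w : ℕ),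
          1 ≤ n → TreewidthLE G t → WordsFit K' n w →
            ∃ I : List ℕ, Builds w B G col (D * n ^ d) I ∧ I.length ≤ C * n ^ (c + 1) ∧
              IsIndex w Q (ExactAnswer G col) (fun m => C * m) I) ∧
    -- the approximate index, which can be built in polynomial time for bounded treewidth
    (∀ ε : ℝ, 0 < ε → ∃ (Q : RamProg) (K C : ℕ),
      (∀ (n : ℕ) (G : SimpleGraph (Fin n)) (col : Fin n → Fin c) (w : ℕ),
        2 ≤ n → WordsFit K n w →
          ∃ I : List ℕ, (I.length : ℝ) ≤ C * (n * Real.log n ^ c) ∧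
            IsIndex w Q (ApproxAnswer ε G col) (fun m => C * m) I) ∧
      ∀ t : ℕ, ∃ (B : RamProg) (K' D d : ℕ),
        ∀ (n : ℕ) (G : SimpleGraph (Fin n)) (col : Fin n → Fin c) (w : ℕ),
          2 ≤ n → TreewidthLE G t → WordsFit K' n w →
            ∃ I : List ℕ, Builds w B G col (D * n ^ d) I ∧
              (I.length : ℝ) ≤ C * (n * Real.log n ^ c) ∧
              IsIndex w Q (ApproxAnswer ε G col) (fun m => C * m) I) ∧
    -- the linear-space exact index for bounded treewidth
    (∀ t : ℕ, ∃ (B Q : RamProg) (K C D d k : ℕ),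
      ∀ (n : ℕ) (G : SimpleGraph (Fin n)) (col : Fin n → Fin c) (w : ℕ),
        1 ≤ n → TreewidthLE G t → WordsFit K n w →
          ∃ I : List ℕ, Builds w B G col (D * n ^ d) I ∧ I.length ≤ C * n ∧
            IsIndex w Q (ExactAnswer G col) (fun m => C * m ^ k) I) := by
  have hwl : ∀ (q n w : ℕ), 1 ≤ n → WordsFit (2 * c + 4) n w →
      tableLen c n (bucket q n + 1) < 2 ^ w := fun q n w hn hw =>
    (tableLen_le hn le_rfl (by have := bucket_le (q := q) n; omega) le_rfl).trans_lt
      (hw.pow_lt hn (by omega))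
  -- A table has at most `(n + 1) ^ (2 * c + 3)` words, so the factor `2 * c + 4` makes it
  -- addressable. The constant serves both as the bound on the space and as the bound on the time,
  -- hence the sum. It does not involve `t`: only the building program depends on the treewidth.
  refine ⟨⟨queryP c .skip, 2 * c + 4, 3 + 2 ^ c * (c + 1) + queryTime c 1, ?_, ?_⟩, ?_,
    exists_linear_index c⟩
  · intro n G col w hn hw
    obtain ⟨T, hT⟩ := exists_isTable hn G col 0
    refine ⟨_, ?_, (isIndex_exact hT hn (hwl 0 n w hn hw)).mono
      fun m => Nat.mul_le_mul_right _ (by omega)⟩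
    rw [length_tableList]
    exact (tableLen_exact_le c hn).trans (Nat.mul_le_mul_right _ (by omega))
  · intro t
    obtain ⟨B, K, D, d, h⟩ := exists_builds_table c t 0
    refine ⟨B, K + (2 * c + 4), D, d, fun n G col w hn htw hw => ?_⟩
    obtain ⟨T, hT, hB⟩ := h n G col w hn htw (le_trans (Nat.mul_le_mul_right _ (by omega)) hw)
    refine ⟨_, hB, ?_, (isIndex_exact hT hn (hwl 0 n w hn
      (le_trans (Nat.mul_le_mul_right _ (by omega)) hw))).mono
      fun m => Nat.mul_le_mul_right _ (by omega)⟩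
    rw [length_tableList]
    exact (tableLen_exact_le c hn).trans (Nat.mul_le_mul_right _ (by omega))
  · intro ε hε
    -- The least natural number for which a bucket `s, …, s + ⌊s / q⌋` is guaranteed to stay within
    -- the factor `1 + ε` by `bucket_ratio`.
    set q := ⌈1 / ε⌉₊ with hq
    have hq0 : 0 < q := Nat.ceil_pos.mpr (by positivity)
    have hq1 : 1 / ε ≤ q := Nat.le_ceil _
    obtain ⟨C, hC⟩ := exists_tableLen_approx_le c hq0
    have hspace : ∀ n T, 2 ≤ n → ((tableList c n (bucket q n + 1) T).length : ℝ) ≤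
        (C + queryTime c ⌈1 + ε⌉₊ : ℕ) * (n * Real.log n ^ c) := by
      intro n T hn
      rw [length_tableList]
      have : 0 ≤ Real.log n := Real.log_natCast_nonneg n
      refine (hC n hn).trans (mul_le_mul_of_nonneg_right ?_ (by positivity))
      exact_mod_cast Nat.le_add_right _ _
    refine ⟨queryP c .skip, 2 * c + 4, C + queryTime c ⌈1 + ε⌉₊, ?_, fun t => ?_⟩
    · intro n G col w hn hw
      obtain ⟨T, hT⟩ := exists_isTable (by omega) G col q
      exact ⟨_, hspace n T hn, (isIndex_approx hε hq1 hT (by omega) (hwl q n w (by omega) hw)).mono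
        fun m => Nat.mul_le_mul_right _ (by omega)⟩
    · obtain ⟨B, K, D, d, h⟩ := exists_builds_table c t q
      refine ⟨B, K + (2 * c + 4), D, d, fun n G col w hn htw hw => ?_⟩
      obtain ⟨T, hT, hB⟩ := h n G col w (by omega) htw
        (le_trans (Nat.mul_le_mul_right _ (by omega)) hw)
      exact ⟨_, hB, hspace n T hn, (isIndex_approx hε hq1 hT (by omega) (hwl q n w (by omega)
        (le_trans (Nat.mul_le_mul_right _ (by omega)) hw))).mono
        fun m => Nat.mul_le_mul_right _ (by omega)⟩
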